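/- **Event structures.** An event structure (es) $E$ is a countable set of events with a partial order $\le_E$ with finite down-sets and an irreflexive symmetric conflict $\#_E$ inherited along $\le_E$; $\mathcal C(E)$ is the set of its configurations (finite, down-closed, conflict-free sets) and $\to_E$ is immediate causality. An isomorphism family on $E$ is a set of bijections between configurations of $E$ that contains identities, is closed under composition, inverse and restriction to subconfigurations of the domain, and such that every $\theta:x\simeq y$ in it extends within it to any configuration $x'\supseteq x$. An es with an isomorphism family (whose elements are called symmetries, $\theta:x\cong_E y$) is an ess. **Arenas.** A $-$-arena $A$ is an ess with polarities in $\{-,+\}$ and labels Question/Answer, both invariant under symmetry, such that: polarity alternates along $\to_A$; $A$ is a forest; events in minimal conflict have the same polarity; minimal events are negative questions; answers are maximal; two answers to the same question are equal or in conflict; and with isomorphism families $\tilde A^-,\tilde A^+\subseteq\tilde A$ such that $\tilde A^-\cap\tilde A^+$ contains only identities and $\tilde A^-$ (resp. $\tilde A^+$) is closed under those extensions in $\tilde A$ that add only negative (resp. positive) events. $A$ is strict if its minimal events are pairwise in conflict. $A^\perp$ reverses polarities (and exchanges $\tilde A^\pm$); $A\parallel B=A\otimes B$ is disjoint juxtaposition;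 $A\& B$ adds all conflicts between the two sides; $A\vdash B$ is $A^\perp\parallel B$; $!A$ has events $\mathbb N\times A$, its symmetries $(n,a)\mapsto(\pi(n),\theta_n(a))$ permute copies (positive symmetries fix the indices of non-empty copies and have all $\theta_n$ positive; negative ones have all $\theta_n$ negative); $A\multimap B$ has one copy of $A^\perp$ above each minimal event of $B$, its configurations are the finite down-closed sets that project injectively to configurations of $A\vdash B$, and its (positive, negative) symmetries are the order-isomorphisms between configurations that project to (positive, negative) symmetries of $A\vdash B$. **Strategies.** A causal strategy from $A$ to $B$ is an ess $\sigma$ with a display map $\partial_\sigma:\sigma\to A\vdash B$ that sends configurations to configurations, is injective on each of them, and sends symmetries to symmetries; events of $\sigma$ have the polarity of their display. It is required to be: $\sim$-receptive (if $\theta:x\cong_\sigma y$, $x$ extends by a negative $s_1$, and $\partial_\sigma\theta$ extends by $(\partial_\sigma s_1,a_2)$ in $A\vdash B$, with $a_2$ negative, there is a unique $s_2$ with $\partial_\sigma s_2=a_2$ such that $\theta$ extends by $(s_1,s_2)$); thin (if $\theta:x\cong_\sigma y$ and $x$ extends by a positive $s_1$, there is a unique extension $s_2$ of $y$ such that $\theta$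 extends by $(s_1,s_2)$); negative (minimal events are negative); courteous ($s_1\to_\sigma s_2$ with $s_1$ positive or $s_2$ negative implies $\partial s_1\to\partial s_2$); receptive (each negative extension of $\partial_\sigma x$, $x\in\mathcal C(\sigma)$, is displayed by a unique extension of $x$); and pointed (below every event there is exactly one minimal event). * $\sigma$ is *visible* if the display of each finite chain $\rho_1\to_\sigma\dots\to_\sigma\rho_n$ with $\rho_1$ minimal is a configuration. * A play on an es with polarities is a non-repetitive sequence of events whose prefixes are all configurations and which is empty or starts with a negative event. The plays of $\sigma$ unfold to plays on $A\multimap B$, by attaching each event of $A$ to the display of the minimal event of $\sigma$ below it. A play is well-bracketed if no event is played immediately above an already answered question, and a question is only answered when all questions played immediately above it are answered. $\sigma$ is *well-bracketed* if whenever $s\,a$ is an unfolded play, $a$ is positive and $s$ is well-bracketed, $s\,a$ is well-bracketed. * For $\sigma:A\vdash B$ and $\tau:B\vdash C$, $x^\sigma\in\mathcal C(\sigma)$ and $x^\tau\in\mathcal C(\tau)$ are causally compatible if their displays agree on $B$ and the union of the causal constraints of $\sigma\parallel C$ and $A\parallel\tau$ on the graph of the induced bijection $x^\sigma\parallel x^\tau_C\simeq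 x^\sigma_A\parallel x^\tau$ is acyclic. The interaction is the es whose events are the causally compatible pairs with a greatest element for the induced order, ordered by componentwise inclusion, with two events compatible iff their componentwise union is causally compatible; its symmetries are those bijections between configurations that project to symmetries of $\sigma\parallel C$ and of $A\parallel\tau$. The composition $\tau\odot\sigma:A\vdash C$ is its restriction to the events whose greatest element lies in $A$ or $C$, with as symmetries the bijections between configurations contained in symmetries of the interaction. * The copycat strategy $c_A:A\vdash A$ has the events of $A\vdash A$ and the identity display; distinct events satisfy $(i,a)\le(j,a')$ iff $a<_A a'$, or $a=a'$ with $(i,a)$ negative and $(j,a')$ positive in $A\vdash A$; $(i,a)$ and $(j,a')$ are in conflict iff $a\,\#_A\,a'$; symmetries are the $\theta_1\parallel\theta_2$ between configurations with $\theta_1,\theta_2$ and $\theta_1\cap\theta_2:\mathrm{dom}\,\theta_1\cap\mathrm{dom}\,\theta_2\simeq\mathrm{cod}\,\theta_1\cap\mathrm{cod}\,\theta_2$ in $\tilde A$. * $\sigma_1\otimes\sigma_2$, $\langle\sigma_1,\sigma_2\rangle$, $!\sigma$ are the ess $\sigma_1\parallel\sigma_2$, $\sigma_1\&\sigma_2$,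 $!\sigma$ with the evident displays; the currying $\Lambda\sigma:\Gamma\vdash A\multimap C$ of $\sigma:\Gamma\otimes A\vdash C$ has the same ess, an event of $A$ being attached to the display of the minimal event of $\sigma$ below it. A positive isomorphism $\sigma\approx\tau$ is an isomorphism of ess $\varphi$ such that $\{(\partial_\sigma s,\partial_\tau\varphi s)\mid s\in x\}$ is a positive symmetry for all $x\in\mathcal C(\sigma)$. **Positional collapse.** A configuration $x$ of an arena is complete if every question in $x$ has an answer in $x$ (an answer immediately above it). $\int A$ is the set of symmetry classes of complete configurations of $A$. For $\sigma:A\vdash B$, $\int\sigma$ is the set of classes of the complete displays $\partial_\sigma(x)$, $x\in\mathcal C(\sigma)$, seen as a relation from $\int A$ to $\int B$ by $([x_A],[x_B])\in\int\sigma$ iff $[x_A\parallel x_B]\in\int\sigma$. Write $\sigma\equiv\tau$ (positional equivalence) if $\int\sigma=\int\tau$. **Theorem.** Between $-$-arenas: 1. If $\sigma:A\vdash B$ and $\tau:B\vdash C$ are well-bracketed visible (pointed) causal strategies, so is $\tau\odot\sigma$, and $\int(\tau\odot\sigma)=\int\tau\circ\int\sigma$ as relations. 2. $c_A$ is a well-bracketed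 visible pointed causal strategy and $\int c_A$ is the identity relation on $\int A$. 3. For well-bracketed visible $\sigma,\sigma':A\vdash B$: $\sigma\equiv\sigma'$ iff $\int\sigma$ and $\int\sigma'$ are equal as relations from $\int A$ to $\int B$; and $\sigma\approx\sigma'$ implies $\sigma\equiv\sigma'$. 4. On well-bracketed visible strategies $\equiv$ is a congruence: it is preserved by composition $\odot$, tensor $\otimes$, pairing $\langle-,-\rangle$, the exponential $!$, and currying $\sigma\mapsto\Lambda\sigma$ of strategies $\sigma:\Gamma\otimes A\vdash C$ with $C$ strict. 5. There is a category whose objects are the $-$-arenas and whose morphisms from $A$ to $B$ are the $\equiv$-classes of well-bracketed visible strategies from $A$ to $B$, with identities the classes of the $c_A$ and composition induced by $\odot$; and $A\mapsto\int A$, $[\sigma]\mapsto\int\sigma$ defines a functor from it to the category $\mathrm{Rel}$ of sets and relations. -/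

import Mathlib

universe u

namespace CausalGames

/-! ## Event structures with symmetry -/

/-- The data of an event structure with symmetry; its axioms are `IsES` and `IsIsoFamily`.
A symmetry (a bijection between two configurations) is represented by its graph. -/
structure ESS where
  ev : Type u
  le : ev → ev → Prop
  conflict : ev → ev → Prop
  sym : Set (Set (ev × ev))

namespace ESS

/-- Configurations: finite, down-closed and conflict-free sets of events. -/
def Conf (E : ESS.{u}) : Set (Set E.ev) :=
  {x | x.Finite ∧ (∀ e ∈ x, ∀ e', E.le e' e → e' ∈ x) ∧ ∀ e ∈ x, ∀ e' ∈ x, ¬ E.conflict e e'}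

def lt (E : ESS.{u}) (e e' : E.ev) : Prop := E.le e e' ∧ e ≠ e'

/-- Immediate causality. -/
def imm (E : ESS.{u}) (e e' : E.ev) : Prop := E.lt e e' ∧ ∀ d, ¬ (E.lt e d ∧ E.lt d e')

/-- Minimal events. -/
def IsMinEv (E : ESS.{u}) (e : E.ev) : Prop := ∀ d, E.le d e → d = e

/-- `x` is a configuration that can be extended to a configuration by the event `e`. -/
def Enables (E : ESS.{u}) (x : Set E.ev) (e : E.ev) : Prop :=
  x ∈ E.Conf ∧ e ∉ x ∧ insert e x ∈ E.Conf

/-- A conflict that is not inherited from an earlier conflict. -/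
def MinConflict (E : ESS.{u}) (e e' : E.ev) : Prop :=
  E.conflict e e' ∧ (∀ d, E.lt d e → ¬ E.conflict d e') ∧ ∀ d, E.lt d e' → ¬ E.conflict e d

/-- The axioms of event structures. -/
structure IsES (E : ESS.{u}) : Prop where
  countable : Countable E.ev
  le_refl : ∀ e, E.le e e
  le_trans : ∀ e₁ e₂ e₃, E.le e₁ e₂ → E.le e₂ e₃ → E.le e₁ e₃
  le_antisymm : ∀ e₁ e₂, E.le e₁ e₂ → E.le e₂ e₁ → e₁ = e₂
  finite_causes : ∀ e, {e' | E.le e' e}.Finite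
  conflict_irrefl : ∀ e, ¬ E.conflict e e
  conflict_symm : ∀ e e', E.conflict e e' → E.conflict e' e
  conflict_inherit : ∀ e₁ e₂ e₃, E.conflict e₁ e₂ → E.le e₂ e₃ → E.conflict e₁ e₃

end ESS

/-- Domain of a bijection given by its graph. -/
def gdom {X : Type u} (θ : Set (X × X)) : Set X := Prod.fst '' θ

/-- Codomain of a bijection given by its graph. -/
def gcod {X : Type u} (θ : Set (X × X)) : Set X := Prod.snd '' θ

/-- The graph of the identity on `x`. -/
def gid {X : Type u} (x : Set X) : Set (X × X) := {p | p.1 ∈ x ∧ p.2 = p.1}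

/-- `θ` is the graph of a bijection between two configurations of `E`. -/
def IsConfBij (E : ESS.{u}) (θ : Set (E.ev × E.ev)) : Prop :=
  Set.InjOn Prod.fst θ ∧ Set.InjOn Prod.snd θ ∧ gdom θ ∈ E.Conf ∧ gcod θ ∈ E.Conf

/-- `S` is an isomorphism family on the event structure `E`. -/
structure IsIsoFamily (E : ESS.{u}) (S : Set (Set (E.ev × E.ev))) : Prop where
  bij : ∀ θ ∈ S, IsConfBij E θ
  id_mem : ∀ x ∈ E.Conf, gid x ∈ S
  inv_mem : ∀ θ ∈ S, Prod.swap '' θ ∈ S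
  comp_mem : ∀ θ ∈ S, ∀ θ' ∈ S, gcod θ = gdom θ' →
    {p : E.ev × E.ev | ∃ e, (p.1, e) ∈ θ ∧ (e, p.2) ∈ θ'} ∈ S
  restrict : ∀ θ ∈ S, ∀ x ∈ E.Conf, x ⊆ gdom θ → {p ∈ θ | p.1 ∈ x} ∈ S
  extend : ∀ θ ∈ S, ∀ x ∈ E.Conf, gdom θ ⊆ x → ∃ θ' ∈ S, θ ⊆ θ' ∧ gdom θ' = x

/-- The enabling relation on a family of symmetries. -/
def SymEnables {X : Type u} (S : Set (Set (X × X))) (θ : Set (X × X)) (p : X × X) : Prop :=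
  p ∉ θ ∧ insert p θ ∈ S

/-! ## Arenas -/

inductive Pol
  | neg
  | pos

def Pol.flip : Pol → Pol
  | .neg => .pos
  | .pos => .neg

inductive QA
  | question
  | answer

/-- The data of an arena: an event structure with symmetry, polarities, a Question/Answer labelling
and the negative and positive symmetries. -/
structure Game extends ESS.{u} where
  pol : ev → Pol
  lam : ev → QA
  nsym : Set (Set (ev × ev))
  psym : Set (Set (ev × ev))

/-- The axioms of arenas. -/
structure IsArena (A : Game.{u}) : Prop where
  isES : A.toESS.IsES
  isoFamily : IsIsoFamily A.toESS A.sym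
  sym_pol : ∀ θ ∈ A.sym, ∀ p ∈ θ, A.pol p.1 = A.pol p.2
  alternating : ∀ a a', A.toESS.imm a a' → A.pol a ≠ A.pol a'
  forestial : ∀ a₁ a₂ a, A.le a₁ a → A.le a₂ a → A.le a₁ a₂ ∨ A.le a₂ a₁
  race_free : ∀ a a', A.toESS.MinConflict a a' → A.pol a = A.pol a'
  sym_lam : ∀ θ ∈ A.sym, ∀ p ∈ θ, A.lam p.1 = A.lam p.2
  question_opening : ∀ a, A.toESS.IsMinEv a → A.lam a = QA.question
  answer_closing : ∀ a, A.lam a = QA.answer → ∀ a', A.le a a' → a' = a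
  answer_linear : ∀ a a₁ a₂, A.lam a₁ = QA.answer → A.lam a₂ = QA.answer →
    A.toESS.imm a a₁ → A.toESS.imm a a₂ → a₁ = a₂ ∨ A.conflict a₁ a₂
  nsym_isoFamily : IsIsoFamily A.toESS A.nsym
  psym_isoFamily : IsIsoFamily A.toESS A.psym
  nsym_sub : A.nsym ⊆ A.sym
  psym_sub : A.psym ⊆ A.sym
  nsym_inter_psym : ∀ θ ∈ A.nsym, θ ∈ A.psym → ∀ p ∈ θ, p.1 = p.2
  nsym_ext : ∀ θ ∈ A.nsym, ∀ θ' ∈ A.sym, θ ⊆ θ' →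
    (∀ p ∈ θ', p ∉ θ → A.pol p.1 = Pol.neg ∧ A.pol p.2 = Pol.neg) → θ' ∈ A.nsym
  psym_ext : ∀ θ ∈ A.psym, ∀ θ' ∈ A.sym, θ ⊆ θ' →
    (∀ p ∈ θ', p ∉ θ → A.pol p.1 = Pol.pos ∧ A.pol p.2 = Pol.pos) → θ' ∈ A.psym

/-- Negative arenas. -/
structure NegArena extends Game.{u} where
  isArena : IsArena toGame
  negative : ∀ a, toGame.toESS.IsMinEv a → toGame.pol a = Pol.neg

/-- An arena is strict if its minimal events are pairwise in conflict. -/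
def IsStrict (A : Game.{u}) : Prop :=
  ∀ a a', A.toESS.IsMinEv a → A.toESS.IsMinEv a' → a ≠ a' → A.conflict a a'

/-! ## Constructions on event structures and arenas -/

/-- The symmetry `θ ∥ θ'`. -/
def parRel {X Y : Type u} (θ : Set (X × X)) (θ' : Set (Y × Y)) : Set ((X ⊕ Y) × (X ⊕ Y)) :=
  Prod.map Sum.inl Sum.inl '' θ ∪ Prod.map Sum.inr Sum.inr '' θ'

def parFam {X Y : Type u} (S : Set (Set (X × X))) (T : Set (Set (Y × Y))) :
    Set (Set ((X ⊕ Y) × (X ⊕ Y))) :=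
  {φ | ∃ θ ∈ S, ∃ θ' ∈ T, φ = parRel θ θ'}

/-- Symmetries of a parallel composition whose domain, hence codomain, is on a single side. -/
def prodFam {X Y : Type u} (S : Set (Set (X × X))) (T : Set (Set (Y × Y))) :
    Set (Set ((X ⊕ Y) × (X ⊕ Y))) :=
  {φ ∈ parFam S T | ∀ p ∈ φ, ∀ q ∈ φ, p.1.isLeft = q.1.isLeft}

/-- The bijection `(n, e) ↦ (π n, f n e)`. -/
def bangRel {X : Type u} (π : Equiv.Perm ℕ) (f : ℕ → Set (X × X)) :
    Set ((ℕ × X) × (ℕ × X)) :=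
  {p | p.2.1 = π p.1.1 ∧ (p.1.2, p.2.2) ∈ f p.1.1}

/-- Symmetries of the exponential with components in `S`. Finiteness says that the domain is a
configuration. -/
def bangFam {X : Type u} (S : Set (Set (X × X))) : Set (Set ((ℕ × X) × (ℕ × X))) :=
  {φ | φ.Finite ∧ ∃ π f, (∀ n, f n ∈ S) ∧ φ = bangRel π f}

/-- Simple parallel composition. -/
def ESS.par (E F : ESS.{u}) : ESS.{u} where
  ev := E.ev ⊕ F.ev
  le := Sum.LiftRel E.le F.le
  conflict := Sum.LiftRel E.conflict F.conflict
  sym := parFam E.sym F.sym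

/-- The product `E & F`: parallel composition with `E` and `F` in conflict. -/
def ESS.prod (E F : ESS.{u}) : ESS.{u} where
  ev := E.ev ⊕ F.ev
  le := Sum.LiftRel E.le F.le
  conflict e e' := Sum.LiftRel E.conflict F.conflict e e' ∨ e.isLeft ≠ e'.isLeft
  sym := prodFam E.sym F.sym

/-- The exponential `!E`. -/
def ESS.bang (E : ESS.{u}) : ESS.{u} where
  ev := ℕ × E.ev
  le p q := p.1 = q.1 ∧ E.le p.2 q.2
  conflict p q := p.1 = q.1 ∧ E.conflict p.2 q.2
  sym := bangFam E.sym

namespace Game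

def dual (A : Game.{u}) : Game.{u} where
  toESS := A.toESS
  pol a := (A.pol a).flip
  lam := A.lam
  nsym := A.psym
  psym := A.nsym

def par (A B : Game.{u}) : Game.{u} where
  toESS := A.toESS.par B.toESS
  pol := Sum.elim A.pol B.pol
  lam := Sum.elim A.lam B.lam
  nsym := parFam A.nsym B.nsym
  psym := parFam A.psym B.psym

/-- `A ⊗ B`. -/
def tensor (A B : Game.{u}) : Game.{u} := A.par B

/-- `A & B`. -/
def prod (A B : Game.{u}) : Game.{u} where
  toESS := A.toESS.prod B.toESS
  pol := Sum.elim A.pol B.pol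
  lam := Sum.elim A.lam B.lam
  nsym := prodFam A.nsym B.nsym
  psym := prodFam A.psym B.psym

/-- `!A`. -/
def bang (A : Game.{u}) : Game.{u} where
  toESS := A.toESS.bang
  pol p := A.pol p.2
  lam p := A.lam p.2
  nsym := bangFam A.nsym
  psym := {φ | φ.Finite ∧ ∃ π f, (∀ n, f n ∈ A.psym) ∧ (∀ n, (f n).Nonempty → π n = n) ∧
    φ = bangRel π f}

/-- `A ⊢ B`, that is `A^⊥ ∥ B`. -/
def hom (A B : Game.{u}) : Game.{u} := A.dual.par B

/-- Events of `A ⊸ B`: one copy of `A` for each minimal event of `B`, and the events of `B`. -/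
abbrev ArrowEv (A B : Game.{u}) : Type u := ({b : B.ev // B.toESS.IsMinEv b} × A.ev) ⊕ B.ev

/-- The map from the events of `A ⊸ B` to those of `A ⊢ B` that forgets the copies. -/
def chi (A B : Game.{u}) : ArrowEv A B → A.ev ⊕ B.ev := Sum.map Prod.snd id

def arrowLe (A B : Game.{u}) : ArrowEv A B → ArrowEv A B → Prop
  | .inr b, .inr b' => B.le b b'
  | .inl (b, a), .inl (b', a') => b = b' ∧ A.le a a'
  | .inr b, .inl (b', _) => b = b'
  | .inl _, .inr _ => False

/-- The conflict on `A ⊸ B`. Besides the conflicts of `A` and `B` (inherited along the order of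
`A ⊸ B`), two copies of `A` may not both play above the same minimal event of `A`. -/
def arrowConflict (A B : Game.{u}) : ArrowEv A B → ArrowEv A B → Prop
  | .inr b, .inr b' => B.conflict b b'
  | .inr b, .inl (b', _) => B.conflict b b'
  | .inl (b, _), .inr b' => B.conflict b b'
  | .inl (b, a), .inl (b', a') => B.conflict b b' ∨ A.conflict a a' ∨
      (b ≠ b' ∧ ∃ a₀, A.toESS.IsMinEv a₀ ∧ A.le a₀ a ∧ A.le a₀ a')

/-- The underlying event structure of `A ⊸ B`, without symmetries. -/
def arrowES (A B : Game.{u}) : ESS.{u} where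
  ev := ArrowEv A B
  le := arrowLe A B
  conflict := arrowConflict A B
  sym := ∅

/-- Order-isomorphisms between configurations of `A ⊸ B` whose image under `chi` is in `S`. -/
def arrowFam (A B : Game.{u}) (S : Set (Set ((A.ev ⊕ B.ev) × (A.ev ⊕ B.ev)))) :
    Set (Set (ArrowEv A B × ArrowEv A B)) :=
  {θ | IsConfBij (arrowES A B) θ ∧
    (∀ p ∈ θ, ∀ q ∈ θ, arrowLe A B p.1 q.1 ↔ arrowLe A B p.2 q.2) ∧
    Prod.map (chi A B) (chi A B) '' θ ∈ S}

/-- The arrow arena `A ⊸ B`. -/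
def arrow (A B : Game.{u}) : Game.{u} where
  ev := ArrowEv A B
  le := arrowLe A B
  conflict := arrowConflict A B
  sym := arrowFam A B (A.hom B).sym
  pol e := (A.hom B).pol (chi A B e)
  lam e := (A.hom B).lam (chi A B e)
  nsym := arrowFam A B (A.hom B).nsym
  psym := arrowFam A B (A.hom B).psym

end Game

/-! ## Causal strategies -/

/-- The data of a causal (pre)strategy on `G`: an event structure with symmetry and a display
map. -/
structure PreStrat (G : Game.{u}) extends ESS.{u} where
  disp : ev → G.ev

/-- Pointed causal strategies on `G`. -/
structure IsPointedStrategy {G : Game.{u}} (σ : PreStrat G) : Prop where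
  isES : σ.toESS.IsES
  isoFamily : IsIsoFamily σ.toESS σ.sym
  rule_abiding : ∀ x ∈ σ.toESS.Conf, σ.disp '' x ∈ G.toESS.Conf
  locally_injective : ∀ x ∈ σ.toESS.Conf, Set.InjOn σ.disp x
  sym_preserving : ∀ θ ∈ σ.sym, Prod.map σ.disp σ.disp '' θ ∈ G.sym
  sim_receptive : ∀ θ ∈ σ.sym, ∀ s₁ a₂, σ.toESS.Enables (gdom θ) s₁ →
    G.pol (σ.disp s₁) = Pol.neg → G.pol a₂ = Pol.neg →
    SymEnables G.sym (Prod.map σ.disp σ.disp '' θ) (σ.disp s₁, a₂) →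
    ∃! s₂, SymEnables σ.sym θ (s₁, s₂) ∧ σ.disp s₂ = a₂
  thin : ∀ θ ∈ σ.sym, ∀ s₁, σ.toESS.Enables (gdom θ) s₁ → G.pol (σ.disp s₁) = Pol.pos →
    ∃! s₂, σ.toESS.Enables (gcod θ) s₂ ∧ SymEnables σ.sym θ (s₁, s₂)
  negative : ∀ s, σ.toESS.IsMinEv s → G.pol (σ.disp s) = Pol.neg
  courteous : ∀ s₁ s₂, σ.toESS.imm s₁ s₂ →
    (G.pol (σ.disp s₁) = Pol.pos ∨ G.pol (σ.disp s₂) = Pol.neg) →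
    G.toESS.imm (σ.disp s₁) (σ.disp s₂)
  receptive : ∀ x ∈ σ.toESS.Conf, ∀ a, G.toESS.Enables (σ.disp '' x) a → G.pol a = Pol.neg →
    ∃! s, σ.toESS.Enables x s ∧ σ.disp s = a
  pointed : ∀ s, ∃! m, σ.toESS.IsMinEv m ∧ σ.le m s

/-- Visibility: the display of every grounded causal chain is a configuration. -/
def IsVisible {G : Game.{u}} (σ : PreStrat G) : Prop :=
  ∀ s l, σ.toESS.IsMinEv s → List.IsChain σ.toESS.imm (s :: l) →
    σ.disp '' {e | e ∈ s :: l} ∈ G.toESS.Conf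

/-- Positive isomorphism of strategies. -/
def PosIso {G : Game.{u}} (σ τ : PreStrat G) : Prop :=
  ∃ φ : σ.ev ≃ τ.ev,
    (∀ s s', σ.le s s' ↔ τ.le (φ s) (φ s')) ∧
    (∀ s s', σ.conflict s s' ↔ τ.conflict (φ s) (φ s')) ∧
    (∀ θ, θ ∈ σ.sym ↔ Prod.map φ φ '' θ ∈ τ.sym) ∧
    ∀ x ∈ σ.toESS.Conf, (fun s => (σ.disp s, τ.disp (φ s))) '' x ∈ G.psym

/-- Causal strategies from `A` to `B` are strategies on `A ⊢ B`. -/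
abbrev Strat (A B : Game.{u}) := PreStrat (A.hom B)

/-! ## Plays and well-bracketing -/

/-- Non-alternating plays: the moves are in the event structure `E` with polarities `pol`. -/
structure IsPlay (E : ESS.{u}) (pol : E.ev → Pol) (w : List E.ev) : Prop where
  valid : ∀ v, v <+: w → {e | e ∈ v} ∈ E.Conf
  nonrepetitive : w.Nodup
  negative : ∀ e ∈ w.head?, pol e = Pol.neg

/-- `q` is answered in the list of moves `w`. -/
def AnsweredIn (A : Game.{u}) (q : A.ev) (w : List A.ev) : Prop :=
  ∃ a ∈ w, A.lam a = QA.answer ∧ A.toESS.imm q a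

/-- Well-bracketed plays. -/
structure IsWbPlay (A : Game.{u}) (w : List A.ev) : Prop where
  fork : ∀ v m, v ++ [m] <+: w → ∀ q ∈ v, A.lam q = QA.question → A.toESS.imm q m →
    ¬ AnsweredIn A q v
  wait : ∀ v a, v ++ [a] <+: w → A.lam a = QA.answer →
    ∀ q ∈ v, A.lam q = QA.question → A.toESS.imm q a →
    ∀ q' ∈ v, A.lam q' = QA.question → A.toESS.imm q q' → AnsweredIn A q' (v ++ [a])

/-- The display of `σ : A ⊢ B` in `A ⊸ B`, as a relation: an event of `A` is attached to the
display of the unique minimal event of `σ` below it. -/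
def ArrowDisp {A B : Game.{u}} (σ : Strat A B) (s : σ.ev) : (A.arrow B).ev → Prop
  | .inr b => σ.disp s = Sum.inr b
  | .inl (b, a) => σ.disp s = Sum.inl a ∧
      ∃ m, σ.toESS.IsMinEv m ∧ σ.le m s ∧ σ.disp m = Sum.inr b.1

/-- The non-alternating unfolding of `σ : A ⊢ B`, a set of plays on `A ⊸ B`. -/
def Unf {A B : Game.{u}} (σ : Strat A B) : Set (List (A.arrow B).ev) :=
  {w | ∃ t, IsPlay σ.toESS (fun s => (A.hom B).pol (σ.disp s)) t ∧
    List.Forall₂ (ArrowDisp σ) t w}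

/-- Well-bracketed strategies: Player is never the first to break well-bracketing. -/
def IsWellBracketed {A B : Game.{u}} (σ : Strat A B) : Prop :=
  ∀ w m, w ++ [m] ∈ Unf σ → (A.arrow B).pol m = Pol.pos →
    IsWbPlay (A.arrow B) w → IsWbPlay (A.arrow B) (w ++ [m])

/-- Well-bracketed visible (pointed) causal strategies from `A` to `B`. -/
structure IsWbVis {A B : Game.{u}} (σ : Strat A B) : Prop where
  strategy : IsPointedStrategy σ
  wellBracketed : IsWellBracketed σ
  visible : IsVisible σ

/-! ## Interaction and composition -/

section Composition

variable {A B C : Game.{u}}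

/-- The graph of the bijection between `xσ ∥ x_C` and `x_A ∥ xτ` induced by a pair of
configurations that agree on `B`. -/
def sync (σ : Strat A B) (τ : Strat B C) (xσ : Set σ.ev) (xτ : Set τ.ev) :
    Set ((σ.ev ⊕ C.ev) × (A.ev ⊕ τ.ev)) :=
  {p | match p with
    | (.inl s, .inl a) => s ∈ xσ ∧ σ.disp s = Sum.inl a
    | (.inl s, .inr t) => s ∈ xσ ∧ t ∈ xτ ∧ ∃ b, σ.disp s = Sum.inr b ∧ τ.disp t = Sum.inl b
    | (.inr c, .inr t) => t ∈ xτ ∧ τ.disp t = Sum.inr c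
    | (.inr _, .inl _) => False}

/-- The causal constraints of `σ` and `τ` on the induced bijection. -/
def syncLt (σ : Strat A B) (τ : Strat B C) (xσ : Set σ.ev) (xτ : Set τ.ev)
    (p q : (σ.ev ⊕ C.ev) × (A.ev ⊕ τ.ev)) : Prop :=
  p ∈ sync σ τ xσ xτ ∧ q ∈ sync σ τ xσ xτ ∧
    ((σ.toESS.par C.toESS).lt p.1 q.1 ∨ (A.toESS.par τ.toESS).lt p.2 q.2)

/-- Causally compatible pairs of configurations: they match on `B`, without deadlock. -/
structure CausallyCompatible (σ : Strat A B) (τ : Strat B C) (xσ : Set σ.ev) (xτ : Set τ.ev) :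
    Prop where
  left_conf : xσ ∈ σ.toESS.Conf
  right_conf : xτ ∈ τ.toESS.Conf
  matching : {b : B.ev | Sum.inr b ∈ σ.disp '' xσ} = {b : B.ev | Sum.inl b ∈ τ.disp '' xτ}
  secured : ∀ p, ¬ Relation.TransGen (syncLt σ τ xσ xτ) p p

/-- Events of the interaction: causally compatible pairs whose induced order has a top element. -/
@[ext]
structure InterEv (σ : Strat A B) (τ : Strat B C) where
  left : Set σ.ev
  right : Set τ.ev
  top : (σ.ev ⊕ C.ev) × (A.ev ⊕ τ.ev)
  compatible : CausallyCompatible σ τ left right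
  top_mem : top ∈ sync σ τ left right
  le_top : ∀ p ∈ sync σ τ left right, p = top ∨ Relation.TransGen (syncLt σ τ left right) p top

/-- The underlying event structure of the interaction, without symmetries. -/
def interES (σ : Strat A B) (τ : Strat B C) : ESS.{u} where
  ev := InterEv σ τ
  le p q := p.left ⊆ q.left ∧ p.right ⊆ q.right
  conflict p q := ¬ CausallyCompatible σ τ (p.left ∪ q.left) (p.right ∪ q.right)
  sym := ∅

/-- The symmetries of the interaction: bijections between configurations whose projections are
symmetries of `σ ∥ C` and of `A ∥ τ`. -/
def interSym (σ : Strat A B) (τ : Strat B C) : Set (Set (InterEv σ τ × InterEv σ τ)) :=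
  {θ | IsConfBij (interES σ τ) θ ∧
    (fun p : InterEv σ τ × InterEv σ τ => (p.1.top.1, p.2.top.1)) '' θ ∈
      (σ.toESS.par C.toESS).sym ∧
    (fun p : InterEv σ τ × InterEv σ τ => (p.1.top.2, p.2.top.2)) '' θ ∈
      (A.toESS.par τ.toESS).sym}

/-- The display in `A ⊢ C` of an event of the interaction, if it does not occur in `B`. -/
def visDisp {σ : Strat A B} {τ : Strat B C} (p : InterEv σ τ) : Option (A.ev ⊕ C.ev) :=
  match p.top with
  | (.inl _, .inl a) => some (Sum.inl a)
  | (.inr c, .inr _) => some (Sum.inr c)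
  | _ => none

/-- Events of the composition: events of the interaction that do not occur in `B`. -/
abbrev CompEv (σ : Strat A B) (τ : Strat B C) : Type u :=
  {p : InterEv σ τ // (visDisp p).isSome}

/-- The underlying event structure of the composition, without symmetries. -/
def compES (σ : Strat A B) (τ : Strat B C) : ESS.{u} where
  ev := CompEv σ τ
  le p q := (interES σ τ).le p.1 q.1
  conflict p q := (interES σ τ).conflict p.1 q.1
  sym := ∅

/-- The composition `τ ⊙ σ`, in diagrammatic order of the arguments. -/
def comp (σ : Strat A B) (τ : Strat B C) : Strat A C where
  ev := CompEv σ τ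
  le := (compES σ τ).le
  conflict := (compES σ τ).conflict
  sym := {θ | IsConfBij (compES σ τ) θ ∧
    ∃ θ' ∈ interSym σ τ, Prod.map Subtype.val Subtype.val '' θ ⊆ θ'}
  disp p := (visDisp p.1).get p.2

end Composition

/-! ## Copycat and the other operations on strategies -/

/-- The underlying event structure of copycat, without symmetries. Its order is generated by the
order of the arena and by the links from a negative event to its positive copy. -/
def copycatES (A : Game.{u}) : ESS.{u} where
  ev := A.ev ⊕ A.ev
  le e e' := e = e' ∨ A.toESS.lt (Sum.elim id id e) (Sum.elim id id e') ∨
    (Sum.elim id id e = Sum.elim id id e' ∧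
      (A.hom A).pol e = Pol.neg ∧ (A.hom A).pol e' = Pol.pos)
  conflict e e' := A.conflict (Sum.elim id id e) (Sum.elim id id e')
  sym := ∅

/-- The copycat strategy. -/
def copycat (A : Game.{u}) : Strat A A where
  ev := A.ev ⊕ A.ev
  le := (copycatES A).le
  conflict := (copycatES A).conflict
  sym := {φ | IsConfBij (copycatES A) φ ∧ ∃ θ₁ ∈ A.sym, ∃ θ₂ ∈ A.sym,
    θ₁ ∩ θ₂ ∈ A.sym ∧ gdom (θ₁ ∩ θ₂) = gdom θ₁ ∩ gdom θ₂ ∧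
    gcod (θ₁ ∩ θ₂) = gcod θ₁ ∩ gcod θ₂ ∧ φ = parRel θ₁ θ₂}
  disp e := e

/-- `σ₁ ⊗ σ₂ : A₁ ⊗ A₂ ⊢ B₁ ⊗ B₂`. -/
def tensorStrat {A₁ B₁ A₂ B₂ : Game.{u}} (σ₁ : Strat A₁ B₁) (σ₂ : Strat A₂ B₂) :
    Strat (A₁.tensor A₂) (B₁.tensor B₂) where
  toESS := σ₁.toESS.par σ₂.toESS
  disp := Sum.elim (fun s => Sum.map Sum.inl Sum.inl (σ₁.disp s))
    (fun s => Sum.map Sum.inr Sum.inr (σ₂.disp s))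

/-- The pairing `⟨σ₁, σ₂⟩ : A ⊢ B₁ & B₂`. -/
def pairing {A B₁ B₂ : Game.{u}} (σ₁ : Strat A B₁) (σ₂ : Strat A B₂) :
    Strat A (B₁.prod B₂) where
  toESS := σ₁.toESS.prod σ₂.toESS
  disp := Sum.elim (fun s => Sum.map id Sum.inl (σ₁.disp s))
    (fun s => Sum.map id Sum.inr (σ₂.disp s))

/-- `!σ : !A ⊢ !B`. -/
def bangStrat {A B : Game.{u}} (σ : Strat A B) : Strat A.bang B.bang where
  toESS := σ.toESS.bang
  disp p := Sum.map (Prod.mk p.1) (Prod.mk p.1) (σ.disp p.2)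

/-- The display of the curryfication of `σ : Γ ⊗ A ⊢ C`, as a relation: an event of `A` is attached
to the display of the unique minimal event of `σ` below it. -/
def CurryDisp {Γ A C : Game.{u}} (σ : Strat (Γ.tensor A) C) (s : σ.ev) :
    (Γ.hom (A.arrow C)).ev → Prop
  | .inl g => σ.disp s = Sum.inl (Sum.inl g)
  | .inr (.inr c) => σ.disp s = Sum.inr c
  | .inr (.inl (c, a)) => σ.disp s = Sum.inl (Sum.inr a) ∧
      ∃ m, σ.toESS.IsMinEv m ∧ σ.le m s ∧ σ.disp m = Sum.inr c.1

theorem exists_curryDisp {Γ A C : NegArena.{u}} {σ : Strat (Γ.toGame.tensor A.toGame) C.toGame}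
    (hσ : IsPointedStrategy σ) (s : σ.ev) : ∃ e, CurryDisp σ s e := by
  rcases h : σ.disp s with (g | a) | c
  · exact ⟨Sum.inl g, h⟩
  · obtain ⟨m, ⟨hm, hms⟩, -⟩ := hσ.pointed s
    have hx : ({m} : Set σ.ev) ∈ σ.toESS.Conf := by
      refine ⟨Set.finite_singleton m, ?_, ?_⟩
      · intro e he e' hle
        rw [Set.mem_singleton_iff] at he
        rw [he] at hle
        rw [Set.mem_singleton_iff]
        exact hm e' hle
      · intro e he e' he'
        rw [Set.mem_singleton_iff] at he he'
        rw [he, he']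
        exact hσ.isES.conflict_irrefl m
    have hy := (hσ.rule_abiding _ hx).2.1
    rw [Set.image_singleton] at hy
    have hneg := hσ.negative m hm
    rcases h' : σ.disp m with b | c
    · exfalso
      rw [h'] at hneg hy
      rcases b with g | a'
      · have hmin : Γ.toGame.toESS.IsMinEv g := by
          intro d hd
          have := hy _ rfl (Sum.inl (Sum.inl d)) (Sum.LiftRel.inl (Sum.LiftRel.inl hd))
          exact Sum.inl.inj (Sum.inl.inj this)
        have h1 : (Γ.toGame.pol g).flip = Pol.neg := hneg
        rw [Γ.negative g hmin] at h1
        cases h1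
      · have hmin : A.toGame.toESS.IsMinEv a' := by
          intro d hd
          have := hy _ rfl (Sum.inl (Sum.inr d)) (Sum.LiftRel.inl (Sum.LiftRel.inr hd))
          exact Sum.inr.inj (Sum.inl.inj this)
        have h1 : (A.toGame.pol a').flip = Pol.neg := hneg
        rw [A.negative a' hmin] at h1
        cases h1
    · have hmin : C.toGame.toESS.IsMinEv c := by
        intro d hd
        rw [h'] at hy
        have := hy _ rfl (Sum.inr d) (Sum.LiftRel.inr hd)
        exact Sum.inr.inj this
      exact ⟨Sum.inr (Sum.inl (⟨c, hmin⟩, a)), h, m, hm, hms, h'⟩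
  · exact ⟨Sum.inr (Sum.inr c), h⟩

/-- The curryfication `Λ σ : Γ ⊢ A ⊸ C` of `σ : Γ ⊗ A ⊢ C`; only the display map changes. -/
noncomputable def curry {Γ A C : NegArena.{u}} (σ : Strat (Γ.toGame.tensor A.toGame) C.toGame)
    (hσ : IsPointedStrategy σ) : Strat Γ.toGame (A.toGame.arrow C.toGame) where
  toESS := σ.toESS
  disp s := (exists_curryDisp hσ s).choose

/-! ## The positional collapse -/

/-- Complete configurations: every question has an answer. -/
def IsComplete (G : Game.{u}) (x : Set G.ev) : Prop :=
  ∀ q ∈ x, G.lam q = QA.question → ∃ a ∈ x, G.lam a = QA.answer ∧ G.toESS.imm q a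

abbrev CompleteConf (G : Game.{u}) : Type u := {x : Set G.ev // x ∈ G.toESS.Conf ∧ IsComplete G x}

/-- Two complete configurations related by a symmetry. -/
def Symmetric (G : Game.{u}) (x y : CompleteConf G) : Prop :=
  ∃ θ ∈ G.sym, gdom θ = x.1 ∧ gcod θ = y.1

/-- Positions: symmetry classes of complete configurations. -/
def Positions (G : Game.{u}) : Type u := Quot (Symmetric G)

def Positions.mk {G : Game.{u}} (x : CompleteConf G) : Positions G := Quot.mk _ x

/-- The positions reached by a strategy. -/
def collapse {G : Game.{u}} (σ : PreStrat G) : Set (Positions G) :=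
  {p | ∃ x ∈ σ.toESS.Conf, ∃ z : CompleteConf G, z.1 = σ.disp '' x ∧ p = Positions.mk z}

/-- The collapse of `σ : A ⊢ B` as a relation between the positions of `A` and of `B`: the position
`[x_A] ∥ [x_B]` of `A ⊢ B` is the class of `x_A ∥ x_B`. -/
def collapseRel {A B : Game.{u}} (σ : Strat A B) : SetRel (Positions A) (Positions B) :=
  {p | ∃ (xA : CompleteConf A) (xB : CompleteConf B) (z : CompleteConf (A.hom B)),
    z.1 = Sum.inl '' xA.1 ∪ Sum.inr '' xB.1 ∧ p = (Positions.mk xA, Positions.mk xB) ∧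
    Positions.mk z ∈ collapse σ}

/-- Positional equivalence. -/
def PosEquiv {G : Game.{u}} (σ τ : PreStrat G) : Prop := collapse σ = collapse τ

end CausalGames

open CausalGames

attribute [reducible] CausalGames.ESS.par CausalGames.Game.par CausalGames.Game.dual
  CausalGames.Game.hom CausalGames.Game.tensor CausalGames.copycat

namespace CausalGames

open Sum (inl inr)

/-! ## Event structures -/

namespace ESS

variable {E F : ESS.{u}}

theorem IsES.lt_trans (h : E.IsES) {a b c : E.ev} (h₁ : E.lt a b) (h₂ : E.lt b c) : E.lt a c := by
  refine ⟨h.le_trans _ _ _ h₁.1 h₂.1, ?_⟩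
  rintro rfl
  exact h₁.2 (h.le_antisymm _ _ h₁.1 h₂.1)

theorem IsES.lt_of_le_of_lt (h : E.IsES) {a b c : E.ev} (h₁ : E.le a b) (h₂ : E.lt b c) :
    E.lt a c := by
  refine ⟨h.le_trans _ _ _ h₁ h₂.1, ?_⟩
  rintro rfl
  exact h₂.2 (h.le_antisymm _ _ h₂.1 h₁)

theorem IsES.conflict_inherit' (h : E.IsES) {a b c d : E.ev} (hc : E.conflict a b) (h₁ : E.le a c)
    (h₂ : E.le b d) : E.conflict c d :=
  h.conflict_symm _ _ (h.conflict_inherit _ _ _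
    (h.conflict_symm _ _ (h.conflict_inherit _ _ _ hc h₂)) h₁)

/-- The down-set of an event. -/
def down (E : ESS.{u}) (e : E.ev) : Set E.ev := {e' | E.le e' e}

theorem IsES.down_conf (h : E.IsES) (e : E.ev) : E.down e ∈ E.Conf :=
  ⟨h.finite_causes e, fun _ ha _ hb => h.le_trans _ _ _ hb ha,
    fun _ ha _ hb hc => h.conflict_irrefl _ (h.conflict_inherit' hc ha hb)⟩

theorem empty_conf : (∅ : Set E.ev) ∈ E.Conf :=
  ⟨Set.finite_empty, fun _ h => h.elim, fun _ h => h.elim⟩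

theorem conf_inter {x y : Set E.ev} (hx : x ∈ E.Conf) (hy : y ∈ E.Conf) : x ∩ y ∈ E.Conf :=
  ⟨hx.1.subset Set.inter_subset_left,
    fun e he e' h => ⟨hx.2.1 e he.1 e' h, hy.2.1 e he.2 e' h⟩,
    fun e he e' he' => hx.2.2 e he.1 e' he'.1⟩

/-- Down-closed subsets of configurations are configurations. -/
theorem conf_of_subset {x y : Set E.ev} (hy : y ∈ E.Conf) (h : x ⊆ y)
    (hd : ∀ e ∈ x, ∀ e', E.lt e' e → e' ∈ x) : x ∈ E.Conf := by
  refine ⟨hy.1.subset h, fun e he e' hle => ?_, fun e he e' he' => hy.2.2 e (h he) e' (h he')⟩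
  by_cases hee : e' = e
  · exact hee ▸ he
  · exact hd e he e' ⟨hle, hee⟩

theorem conf_union {x y z : Set E.ev} (hx : x ∈ E.Conf) (hy : y ∈ E.Conf) (hz : z ∈ E.Conf)
    (hxz : x ⊆ z) (hyz : y ⊆ z) : x ∪ y ∈ E.Conf :=
  conf_of_subset hz (Set.union_subset hxz hyz) fun e he e' hl =>
    he.imp (fun h => hx.2.1 e h e' hl.1) (fun h => hy.2.1 e h e' hl.1)

/-- Every strict causal dependency ends with an immediate one. -/
theorem IsES.exists_imm (h : E.IsES) {a b : E.ev} (hab : E.lt a b) :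
    ∃ c, E.le a c ∧ E.imm c b := by
  have hfin : {c | E.le a c ∧ E.lt c b}.Finite := (h.finite_causes b).subset fun c hc => hc.2.1
  obtain ⟨c, hc, hmax⟩ := hfin.exists_maximalFor (fun c => (E.down c).ncard) _
    ⟨a, h.le_refl a, hab⟩
  refine ⟨c, hc.1, hc.2, fun d hd => ?_⟩
  have h1 : E.down c ⊂ E.down d := by
    refine Set.ssubset_iff_exists.2 ⟨fun e he => h.le_trans _ _ _ he hd.1.1, d, h.le_refl d, ?_⟩
    intro hdc
    exact hd.1.2 (h.le_antisymm _ _ hd.1.1 hdc)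
  have h2 := Set.ncard_lt_ncard h1 (h.finite_causes d)
  exact absurd (hmax ⟨h.le_trans _ _ _ hc.1 hd.1.1, hd.2⟩ h2.le) (not_le.2 h2)

theorem IsES.exists_imm_of_not_min (h : E.IsES) {b : E.ev} (hb : ¬ E.IsMinEv b) :
    ∃ c, E.imm c b := by
  simp only [IsMinEv, not_forall] at hb
  obtain ⟨a, ha, hab⟩ := hb
  obtain ⟨c, -, hc⟩ := h.exists_imm ⟨ha, hab⟩
  exact ⟨c, hc⟩

theorem not_min_of_imm {a b : E.ev} (h : E.imm a b) : ¬ E.IsMinEv b := fun hb => h.1.2 (hb _ h.1.1)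

/-- A minimal element of a nonempty finite set of events. -/
theorem IsES.exists_minimal (h : E.IsES) {x : Set E.ev} (P : E.ev → Prop)
    (hP : ∃ a ∈ x, P a) :
    ∃ a ∈ x, P a ∧ ∀ b ∈ x, E.lt b a → ¬ P b := by
  obtain ⟨a, ha, hPa⟩ := hP
  induction hn : (E.down a).ncard using Nat.strong_induction_on generalizing a with
  | _ n ih =>
    by_cases hb : ∃ b ∈ x, E.lt b a ∧ P b
    · obtain ⟨b, hb, hba, hPb⟩ := hb
      refine ih _ ?_ b hb hPb rfl
      rw [← hn]
      refine Set.ncard_lt_ncard (Set.ssubset_iff_exists.2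
        ⟨fun e he => h.le_trans _ _ _ he hba.1, a, h.le_refl a, ?_⟩) (h.finite_causes a)
      exact fun hab => hba.2 (h.le_antisymm _ _ hba.1 hab)
    · push Not at hb
      exact ⟨a, ha, hPa, hb⟩

theorem IsES.exists_min_le (h : E.IsES) (e : E.ev) : ∃ m, E.IsMinEv m ∧ E.le m e := by
  obtain ⟨m, hm, -, hmin⟩ := h.exists_minimal (x := E.down e) (fun _ => True)
    ⟨e, h.le_refl e, trivial⟩
  refine ⟨m, fun d hd => ?_, hm⟩
  by_contra hne
  exact hmin d (h.le_trans _ _ _ hd hm) ⟨hd, hne⟩ trivial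

/-- Extending a configuration by an event whose causes it contains. -/
theorem enables_of {x z : Set E.ev} {e : E.ev} (hx : x ∈ E.Conf) (hz : z ∈ E.Conf) (hxz : x ⊆ z)
    (hez : e ∈ z) (hex : e ∉ x) (hpre : ∀ e', E.lt e' e → e' ∈ x) : E.Enables x e := by
  refine ⟨hx, hex, conf_of_subset hz (Set.insert_subset hez hxz) ?_⟩
  rintro a (rfl | ha) b hb
  · exact Or.inr (hpre b hb)
  · exact Or.inr (hx.2.1 a ha b hb.1)

theorem Enables.pre {x : Set E.ev} {e e' : E.ev} (h : E.Enables x e) (hl : E.lt e' e) : e' ∈ x := by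
  rcases h.2.2.2.1 e (Set.mem_insert _ _) e' hl.1 with rfl | h'
  · exact absurd rfl hl.2
  · exact h'

/-- Grounded causal chains, as a set together with the last event. -/
inductive Thr (E : ESS.{u}) : Set E.ev → E.ev → Prop
  | base {m : E.ev} : E.IsMinEv m → Thr E {m} m
  | step {K : Set E.ev} {e e' : E.ev} : Thr E K e → E.imm e e' → Thr E (insert e' K) e'

theorem Thr.exists_list {K : Set E.ev} {e : E.ev} (h : E.Thr K e) :
    ∃ s l, E.IsMinEv s ∧ List.IsChain E.imm (s :: l) ∧ {a | a ∈ s :: l} = K ∧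
      (s :: l).getLast (by simp) = e := by
  induction h with
  | base hm => exact ⟨_, [], hm, by simp, by ext; simp, rfl⟩
  | @step K e e' _ hi ih =>
    obtain ⟨s, l, hs, hl, hK, hlast⟩ := ih
    refine ⟨s, l ++ [e'], hs, ?_, ?_, by simp⟩
    · rw [← List.cons_append, List.isChain_append]
      refine ⟨hl, by simp, ?_⟩
      intro a ha b hb
      rw [List.getLast?_eq_getLast_of_ne_nil (by simp), hlast] at ha
      simp only [Option.mem_def, Option.some.injEq, List.head?_cons] at ha hb
      exact ha ▸ hb ▸ hi
    · ext a
      rw [← hK]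
      simp only [List.mem_cons, List.mem_append, Set.mem_ofPred_eq, Set.mem_insert_iff,
        List.mem_nil_iff]
      tauto

theorem Thr.of_list {s : E.ev} (hs : E.IsMinEv s) (l : List E.ev)
    (hl : List.IsChain E.imm (s :: l)) :
    E.Thr {a | a ∈ s :: l} ((s :: l).getLast (by simp)) := by
  induction l using List.reverseRecOn with
  | nil =>
    have : ({a | a ∈ [s]} : Set E.ev) = {s} := by ext; simp
    rw [this]
    exact .base hs
  | append_singleton l e ih =>
    rw [← List.cons_append, List.isChain_append] at hl
    have h1 := ih hl.1
    have h2 : E.imm ((s :: l).getLast (by simp)) e :=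
      hl.2.2 _ (List.getLast?_eq_getLast_of_ne_nil (by simp)) _ (by simp)
    have h3 := h1.step h2
    have : ({a | a ∈ s :: (l ++ [e])} : Set E.ev) = insert e {a | a ∈ s :: l} := by
      ext a
      simp only [List.mem_cons, List.mem_append, Set.mem_ofPred_eq, Set.mem_insert_iff,
        List.mem_nil_iff]
      tauto
    rw [this]
    simpa using h3

theorem Thr.last_mem {K : Set E.ev} {e : E.ev} (h : E.Thr K e) : e ∈ K := by
  cases h <;> simp

theorem Thr.le_last (hE : E.IsES) {K : Set E.ev} {e : E.ev} (h : E.Thr K e) :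
    ∀ a ∈ K, E.le a e := by
  induction h with
  | base _ => rintro a rfl; exact hE.le_refl _
  | step _ hi ih =>
    rintro a (rfl | ha)
    · exact hE.le_refl _
    · exact hE.le_trans _ _ _ (ih a ha) hi.1.1

theorem Thr.total (hE : E.IsES) {K : Set E.ev} {e : E.ev} (h : E.Thr K e) :
    ∀ a ∈ K, ∀ b ∈ K, E.le a b ∨ E.le b a := by
  induction h with
  | base _ => rintro a rfl b rfl; exact Or.inl (hE.le_refl _)
  | step hK hi ih =>
    have h' := (hK.step hi).le_last hE
    rintro a (rfl | ha) b (rfl | hb)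
    · exact Or.inl (hE.le_refl _)
    · exact Or.inr (h' b (Or.inr hb))
    · exact Or.inl (h' a (Or.inr ha))
    · exact ih a ha b hb

theorem IsES.exists_thr_from (hE : E.IsES) {K : Set E.ev} {a b : E.ev} (hK : E.Thr K a)
    (hab : E.le a b) : ∃ K', E.Thr K' b ∧ K ⊆ K' := by
  induction hn : (E.down b).ncard using Nat.strong_induction_on generalizing b with
  | _ n ih =>
    by_cases hne : a = b
    · exact ⟨K, hne ▸ hK, subset_rfl⟩
    · obtain ⟨c, hac, hcb⟩ := hE.exists_imm ⟨hab, hne⟩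
      have hlt : (E.down c).ncard < n := by
        rw [← hn]
        refine Set.ncard_lt_ncard (Set.ssubset_iff_exists.2
          ⟨fun e he => hE.le_trans _ _ _ he hcb.1.1, b, hE.le_refl b, ?_⟩) (hE.finite_causes b)
        exact fun hab => hcb.1.2 (hE.le_antisymm _ _ hcb.1.1 hab)
      obtain ⟨K', hK', hsub⟩ := ih _ hlt hac rfl
      exact ⟨_, hK'.step hcb, hsub.trans (Set.subset_insert _ _)⟩

/-- A grounded chain through an event and up to a later one. -/
theorem IsES.exists_thr (hE : E.IsES) {a b : E.ev} (hab : E.le a b) :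
    ∃ K, E.Thr K b ∧ a ∈ K := by
  obtain ⟨m, hm, hma⟩ := hE.exists_min_le a
  obtain ⟨K, hK, -⟩ := hE.exists_thr_from (.base hm) hma
  obtain ⟨K', hK', hsub⟩ := hE.exists_thr_from hK hab
  exact ⟨K', hK', hsub hK.last_mem⟩

end ESS

/-! ## Isomorphism families -/

section Graphs

variable {X Y : Type u}

theorem mem_gdom {θ : Set (X × X)} {a : X} : a ∈ gdom θ ↔ ∃ b, (a, b) ∈ θ := by
  simp [gdom]

theorem mem_gcod {θ : Set (X × X)} {b : X} : b ∈ gcod θ ↔ ∃ a, (a, b) ∈ θ := by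
  simp [gcod]

theorem mem_swap {θ : Set (X × X)} {a b : X} : (a, b) ∈ Prod.swap '' θ ↔ (b, a) ∈ θ := by
  simp

theorem gdom_swap (θ : Set (X × X)) : gdom (Prod.swap '' θ) = gcod θ := by
  ext a; simp [mem_gdom, mem_gcod]

theorem gcod_swap (θ : Set (X × X)) : gcod (Prod.swap '' θ) = gdom θ := by
  ext a; simp [mem_gdom, mem_gcod]

theorem gdom_insert (θ : Set (X × X)) (a b : X) : gdom (insert (a, b) θ) = insert a (gdom θ) := by
  simp [gdom, Set.image_insert_eq]

theorem gcod_insert (θ : Set (X × X)) (a b : X) : gcod (insert (a, b) θ) = insert b (gcod θ) := by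
  simp [gcod, Set.image_insert_eq]

theorem gdom_gid (x : Set X) : gdom (gid x) = x := by
  ext a; simp [mem_gdom, gid]

theorem gcod_gid (x : Set X) : gcod (gid x) = x := by
  ext a
  simp only [mem_gcod, gid, Set.mem_ofPred_eq]
  exact ⟨fun ⟨b, hb, hab⟩ => hab ▸ hb, fun h => ⟨a, h, rfl⟩⟩

theorem gdom_mono {θ θ' : Set (X × X)} (h : θ ⊆ θ') : gdom θ ⊆ gdom θ' := Set.image_mono h

theorem gcod_mono {θ θ' : Set (X × X)} (h : θ ⊆ θ') : gcod θ ⊆ gcod θ' := Set.image_mono h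

theorem gdom_restrict {θ : Set (X × X)} {x : Set X} (h : x ⊆ gdom θ) :
    gdom {p ∈ θ | p.1 ∈ x} = x := by
  ext a
  rw [mem_gdom]
  exact ⟨fun ⟨b, hb⟩ => hb.2, fun ha => (mem_gdom.1 (h ha)).imp fun b hb => ⟨hb, ha⟩⟩

theorem gcod_restrict {θ : Set (X × X)} {x : Set X} (h : x ⊆ gcod θ) :
    gcod {p ∈ θ | p.2 ∈ x} = x := by
  ext a
  rw [mem_gcod]
  exact ⟨fun ⟨b, hb⟩ => hb.2, fun ha => (mem_gcod.1 (h ha)).imp fun b hb => ⟨hb, ha⟩⟩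

/-- Composition of graphs. -/
def gcomp (θ θ' : Set (X × X)) : Set (X × X) := {p | ∃ e, (p.1, e) ∈ θ ∧ (e, p.2) ∈ θ'}

theorem mem_gcomp {θ θ' : Set (X × X)} {a b : X} :
    (a, b) ∈ gcomp θ θ' ↔ ∃ e, (a, e) ∈ θ ∧ (e, b) ∈ θ' := Iff.rfl

theorem gdom_gcomp {θ θ' : Set (X × X)} (h : gcod θ ⊆ gdom θ') : gdom (gcomp θ θ') = gdom θ := by
  ext a
  simp only [mem_gdom, mem_gcomp]
  constructor
  · rintro ⟨b, e, he, -⟩; exact ⟨e, he⟩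
  · rintro ⟨e, he⟩
    obtain ⟨b, hb⟩ := mem_gdom.1 (h (mem_gcod.2 ⟨a, he⟩))
    exact ⟨b, e, he, hb⟩

theorem gcod_gcomp {θ θ' : Set (X × X)} (h : gdom θ' ⊆ gcod θ) :
    gcod (gcomp θ θ') = gcod θ' := by
  ext b
  simp only [mem_gcod, mem_gcomp]
  constructor
  · rintro ⟨a, e, -, he⟩; exact ⟨e, he⟩
  · rintro ⟨e, he⟩
    obtain ⟨a, ha⟩ := mem_gcod.1 (h (mem_gdom.2 ⟨b, he⟩))
    exact ⟨a, e, ha, he⟩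

end Graphs

section IsoFamily

variable {E : ESS.{u}} {S : Set (Set (E.ev × E.ev))}

theorem IsConfBij.inj₁ {θ : Set (E.ev × E.ev)} (h : IsConfBij E θ) {a b b' : E.ev}
    (h₁ : (a, b) ∈ θ) (h₂ : (a, b') ∈ θ) : b = b' :=
  congrArg Prod.snd (h.1 h₁ h₂ rfl)

theorem IsConfBij.inj₂ {θ : Set (E.ev × E.ev)} (h : IsConfBij E θ) {a a' b : E.ev}
    (h₁ : (a, b) ∈ θ) (h₂ : (a', b) ∈ θ) : a = a' :=
  congrArg Prod.fst (h.2.1 h₁ h₂ rfl)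

theorem IsConfBij.swap {θ : Set (E.ev × E.ev)} (h : IsConfBij E θ) :
    IsConfBij E (Prod.swap '' θ) := by
  refine ⟨?_, ?_, ?_, ?_⟩
  · rintro ⟨a, b⟩ h1 ⟨a', b'⟩ h2 (rfl : a = a')
    rw [mem_swap] at h1 h2
    rw [h.inj₂ h1 h2]
  · rintro ⟨a, b⟩ h1 ⟨a', b'⟩ h2 (rfl : b = b')
    rw [mem_swap] at h1 h2
    rw [h.inj₁ h1 h2]
  · rw [gdom_swap]; exact h.2.2.2
  · rw [gcod_swap]; exact h.2.2.1

namespace IsIsoFamily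

theorem dom_conf (h : IsIsoFamily E S) {θ} (hθ : θ ∈ S) : gdom θ ∈ E.Conf := (h.bij θ hθ).2.2.1

theorem cod_conf (h : IsIsoFamily E S) {θ} (hθ : θ ∈ S) : gcod θ ∈ E.Conf := (h.bij θ hθ).2.2.2

theorem restrict_cod (h : IsIsoFamily E S) {θ} (hθ : θ ∈ S) {x : Set E.ev} (hx : x ∈ E.Conf)
    (hsub : x ⊆ gcod θ) : {p ∈ θ | p.2 ∈ x} ∈ S := by
  have h1 := h.inv_mem _ (h.restrict _ (h.inv_mem _ hθ) x hx (by rwa [gdom_swap]))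
  convert h1 using 1
  ext ⟨a, b⟩
  simp

theorem le_of_le (hE : E.IsES) (h : IsIsoFamily E S) {θ} (hθ : θ ∈ S) {a a' b b' : E.ev}
    (ha : (a, a') ∈ θ) (hb : (b, b') ∈ θ) (hab : E.le a b) : E.le a' b' := by
  have hsub : E.down b' ⊆ gcod θ :=
    fun e he => (h.cod_conf hθ).2.1 b' (mem_gcod.2 ⟨b, hb⟩) e he
  have h1 := h.restrict_cod hθ (hE.down_conf b') hsub
  have h2 := (h.dom_conf h1).2.1 b (mem_gdom.2 ⟨b', hb, hE.le_refl _⟩) a hab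
  obtain ⟨c, hc, hc'⟩ := mem_gdom.1 h2
  rw [(h.bij θ hθ).inj₁ ha hc]
  exact hc'

theorem le_iff (hE : E.IsES) (h : IsIsoFamily E S) {θ} (hθ : θ ∈ S) {a a' b b' : E.ev}
    (ha : (a, a') ∈ θ) (hb : (b, b') ∈ θ) : E.le a b ↔ E.le a' b' :=
  ⟨h.le_of_le hE hθ ha hb,
    h.le_of_le hE (h.inv_mem _ hθ) (mem_swap.2 ha) (mem_swap.2 hb)⟩

theorem lt_iff (hE : E.IsES) (h : IsIsoFamily E S) {θ} (hθ : θ ∈ S) {a a' b b' : E.ev}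
    (ha : (a, a') ∈ θ) (hb : (b, b') ∈ θ) : E.lt a b ↔ E.lt a' b' := by
  refine and_congr (h.le_iff hE hθ ha hb) (not_congr ⟨?_, ?_⟩)
  · rintro rfl; exact (h.bij θ hθ).inj₁ ha hb
  · rintro rfl; exact (h.bij θ hθ).inj₂ ha hb

theorem imm_of_imm (hE : E.IsES) (h : IsIsoFamily E S) {θ} (hθ : θ ∈ S) {a a' b b' : E.ev}
    (ha : (a, a') ∈ θ) (hb : (b, b') ∈ θ) (hab : E.imm a b) : E.imm a' b' := by
  refine ⟨(h.lt_iff hE hθ ha hb).1 hab.1, fun d hd => ?_⟩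
  obtain ⟨c, hc⟩ := mem_gcod.1 ((h.cod_conf hθ).2.1 b' (mem_gcod.2 ⟨b, hb⟩) d hd.2.1)
  exact hab.2 c ⟨(h.lt_iff hE hθ ha hc).2 hd.1, (h.lt_iff hE hθ hc hb).2 hd.2⟩

theorem imm_iff (hE : E.IsES) (h : IsIsoFamily E S) {θ} (hθ : θ ∈ S) {a a' b b' : E.ev}
    (ha : (a, a') ∈ θ) (hb : (b, b') ∈ θ) : E.imm a b ↔ E.imm a' b' :=
  ⟨h.imm_of_imm hE hθ ha hb,
    h.imm_of_imm hE (h.inv_mem _ hθ) (mem_swap.2 ha) (mem_swap.2 hb)⟩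

theorem extend_one (h : IsIsoFamily E S) {θ} (hθ : θ ∈ S) {a : E.ev} (ha : E.Enables (gdom θ) a) :
    ∃ b, insert (a, b) θ ∈ S := by
  obtain ⟨θ', hθ', hsub, hdom⟩ := h.extend θ hθ _ ha.2.2 (Set.subset_insert _ _)
  obtain ⟨b, hb⟩ := mem_gdom.1 (hdom ▸ Set.mem_insert a (gdom θ))
  refine ⟨b, ?_⟩
  have : insert (a, b) θ = θ' := by
    refine (Set.insert_subset hb hsub).antisymm ?_
    rintro ⟨c, d⟩ hcd
    rcases hdom ▸ mem_gdom.2 ⟨d, hcd⟩ with rfl | hc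
    · rw [(h.bij _ hθ').inj₁ hcd hb]; exact Set.mem_insert _ _
    · obtain ⟨d', hd'⟩ := mem_gdom.1 hc
      rw [(h.bij _ hθ').inj₁ hcd (hsub hd')]
      exact Or.inr hd'
  rwa [this]

theorem comp_mem' (h : IsIsoFamily E S) {θ θ'} (hθ : θ ∈ S) (hθ' : θ' ∈ S)
    (hc : gcod θ = gdom θ') : gcomp θ θ' ∈ S := h.comp_mem θ hθ θ' hθ' hc

end IsIsoFamily

/-- To extend along configurations it is enough to extend by one event at a time. -/
theorem extend_of_step (hE : E.IsES) (hbij : ∀ θ ∈ S, IsConfBij E θ)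
    (hstep : ∀ θ ∈ S, ∀ a, E.Enables (gdom θ) a → ∃ b, insert (a, b) θ ∈ S) :
    ∀ θ ∈ S, ∀ x ∈ E.Conf, gdom θ ⊆ x → ∃ θ' ∈ S, θ ⊆ θ' ∧ gdom θ' = x := by
  intro θ hθ x hx hsub
  induction hn : (x \ gdom θ).ncard using Nat.strong_induction_on generalizing θ with
  | _ n ih =>
    by_cases hne : (x \ gdom θ).Nonempty
    · obtain ⟨a, ha, -, hmin⟩ := hE.exists_minimal (fun _ => True) ⟨_, hne.some_mem, trivial⟩
      have hen : E.Enables (gdom θ) a := by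
        refine ESS.enables_of (hbij θ hθ).2.2.1 hx hsub ha.1 ha.2 fun e he => ?_
        by_contra hc
        exact hmin e ⟨hx.2.1 a ha.1 e he.1, hc⟩ he trivial
      obtain ⟨b, hb⟩ := hstep θ hθ a hen
      have hsub' : gdom (insert (a, b) θ) ⊆ x := by
        rw [gdom_insert]; exact Set.insert_subset ha.1 hsub
      obtain ⟨θ', h1, h2, h3⟩ := ih _ (by
        rw [← hn, gdom_insert]
        refine Set.ncard_lt_ncard (Set.ssubset_iff_exists.2 ⟨?_, a, ha, ?_⟩) hx.1.sdiff
        · exact fun e he => ⟨he.1, fun h => he.2 (Or.inr h)⟩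
        · exact fun h => h.2 (Or.inl rfl)) _ hb hsub' rfl
      exact ⟨θ', h1, (Set.subset_insert _ _).trans h2, h3⟩
    · refine ⟨θ, hθ, subset_rfl, hsub.antisymm ?_⟩
      intro e he
      by_contra hc
      exact hne ⟨e, he, hc⟩

end IsoFamily

/-! ## Parallel composition -/

section ParRel

variable {X Y X' Y' : Type u} {θ θ₁ : Set (X × X)} {θ' θ₁' : Set (Y × Y)}

@[simp] theorem mem_parRel_ll {a b : X} : (inl a, inl b) ∈ parRel θ θ' ↔ (a, b) ∈ θ := by
  simp [parRel]

@[simp] theorem mem_parRel_rr {a b : Y} : (inr a, inr b) ∈ parRel θ θ' ↔ (a, b) ∈ θ' := by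
  simp [parRel]

@[simp] theorem mem_parRel_lr {a : X} {b : Y} : (inl a, inr b) ∈ parRel θ θ' ↔ False := by
  simp [parRel]

@[simp] theorem mem_parRel_rl {a : Y} {b : X} : (inr a, inl b) ∈ parRel θ θ' ↔ False := by
  simp [parRel]

theorem rel_ext {φ ψ : Set ((X ⊕ Y) × (X ⊕ Y))}
    (h₁ : ∀ a b, (inl a, inl b) ∈ φ ↔ (inl a, inl b) ∈ ψ)
    (h₂ : ∀ a b, (inl a, inr b) ∈ φ ↔ (inl a, inr b) ∈ ψ)
    (h₃ : ∀ a b, (inr a, inl b) ∈ φ ↔ (inr a, inl b) ∈ ψ)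
    (h₄ : ∀ a b, (inr a, inr b) ∈ φ ↔ (inr a, inr b) ∈ ψ) : φ = ψ := by
  ext ⟨a | a, b | b⟩
  exacts [h₁ a b, h₂ a b, h₃ a b, h₄ a b]

theorem parRel_inj (h : parRel θ θ' = parRel θ₁ θ₁') : θ = θ₁ ∧ θ' = θ₁' := by
  constructor
  · ext ⟨a, b⟩
    rw [← mem_parRel_ll (θ' := θ'), h, mem_parRel_ll]
  · ext ⟨a, b⟩
    rw [← mem_parRel_rr (θ := θ), h, mem_parRel_rr]

@[simp] theorem inl_mem_gdom_parRel {a : X} : inl a ∈ gdom (parRel θ θ') ↔ a ∈ gdom θ := by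
  simp [mem_gdom]

@[simp] theorem inr_mem_gdom_parRel {a : Y} : inr a ∈ gdom (parRel θ θ') ↔ a ∈ gdom θ' := by
  simp [mem_gdom]

@[simp] theorem inl_mem_gcod_parRel {a : X} : inl a ∈ gcod (parRel θ θ') ↔ a ∈ gcod θ := by
  simp [mem_gcod]

@[simp] theorem inr_mem_gcod_parRel {a : Y} : inr a ∈ gcod (parRel θ θ') ↔ a ∈ gcod θ' := by
  simp [mem_gcod]

theorem preimage_inl_gdom : inl ⁻¹' gdom (parRel θ θ') = gdom θ := by ext; simp

theorem preimage_inr_gdom : inr ⁻¹' gdom (parRel θ θ') = gdom θ' := by ext; simp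

theorem preimage_inl_gcod : inl ⁻¹' gcod (parRel θ θ') = gcod θ := by ext; simp

theorem preimage_inr_gcod : inr ⁻¹' gcod (parRel θ θ') = gcod θ' := by ext; simp

theorem insert_inl_parRel {a b : X} :
    insert (inl a, inl b) (parRel θ θ') = parRel (insert (a, b) θ) θ' := by
  apply rel_ext <;> simp

theorem insert_inr_parRel {a b : Y} :
    insert (inr a, inr b) (parRel θ θ') = parRel θ (insert (a, b) θ') := by
  apply rel_ext <;> simp

theorem map_parRel (f : X → X') (g : Y → Y') :
    Prod.map (Sum.map f g) (Sum.map f g) '' parRel θ θ' =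
      parRel (Prod.map f f '' θ) (Prod.map g g '' θ') := by
  apply rel_ext <;> simp

theorem swap_parRel : Prod.swap '' parRel θ θ' = parRel (Prod.swap '' θ) (Prod.swap '' θ') := by
  apply rel_ext <;> simp

theorem parRel_subset : parRel θ θ' ⊆ parRel θ₁ θ₁' ↔ θ ⊆ θ₁ ∧ θ' ⊆ θ₁' := by
  constructor
  · intro h
    exact ⟨fun ⟨a, b⟩ hab => mem_parRel_ll.1 (h (mem_parRel_ll.2 hab)),
      fun ⟨a, b⟩ hab => mem_parRel_rr.1 (h (mem_parRel_rr.2 hab))⟩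
  · rintro ⟨h₁, h₂⟩ ⟨a | a, b | b⟩ h
    · exact mem_parRel_ll.2 (h₁ (mem_parRel_ll.1 h))
    · simp at h
    · simp at h
    · exact mem_parRel_rr.2 (h₂ (mem_parRel_rr.1 h))

theorem parRel_mem_parFam {S : Set (Set (X × X))} {T : Set (Set (Y × Y))} :
    parRel θ θ' ∈ parFam S T ↔ θ ∈ S ∧ θ' ∈ T := by
  constructor
  · rintro ⟨θ₁, h₁, θ₂, h₂, h⟩
    obtain ⟨rfl, rfl⟩ := parRel_inj h
    exact ⟨h₁, h₂⟩
  · rintro ⟨h₁, h₂⟩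
    exact ⟨_, h₁, _, h₂, rfl⟩

theorem gid_par (x : Set (X ⊕ Y)) : gid x = parRel (gid (inl ⁻¹' x)) (gid (inr ⁻¹' x)) := by
  apply rel_ext <;> simp [gid]

end ParRel

namespace ESS

variable {E F : ESS.{u}}

theorem par_conf {x : Set (E.ev ⊕ F.ev)} :
    x ∈ (E.par F).Conf ↔ inl ⁻¹' x ∈ E.Conf ∧ inr ⁻¹' x ∈ F.Conf := by
  constructor
  · rintro ⟨h1, h2, h3⟩
    exact ⟨⟨h1.preimage Sum.inl_injective.injOn,
        fun e he e' h => h2 _ he (inl e') (Sum.LiftRel.inl h),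
        fun e he e' he' h => h3 _ he _ he' (Sum.LiftRel.inl h)⟩,
      ⟨h1.preimage Sum.inr_injective.injOn,
        fun e he e' h => h2 _ he (inr e') (Sum.LiftRel.inr h),
        fun e he e' he' h => h3 _ he _ he' (Sum.LiftRel.inr h)⟩⟩
  · rintro ⟨⟨a1, a2, a3⟩, ⟨b1, b2, b3⟩⟩
    refine ⟨?_, ?_, ?_⟩
    · refine ((a1.image inl).union (b1.image inr)).subset ?_
      rintro (e | e) he
      · exact Or.inl ⟨e, he, rfl⟩
      · exact Or.inr ⟨e, he, rfl⟩
    · rintro e he e' (h | h)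
      · exact a2 _ he _ h
      · exact b2 _ he _ h
    · rintro e he e' he' (h | h)
      · exact a3 _ he _ he' h
      · exact b3 _ he _ he' h

@[simp] theorem par_le_ll {a b : E.ev} : (E.par F).le (inl a) (inl b) ↔ E.le a b :=
  Sum.liftRel_inl_inl

@[simp] theorem par_le_rr {a b : F.ev} : (E.par F).le (inr a) (inr b) ↔ F.le a b :=
  Sum.liftRel_inr_inr

@[simp] theorem par_le_lr {a : E.ev} {b : F.ev} : (E.par F).le (inl a) (inr b) ↔ False :=
  iff_false_intro Sum.not_liftRel_inl_inr

@[simp] theorem par_le_rl {a : F.ev} {b : E.ev} : (E.par F).le (inr a) (inl b) ↔ False :=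
  iff_false_intro Sum.not_liftRel_inr_inl

@[simp] theorem par_lt_ll {a b : E.ev} : (E.par F).lt (inl a) (inl b) ↔ E.lt a b :=
  and_congr par_le_ll (not_congr Sum.inl_injective.eq_iff)

@[simp] theorem par_lt_rr {a b : F.ev} : (E.par F).lt (inr a) (inr b) ↔ F.lt a b :=
  and_congr par_le_rr (not_congr Sum.inr_injective.eq_iff)

@[simp] theorem par_lt_lr {a : E.ev} {b : F.ev} : (E.par F).lt (inl a) (inr b) ↔ False :=
  iff_false_intro fun h => Sum.not_liftRel_inl_inr h.1

@[simp] theorem par_lt_rl {a : F.ev} {b : E.ev} : (E.par F).lt (inr a) (inl b) ↔ False :=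
  iff_false_intro fun h => Sum.not_liftRel_inr_inl h.1

@[simp] theorem par_imm_ll {a b : E.ev} : (E.par F).imm (inl a) (inl b) ↔ E.imm a b := by
  refine and_congr par_lt_ll ⟨fun h d hd => h (inl d) (by simpa using hd), ?_⟩
  rintro h (d | d) ⟨h1, h2⟩
  · exact h d ⟨par_lt_ll.1 h1, par_lt_ll.1 h2⟩
  · exact par_lt_lr.1 h1

@[simp] theorem par_imm_rr {a b : F.ev} : (E.par F).imm (inr a) (inr b) ↔ F.imm a b := by
  refine and_congr par_lt_rr ⟨fun h d hd => h (inr d) (by simpa using hd), ?_⟩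
  rintro h (d | d) ⟨h1, h2⟩
  · exact par_lt_rl.1 h1
  · exact h d ⟨par_lt_rr.1 h1, par_lt_rr.1 h2⟩

@[simp] theorem par_imm_lr {a : E.ev} {b : F.ev} : (E.par F).imm (inl a) (inr b) ↔ False :=
  iff_false_intro fun h => par_lt_lr.1 h.1

@[simp] theorem par_imm_rl {a : F.ev} {b : E.ev} : (E.par F).imm (inr a) (inl b) ↔ False :=
  iff_false_intro fun h => par_lt_rl.1 h.1

@[simp] theorem par_min_l {a : E.ev} : (E.par F).IsMinEv (inl a) ↔ E.IsMinEv a := by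
  constructor
  · intro h d hd
    exact Sum.inl.inj (h (inl d) (par_le_ll.2 hd))
  · rintro h (d | d) hd
    · rw [h d (par_le_ll.1 hd)]
    · exact (par_le_rl.1 hd).elim

@[simp] theorem par_min_r {a : F.ev} : (E.par F).IsMinEv (inr a) ↔ F.IsMinEv a := by
  constructor
  · intro h d hd
    exact Sum.inr.inj (h (inr d) (par_le_rr.2 hd))
  · rintro h (d | d) hd
    · exact (par_le_lr.1 hd).elim
    · rw [h d (par_le_rr.1 hd)]

theorem preimage_inl_insert_inl {X Y : Type*} (x : Set (X ⊕ Y)) (a : X) :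
    inl ⁻¹' (insert (inl a) x) = insert a (inl ⁻¹' x) := by
  ext; simp

theorem preimage_inr_insert_inl {X Y : Type*} (x : Set (X ⊕ Y)) (a : X) :
    inr ⁻¹' (insert (inl a) x) = inr ⁻¹' x := by
  ext; simp

theorem preimage_inl_insert_inr {X Y : Type*} (x : Set (X ⊕ Y)) (a : Y) :
    inl ⁻¹' (insert (inr a) x) = inl ⁻¹' x := by
  ext; simp

theorem preimage_inr_insert_inr {X Y : Type*} (x : Set (X ⊕ Y)) (a : Y) :
    inr ⁻¹' (insert (inr a) x) = insert a (inr ⁻¹' x) := by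
  ext; simp

theorem par_enables_l {x : Set (E.ev ⊕ F.ev)} {a : E.ev} :
    (E.par F).Enables x (inl a) ↔ E.Enables (inl ⁻¹' x) a ∧ inr ⁻¹' x ∈ F.Conf := by
  refine (and_congr par_conf (and_congr Iff.rfl par_conf)).trans ?_
  rw [preimage_inl_insert_inl, preimage_inr_insert_inl]
  simp only [Enables, Set.mem_preimage]
  tauto

theorem par_enables_r {x : Set (E.ev ⊕ F.ev)} {a : F.ev} :
    (E.par F).Enables x (inr a) ↔ F.Enables (inr ⁻¹' x) a ∧ inl ⁻¹' x ∈ E.Conf := by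
  refine (and_congr par_conf (and_congr Iff.rfl par_conf)).trans ?_
  rw [preimage_inl_insert_inr, preimage_inr_insert_inr]
  simp only [Enables, Set.mem_preimage]
  tauto

theorem IsES.par (hE : E.IsES) (hF : F.IsES) : (E.par F).IsES where
  countable := by
    have := hE.countable
    have := hF.countable
    exact inferInstanceAs (Countable (E.ev ⊕ F.ev))
  le_refl := by
    rintro (e | e)
    · exact Sum.LiftRel.inl (hE.le_refl e)
    · exact Sum.LiftRel.inr (hF.le_refl e)
  le_trans := by
    rintro _ _ _ (h | h) (h' | h')
    · exact Sum.LiftRel.inl (hE.le_trans _ _ _ h h')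
    · exact Sum.LiftRel.inr (hF.le_trans _ _ _ h h')
  le_antisymm := by
    rintro _ _ (h | h) h'
    · rw [hE.le_antisymm _ _ h (par_le_ll.1 h')]
    · rw [hF.le_antisymm _ _ h (par_le_rr.1 h')]
  finite_causes := by
    rintro (e | e)
    · refine ((hE.finite_causes e).image inl).subset ?_
      rintro _ (h | _)
      exact ⟨_, h, rfl⟩
    · refine ((hF.finite_causes e).image inr).subset ?_
      rintro _ (_ | h)
      exact ⟨_, h, rfl⟩
  conflict_irrefl := by
    rintro _ (h | h)
    · exact hE.conflict_irrefl _ h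
    · exact hF.conflict_irrefl _ h
  conflict_symm := by
    rintro _ _ (h | h)
    · exact Sum.LiftRel.inl (hE.conflict_symm _ _ h)
    · exact Sum.LiftRel.inr (hF.conflict_symm _ _ h)
  conflict_inherit := by
    rintro _ _ _ (h | h) (h' | h')
    · exact Sum.LiftRel.inl (hE.conflict_inherit _ _ _ h h')
    · exact Sum.LiftRel.inr (hF.conflict_inherit _ _ _ h h')

end ESS

section ParFam

variable {E F : ESS.{u}} {S : Set (Set (E.ev × E.ev))} {T : Set (Set (F.ev × F.ev))}

theorem IsConfBij.par {θ : Set (E.ev × E.ev)} {θ' : Set (F.ev × F.ev)} (h : IsConfBij E θ)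
    (h' : IsConfBij F θ') : IsConfBij (E.par F) (parRel θ θ') := by
  refine ⟨?_, ?_, ?_, ?_⟩
  · rintro ⟨a | a, b | b⟩ h1 ⟨a' | a', b' | b'⟩ h2 hab <;> simp_all [ESS.par] <;>
      [exact h.inj₁ h1 h2; exact h'.inj₁ h1 h2]
  · rintro ⟨a | a, b | b⟩ h1 ⟨a' | a', b' | b'⟩ h2 hab <;> simp_all [ESS.par] <;>
      [exact h.inj₂ h1 h2; exact h'.inj₂ h1 h2]
  · exact ESS.par_conf.2 ⟨by rw [preimage_inl_gdom]; exact h.2.2.1,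
      by rw [preimage_inr_gdom]; exact h'.2.2.1⟩
  · exact ESS.par_conf.2 ⟨by rw [preimage_inl_gcod]; exact h.2.2.2,
      by rw [preimage_inr_gcod]; exact h'.2.2.2⟩

theorem gcomp_parRel {X Y : Type u} {θ θ₁ : Set (X × X)} {θ' θ₁' : Set (Y × Y)} :
    gcomp (parRel θ θ') (parRel θ₁ θ₁') = parRel (gcomp θ θ₁) (gcomp θ' θ₁') := by
  apply rel_ext <;> simp [mem_gcomp]

theorem IsIsoFamily.par (hS : IsIsoFamily E S) (hT : IsIsoFamily F T) :
    IsIsoFamily (E.par F) (parFam S T) where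
  bij := by
    rintro _ ⟨θ, hθ, θ', hθ', rfl⟩
    exact (hS.bij _ hθ).par (hT.bij _ hθ')
  id_mem := by
    intro x hx
    rw [gid_par]
    exact ⟨_, hS.id_mem _ (ESS.par_conf.1 hx).1, _, hT.id_mem _ (ESS.par_conf.1 hx).2, rfl⟩
  inv_mem := by
    rintro _ ⟨θ, hθ, θ', hθ', rfl⟩
    exact ⟨_, hS.inv_mem _ hθ, _, hT.inv_mem _ hθ', swap_parRel⟩
  comp_mem := by
    rintro _ ⟨θ, hθ, θ', hθ', rfl⟩ _ ⟨θ₁, hθ₁, θ₁', hθ₁', rfl⟩ h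
    have h1 := congrArg (inl ⁻¹' ·) h
    have h2 := congrArg (inr ⁻¹' ·) h
    dsimp only at h1 h2
    rw [preimage_inl_gcod, preimage_inl_gdom] at h1
    rw [preimage_inr_gcod, preimage_inr_gdom] at h2
    exact ⟨_, hS.comp_mem' hθ hθ₁ h1, _, hT.comp_mem' hθ' hθ₁' h2, gcomp_parRel⟩
  restrict := by
    rintro _ ⟨θ, hθ, θ', hθ', rfl⟩ x hx hsub
    refine ⟨_, hS.restrict _ hθ _ (ESS.par_conf.1 hx).1 ?_, _,
      hT.restrict _ hθ' _ (ESS.par_conf.1 hx).2 ?_, ?_⟩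
    · exact fun e he => inl_mem_gdom_parRel.1 (hsub he)
    · exact fun e he => inr_mem_gdom_parRel.1 (hsub he)
    · apply rel_ext <;> simp
  extend := by
    rintro _ ⟨θ, hθ, θ', hθ', rfl⟩ x hx hsub
    obtain ⟨θ₁, h1, h2, h3⟩ := hS.extend _ hθ _ (ESS.par_conf.1 hx).1
      (fun e he => hsub (inl_mem_gdom_parRel.2 he))
    obtain ⟨θ₁', h1', h2', h3'⟩ := hT.extend _ hθ' _ (ESS.par_conf.1 hx).2
      (fun e he => hsub (inr_mem_gdom_parRel.2 he))
    refine ⟨_, ⟨_, h1, _, h1', rfl⟩, parRel_subset.2 ⟨h2, h2'⟩, ?_⟩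
    ext (e | e)
    · rw [inl_mem_gdom_parRel, h3]; rfl
    · rw [inr_mem_gdom_parRel, h3']; rfl

end ParFam

/-- The parallel composition of strategies on separate games. -/
@[reducible] def parStrat {G H : Game.{u}} (σ : PreStrat G) (τ : PreStrat H) : PreStrat (G.par H) where
  toESS := σ.toESS.par τ.toESS
  disp := Sum.map σ.disp τ.disp

section ParStrat

variable {G H : Game.{u}} {σ : PreStrat G} {τ : PreStrat H}

theorem preimage_inl_image_map {X Y X' Y' : Type*} (f : X → X') (g : Y → Y') (x : Set (X ⊕ Y)) :
    inl ⁻¹' (Sum.map f g '' x) = f '' (inl ⁻¹' x) := by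
  ext; simp

theorem preimage_inr_image_map {X Y X' Y' : Type*} (f : X → X') (g : Y → Y') (x : Set (X ⊕ Y)) :
    inr ⁻¹' (Sum.map f g '' x) = g '' (inr ⁻¹' x) := by
  ext; simp

theorem symEnables_par_l {X Y : Type u} {S : Set (Set (X × X))} {T : Set (Set (Y × Y))}
    {θ : Set (X × X)} {θ' : Set (Y × Y)} {a b : X} (hθ' : θ' ∈ T) :
    SymEnables (parFam S T) (parRel θ θ') (inl a, inl b) ↔ SymEnables S θ (a, b) := by
  simp only [SymEnables, mem_parRel_ll, insert_inl_parRel, parRel_mem_parFam]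
  tauto

theorem symEnables_par_r {X Y : Type u} {S : Set (Set (X × X))} {T : Set (Set (Y × Y))}
    {θ : Set (X × X)} {θ' : Set (Y × Y)} {a b : Y} (hθ : θ ∈ S) :
    SymEnables (parFam S T) (parRel θ θ') (inr a, inr b) ↔ SymEnables T θ' (a, b) := by
  simp only [SymEnables, mem_parRel_rr, insert_inr_parRel, parRel_mem_parFam]
  tauto

theorem not_symEnables_par_lr {X Y : Type u} {S : Set (Set (X × X))} {T : Set (Set (Y × Y))}
    {φ : Set ((X ⊕ Y) × (X ⊕ Y))} {a : X} {b : Y} :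
    ¬ SymEnables (parFam S T) φ (inl a, inr b) := by
  rintro ⟨-, θ, -, θ', -, h⟩
  have : (inl a, inr b) ∈ parRel θ θ' := h ▸ Set.mem_insert _ _
  simp at this

theorem not_symEnables_par_rl {X Y : Type u} {S : Set (Set (X × X))} {T : Set (Set (Y × Y))}
    {φ : Set ((X ⊕ Y) × (X ⊕ Y))} {a : Y} {b : X} :
    ¬ SymEnables (parFam S T) φ (inr a, inl b) := by
  rintro ⟨-, θ, -, θ', -, h⟩
  have : (inr a, inl b) ∈ parRel θ θ' := h ▸ Set.mem_insert _ _
  simp at this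

theorem IsPointedStrategy.par (hσ : IsPointedStrategy σ) (hτ : IsPointedStrategy τ) :
    IsPointedStrategy (parStrat σ τ) where
  isES := hσ.isES.par hτ.isES
  isoFamily := hσ.isoFamily.par hτ.isoFamily
  rule_abiding := by
    intro x hx
    have hx' := ESS.par_conf.1 hx
    refine ESS.par_conf.2 ⟨?_, ?_⟩
    · have := hσ.rule_abiding _ hx'.1
      rwa [← preimage_inl_image_map σ.disp τ.disp] at this
    · have := hτ.rule_abiding _ hx'.2
      rwa [← preimage_inr_image_map σ.disp τ.disp] at this
  locally_injective := by
    intro x hx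
    have hx' := ESS.par_conf.1 hx
    rintro (s | s) hs (t | t) ht h
    · rw [hσ.locally_injective _ hx'.1 hs ht (Sum.inl.inj h)]
    · cases h
    · cases h
    · rw [hτ.locally_injective _ hx'.2 hs ht (Sum.inr.inj h)]
  sym_preserving := by
    rintro _ ⟨θ, hθ, θ', hθ', rfl⟩
    exact ⟨_, hσ.sym_preserving _ hθ, _, hτ.sym_preserving _ hθ', map_parRel _ _⟩
  sim_receptive := by
    rintro _ ⟨θ, hθ, θ', hθ', rfl⟩ (s | s) (a | a) hen h1 h2 hsym
    · have hen' := ESS.par_enables_l.1 hen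
      rw [preimage_inl_gdom] at hen'
      have hsym' : SymEnables (parFam G.sym H.sym) (parRel (Prod.map σ.disp σ.disp '' θ)
        (Prod.map τ.disp τ.disp '' θ')) (inl (σ.disp s), inl a) := by
        rw [← map_parRel]; exact hsym
      rw [symEnables_par_l (hτ.sym_preserving _ hθ')] at hsym'
      obtain ⟨s₂, ⟨h3, h4⟩, h5⟩ := hσ.sim_receptive θ hθ s a hen'.1 h1 h2 hsym'
      refine ⟨inl s₂, ⟨(symEnables_par_l hθ').2 h3, congrArg inl h4⟩, ?_⟩
      rintro (t | t) ⟨h6, h7⟩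
      · rw [h5 t ⟨(symEnables_par_l hθ').1 h6, Sum.inl.inj h7⟩]
      · cases h7
    · exact (not_symEnables_par_lr hsym).elim
    · exact (not_symEnables_par_rl hsym).elim
    · have hen' := ESS.par_enables_r.1 hen
      rw [preimage_inr_gdom] at hen'
      have hsym' : SymEnables (parFam G.sym H.sym) (parRel (Prod.map σ.disp σ.disp '' θ)
        (Prod.map τ.disp τ.disp '' θ')) (inr (τ.disp s), inr a) := by
        rw [← map_parRel]; exact hsym
      rw [symEnables_par_r (hσ.sym_preserving _ hθ)] at hsym'
      obtain ⟨s₂, ⟨h3, h4⟩, h5⟩ := hτ.sim_receptive θ' hθ' s a hen'.1 h1 h2 hsym'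
      refine ⟨inr s₂, ⟨(symEnables_par_r hθ).2 h3, congrArg inr h4⟩, ?_⟩
      rintro (t | t) ⟨h6, h7⟩
      · cases h7
      · rw [h5 t ⟨(symEnables_par_r hθ).1 h6, Sum.inr.inj h7⟩]
  thin := by
    rintro _ ⟨θ, hθ, θ', hθ', rfl⟩ (s | s) hen hp
    · have hen' := ESS.par_enables_l.1 hen
      rw [preimage_inl_gdom] at hen'
      obtain ⟨s₂, ⟨h3, h4⟩, h5⟩ := hσ.thin θ hθ s hen'.1 hp
      refine ⟨inl s₂, ⟨ESS.par_enables_l.2 ⟨?_, ?_⟩, (symEnables_par_l hθ').2 h4⟩, ?_⟩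
      · rwa [preimage_inl_gcod]
      · rw [preimage_inr_gcod]; exact hτ.isoFamily.cod_conf hθ'
      · rintro (t | t) ⟨h6, h7⟩
        · have h6' := (ESS.par_enables_l.1 h6).1
          rw [preimage_inl_gcod] at h6'
          rw [h5 t ⟨h6', (symEnables_par_l hθ').1 h7⟩]
        · exact (not_symEnables_par_lr h7).elim
    · have hen' := ESS.par_enables_r.1 hen
      rw [preimage_inr_gdom] at hen'
      obtain ⟨s₂, ⟨h3, h4⟩, h5⟩ := hτ.thin θ' hθ' s hen'.1 hp
      refine ⟨inr s₂, ⟨ESS.par_enables_r.2 ⟨?_, ?_⟩, (symEnables_par_r hθ).2 h4⟩, ?_⟩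
      · rwa [preimage_inr_gcod]
      · rw [preimage_inl_gcod]; exact hσ.isoFamily.cod_conf hθ
      · rintro (t | t) ⟨h6, h7⟩
        · exact (not_symEnables_par_rl h7).elim
        · have h6' := (ESS.par_enables_r.1 h6).1
          rw [preimage_inr_gcod] at h6'
          rw [h5 t ⟨h6', (symEnables_par_r hθ).1 h7⟩]
  negative := by
    rintro (s | s) hs
    · exact hσ.negative s (ESS.par_min_l.1 hs)
    · exact hτ.negative s (ESS.par_min_r.1 hs)
  courteous := by
    rintro (s | s) (t | t) hi hp
    · exact ESS.par_imm_ll.2 (hσ.courteous s t (ESS.par_imm_ll.1 hi) hp)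
    · exact (ESS.par_imm_lr.1 hi).elim
    · exact (ESS.par_imm_rl.1 hi).elim
    · exact ESS.par_imm_rr.2 (hτ.courteous s t (ESS.par_imm_rr.1 hi) hp)
  receptive := by
    rintro x hx (a | a) hen hn
    · have hx' := ESS.par_conf.1 hx
      have hen' := (ESS.par_enables_l.1 hen).1
      have h0 : inl ⁻¹' ((parStrat σ τ).disp '' x) = σ.disp '' (inl ⁻¹' x) :=
        preimage_inl_image_map σ.disp τ.disp x
      rw [h0] at hen'
      obtain ⟨s, ⟨h1, h2⟩, h3⟩ := hσ.receptive _ hx'.1 a hen' hn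
      refine ⟨inl s, ⟨ESS.par_enables_l.2 ⟨h1, hx'.2⟩, congrArg inl h2⟩, ?_⟩
      rintro (t | t) ⟨h4, h5⟩
      · rw [h3 t ⟨(ESS.par_enables_l.1 h4).1, Sum.inl.inj h5⟩]
      · cases h5
    · have hx' := ESS.par_conf.1 hx
      have hen' := (ESS.par_enables_r.1 hen).1
      have h0 : inr ⁻¹' ((parStrat σ τ).disp '' x) = τ.disp '' (inr ⁻¹' x) :=
        preimage_inr_image_map σ.disp τ.disp x
      rw [h0] at hen'
      obtain ⟨s, ⟨h1, h2⟩, h3⟩ := hτ.receptive _ hx'.2 a hen' hn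
      refine ⟨inr s, ⟨ESS.par_enables_r.2 ⟨h1, hx'.1⟩, congrArg inr h2⟩, ?_⟩
      rintro (t | t) ⟨h4, h5⟩
      · cases h5
      · rw [h3 t ⟨(ESS.par_enables_r.1 h4).1, Sum.inr.inj h5⟩]
  pointed := by
    rintro (s | s)
    · obtain ⟨m, ⟨h1, h2⟩, h3⟩ := hσ.pointed s
      refine ⟨inl m, ⟨ESS.par_min_l.2 h1, ESS.par_le_ll.2 h2⟩, ?_⟩
      rintro (t | t) ⟨h4, h5⟩
      · rw [h3 t ⟨ESS.par_min_l.1 h4, ESS.par_le_ll.1 h5⟩]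
      · exact (ESS.par_le_rl.1 h5).elim
    · obtain ⟨m, ⟨h1, h2⟩, h3⟩ := hτ.pointed s
      refine ⟨inr m, ⟨ESS.par_min_r.2 h1, ESS.par_le_rr.2 h2⟩, ?_⟩
      rintro (t | t) ⟨h4, h5⟩
      · exact (ESS.par_le_lr.1 h5).elim
      · rw [h3 t ⟨ESS.par_min_r.1 h4, ESS.par_le_rr.1 h5⟩]

theorem thr_par {E F : ESS.{u}} {K : Set (E.par F).ev} {e : (E.par F).ev}
    (h : (E.par F).Thr K e) :
    (∃ K' e', E.Thr K' e' ∧ K = inl '' K' ∧ e = inl e') ∨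
      ∃ K' e', F.Thr K' e' ∧ K = inr '' K' ∧ e = inr e' := by
  induction h with
  | @base m hm =>
    rcases m with m | m
    · exact Or.inl ⟨{m}, m, .base (ESS.par_min_l.1 hm), by simp, rfl⟩
    · exact Or.inr ⟨{m}, m, .base (ESS.par_min_r.1 hm), by simp, rfl⟩
  | @step K e e' _ hi ih =>
    rcases ih with ⟨K', d, h1, rfl, rfl⟩ | ⟨K', d, h1, rfl, rfl⟩
    · rcases e' with e' | e'
      · exact Or.inl ⟨_, _, h1.step (ESS.par_imm_ll.1 hi), by simp [Set.image_insert_eq], rfl⟩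
      · exact (ESS.par_imm_lr.1 hi).elim
    · rcases e' with e' | e'
      · exact (ESS.par_imm_rl.1 hi).elim
      · exact Or.inr ⟨_, _, h1.step (ESS.par_imm_rr.1 hi), by simp [Set.image_insert_eq], rfl⟩

theorem IsVisible.thr {G : Game.{u}} {σ : PreStrat G} (h : IsVisible σ) {K e}
    (hK : σ.Thr K e) : σ.disp '' K ∈ G.Conf := by
  obtain ⟨s, l, h1, h2, rfl, -⟩ := hK.exists_list
  exact h s l h1 h2

theorem isVisible_of_thr {G : Game.{u}} {σ : PreStrat G}
    (h : ∀ K e, σ.Thr K e → σ.disp '' K ∈ G.Conf) : IsVisible σ :=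
  fun _ l hs hl => h _ _ (.of_list hs l hl)

theorem IsVisible.par (h : IsVisible σ)
    (h' : IsVisible τ) : IsVisible (parStrat σ τ) := by
  refine isVisible_of_thr fun K e hK => ?_
  rcases thr_par hK with ⟨K', e', h1, rfl, rfl⟩ | ⟨K', e', h1, rfl, rfl⟩
  · refine ESS.par_conf.2 ⟨?_, ?_⟩
    · convert h.thr h1 using 1
      ext; simp [parStrat]
    · convert ESS.empty_conf (E := H.toESS) using 1
      ext; simp [parStrat]
  · refine ESS.par_conf.2 ⟨?_, ?_⟩
    · convert ESS.empty_conf (E := G.toESS) using 1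
      ext; simp [parStrat]
    · convert h'.thr h1 using 1
      ext; simp [parStrat]

end ParStrat

/-! ## General facts on strategies -/

namespace IsPointedStrategy

variable {G : Game.{u}} {σ : PreStrat G}

/-- The display reflects causality within a configuration. -/
theorem le_of_disp_le (hσ : IsPointedStrategy σ) {x : Set σ.ev} (hx : x ∈ σ.Conf) {s t : σ.ev}
    (hs : s ∈ x) (ht : t ∈ x) (h : G.le (σ.disp s) (σ.disp t)) : σ.le s t := by
  have h1 := hσ.rule_abiding _ (hσ.isES.down_conf t)
  obtain ⟨s', hs', h2⟩ := h1.2.1 _ ⟨t, hσ.isES.le_refl t, rfl⟩ _ h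
  have h3 : s' ∈ x := hx.2.1 t ht s' hs'
  rw [← hσ.locally_injective x hx h3 hs h2]
  exact hs'

theorem lt_of_disp_lt (hσ : IsPointedStrategy σ) {x : Set σ.ev} (hx : x ∈ σ.Conf) {s t : σ.ev}
    (hs : s ∈ x) (ht : t ∈ x) (h : G.lt (σ.disp s) (σ.disp t)) : σ.lt s t :=
  ⟨hσ.le_of_disp_le hx hs ht h.1, by rintro rfl; exact h.2 rfl⟩

/-- A cause in the game of the display of an event is displayed by a cause of this event. -/
theorem exists_lt_of_disp (hσ : IsPointedStrategy σ) {t : σ.ev} {a : G.ev}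
    (h : G.lt a (σ.disp t)) : ∃ s, σ.lt s t ∧ σ.disp s = a := by
  obtain ⟨s, hs, h2⟩ := (hσ.rule_abiding _ (hσ.isES.down_conf t)).2.1 _ ⟨t, hσ.isES.le_refl t, rfl⟩
    _ h.1
  exact ⟨s, ⟨hs, by rintro rfl; exact h.2 h2.symm⟩, h2⟩

/-- The causes of a negative event go through its cause in the game. -/
theorem exists_imm_of_neg (hσ : IsPointedStrategy σ) {v m : σ.ev} (h : σ.lt v m)
    (hm : G.pol (σ.disp m) = Pol.neg) :
    ∃ j, σ.le v j ∧ σ.imm j m ∧ G.imm (σ.disp j) (σ.disp m) := by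
  obtain ⟨j, h1, h2⟩ := hσ.isES.exists_imm h
  exact ⟨j, h1, h2, hσ.courteous j m h2 (Or.inr hm)⟩

/-- In a visible strategy, the cause in the game of an event is comparable with all its causes. -/
theorem comparable (hσ : IsPointedStrategy σ) (hv : IsVisible σ) {v m j : σ.ev}
    (h : σ.le v m) (hj : σ.le j m) (hjm : G.le (σ.disp j) (σ.disp m)) :
    σ.le v j ∨ σ.le j v := by
  obtain ⟨K, hK, hvK⟩ := hσ.isES.exists_thr h
  obtain ⟨j', hj', h1⟩ := (hv.thr hK).2.1 _ ⟨m, hK.last_mem, rfl⟩ _ hjm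
  have h2 : j' = j := hσ.locally_injective _ (hσ.isES.down_conf m)
    (hK.le_last hσ.isES _ hj') hj h1
  exact hK.total hσ.isES _ hvK _ (h2 ▸ hj')

end IsPointedStrategy

/-! ## Games without the conditions on roots -/

/-- The axioms of arenas that are stable under duality and parallel composition and bear on
causality and full symmetries only. -/
structure IsPreArena (G : Game.{u}) : Prop where
  isES : G.IsES
  isoFamily : IsIsoFamily G.toESS G.sym
  sym_pol : ∀ θ ∈ G.sym, ∀ p ∈ θ, G.pol p.1 = G.pol p.2
  sym_lam : ∀ θ ∈ G.sym, ∀ p ∈ θ, G.lam p.1 = G.lam p.2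
  alternating : ∀ a a', G.imm a a' → G.pol a ≠ G.pol a'
  forestial : ∀ a₁ a₂ a, G.le a₁ a → G.le a₂ a → G.le a₁ a₂ ∨ G.le a₂ a₁

theorem Pol.flip_inj {p q : Pol} : p.flip = q.flip ↔ p = q := by cases p <;> cases q <;> simp [flip]

theorem Pol.eq_pos {p : Pol} : p = .pos ↔ p ≠ .neg := by cases p <;> simp

theorem Pol.eq_neg {p : Pol} : p = .neg ↔ p ≠ .pos := by cases p <;> simp

theorem Pol.flip_eq_neg {p : Pol} : p.flip = .neg ↔ p = .pos := by cases p <;> simp [flip]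

theorem Pol.flip_eq_pos {p : Pol} : p.flip = .pos ↔ p = .neg := by cases p <;> simp [flip]

theorem Pol.flip_ne (p : Pol) : p.flip ≠ p := by cases p <;> simp [flip]

theorem IsArena.pre {A : Game.{u}} (h : IsArena A) : IsPreArena A :=
  ⟨h.isES, h.isoFamily, h.sym_pol, h.sym_lam, h.alternating, h.forestial⟩

theorem IsPreArena.dual {A : Game.{u}} (h : IsPreArena A) : IsPreArena A.dual :=
  ⟨h.isES, h.isoFamily, fun θ hθ p hp => congrArg Pol.flip (h.sym_pol θ hθ p hp), h.sym_lam,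
    fun a a' hi hp => h.alternating a a' hi (Pol.flip_inj.1 hp), h.forestial⟩

theorem IsPreArena.par {A B : Game.{u}} (hA : IsPreArena A) (hB : IsPreArena B) :
    IsPreArena (A.par B) where
  isES := hA.isES.par hB.isES
  isoFamily := hA.isoFamily.par hB.isoFamily
  sym_pol := by
    rintro _ ⟨θ, hθ, θ', hθ', rfl⟩ ⟨a | a, b | b⟩ hp
    · exact hA.sym_pol θ hθ (a, b) (mem_parRel_ll.1 hp)
    · exact (mem_parRel_lr.1 hp).elim
    · exact (mem_parRel_rl.1 hp).elim
    · exact hB.sym_pol θ' hθ' (a, b) (mem_parRel_rr.1 hp)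
  sym_lam := by
    rintro _ ⟨θ, hθ, θ', hθ', rfl⟩ ⟨a | a, b | b⟩ hp
    · exact hA.sym_lam θ hθ (a, b) (mem_parRel_ll.1 hp)
    · exact (mem_parRel_lr.1 hp).elim
    · exact (mem_parRel_rl.1 hp).elim
    · exact hB.sym_lam θ' hθ' (a, b) (mem_parRel_rr.1 hp)
  alternating := by
    rintro (a | a) (b | b) h
    · exact hA.alternating a b (ESS.par_imm_ll.1 h)
    · exact (ESS.par_imm_lr.1 h).elim
    · exact (ESS.par_imm_rl.1 h).elim
    · exact hB.alternating a b (ESS.par_imm_rr.1 h)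
  forestial := by
    rintro _ _ _ (h | h) h'
    · rcases h' with h' | h'
      exact (hA.forestial _ _ _ h h').imp Sum.LiftRel.inl Sum.LiftRel.inl
    · rcases h' with _ | h'
      exact (hB.forestial _ _ _ h h').imp Sum.LiftRel.inr Sum.LiftRel.inr

theorem IsPreArena.imm_unique {G : Game.{u}} (h : IsPreArena G) {a b c : G.ev}
    (ha : G.imm a c) (hb : G.imm b c) : a = b := by
  by_contra hne
  rcases h.forestial a b c ha.1.1 hb.1.1 with hab | hab
  · exact ha.2 b ⟨⟨hab, hne⟩, hb.1⟩
  · exact hb.2 a ⟨⟨hab, fun h => hne h.symm⟩, ha.1⟩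

theorem NegArena.preArena (A : NegArena.{u}) : IsPreArena A.toGame := A.isArena.pre

theorem IsPreArena.hom {A B : Game.{u}} (hA : IsPreArena A) (hB : IsPreArena B) :
    IsPreArena (A.hom B) := hA.dual.par hB

theorem NegArena.hom_preArena (A B : NegArena.{u}) : IsPreArena (A.hom B.toGame) :=
  A.preArena.hom B.preArena

/-! ## The interaction game -/

/-- The game on which an interaction takes place, with two copies of the middle arena. -/
abbrev mid (A B C : Game.{u}) : Game.{u} := (A.hom B).par (B.hom C)

abbrev arenaMid (A B C : NegArena.{u}) : Game.{u} := mid A.toGame B.toGame C.toGame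

theorem mid_preArena (A B C : NegArena.{u}) : IsPreArena (arenaMid A B C) :=
  (A.hom_preArena B).par (B.hom_preArena C)

section Mid

variable {A B C : Game.{u}}

/-- Events of one of the two copies of the middle arena. -/
def Hid : (mid A B C).ev → Prop
  | .inl (.inr _) => True
  | .inr (.inl _) => True
  | _ => False

/-- Events of the two copies of the middle arena matched by `K`. -/
inductive Mir (K : Set (B.ev × B.ev)) : (mid A B C).ev → (mid A B C).ev → Prop
  | lr {b b' : B.ev} : (b, b') ∈ K → Mir K (inl (inr b)) (inr (inl b'))
  | rl {b b' : B.ev} : (b, b') ∈ K → Mir K (inr (inl b')) (inl (inr b))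

/-- The properties of symmetries, and of the identity, that make them suitable for matching. -/
structure IsMirror (B : Game.{u}) (K : Set (B.ev × B.ev)) : Prop where
  inj₁ : ∀ a b b', (a, b) ∈ K → (a, b') ∈ K → b = b'
  inj₂ : ∀ a a' b, (a, b) ∈ K → (a', b) ∈ K → a = a'
  pol : ∀ a b, (a, b) ∈ K → B.pol a = B.pol b
  imm₁ : ∀ a b c, (a, b) ∈ K → B.imm c a → ∃ d, (c, d) ∈ K ∧ B.imm d b
  imm₂ : ∀ a b d, (a, b) ∈ K → B.imm d b → ∃ c, (c, d) ∈ K ∧ B.imm c a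

theorem isMirror_diag (B : Game.{u}) : IsMirror B (Set.diagonal B.ev) := by
  constructor
  · intro a b b' h h'; exact h.symm.trans h'
  · intro a a' b h h'; exact h.trans h'.symm
  · intro a b h; exact congrArg B.pol h
  · intro a b c h hc; obtain rfl : a = b := h; exact ⟨c, rfl, hc⟩
  · intro a b c h hc; obtain rfl : a = b := h; exact ⟨c, rfl, hc⟩

theorem IsPreArena.isMirror (hB : IsPreArena B) {θ : Set (B.ev × B.ev)} (hθ : θ ∈ B.sym) :
    IsMirror B θ := by
  refine ⟨fun _ _ _ => (hB.isoFamily.bij _ hθ).inj₁, fun _ _ _ => (hB.isoFamily.bij _ hθ).inj₂,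
    fun a b h => hB.sym_pol θ hθ _ h, ?_, ?_⟩
  · intro a b c hab hca
    obtain ⟨d, hd⟩ := mem_gdom.1
      ((hB.isoFamily.dom_conf hθ).2.1 a (mem_gdom.2 ⟨b, hab⟩) c hca.1.1)
    exact ⟨d, hd, hB.isoFamily.imm_of_imm hB.isES hθ hd hab hca⟩
  · intro a b d hab hdb
    obtain ⟨c, hc⟩ := mem_gcod.1
      ((hB.isoFamily.cod_conf hθ).2.1 b (mem_gcod.2 ⟨a, hab⟩) d hdb.1.1)
    exact ⟨c, hc, (hB.isoFamily.imm_iff hB.isES hθ hc hab).2 hdb⟩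

theorem ESS.par_imm_cases {E F : ESS.{u}} {g h : (E.par F).ev} (hi : (E.par F).imm g h) :
    (∃ a b, g = inl a ∧ h = inl b ∧ E.imm a b) ∨
      ∃ a b, g = inr a ∧ h = inr b ∧ F.imm a b := by
  rcases g with a | a <;> rcases h with b | b
  · exact Or.inl ⟨a, b, rfl, rfl, ESS.par_imm_ll.1 hi⟩
  · exact (ESS.par_imm_lr.1 hi).elim
  · exact (ESS.par_imm_rl.1 hi).elim
  · exact Or.inr ⟨a, b, rfl, rfl, ESS.par_imm_rr.1 hi⟩

theorem mid_imm_left {g : (mid A B C).ev} {b : B.ev}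
    (hi : (mid A B C).imm g (inl (inr b))) :
    ∃ c, g = inl (inr c) ∧ B.imm c b := by
  rcases ESS.par_imm_cases hi with ⟨g, h, rfl, h1, hi⟩ | ⟨g, h, rfl, h1, hi⟩ <;> cases h1
  rcases ESS.par_imm_cases hi with ⟨g, h, rfl, h1, hi⟩ | ⟨g, h, rfl, h1, hi⟩ <;> cases h1
  exact ⟨_, rfl, hi⟩

theorem mid_imm_right {g : (mid A B C).ev} {b : B.ev}
    (hi : (mid A B C).imm g (inr (inl b))) :
    ∃ c, g = inr (inl c) ∧ B.imm c b := by
  rcases ESS.par_imm_cases hi with ⟨g, h, rfl, h1, hi⟩ | ⟨g, h, rfl, h1, hi⟩ <;> cases h1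
  rcases ESS.par_imm_cases hi with ⟨g, h, rfl, h1, hi⟩ | ⟨g, h, rfl, h1, hi⟩ <;> cases h1
  exact ⟨_, rfl, hi⟩

namespace Mir

variable {K : Set (B.ev × B.ev)} {g h g' h' : (mid A B C).ev}

theorem symm (hm : Mir K g h) : Mir K h g := by
  cases hm with
  | lr h => exact .rl h
  | rl h => exact .lr h

theorem hid (hm : Mir K g h) : Hid g := by cases hm <;> trivial

theorem hid' (hm : Mir K g h) : Hid h := hm.symm.hid

theorem unique (hK : IsMirror B K) (h₁ : Mir K g h) (h₂ : Mir K g h') : h = h' := by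
  cases h₁ with
  | lr h₁ => cases h₂ with | lr h₂ => rw [hK.inj₁ _ _ _ h₁ h₂]
  | rl h₁ => cases h₂ with | rl h₂ => rw [hK.inj₂ _ _ _ h₁ h₂]

theorem pol_eq (hK : IsMirror B K) (h₁ : Mir K g h) :
    (mid A B C).pol g = ((mid A B C).pol h).flip := by
  cases h₁ with
  | @lr b b' h₁ =>
    change B.pol b = (B.pol b').flip.flip
    rw [hK.pol _ _ h₁]; cases B.pol b' <;> rfl
  | @rl b b' h₁ =>
    change (B.pol b').flip = (B.pol b).flip
    rw [hK.pol _ _ h₁]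

theorem exists_imm (hK : IsMirror B K) (h₁ : Mir K g h) (hi : (mid A B C).imm g' g) :
    ∃ h', Mir K g' h' ∧ (mid A B C).imm h' h := by
  cases h₁ with
  | lr h₁ =>
    obtain ⟨c, rfl, hc⟩ := mid_imm_left hi
    obtain ⟨d, hd, hdb⟩ := hK.imm₁ _ _ _ h₁ hc
    exact ⟨_, .lr hd, ESS.par_imm_rr.2 (ESS.par_imm_ll.2 hdb)⟩
  | rl h₁ =>
    obtain ⟨c, rfl, hc⟩ := mid_imm_right hi
    obtain ⟨d, hd, hdb⟩ := hK.imm₂ _ _ _ h₁ hc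
    exact ⟨_, .rl hd, ESS.par_imm_ll.2 (ESS.par_imm_rr.2 hdb)⟩

end Mir

theorem hid_of_imm {g h : (mid A B C).ev} (hi : (mid A B C).imm g h) : Hid g ↔ Hid h := by
  rcases ESS.par_imm_cases hi with ⟨g, h, rfl, rfl, hi'⟩ | ⟨g, h, rfl, rfl, hi'⟩ <;>
  rcases ESS.par_imm_cases hi' with ⟨g, h, rfl, rfl, -⟩ | ⟨g, h, rfl, rfl, -⟩ <;> simp [Hid]

theorem mir_diag_exists {g : (mid A B C).ev} (hg : Hid g) :
    ∃ h, Mir (Set.diagonal B.ev) g h := by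
  rcases g with (a | b) | (b | c)
  · exact hg.elim
  · exact ⟨_, .lr rfl⟩
  · exact ⟨_, .rl rfl⟩
  · exact hg.elim

end Mid

/-! ## States of the interaction and their securing -/

section States

variable {A B C : NegArena.{u}} (R : PreStrat (arenaMid A B C))

/-- Configurations of the two strategies whose displays on the middle arena are matched by `K`. -/
structure State (K : Set (B.ev × B.ev)) (x : Set R.ev) : Prop where
  conf : x ∈ R.Conf
  mir : ∀ m ∈ x, Hid (R.disp m) → ∃ m' ∈ x, Mir K (R.disp m) (R.disp m')

/-- A rank function on a state, witnessing the absence of deadlocks. -/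
structure IsRank (K : Set (B.ev × B.ev)) (x : Set R.ev) (r : R.ev → ℕ) : Prop where
  lt : ∀ m ∈ x, ∀ n ∈ x, R.lt m n → r m < r n
  mir : ∀ m ∈ x, ∀ n ∈ x, Mir K (R.disp m) (R.disp n) → r m = r n

variable {R} {K : Set (B.ev × B.ev)} {x y w : Set R.ev} {r : R.ev → ℕ}

theorem IsPointedStrategy.mir_unique (hR : IsPointedStrategy R) (hK : IsMirror B.toGame K)
    (hx : x ∈ R.Conf) {m n n' : R.ev} (hn : n ∈ x) (hn' : n' ∈ x)
    (h : Mir K (R.disp m) (R.disp n)) (h' : Mir K (R.disp m) (R.disp n')) : n = n' :=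
  hR.locally_injective x hx hn hn' (h.unique hK h')

theorem State.extend_rank (hR : IsPointedStrategy R) (hK : IsMirror B.toGame K) (hx : State R K x)
    (hyx : y ⊆ x) (hy : State R K y) (hr : IsRank R K y r) (hwx : w ⊆ x) (hdis : ∀ m ∈ w, m ∉ y)
    (hpre : ∀ m ∈ w, ∀ n, R.lt n m → n ∈ y)
    (hmir : ∀ m ∈ w, Hid (R.disp m) → ∃ m' ∈ w, Mir K (R.disp m) (R.disp m')) :
    State R K (y ∪ w) ∧ ∃ r', IsRank R K (y ∪ w) r' := by
  classical
  refine ⟨⟨ESS.conf_of_subset hx.conf (Set.union_subset hyx hwx) ?_, ?_⟩, ?_⟩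
  · rintro e (he | he) e' hl
    · exact Or.inl (hy.conf.2.1 e he e' hl.1)
    · exact Or.inl (hpre e he e' hl)
  · rintro m (hm | hm) hh
    · obtain ⟨m', h1, h2⟩ := hy.mir m hm hh
      exact ⟨m', Or.inl h1, h2⟩
    · obtain ⟨m', h1, h2⟩ := hmir m hm hh
      exact ⟨m', Or.inr h1, h2⟩
  · obtain ⟨N, hN⟩ := (hy.conf.1.image r).bddAbove
    have hN' : ∀ m ∈ y, r m < N + 1 := fun m hm => Nat.lt_succ_of_le (hN ⟨m, hm, rfl⟩)
    have key : ∀ m ∈ y, ∀ n ∈ w, ¬ Mir K (R.disp m) (R.disp n) := by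
      intro m hm n hn h
      obtain ⟨n', h1, h2⟩ := hy.mir m hm h.hid
      rw [← hR.mir_unique hK hx.conf (hwx hn) (hyx h1) h h2] at h1
      exact hdis n hn h1
    refine ⟨fun m => if m ∈ y then r m else N + 1, ?_, ?_⟩
    · rintro m hm n (hn | hn) hl
      · have hm' : m ∈ y := hy.conf.2.1 n hn m hl.1
        simpa [hm', hn] using hr.lt m hm' n hn hl
      · have hm' : m ∈ y := hpre n hn m hl
        simpa [hm', hdis n hn] using hN' m hm'
    · rintro m (hm | hm) n (hn | hn) h
      · simpa [hm, hn] using hr.mir m hm n hn h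
      · exact (key m hm n hn h).elim
      · exact (key n hn m hm h.symm).elim
      · simp [hdis m hm, hdis n hn]

theorem hid_neg_min {g : (arenaMid A B C).ev} (hg : Hid g)
    (hmin : ∀ g', ¬ (arenaMid A B C).imm g' g)
    (hneg : (arenaMid A B C).pol g = Pol.neg) :
    ∃ b, g = inl (inr b) := by
  rcases g with (a | b) | (b | c)
  · exact hg.elim
  · exact ⟨b, rfl⟩
  · exfalso
    have hb : B.IsMinEv b := by
      by_contra hb
      obtain ⟨c, hc⟩ := B.preArena.isES.exists_imm_of_not_min hb
      exact hmin (inr (inl c)) (ESS.par_imm_rr.2 (ESS.par_imm_ll.2 hc))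
    have h1 : (B.pol b).flip = Pol.neg := hneg
    rw [B.negative b hb] at h1
    cases h1
  · exact hg.elim

/-- A negative event of the right copy of the middle arena is not minimal. -/
theorem exists_imm_right {g h : (arenaMid A B C).ev} {b : B.ev} (hg : Hid g)
    (hneg : (arenaMid A B C).pol g = Pol.neg)
    (hh : Mir K (inl (inr b)) h) (hgh : g.isLeft = h.isLeft) :
    ∃ g', (arenaMid A B C).imm g' g := by
  by_contra hc
  push Not at hc
  obtain ⟨b', rfl⟩ := hid_neg_min hg hc hneg
  cases hh
  simp at hgh

/-- Interactions between visible strategies do not deadlock. -/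
theorem State.exists_rank (hR : IsPointedStrategy R) (hv' : IsVisible R)
    (hside : ∀ m n, R.le m n → (R.disp m).isLeft = (R.disp n).isLeft)
    (hK : IsMirror B.toGame K) (hx : State R K x) : ∃ r, IsRank R K x r := by
  have hE := hR.isES
  have hG := mid_preArena A B C
  have hTfin : {y | y ⊆ x ∧ State R K y ∧ ∃ r, IsRank R K y r}.Finite :=
    hx.conf.1.finite_subsets.subset fun y hy => hy.1
  obtain ⟨y, ⟨hyx, hy, r, hr⟩, hmax⟩ := Set.exists_max_image _ Set.ncard hTfin
    ⟨∅, Set.empty_subset _, ⟨ESS.empty_conf, fun _ h => h.elim⟩, fun _ => 0,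
      fun _ h => h.elim, fun _ h => h.elim⟩
  by_cases hne : ∃ u ∈ x, u ∉ y
  swap
  · push Not at hne
    rw [show x = y from subset_antisymm hne hyx]
    exact ⟨r, hr⟩
  exfalso
  have hstuck : ∀ w : Set R.ev, w.Nonempty → w ⊆ x → (∀ m ∈ w, m ∉ y) →
      (∀ m ∈ w, ∀ n, R.lt n m → n ∈ y) →
      ¬ ∀ m ∈ w, Hid (R.disp m) → ∃ m' ∈ w, Mir K (R.disp m) (R.disp m') := by
    intro w ⟨m, hm⟩ hwx hdis hpre hmir
    have h1 := hx.extend_rank hR hK hyx hy hr hwx hdis hpre hmir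
    have h2 := hmax _ ⟨Set.union_subset hyx hwx, h1⟩
    refine absurd h2 (not_le.2 (Set.ncard_lt_ncard (Set.ssubset_iff_exists.2
      ⟨Set.subset_union_left, m, Or.inr hm, hdis m hm⟩) h1.1.conf.1))
  let Mn : Set R.ev := {u | u ∈ x ∧ u ∉ y ∧ ∀ v, R.lt v u → v ∈ y}
  have hMnBelow : ∀ u ∈ x, u ∉ y → ∃ v ∈ Mn, R.le v u := by
    intro u hu huy
    obtain ⟨v, hv, hvx, hmin⟩ := hE.exists_minimal (x := R.down u)
      (fun v => v ∈ x ∧ v ∉ y) ⟨u, hE.le_refl u, hu, huy⟩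
    refine ⟨v, ⟨hvx.1, hvx.2, fun w hw => ?_⟩, hv⟩
    by_contra hwy
    exact hmin w (hE.le_trans _ _ _ hw.1 hv) hw ⟨hx.conf.2.1 v hvx.1 w hw.1, hwy⟩
  have hMnHid : ∀ u ∈ Mn, Hid (R.disp u) := by
    intro u hu
    by_contra hh
    refine hstuck {u} ⟨u, rfl⟩ (by simpa using hu.1) (by simpa using hu.2.1)
      (by simpa using hu.2.2) ?_
    rintro m rfl hm
    exact (hh hm).elim
  have hMnMir : ∀ u ∈ Mn, ∀ u' ∈ x, Mir K (R.disp u) (R.disp u') →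
      u' ∉ y ∧ ∃ v ∈ Mn, R.lt v u' := by
    intro u hu u' hu' hm
    have huy : u' ∉ y := by
      intro h
      obtain ⟨u'', h1, h2⟩ := hy.mir u' h hm.hid'
      rw [hR.mir_unique hK hx.conf (hyx h1) hu.1 h2 hm.symm] at h1
      exact hu.2.1 h1
    refine ⟨huy, ?_⟩
    obtain ⟨v, hv, hvu⟩ := hMnBelow u' hu' huy
    refine ⟨v, hv, hvu, ?_⟩
    rintro rfl
    refine hstuck {u, v} ⟨u, Or.inl rfl⟩ ?_ ?_ ?_ ?_
    · rintro m (rfl | rfl)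
      exacts [hu.1, hu']
    · rintro m (rfl | rfl)
      exacts [hu.2.1, huy]
    · rintro m (rfl | rfl)
      exacts [hu.2.2, hv.2.2]
    · rintro m (rfl | rfl) _
      exacts [⟨v, Or.inr rfl, hm⟩, ⟨u, Or.inl rfl, hm.symm⟩]
  have hMnNeg : ∀ u ∈ Mn, (arenaMid A B C).pol (R.disp u) = Pol.neg := by
    intro u hu
    by_contra hpos
    obtain ⟨u', hu', hm⟩ := hx.mir u hu.1 (hMnHid u hu)
    obtain ⟨huy, v, hv, hvu⟩ := hMnMir u hu u' hu' hm
    have hneg : (arenaMid A B C).pol (R.disp u') = Pol.neg := by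
      rw [hm.symm.pol_eq hK, Pol.flip_eq_neg, Pol.eq_pos]
      exact hpos
    obtain ⟨j, hvj, hju, hj⟩ := hR.exists_imm_of_neg hvu hneg
    obtain ⟨g, hg, hgi⟩ := hm.symm.exists_imm hK hj
    obtain ⟨k, hk, rfl⟩ := hR.exists_lt_of_disp hgi.1
    obtain ⟨j', hj', hjm⟩ := hy.mir k (hu.2.2 k hk) hg.hid'
    rw [hR.mir_unique hK hx.conf (hyx hj') (hx.conf.2.1 u' hu' j hju.1.1) hjm hg.symm] at hj'
    exact hv.2.1 (hy.conf.2.1 j hj' v hvj)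
  classical
  let h : R.ev → ℕ := fun u => if H : ∃ j ∈ y, (arenaMid A B C).imm
    (R.disp j) (R.disp u) then r H.choose + 1 else 0
  have hval : ∀ u j, j ∈ y → (arenaMid A B C).imm (R.disp j) (R.disp u) →
      h u = r j + 1 := by
    intro u j hj hi
    have H : ∃ j ∈ y, (arenaMid A B C).imm (R.disp j) (R.disp u) :=
      ⟨j, hj, hi⟩
    have h1 : H.choose = j := hR.locally_injective y hy.conf H.choose_spec.1 hj
      (hG.imm_unique H.choose_spec.2 hi)
    simp only [h, dif_pos H, h1]
  obtain ⟨u₀, hu₀, hu₀y⟩ := hne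
  obtain ⟨v₀, hv₀, -⟩ := hMnBelow u₀ hu₀ hu₀y
  obtain ⟨u, hu, humax⟩ := Set.exists_max_image Mn h (hx.conf.1.subset fun _ h => h.1) ⟨v₀, hv₀⟩
  obtain ⟨u', hu', hm⟩ := hx.mir u hu.1 (hMnHid u hu)
  obtain ⟨huy, v, hv, hvu⟩ := hMnMir u hu u' hu' hm
  have hpos : (arenaMid A B C).pol (R.disp u') = Pol.pos := by
    rw [hm.symm.pol_eq hK, hMnNeg u hu]; rfl
  refine absurd (humax v hv) (not_le.2 ?_)
  by_cases H : ∃ j ∈ y, (arenaMid A B C).imm (R.disp j) (R.disp u)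
  · obtain ⟨j, hj, hi⟩ := H
    obtain ⟨g, hg, hgi⟩ := hm.exists_imm hK hi
    obtain ⟨k, hk, rfl⟩ := hR.exists_lt_of_disp hgi.1
    have hky : k ∈ y := by
      obtain ⟨j', hj', hjm⟩ := hy.mir j hj hg.hid
      rwa [hR.mir_unique hK hx.conf (hyx hj') (hx.conf.2.1 u' hu' k hk.1) hjm hg] at hj'
    have hkv : R.le k v := by
      rcases hR.comparable hv' hvu.1 hk.1 hgi.1.1 with h1 | h1
      · exact (hv.2.1 (hy.conf.2.1 k hky v h1)).elim
      · exact h1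
    have hkv' : R.lt k v := ⟨hkv, by rintro rfl; exact hv.2.1 hky⟩
    obtain ⟨jv, h1, h2, h3⟩ := hR.exists_imm_of_neg hkv' (hMnNeg v hv)
    have hjv : jv ∈ y := hv.2.2 jv h2.1
    rw [hval u j hj hi, hval v jv hjv h3, hr.mir j hj k hky hg]
    have hne : k ≠ jv := by
      rintro rfl
      have h4 := hG.alternating _ _ hgi
      have h5 := hG.alternating _ _ h3
      rw [hMnNeg v hv] at h5
      rw [hpos] at h4
      exact h4 (Pol.eq_pos.2 h5)
    exact Nat.succ_lt_succ (hr.lt k hky jv hjv ⟨h1, hne⟩)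
  · have h0 : h u = 0 := dif_neg H
    have hnoimm : ∀ g', ¬ (arenaMid A B C).imm g' (R.disp u) := by
      intro g' hg'
      obtain ⟨k, hk, rfl⟩ := hR.exists_lt_of_disp hg'.1
      exact H ⟨k, hu.2.2 k hk, hg'⟩
    obtain ⟨b, hb⟩ := hid_neg_min (hMnHid u hu) hnoimm (hMnNeg u hu)
    rw [hb] at hm
    obtain ⟨g', hg'⟩ := exists_imm_right (hMnHid v hv) (hMnNeg v hv) hm (hside _ _ hvu.1)
    obtain ⟨k, hk, rfl⟩ := hR.exists_lt_of_disp hg'.1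
    rw [h0, hval v k (hv.2.2 k hk) hg']
    exact Nat.succ_pos _

end States

/-! ## Symmetries of the interaction -/

namespace IsIsoFamily

variable {E : ESS.{u}} {S : Set (Set (E.ev × E.ev))}

theorem gcomp_mem (h : IsIsoFamily E S) {θ P} (hθ : θ ∈ S) (hP : P ∈ S) (hsub : gdom P ⊆ gcod θ) :
    gcomp θ P ∈ S := by
  have h1 := h.comp_mem' (h.restrict_cod hθ (h.dom_conf hP) hsub) hP (gcod_restrict hsub)
  convert h1 using 1
  ext ⟨a, b⟩
  simp only [mem_gcomp, Set.mem_ofPred_eq]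
  exact ⟨fun ⟨e, h1, h2⟩ => ⟨e, ⟨h1, mem_gdom.2 ⟨b, h2⟩⟩, h2⟩, fun ⟨e, h1, h2⟩ => ⟨e, h1.1, h2⟩⟩

theorem enables_cod (h : IsIsoFamily E S) {θ a b} (hθ : θ ∈ S) (hi : insert (a, b) θ ∈ S)
    (ha : a ∉ gdom θ) : E.Enables (gcod θ) b := by
  refine ⟨h.cod_conf hθ, fun hb => ?_, by rw [← gcod_insert θ a b]; exact h.cod_conf hi⟩
  obtain ⟨c, hc⟩ := mem_gcod.1 hb
  have : c = a := (h.bij _ hi).inj₂ (Set.mem_insert_of_mem _ hc) (Set.mem_insert _ _)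
  exact ha (this ▸ mem_gdom.2 ⟨b, hc⟩)

end IsIsoFamily

theorem IsConfBij.restrict_insert {E : ESS.{u}} {θ : Set (E.ev × E.ev)} (h : IsConfBij E θ)
    {a b : E.ev} (hab : (a, b) ∈ θ) (z : Set E.ev) :
    {p ∈ θ | p.1 ∈ insert a z} = insert (a, b) {p ∈ θ | p.1 ∈ z} := by
  ext ⟨c, d⟩
  simp only [Set.mem_ofPred_eq, Set.mem_insert_iff, Prod.mk.injEq]
  constructor
  · rintro ⟨hcd, rfl | hc⟩
    · exact Or.inl ⟨rfl, h.inj₁ hcd hab⟩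
    · exact Or.inr ⟨hcd, hc⟩
  · rintro (⟨rfl, rfl⟩ | ⟨hcd, hc⟩)
    · exact ⟨hab, Or.inl rfl⟩
    · exact ⟨hcd, Or.inr hc⟩

/-- Strategies on the interaction game that are made of two visible strategies. -/
structure IsInter {A B C : NegArena.{u}} (R : PreStrat (arenaMid A B C)) :
    Prop where
  pointed : IsPointedStrategy R
  visible : IsVisible R
  side : ∀ m n, R.le m n → (R.disp m).isLeft = (R.disp n).isLeft

section Bal

variable {A B C : NegArena.{u}} {R : PreStrat (arenaMid A B C)}

theorem mid_sym_cases {φ} (hφ : φ ∈ (arenaMid A B C).sym) {g h} (hgh : (g, h) ∈ φ) :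
    (∃ a a', g = inl (inl a) ∧ h = inl (inl a')) ∨
    (∃ b b', g = inl (inr b) ∧ h = inl (inr b')) ∨
    (∃ b b', g = inr (inl b) ∧ h = inr (inl b')) ∨
    (∃ c c', g = inr (inr c) ∧ h = inr (inr c')) := by
  obtain ⟨_, ⟨P, -, Q, -, rfl⟩, _, ⟨P', -, Q', -, rfl⟩, rfl⟩ := hφ
  rcases g with (g | g) | (g | g) <;> rcases h with (h | h) | (h | h) <;> simp at hgh ⊢

theorem IsPointedStrategy.disp_mem (_hR : IsPointedStrategy R) {Θ : Set (R.ev × R.ev)} {m n : R.ev}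
    (h : (m, n) ∈ Θ) : (R.disp m, R.disp n) ∈ Prod.map R.disp R.disp '' Θ := ⟨_, h, rfl⟩

theorem IsPointedStrategy.hid_iff (hR : IsPointedStrategy R) {Θ} (hΘ : Θ ∈ R.sym) {m n : R.ev}
    (h : (m, n) ∈ Θ) : Hid (R.disp m) ↔ Hid (R.disp n) := by
  rcases mid_sym_cases (hR.sym_preserving Θ hΘ) (hR.disp_mem h) with
    ⟨_, _, h1, h2⟩ | ⟨_, _, h1, h2⟩ | ⟨_, _, h1, h2⟩ | ⟨_, _, h1, h2⟩ <;> rw [h1, h2] <;> simp [Hid]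

theorem IsPointedStrategy.pol_sym (hR : IsPointedStrategy R) {Θ} (hΘ : Θ ∈ R.sym) {m n : R.ev}
    (h : (m, n) ∈ Θ) : (arenaMid A B C).pol (R.disp m) =
      (arenaMid A B C).pol (R.disp n) :=
  (mid_preArena A B C).sym_pol _ (hR.sym_preserving Θ hΘ) _ (hR.disp_mem h)

variable (R) in
/-- Symmetries whose domain is matched by `K` and that send matched events to events matched by
the identity. -/
structure Bal (K : Set (B.ev × B.ev)) (Θ : Set (R.ev × R.ev)) : Prop where
  sym : Θ ∈ R.sym
  dom : State R K (gdom Θ)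
  mir : ∀ m n m' n', (m, n) ∈ Θ → (m', n') ∈ Θ → Mir K (R.disp m) (R.disp m') →
    Mir (Set.diagonal B.ev) (R.disp n) (R.disp n')

variable {K : Set (B.ev × B.ev)} {Θ Θ' : Set (R.ev × R.ev)}

theorem Bal.cod (hR : IsPointedStrategy R) (h : Bal R K Θ) :
    State R (Set.diagonal B.ev) (gcod Θ) := by
  refine ⟨hR.isoFamily.cod_conf h.sym, fun n hn hh => ?_⟩
  obtain ⟨m, hm⟩ := mem_gcod.1 hn
  obtain ⟨m', hm', hmir⟩ := h.dom.mir m (mem_gdom.2 ⟨n, hm⟩) ((hR.hid_iff h.sym hm).2 hh)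
  obtain ⟨n', hn'⟩ := mem_gdom.1 hm'
  exact ⟨n', mem_gcod.2 ⟨m', hn'⟩, h.mir _ _ _ _ hm hn' hmir⟩

theorem IsPointedStrategy.not_mem_disp (hR : IsPointedStrategy R) {m : R.ev}
    (hm : R.Enables (gdom Θ) m) (h) : (R.disp m, h) ∉ Prod.map R.disp R.disp '' Θ := by
  rintro ⟨⟨a, b⟩, hab, h1⟩
  have h2 : R.disp a = R.disp m := congrArg Prod.fst h1
  have h3 : a ∈ gdom Θ := mem_gdom.2 ⟨b, hab⟩
  rw [hR.locally_injective _ hm.2.2 (Or.inr h3) (Or.inl rfl) h2] at h3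
  exact hm.2.1 h3

/-- If one event of a matched pair is mapped, the mapping of the other one is prescribed. -/
theorem Bal.mirror_sym (hR : IsPointedStrategy R) (hB : Bal R K Θ) (hK : K ∈ B.sym) {m n m' : R.ev}
    {h' : (arenaMid A B C).ev}
    (hi : insert (m, n) Θ ∈ R.sym) (hm : Mir K (R.disp m) (R.disp m'))
    (hn : Mir (Set.diagonal B.ev) (R.disp n) h') :
    insert (R.disp m', h') (Prod.map R.disp R.disp '' insert (m, n) Θ) ∈
      (arenaMid A B C).sym := by
  have hKm := B.preArena.isMirror hK
  have hiso := B.preArena.isoFamily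
  have hdiag := isMirror_diag B.toGame
  obtain ⟨_, ⟨PA, hPA, PB, hPB, rfl⟩, _, ⟨PB', hPB', PC, hPC, rfl⟩, hφ⟩ := hR.sym_preserving _ hi
  have hmn := hR.disp_mem (Set.mem_insert (m, n) Θ)
  rw [hφ] at hmn ⊢
  have memL : ∀ c c', (c, c') ∈ PB ↔ ∃ p ∈ insert (m, n) Θ, R.disp p.1 = inl (inr c) ∧
      R.disp p.2 = inl (inr c') := by
    intro c c'
    have : (inl (inr c), inl (inr c')) ∈
      Prod.map R.disp R.disp '' insert (m, n) Θ ↔ (c, c') ∈ PB := by rw [hφ]; simp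
    rw [← this, Set.mem_image]
    simp only [Prod.map, Prod.mk.injEq]
  have memR : ∀ c c', (c, c') ∈ PB' ↔ ∃ p ∈ insert (m, n) Θ, R.disp p.1 = inr (inl c) ∧
      R.disp p.2 = inr (inl c') := by
    intro c c'
    have : (inr (inl c), inr (inl c')) ∈
      Prod.map R.disp R.disp '' insert (m, n) Θ ↔ (c, c') ∈ PB' := by rw [hφ]; simp
    rw [← this, Set.mem_image]
    simp only [Prod.map, Prod.mk.injEq]
  have mirr : ∀ a a', (a, a') ∈ Θ → Hid (R.disp a) → ∃ c c', (c, c') ∈ Θ ∧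
      Mir K (R.disp a) (R.disp c) ∧ Mir (Set.diagonal B.ev) (R.disp a') (R.disp c') := by
    intro a a' haa hh
    obtain ⟨c, hc, hac⟩ := hB.dom.mir a (mem_gdom.2 ⟨a', haa⟩) hh
    obtain ⟨c', hc'⟩ := mem_gdom.1 hc
    exact ⟨c, c', hc', hac, hB.mir _ _ _ _ haa hc' hac⟩
  generalize hgm : R.disp m = gm at *
  generalize hgm' : R.disp m' = gm' at *
  generalize hgn : R.disp n = gn at *
  cases hm with
  | @lr b b' hbb' =>
    cases hn with
    | rl hn => simp at hmn
    | @lr b₂ b₂' hb₂ =>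
      obtain rfl : b₂ = b₂' := hb₂
      have hins : insert (b', b₂) PB' = gcomp (Prod.swap '' K) PB := by
        ext ⟨c', c₂⟩
        rw [mem_gcomp, Set.mem_insert_iff, Prod.mk.injEq]
        simp only [mem_swap]
        constructor
        · rintro (⟨rfl, rfl⟩ | h)
          · exact ⟨b, hbb', (memL _ _).2 ⟨(m, n), Set.mem_insert _ _, hgm, hgn⟩⟩
          · obtain ⟨⟨a, a'⟩, haa, h1, h2⟩ := (memR _ _).1 h
            rcases haa with haa | haa
            · obtain ⟨rfl, rfl⟩ := Prod.mk.inj haa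
              rw [hgm] at h1; cases h1
            · dsimp only at h1 h2
              obtain ⟨c, d, hcd, h3, h4⟩ := mirr a a' haa (by rw [h1]; trivial)
              rw [h1] at h3
              rw [h2] at h4
              generalize hc : R.disp c = gc at h3
              generalize hd : R.disp d = gd at h4
              cases h3 with
              | @rl e _ h3 => cases h4 with
                | rl h4 =>
                  rw [Set.mem_diagonal_iff] at h4
                  dsimp only at h4
                  subst h4
                  exact ⟨e, h3, (memL _ _).2 ⟨(c, d), Or.inr hcd, hc, hd⟩⟩
        · rintro ⟨e, h1, h2⟩
          obtain ⟨⟨a, a'⟩, haa, h3, h4⟩ := (memL _ _).1 h2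
          rcases haa with haa | haa
          · obtain ⟨rfl, rfl⟩ := Prod.mk.inj haa
            dsimp only at h3 h4
            rw [hgm] at h3; rw [hgn] at h4
            cases h3; cases h4
            exact Or.inl ⟨hKm.inj₁ _ _ _ h1 hbb', rfl⟩
          · dsimp only at h3 h4
            obtain ⟨c, d, hcd, h5, h6⟩ := mirr a a' haa (by rw [h3]; trivial)
            rw [h3] at h5
            rw [h4] at h6
            generalize hc : R.disp c = gc at h5
            generalize hd : R.disp d = gd at h6
            cases h5 with
            | @lr _ e' h5 => cases h6 with
              | lr h6 =>
                rw [Set.mem_diagonal_iff] at h6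
                dsimp only at h6
                subst h6
                rw [hKm.inj₁ _ _ _ h1 h5]
                exact Or.inr ((memR _ _).2 ⟨(c, d), Or.inr hcd, hc, hd⟩)
      have hsub : gdom PB ⊆ gcod (Prod.swap '' K) := by
        intro e he
        obtain ⟨e', he'⟩ := mem_gdom.1 he
        rw [gcod_swap]
        obtain ⟨⟨a, a'⟩, haa, h3, h4⟩ := (memL _ _).1 he'
        rcases haa with haa | haa
        · obtain ⟨rfl, rfl⟩ := Prod.mk.inj haa
          dsimp only at h3
          rw [hgm] at h3
          cases h3
          exact mem_gdom.2 ⟨_, hbb'⟩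
        · dsimp only at h3
          obtain ⟨c, d, hcd, h5, -⟩ := mirr a a' haa (by rw [h3]; trivial)
          rw [h3] at h5
          generalize hc : R.disp c = gc at h5
          cases h5 with
          | @lr _ e' h5 => exact mem_gdom.2 ⟨_, h5⟩
      rw [insert_inr_parRel, insert_inl_parRel, hins]
      exact parRel_mem_parFam.2 ⟨parRel_mem_parFam.2 ⟨hPA, hPB⟩, parRel_mem_parFam.2
        ⟨hiso.gcomp_mem (hiso.inv_mem _ hK) hPB hsub, hPC⟩⟩
  | @rl b b' hbb' =>
    cases hn with
    | lr hn => simp at hmn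
    | @rl b₂' b₂ hb₂ =>
      obtain rfl : b₂' = b₂ := hb₂
      have hins : insert (b, b₂') PB = gcomp K PB' := by
        ext ⟨c', c₂⟩
        rw [mem_gcomp, Set.mem_insert_iff, Prod.mk.injEq]
        constructor
        · rintro (⟨rfl, rfl⟩ | h)
          · exact ⟨b', hbb', (memR _ _).2 ⟨(m, n), Set.mem_insert _ _, hgm, hgn⟩⟩
          · obtain ⟨⟨a, a'⟩, haa, h1, h2⟩ := (memL _ _).1 h
            rcases haa with haa | haa
            · obtain ⟨rfl, rfl⟩ := Prod.mk.inj haa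
              rw [hgm] at h1; cases h1
            · dsimp only at h1 h2
              obtain ⟨c, d, hcd, h3, h4⟩ := mirr a a' haa (by rw [h1]; trivial)
              rw [h1] at h3
              rw [h2] at h4
              generalize hc : R.disp c = gc at h3
              generalize hd : R.disp d = gd at h4
              cases h3 with
              | @lr _ e h3 => cases h4 with
                | lr h4 =>
                  rw [Set.mem_diagonal_iff] at h4
                  dsimp only at h4
                  subst h4
                  exact ⟨e, h3, (memR _ _).2 ⟨(c, d), Or.inr hcd, hc, hd⟩⟩
        · rintro ⟨e, h1, h2⟩
          obtain ⟨⟨a, a'⟩, haa, h3, h4⟩ := (memR _ _).1 h2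
          rcases haa with haa | haa
          · obtain ⟨rfl, rfl⟩ := Prod.mk.inj haa
            dsimp only at h3 h4
            rw [hgm] at h3; rw [hgn] at h4
            cases h3; cases h4
            exact Or.inl ⟨hKm.inj₂ _ _ _ h1 hbb', rfl⟩
          · dsimp only at h3 h4
            obtain ⟨c, d, hcd, h5, h6⟩ := mirr a a' haa (by rw [h3]; trivial)
            rw [h3] at h5
            rw [h4] at h6
            generalize hc : R.disp c = gc at h5
            generalize hd : R.disp d = gd at h6
            cases h5 with
            | @rl e' _ h5 => cases h6 with
              | rl h6 =>
                rw [Set.mem_diagonal_iff] at h6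
                dsimp only at h6
                subst h6
                rw [hKm.inj₂ _ _ _ h1 h5]
                exact Or.inr ((memL _ _).2 ⟨(c, d), Or.inr hcd, hc, hd⟩)
      have hsub : gdom PB' ⊆ gcod K := by
        intro e he
        obtain ⟨e', he'⟩ := mem_gdom.1 he
        obtain ⟨⟨a, a'⟩, haa, h3, h4⟩ := (memR _ _).1 he'
        rcases haa with haa | haa
        · obtain ⟨rfl, rfl⟩ := Prod.mk.inj haa
          dsimp only at h3
          rw [hgm] at h3
          cases h3
          exact mem_gcod.2 ⟨_, hbb'⟩
        · dsimp only at h3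
          obtain ⟨c, d, hcd, h5, -⟩ := mirr a a' haa (by rw [h3]; trivial)
          rw [h3] at h5
          generalize hc : R.disp c = gc at h5
          cases h5 with
          | @rl e' _ h5 => exact mem_gcod.2 ⟨_, h5⟩
      rw [insert_inl_parRel, insert_inr_parRel, hins]
      exact parRel_mem_parFam.2 ⟨parRel_mem_parFam.2 ⟨hPA, hiso.gcomp_mem hK hPB' hsub⟩,
        parRel_mem_parFam.2 ⟨hPB', hPC⟩⟩

theorem Bal.step (hR : IsInter R) (hK : K ∈ B.sym) (hB : Bal R K Θ) {x : Set R.ev}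
    (hx : State R K x) (hsub : gdom Θ ⊆ x) (hne : ∃ a ∈ x, a ∉ gdom Θ) :
    ∃ Θ', Θ ⊆ Θ' ∧ Bal R K Θ' ∧ gdom Θ' ⊆ x ∧ gdom Θ ⊂ gdom Θ' := by
  have hKm := B.preArena.isMirror hK
  have hP := hR.pointed
  obtain ⟨r, hr⟩ := hx.exists_rank hP hR.visible hR.side hKm
  obtain ⟨m₀, ⟨hm₀, hm₀Θ⟩, hmin⟩ := Set.exists_min_image {a | a ∈ x ∧ a ∉ gdom Θ} r
    (hx.conf.1.subset fun _ h => h.1) hne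
  have hpre : ∀ m ∈ x, r m ≤ r m₀ → ∀ n, R.lt n m → n ∈ gdom Θ := by
    intro m hm hle n hn
    by_contra hc
    have hnx := hx.conf.2.1 m hm n hn.1
    exact absurd (hmin n ⟨hnx, hc⟩) (not_le.2 ((hr.lt n hnx m hm hn).trans_le hle))
  have hen : ∀ m ∈ x, m ∉ gdom Θ → r m ≤ r m₀ → R.Enables (gdom Θ) m :=
    fun m hm hmΘ hle => ESS.enables_of hB.dom.conf hx.conf hsub hm hmΘ (hpre m hm hle)
  have huni : ∀ m ∈ x, m ∉ gdom Θ → ∀ m' ∈ gdom Θ, ¬ Mir K (R.disp m') (R.disp m) := by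
    intro m hm hmΘ m' hm' h
    obtain ⟨m'', h1, h2⟩ := hB.dom.mir m' hm' h.hid
    rw [hP.mir_unique hKm hx.conf (hsub h1) hm h2 h] at h1
    exact hmΘ h1
  by_cases hh : Hid (R.disp m₀)
  swap
  · obtain ⟨n, hn⟩ := hP.isoFamily.extend_one hB.sym (hen m₀ hm₀ hm₀Θ le_rfl)
    refine ⟨_, Set.subset_insert _ _, ⟨hn, ⟨hP.isoFamily.dom_conf hn, ?_⟩, ?_⟩, ?_, ?_⟩
    · rw [gdom_insert]
      rintro a (rfl | ha) h
      · exact (hh h).elim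
      · obtain ⟨b, h1, h2⟩ := hB.dom.mir a ha h
        exact ⟨b, Or.inr h1, h2⟩
    · rintro a b a' b' (h1 | h1) (h2 | h2) h
      · cases h1; exact (hh h.hid).elim
      · cases h1; exact (hh h.hid).elim
      · cases h2; exact (hh h.hid').elim
      · exact hB.mir _ _ _ _ h1 h2 h
    · rw [gdom_insert]; exact Set.insert_subset hm₀ hsub
    · rw [gdom_insert]; exact Set.ssubset_insert hm₀Θ
  have hpair : ∃ m ∈ x, ∃ m' ∈ x, m ∉ gdom Θ ∧ m' ∉ gdom Θ ∧ r m ≤ r m₀ ∧ r m' ≤ r m₀ ∧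
      Mir K (R.disp m) (R.disp m') ∧
      (arenaMid A B C).pol (R.disp m') = Pol.neg := by
    obtain ⟨m', hm', h⟩ := hx.mir m₀ hm₀ hh
    have h1 : m' ∉ gdom Θ := fun h1 => huni m₀ hm₀ hm₀Θ m' h1 h.symm
    have h2 := hr.mir _ hm₀ _ hm' h
    by_cases hneg : (arenaMid A B C).pol (R.disp m') = Pol.neg
    · exact ⟨m₀, hm₀, m', hm', hm₀Θ, h1, le_rfl, h2.ge, h, hneg⟩
    · refine ⟨m', hm', m₀, hm₀, h1, hm₀Θ, h2.ge, le_rfl, h.symm, ?_⟩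
      rw [h.pol_eq hKm, Pol.flip_eq_neg]
      exact Pol.eq_pos.2 hneg
  obtain ⟨m, hm, m', hm', hmΘ, hm'Θ, hle, hle', hmir, hneg⟩ := hpair
  have hmm' : m' ≠ m := by
    rintro rfl
    have := hmir.pol_eq hKm
    exact Pol.flip_ne _ this.symm
  obtain ⟨n, hn⟩ := hP.isoFamily.extend_one hB.sym (hen m hm hmΘ hle)
  have hhn : Hid (R.disp n) := (hP.hid_iff hn (Set.mem_insert _ _)).1 hmir.hid
  obtain ⟨h', hh'⟩ := mir_diag_exists hhn
  have hpn : (arenaMid A B C).pol h' = Pol.neg := by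
    rw [hh'.symm.pol_eq (isMirror_diag _), ← hP.pol_sym hn (Set.mem_insert _ _),
      ← hmir.symm.pol_eq hKm, hneg]
  have hen' : R.Enables (gdom (insert (m, n) Θ)) m' := by
    rw [gdom_insert]
    refine ESS.enables_of (hen m hm hmΘ hle).2.2 hx.conf (Set.insert_subset hm hsub) hm' ?_
      fun e he => Or.inr (hpre m' hm' hle' e he)
    rintro (h | h)
    exacts [hmm' h, hm'Θ h]
  obtain ⟨n', ⟨⟨-, hn'⟩, hdn'⟩, -⟩ := hP.sim_receptive _ hn m' h' hen' hneg hpn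
    ⟨hP.not_mem_disp hen' _, hB.mirror_sym hP hK hn hmir hh'⟩
  have hmir' : Mir (Set.diagonal B.ev) (R.disp n) (R.disp n') := by rw [hdn']; exact hh'
  have hgd : gdom (insert (m', n') (insert (m, n) Θ)) = insert m' (insert m (gdom Θ)) := by
    rw [gdom_insert, gdom_insert]
  have hself : ∀ a, ¬ Mir K (R.disp a) (R.disp a) := fun a h =>
    Pol.flip_ne _ (h.pol_eq hKm).symm
  refine ⟨_, (Set.subset_insert _ _).trans (Set.subset_insert _ _),
    ⟨hn', ⟨hP.isoFamily.dom_conf hn', ?_⟩, ?_⟩, ?_, ?_⟩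
  · rw [hgd]
    rintro a (rfl | rfl | ha) h
    · exact ⟨m, Or.inr (Or.inl rfl), hmir.symm⟩
    · exact ⟨m', Or.inl rfl, hmir⟩
    · obtain ⟨b, h1, h2⟩ := hB.dom.mir a ha h
      exact ⟨b, Or.inr (Or.inr h1), h2⟩
  · rintro a b a' b' (h1 | h1 | h1) (h2 | h2 | h2) h
    · cases h1; cases h2; exact (hself _ h).elim
    · cases h1; cases h2; exact hmir'.symm
    · cases h1; exact (huni _ hm' hm'Θ a' (mem_gdom.2 ⟨_, h2⟩) h.symm).elim
    · cases h1; cases h2; exact hmir'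
    · cases h1; cases h2; exact (hself _ h).elim
    · cases h1; exact (huni _ hm hmΘ a' (mem_gdom.2 ⟨_, h2⟩) h.symm).elim
    · cases h2; exact (huni _ hm' hm'Θ a (mem_gdom.2 ⟨_, h1⟩) h).elim
    · cases h2; exact (huni _ hm hmΘ a (mem_gdom.2 ⟨_, h1⟩) h).elim
    · exact hB.mir _ _ _ _ h1 h2 h
  · rw [hgd]; exact Set.insert_subset hm' (Set.insert_subset hm hsub)
  · rw [hgd]
    exact Set.ssubset_iff_exists.2 ⟨(Set.subset_insert _ _).trans (Set.subset_insert _ _),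
      m', Or.inl rfl, hm'Θ⟩

/-- Balanced symmetries extend to all states containing their domain. -/
theorem Bal.extend (hR : IsInter R) (hK : K ∈ B.sym) (hB : Bal R K Θ) {x : Set R.ev}
    (hx : State R K x) (hsub : gdom Θ ⊆ x) : ∃ Θ', Θ ⊆ Θ' ∧ Bal R K Θ' ∧ gdom Θ' = x := by
  induction hn : (x \ gdom Θ).ncard using Nat.strong_induction_on generalizing Θ with
  | _ n ih =>
    by_cases hne : ∃ a ∈ x, a ∉ gdom Θ
    · obtain ⟨Θ₁, h1, h2, h3, h4⟩ := hB.step hR hK hx hsub hne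
      obtain ⟨a, ha, haΘ⟩ := Set.exists_of_ssubset h4
      obtain ⟨Θ', h5, h6, h7⟩ := ih _ (by
        rw [← hn]
        refine Set.ncard_lt_ncard (Set.ssubset_iff_exists.2 ⟨?_, a, ⟨h3 ha, haΘ⟩, fun h => h.2 ha⟩)
          hx.conf.1.sdiff
        exact fun e he => ⟨he.1, fun h => he.2 (h4.1 h)⟩) h2 h3 rfl
      exact ⟨Θ', h1.trans h5, h6, h7⟩
    · push Not at hne
      exact ⟨Θ, subset_rfl, hB, hsub.antisymm hne⟩

/-- Balanced symmetries with a given domain are determined by the images of the negative events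
outside of the middle arena. -/
theorem Bal.unique (hR : IsInter R) (hK : IsMirror B.toGame K) (hB : Bal R K Θ) (hB' : Bal R K Θ')
    (hdom : gdom Θ = gdom Θ')
    (hagree : ∀ m n n', (m, n) ∈ Θ → (m, n') ∈ Θ' → ¬ Hid (R.disp m) →
      (arenaMid A B C).pol (R.disp m) = Pol.neg → n = n') : Θ = Θ' := by
  have hP := hR.pointed
  obtain ⟨r, hr⟩ := hB.dom.exists_rank hP hR.visible hR.side hK
  have main : ∀ k m n n', r m = k → (m, n) ∈ Θ → (m, n') ∈ Θ' → n = n' := by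
    intro k
    induction k using Nat.strong_induction_on with
    | _ k ih =>
      have hz : {a ∈ gdom Θ | r a < k} ∈ R.Conf :=
        ESS.conf_of_subset hB.dom.conf (fun _ h => h.1) fun e he e' hl =>
          have h1 := hB.dom.conf.2.1 e he.1 e' hl.1
          ⟨h1, (hr.lt _ h1 _ he.1 hl).trans he.2⟩
      set z := {a ∈ gdom Θ | r a < k} with hzdef
      have hzz : {p ∈ Θ | p.1 ∈ z} = {p ∈ Θ' | p.1 ∈ z} := by
        ext ⟨a, b⟩
        constructor
        · rintro ⟨h1, h2⟩
          obtain ⟨b', hb'⟩ := mem_gdom.1 (hdom ▸ h2.1)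
          rw [ih _ h2.2 a b b' rfl h1 hb']
          exact ⟨hb', h2⟩
        · rintro ⟨h1, h2⟩
          obtain ⟨b', hb'⟩ := mem_gdom.1 h2.1
          rw [← ih _ h2.2 a b' b rfl hb' h1]
          exact ⟨hb', h2⟩
      have hzΘ : {p ∈ Θ | p.1 ∈ z} ∈ R.sym := hP.isoFamily.restrict _ hB.sym z hz fun _ h => h.1
      have hgz : gdom {p ∈ Θ | p.1 ∈ z} = z := gdom_restrict fun _ h => h.1
      have hen : ∀ m, m ∈ gdom Θ → r m = k → R.Enables z m := by
        rintro m hm hrm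
        refine ESS.enables_of hz hB.dom.conf (fun _ h => h.1) hm (fun h => h.2.ne hrm) ?_
        intro e he
        have h1 := hB.dom.conf.2.1 m hm e he.1
        exact ⟨h1, hrm ▸ hr.lt _ h1 _ hm he⟩
      have hins : ∀ m n, r m = k → (m, n) ∈ Θ → insert (m, n) {p ∈ Θ | p.1 ∈ z} ∈ R.sym := by
        intro m n hrm hmn
        have h1 := hen m (mem_gdom.2 ⟨n, hmn⟩) hrm
        rw [← (hP.isoFamily.bij _ hB.sym).restrict_insert hmn]
        refine hP.isoFamily.restrict _ hB.sym _ h1.2.2 (Set.insert_subset (mem_gdom.2 ⟨n, hmn⟩) ?_)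
        exact fun _ h => h.1
      have hins' : ∀ m n, r m = k → (m, n) ∈ Θ' → insert (m, n) {p ∈ Θ | p.1 ∈ z} ∈ R.sym := by
        intro m n hrm hmn
        have hm : m ∈ gdom Θ := hdom ▸ mem_gdom.2 ⟨n, hmn⟩
        have h1 := hen m hm hrm
        rw [hzz, ← (hP.isoFamily.bij _ hB'.sym).restrict_insert hmn]
        refine hP.isoFamily.restrict _ hB'.sym _ h1.2.2 (hdom ▸ Set.insert_subset hm ?_)
        exact fun _ h => h.1
      have hnot : ∀ m n, r m = k → (m, n) ∉ {p ∈ Θ | p.1 ∈ z} := fun m n h1 h2 => h2.2.2.ne h1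
      have hpos : ∀ m n n', r m = k → (m, n) ∈ Θ → (m, n') ∈ Θ' →
          (arenaMid A B C).pol (R.disp m) = Pol.pos → n = n' := by
        intro m n n' hrm h1 h2 hp
        have hm : m ∈ gdom Θ := mem_gdom.2 ⟨n, h1⟩
        have hmz : m ∉ gdom {p ∈ Θ | p.1 ∈ z} := by rw [hgz]; exact fun h => h.2.ne hrm
        refine (hP.thin _ hzΘ m (by rw [hgz]; exact hen m hm hrm) hp).unique
          ⟨hP.isoFamily.enables_cod hzΘ (hins m n hrm h1) hmz, hnot m n hrm, hins m n hrm h1⟩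
          ⟨hP.isoFamily.enables_cod hzΘ (hins' m n' hrm h2) hmz, hnot m n' hrm, hins' m n' hrm h2⟩
      intro m n n' hrm h1 h2
      by_cases hp : (arenaMid A B C).pol (R.disp m) = Pol.pos
      · exact hpos m n n' hrm h1 h2 hp
      have hneg := Pol.eq_neg.2 hp
      by_cases hh : Hid (R.disp m)
      swap
      · exact hagree m n n' h1 h2 hh hneg
      have hm : m ∈ gdom Θ := mem_gdom.2 ⟨n, h1⟩
      obtain ⟨m', hm', hmir⟩ := hB.dom.mir m hm hh
      obtain ⟨l, hl⟩ := mem_gdom.1 hm'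
      obtain ⟨l', hl'⟩ := mem_gdom.1 (hdom ▸ hm')
      have hll : l = l' := hpos m' l l' ((hr.mir _ hm _ hm' hmir).symm.trans hrm) hl hl' (by
        rw [hmir.symm.pol_eq hK, hneg]; rfl)
      have hd : R.disp n' = R.disp n := (hB'.mir _ _ _ _ hl' h2 hmir.symm).symm.symm.unique
        (isMirror_diag _) (hll ▸ hB.mir _ _ _ _ hl h1 hmir.symm)
      have henm := hen m hm hrm
      refine (hP.sim_receptive _ hzΘ m (R.disp n) (by rwa [hgz]) hneg
        ((hP.pol_sym hB.sym h1).symm.trans hneg) ⟨hP.not_mem_disp (by rwa [hgz]) _, ?_⟩).unique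
        ⟨⟨hnot m n hrm, hins m n hrm h1⟩, rfl⟩ ⟨⟨hnot m n' hrm, hins' m n' hrm h2⟩, hd⟩
      have := hP.sym_preserving _ (hins m n hrm h1)
      rwa [Set.image_insert_eq] at this
  ext ⟨m, n⟩
  constructor
  · intro h
    obtain ⟨n', hn'⟩ := mem_gdom.1 (hdom ▸ mem_gdom.2 ⟨n, h⟩)
    rw [main _ m n n' rfl h hn']
    exact hn'
  · intro h
    obtain ⟨n', hn'⟩ := mem_gdom.1 (hdom.symm ▸ mem_gdom.2 ⟨n, h⟩)
    rw [← main _ m n' n rfl hn' h]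
    exact hn'

end Bal

/-! ## States as configurations of an event structure of primes -/

section StateLemmas

variable {A B C : NegArena.{u}} {R : PreStrat (arenaMid A B C)}
  {K : Set (B.ev × B.ev)} {x y z : Set R.ev} {Θ Θ' : Set (R.ev × R.ev)}

theorem Mir.mono {A B C : Game.{u}} {K K' : Set (B.ev × B.ev)} {g h : (mid A B C).ev}
    (hm : Mir K g h) (hK : ∀ b b', (b, b') ∈ K → (b, b') ∈ K') : Mir K' g h := by
  cases hm with
  | lr h => exact .lr (hK _ _ h)
  | rl h => exact .rl (hK _ _ h)

theorem State.union (hx : State R K x) (hy : State R K y) (hz : z ∈ R.Conf) (hxz : x ⊆ z)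
    (hyz : y ⊆ z) : State R K (x ∪ y) := by
  refine ⟨ESS.conf_union hx.conf hy.conf hz hxz hyz, ?_⟩
  rintro m (hm | hm) hh
  · exact (hx.mir m hm hh).imp fun a h => ⟨Or.inl h.1, h.2⟩
  · exact (hy.mir m hm hh).imp fun a h => ⟨Or.inr h.1, h.2⟩

theorem State.insert_vis {m : R.ev} (hx : State R K x) (hm : ¬ Hid (R.disp m))
    (h : insert m x ∈ R.Conf) : State R K (insert m x) := by
  refine ⟨h, ?_⟩
  rintro a (rfl | ha) hh
  · exact (hm hh).elim
  · exact (hx.mir a ha hh).imp fun b h => ⟨Or.inr h.1, h.2⟩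

theorem State.empty : State R K ∅ := ⟨ESS.empty_conf, fun _ h => h.elim⟩

/-- The smallest state containing an event and contained in a given state. -/
def cl (R : PreStrat (arenaMid A B C)) (x : Set R.ev) (m : R.ev) : Set R.ev :=
  {a | ∀ y, State R (Set.diagonal B.ev) y → y ⊆ x → m ∈ y → a ∈ y}

theorem State.cl (hR : IsPointedStrategy R) (hx : State R (Set.diagonal B.ev) x) {m : R.ev}
    (hm : m ∈ x) : State R (Set.diagonal B.ev) (cl R x m) := by
  have hsub : CausalGames.cl R x m ⊆ x := fun a ha => ha x hx subset_rfl hm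
  refine ⟨ESS.conf_of_subset hx.conf hsub fun e he e' hl y hy hyx hmy =>
    hy.conf.2.1 e (he y hy hyx hmy) e' hl.1, fun a ha hh => ?_⟩
  obtain ⟨b, hb, hab⟩ := hx.mir a (hsub ha) hh
  refine ⟨b, fun y hy hyx hmy => ?_, hab⟩
  obtain ⟨c, hc, hac⟩ := hy.mir a (ha y hy hyx hmy) hh
  rwa [hR.mir_unique (isMirror_diag _) hx.conf hb (hyx hc) hab hac]

/-- The part of a set of events displayed in the left copy of the middle arena. -/
def midPart (R : PreStrat (arenaMid A B C)) (x : Set R.ev) : Set B.ev :=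
  {b | inl (inr b) ∈ R.disp '' x}

theorem IsPointedStrategy.midPart_conf (hR : IsPointedStrategy R) (hx : x ∈ R.Conf) :
    midPart R x ∈ B.Conf :=
  (ESS.par_conf.1 (ESS.par_conf.1 (hR.rule_abiding x hx)).1).2

theorem mir_midPart {m n : R.ev} (hm : m ∈ x) (hn : n ∈ x)
    (h : Mir (Set.diagonal B.ev) (R.disp m) (R.disp n)) :
    Mir (gid (midPart R x)) (R.disp m) (R.disp n) := by
  generalize hgm : R.disp m = g at h
  generalize hgn : R.disp n = g' at h
  cases h with
  | lr h => exact .lr ⟨⟨m, hm, hgm⟩, h.symm⟩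
  | rl h => exact .rl ⟨⟨n, hn, hgn⟩, h.symm⟩

theorem mir_of_gid {w : Set B.ev} {g h : (arenaMid A B C).ev}
    (hm : Mir (gid w) g h) : Mir (Set.diagonal B.ev) g h :=
  hm.mono fun _ _ h => h.2.symm

/-- Balanced symmetries extend to all states containing their domain. -/
theorem Bal.extend_diag (hR : IsInter R) (hB : Bal R (Set.diagonal B.ev) Θ)
    (hx : State R (Set.diagonal B.ev) x) (hsub : gdom Θ ⊆ x) :
    ∃ Θ', Θ ⊆ Θ' ∧ Bal R (Set.diagonal B.ev) Θ' ∧ gdom Θ' = x := by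
  have hK := B.preArena.isoFamily.id_mem _ (hR.pointed.midPart_conf hx.conf)
  have h1 : Bal R (gid (midPart R x)) Θ := by
    refine ⟨hB.sym, ⟨hB.dom.conf, fun m hm hh => ?_⟩, fun m n m' n' h h' hm =>
      hB.mir m n m' n' h h' (mir_of_gid hm)⟩
    obtain ⟨m', hm', h⟩ := hB.dom.mir m hm hh
    exact ⟨m', hm', mir_midPart (hsub hm) (hsub hm') h⟩
  have h2 : State R (gid (midPart R x)) x := by
    refine ⟨hx.conf, fun m hm hh => ?_⟩
    obtain ⟨m', hm', h⟩ := hx.mir m hm hh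
    exact ⟨m', hm', mir_midPart hm hm' h⟩
  obtain ⟨Θ', h3, h4, rfl⟩ := h1.extend hR hK h2 hsub
  exact ⟨Θ', h3, ⟨h4.sym, hx, fun m n m' n' h h' hm => h4.mir m n m' n' h h'
    (mir_midPart (mem_gdom.2 ⟨_, h⟩) (mem_gdom.2 ⟨_, h'⟩) hm)⟩, rfl⟩

theorem Bal.gid (hR : IsPointedStrategy R) (hx : State R (Set.diagonal B.ev) x) :
    Bal R (Set.diagonal B.ev) (gid x) := by
  refine ⟨hR.isoFamily.id_mem _ hx.conf, by rwa [gdom_gid], ?_⟩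
  intro m n m' n' h1 h2 h
  obtain rfl : n = m := h1.2
  obtain rfl : n' = m' := h2.2
  exact h

theorem Bal.swap (hR : IsPointedStrategy R) (h : Bal R (Set.diagonal B.ev) Θ) :
    Bal R (Set.diagonal B.ev) (Prod.swap '' Θ) := by
  refine ⟨hR.isoFamily.inv_mem _ h.sym, by rw [gdom_swap]; exact h.cod hR, ?_⟩
  intro m n m' n' h1 h2 hm
  rw [mem_swap] at h1 h2
  obtain ⟨c, hc, hnc⟩ := h.dom.mir n (mem_gdom.2 ⟨m, h1⟩) ((hR.hid_iff h.sym h1).2 hm.hid)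
  obtain ⟨d, hd⟩ := mem_gdom.1 hc
  have h3 := h.mir _ _ _ _ h1 hd hnc
  have h4 : m' = d := hR.mir_unique (isMirror_diag _) (hR.isoFamily.cod_conf h.sym)
    (mem_gcod.2 ⟨_, h2⟩) (mem_gcod.2 ⟨_, hd⟩) hm h3
  subst h4
  rwa [(hR.isoFamily.bij _ h.sym).inj₂ h2 hd]

theorem Bal.restrict (hR : IsPointedStrategy R) (h : Bal R (Set.diagonal B.ev) Θ)
    (hx : State R (Set.diagonal B.ev) x) (hsub : x ⊆ gdom Θ) :
    Bal R (Set.diagonal B.ev) {p ∈ Θ | p.1 ∈ x} := by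
  refine ⟨hR.isoFamily.restrict _ h.sym x hx.conf hsub, by rwa [gdom_restrict hsub], ?_⟩
  rintro m n m' n' ⟨h1, -⟩ ⟨h2, -⟩ hm
  exact h.mir m n m' n' h1 h2 hm

theorem Bal.gcomp (hR : IsPointedStrategy R) (h : Bal R (Set.diagonal B.ev) Θ)
    (h' : Bal R (Set.diagonal B.ev) Θ') (hc : gcod Θ = gdom Θ') :
    Bal R (Set.diagonal B.ev) (gcomp Θ Θ') := by
  refine ⟨hR.isoFamily.comp_mem' h.sym h'.sym hc, by rw [gdom_gcomp hc.le]; exact h.dom, ?_⟩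
  rintro m n m' n' ⟨a, h1, h2⟩ ⟨a', h3, h4⟩ hm
  exact h'.mir _ _ _ _ h2 h4 (h.mir _ _ _ _ h1 h3 hm)

end StateLemmas

section Primes

variable {A B C : NegArena.{u}} {R : PreStrat (arenaMid A B C)}
  {P : Type u} {D : P → Set R.ev} {tp : P → R.ev} {V : Set R.ev}

variable (R) in
/-- `P` is the type of the states that are generated by an event in `V`. -/
structure IsPrimes (D : P → Set R.ev) (tp : P → R.ev) (V : Set R.ev) : Prop where
  state : ∀ p, State R (Set.diagonal B.ev) (D p)
  tp_mem : ∀ p, tp p ∈ D p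
  tp_V : ∀ p, tp p ∈ V
  least : ∀ p y z, State R (Set.diagonal B.ev) y → State R (Set.diagonal B.ev) z → y ⊆ z →
    D p ⊆ z → tp p ∈ y → D p ⊆ y
  exists_prime : ∀ x m, State R (Set.diagonal B.ev) x → m ∈ x → m ∈ V → ∃ p, tp p = m ∧ D p ⊆ x
  inj : Function.Injective D
  sym_V : ∀ Θ ∈ R.sym, ∀ m n, (m, n) ∈ Θ → (m ∈ V ↔ n ∈ V)

/-- The primes contained in a state. -/
def cfg {P X : Type u} (D : P → Set X) (y : Set X) : Set P := {p | D p ⊆ y}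

/-- The state generated by a set of primes. -/
def gen {P X : Type u} (D : P → Set X) (x : Set P) : Set X := {a | ∃ p ∈ x, a ∈ D p}

/-- The action of a symmetry on primes. -/
def cfgSym {P X : Type u} (D : P → Set X) (tp : P → X) (Θ : Set (X × X)) : Set (P × P) :=
  {p | D p.1 ⊆ gdom Θ ∧ D p.2 ⊆ gcod Θ ∧ (tp p.1, tp p.2) ∈ Θ}

/-- The event structure of primes. -/
@[reducible] def primeES (R : PreStrat (arenaMid A B C)) (D : P → Set R.ev)
    (tp : P → R.ev) : ESS.{u} where
  ev := P
  le p q := D p ⊆ D q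
  conflict p q := ¬ State R (Set.diagonal B.ev) (D p ∪ D q)
  sym := {θ | ∃ Θ, Bal R (Set.diagonal B.ev) Θ ∧ θ = cfgSym D tp Θ}

namespace IsPrimes

theorem le_of_mem (h : IsPrimes R D tp V) {p q : P} {z} (hz : State R (Set.diagonal B.ev) z)
    (hp : D p ⊆ z) (hq : D q ⊆ z) (hpq : tp p ∈ D q) : D p ⊆ D q :=
  h.least p _ z (h.state q) hz hq hp hpq

theorem tp_inj (h : IsPrimes R D tp V) {p q : P} {z} (hz : State R (Set.diagonal B.ev) z)
    (hp : D p ⊆ z) (hq : D q ⊆ z) (hpq : tp p = tp q) : p = q :=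
  h.inj ((h.le_of_mem hz hp hq (hpq ▸ h.tp_mem q)).antisymm
    (h.le_of_mem hz hq hp (hpq ▸ h.tp_mem p)))

theorem gen_state (h : IsPrimes R D tp V) {x : Set P} (hx : x ∈ (primeES R D tp).Conf) :
    State R (Set.diagonal B.ev) (gen D x) := by
  refine ⟨⟨?_, ?_, ?_⟩, ?_⟩
  · have : gen D x = ⋃ p ∈ x, D p := by ext; simp [gen]
    rw [this]
    exact hx.1.biUnion fun p _ => (h.state p).conf.1
  · rintro a ⟨p, hp, ha⟩ b hb
    exact ⟨p, hp, (h.state p).conf.2.1 a ha b hb⟩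
  · rintro a ⟨p, hp, ha⟩ b ⟨q, hq, hb⟩
    have := not_not.1 (hx.2.2 p hp q hq)
    exact this.conf.2.2 a (Or.inl ha) b (Or.inr hb)
  · rintro a ⟨p, hp, ha⟩ hh
    obtain ⟨b, hb, hab⟩ := (h.state p).mir a ha hh
    exact ⟨b, ⟨p, hp, hb⟩, hab⟩

theorem subset_gen {P X : Type u} {D : P → Set X} {x : Set P} {p : P} (hp : p ∈ x) :
    D p ⊆ gen D x := fun _ ha => ⟨p, hp, ha⟩

theorem cfg_gen (h : IsPrimes R D tp V) {x : Set P} (hx : x ∈ (primeES R D tp).Conf) :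
    cfg D (gen D x) = x := by
  ext p
  refine ⟨fun hp => ?_, subset_gen⟩
  obtain ⟨q, hq, hpq⟩ := hp (h.tp_mem p)
  exact hx.2.1 q hq p (h.le_of_mem (h.gen_state hx) hp (subset_gen hq) hpq)

theorem cfg_conf (h : IsPrimes R D tp V) {y} (hy : State R (Set.diagonal B.ev) y) :
    cfg D y ∈ (primeES R D tp).Conf := by
  refine ⟨?_, fun p hp q hq => hq.trans hp, fun p hp q hq => not_not.2
    ((h.state p).union (h.state q) hy.conf hp hq)⟩
  exact (hy.conf.1.finite_subsets.preimage h.inj.injOn)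

theorem exists_mem_cfg (h : IsPrimes R D tp V) {y} (hy : State R (Set.diagonal B.ev) y) {m : R.ev}
    (hm : m ∈ y) (hV : m ∈ V) : ∃ p ∈ cfg D y, tp p = m := by
  obtain ⟨p, hp, hpy⟩ := h.exists_prime y m hy hm hV
  exact ⟨p, hpy, hp⟩

theorem gen_cfg_subset {P X : Type u} {D : P → Set X} {y : Set X} : gen D (cfg D y) ⊆ y := fun _ ⟨_, hp, ha⟩ => hp ha

theorem isES (h : IsPrimes R D tp V) (hR : IsPointedStrategy R) : (primeES R D tp).IsES where
  countable := by
    have := hR.isES.countable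
    have hinj : Function.Injective fun p => (h.state p).conf.1.toFinset := by
      intro p q hpq
      exact h.inj (Set.Finite.toFinset_inj.1 hpq)
    exact hinj.countable
  le_refl _ := subset_rfl
  le_trans _ _ _ := Set.Subset.trans
  le_antisymm _ _ h1 h2 := h.inj (subset_antisymm h1 h2)
  finite_causes p := (h.cfg_conf (h.state p)).1
  conflict_irrefl p := not_not.2 (by rw [Set.union_self]; exact h.state p)
  conflict_symm p q hc hs := hc (Set.union_comm (D q) (D p) ▸ hs)
  conflict_inherit p q r hc hle hs := hc ((h.state p).union (h.state q) hs.conf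
    Set.subset_union_left (hle.trans Set.subset_union_right))

variable {Θ Θ' : Set (R.ev × R.ev)}

theorem swap_cfgSym : Prod.swap '' cfgSym D tp Θ = cfgSym D tp (Prod.swap '' Θ) := by
  ext ⟨p, q⟩
  rw [mem_swap]
  simp only [cfgSym, Set.mem_ofPred_eq, gdom_swap, gcod_swap, mem_swap]
  tauto

theorem gdom_cfgSym (h : IsPrimes R D tp V) (hR : IsPointedStrategy R)
    (hΘ : Bal R (Set.diagonal B.ev) Θ) : gdom (cfgSym D tp Θ) = cfg D (gdom Θ) := by
  ext p
  rw [mem_gdom]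
  refine ⟨fun ⟨q, hq⟩ => hq.1, fun hp => ?_⟩
  obtain ⟨n, hn⟩ := mem_gdom.1 (hp (h.tp_mem p))
  obtain ⟨q, hq, rfl⟩ := h.exists_mem_cfg (hΘ.cod hR) (mem_gcod.2 ⟨_, hn⟩)
    ((h.sym_V Θ hΘ.sym _ _ hn).1 (h.tp_V p))
  exact ⟨q, hp, hq, hn⟩

theorem gcod_cfgSym (h : IsPrimes R D tp V) (hR : IsPointedStrategy R)
    (hΘ : Bal R (Set.diagonal B.ev) Θ) : gcod (cfgSym D tp Θ) = cfg D (gcod Θ) := by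
  rw [← gdom_swap, swap_cfgSym, h.gdom_cfgSym hR (hΘ.swap hR), gdom_swap]

theorem cfgSym_bij (h : IsPrimes R D tp V) (hR : IsPointedStrategy R)
    (hΘ : Bal R (Set.diagonal B.ev) Θ) : IsConfBij (primeES R D tp) (cfgSym D tp Θ) := by
  have hb := hR.isoFamily.bij _ hΘ.sym
  refine ⟨?_, ?_, ?_, ?_⟩
  · rintro ⟨p, q⟩ h1 ⟨p', q'⟩ h2 (rfl : p = p')
    exact congrArg (Prod.mk p) (h.tp_inj (hΘ.cod hR) h1.2.1 h2.2.1 (hb.inj₁ h1.2.2 h2.2.2))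
  · rintro ⟨p, q⟩ h1 ⟨p', q'⟩ h2 (rfl : q = q')
    exact congrArg (·, q) (h.tp_inj hΘ.dom h1.1 h2.1 (hb.inj₂ h1.2.2 h2.2.2))
  · rw [h.gdom_cfgSym hR hΘ]; exact h.cfg_conf hΘ.dom
  · rw [h.gcod_cfgSym hR hΘ]; exact h.cfg_conf (hΘ.cod hR)

theorem exists_of_mem_cod (h : IsPrimes R D tp V) (hR : IsPointedStrategy R)
    (hΘ : Bal R (Set.diagonal B.ev) Θ) {p q : P} (hpq : (p, q) ∈ cfgSym D tp Θ) {n : R.ev}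
    (hn : n ∈ D q) : ∃ m ∈ D p, (m, n) ∈ Θ := by
  have h1 := hΘ.restrict hR (h.state p) hpq.1
  have h2 : gcod {r ∈ Θ | r.1 ∈ D p} ⊆ gcod Θ := gcod_mono fun _ h => h.1
  have h3 := h.least q _ _ (h1.cod hR) (hΘ.cod hR) h2 hpq.2.1
    (mem_gcod.2 ⟨tp p, hpq.2.2, h.tp_mem p⟩) hn
  obtain ⟨m, hm, hm'⟩ := mem_gcod.1 h3
  exact ⟨m, hm', hm⟩

theorem cfgSym_restrict (h : IsPrimes R D tp V) (hR : IsPointedStrategy R)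
    (hΘ : Bal R (Set.diagonal B.ev) Θ) {z} (hsub : z ⊆ gdom Θ) :
    cfgSym D tp {r ∈ Θ | r.1 ∈ z} = {r ∈ cfgSym D tp Θ | r.1 ∈ cfg D z} := by
  ext ⟨p, q⟩
  constructor
  · rintro ⟨h1, h2, h3⟩
    rw [gdom_restrict hsub] at h1
    exact ⟨⟨h1.trans hsub, h2.trans (gcod_mono fun _ h => h.1), h3.1⟩, h1⟩
  · rintro ⟨h1, h2⟩
    refine ⟨by rw [gdom_restrict hsub]; exact h2, fun n hn => ?_, h1.2.2, h2 (h.tp_mem p)⟩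
    obtain ⟨m, hm, hmn⟩ := h.exists_of_mem_cod hR hΘ h1 hn
    exact mem_gcod.2 ⟨m, hmn, h2 hm⟩

theorem cfgSym_gcomp (h : IsPrimes R D tp V) (hR : IsPointedStrategy R)
    (hΘ : Bal R (Set.diagonal B.ev) Θ) (hc : gcod Θ = gdom Θ') :
    cfgSym D tp (gcomp Θ Θ') = gcomp (cfgSym D tp Θ) (cfgSym D tp Θ') := by
  ext ⟨p, q⟩
  rw [mem_gcomp]
  simp only [cfgSym, Set.mem_ofPred_eq, gdom_gcomp hc.le, gcod_gcomp hc.ge]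
  constructor
  · rintro ⟨h1, h2, m, h3, h4⟩
    obtain ⟨e, he, rfl⟩ := h.exists_mem_cfg (hΘ.cod hR) (mem_gcod.2 ⟨_, h3⟩)
      ((h.sym_V Θ hΘ.sym _ _ h3).1 (h.tp_V p))
    exact ⟨e, ⟨h1, he, h3⟩, hc ▸ he, h2, h4⟩
  · rintro ⟨e, ⟨h1, h2, h3⟩, h4, h5, h6⟩
    exact ⟨h1, h5, _, h3, h6⟩

/-- A symmetry can be restricted to the part of its domain generated by primes. -/
theorem cfgSym_gen (h : IsPrimes R D tp V) (hR : IsPointedStrategy R)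
    (hΘ : Bal R (Set.diagonal B.ev) Θ) : ∃ Θ', Θ' ⊆ Θ ∧ Bal R (Set.diagonal B.ev) Θ' ∧
      cfgSym D tp Θ' = cfgSym D tp Θ ∧ gdom Θ' = gen D (cfg D (gdom Θ)) := by
  have h1 := h.gen_state (h.cfg_conf hΘ.dom)
  refine ⟨_, fun _ h => h.1, hΘ.restrict hR h1 gen_cfg_subset, ?_, gdom_restrict gen_cfg_subset⟩
  rw [h.cfgSym_restrict hR hΘ gen_cfg_subset, h.cfg_gen (h.cfg_conf hΘ.dom)]
  ext ⟨p, q⟩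
  exact ⟨fun h => h.1, fun h => ⟨h, h.1⟩⟩

theorem isoFamily (h : IsPrimes R D tp V) (hR : IsInter R) :
    IsIsoFamily (primeES R D tp) (primeES R D tp).sym where
  bij := by
    rintro _ ⟨Θ, hΘ, rfl⟩
    exact h.cfgSym_bij hR.pointed hΘ
  id_mem := by
    intro x hx
    refine ⟨gid (gen D x), .gid hR.pointed (h.gen_state hx), ?_⟩
    ext ⟨p, q⟩
    simp only [gid, cfgSym, Set.mem_ofPred_eq]
    rw [show gdom {p : R.ev × R.ev | p.1 ∈ gen D x ∧ p.2 = p.1} = gen D x from gdom_gid _,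
      show gcod {p : R.ev × R.ev | p.1 ∈ gen D x ∧ p.2 = p.1} = gen D x from gcod_gid _]
    constructor
    · rintro ⟨h1, rfl⟩
      exact ⟨subset_gen h1, subset_gen h1, subset_gen h1 (h.tp_mem _), rfl⟩
    · rintro ⟨h1, h2, -, h3⟩
      refine ⟨by rw [← h.cfg_gen hx]; exact h1, h.tp_inj (h.gen_state hx) h2 h1 h3⟩
  inv_mem := by
    rintro _ ⟨Θ, hΘ, rfl⟩
    exact ⟨_, hΘ.swap hR.pointed, swap_cfgSym⟩
  comp_mem := by
    rintro _ ⟨Θ, hΘ, rfl⟩ _ ⟨Θ', hΘ', rfl⟩ hc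
    obtain ⟨Θ₁, -, h2, h3, h4⟩ := h.cfgSym_gen hR.pointed (hΘ.swap hR.pointed)
    obtain ⟨Θ₂, -, h6, h7, h8⟩ := h.cfgSym_gen hR.pointed hΘ'
    rw [h.gcod_cfgSym hR.pointed hΘ, h.gdom_cfgSym hR.pointed hΘ'] at hc
    have h9 : cfgSym D tp (Prod.swap '' Θ₁) = cfgSym D tp Θ := by
      rw [← swap_cfgSym, h3, swap_cfgSym]
      congr 1
      ext ⟨a, b⟩
      simp
    have h10 : gcod (Prod.swap '' Θ₁) = gdom Θ₂ := by
      rw [gcod_swap, h4, h8, gdom_swap, hc]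
    refine ⟨_, (h2.swap hR.pointed).gcomp hR.pointed h6 h10, ?_⟩
    rw [h.cfgSym_gcomp hR.pointed (h2.swap hR.pointed) h10, h9, h7]
    rfl
  restrict := by
    rintro _ ⟨Θ, hΘ, rfl⟩ x hx hsub
    rw [h.gdom_cfgSym hR.pointed hΘ] at hsub
    have h1 : gen D x ⊆ gdom Θ := fun a ⟨p, hp, ha⟩ => hsub hp ha
    refine ⟨_, hΘ.restrict hR.pointed (h.gen_state hx) h1, ?_⟩
    rw [h.cfgSym_restrict hR.pointed hΘ h1, h.cfg_gen hx]
  extend := by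
    rintro _ ⟨Θ, hΘ, rfl⟩ x hx hsub
    rw [h.gdom_cfgSym hR.pointed hΘ] at hsub
    obtain ⟨Θ₁, -, h2, h3, h4⟩ := h.cfgSym_gen hR.pointed hΘ
    obtain ⟨Θ₂, h5, h6, h7⟩ := h2.extend_diag hR (h.gen_state hx)
      (by rw [h4]; exact fun a ⟨p, hp, ha⟩ => ⟨p, hsub hp, ha⟩)
    refine ⟨_, ⟨Θ₂, h6, rfl⟩, ?_, ?_⟩
    · rw [← h3]
      exact fun p hp => ⟨hp.1.trans (gdom_mono h5), hp.2.1.trans (gcod_mono h5), h5 hp.2.2⟩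
    · rw [h.gdom_cfgSym hR.pointed h6, h7, h.cfg_gen hx]

end IsPrimes

end Primes

/-! ## The interaction of two strategies -/

section Interaction

variable {A B C : NegArena.{u}} {σ : Strat A.toGame B.toGame} {τ : Strat B.toGame C.toGame}

theorem isInter_parStrat (hσ : IsPointedStrategy σ) (hτ : IsPointedStrategy τ) (vσ : IsVisible σ)
    (vτ : IsVisible τ) :
    IsInter (A := A) (B := B) (C := C) (parStrat σ τ) := by
  refine ⟨hσ.par hτ, vσ.par vτ, ?_⟩
  rintro (m | m) (n | n) h
  · rfl
  · exact (ESS.par_le_lr.1 h).elim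
  · exact (ESS.par_le_rl.1 h).elim
  · rfl

/-- The events of a pair of configurations. -/
def pairSet (σ : Strat A.toGame B.toGame) (τ : Strat B.toGame C.toGame) (x : Set σ.ev)
    (y : Set τ.ev) : Set (σ.ev ⊕ τ.ev) := inl '' x ∪ inr '' y

@[simp] theorem inl_mem_pairSet {x : Set σ.ev} {y : Set τ.ev} {s : σ.ev} :
    inl s ∈ pairSet σ τ x y ↔ s ∈ x := by simp [pairSet]

@[simp] theorem inr_mem_pairSet {x : Set σ.ev} {y : Set τ.ev} {t : τ.ev} :
    inr t ∈ pairSet σ τ x y ↔ t ∈ y := by simp [pairSet]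

theorem pairSet_preimage (z : Set (σ.ev ⊕ τ.ev)) :
    pairSet σ τ (inl ⁻¹' z) (inr ⁻¹' z) = z := by
  ext (s | t) <;> simp

theorem pairSet_union {x x' : Set σ.ev} {y y' : Set τ.ev} :
    pairSet σ τ (x ∪ x') (y ∪ y') = pairSet σ τ x y ∪ pairSet σ τ x' y' := by
  ext (s | t) <;> simp

theorem pairSet_subset {x x' : Set σ.ev} {y y' : Set τ.ev} :
    pairSet σ τ x y ⊆ pairSet σ τ x' y' ↔ x ⊆ x' ∧ y ⊆ y' := by
  constructor
  · intro h
    exact ⟨fun s hs => inl_mem_pairSet.1 (h (inl_mem_pairSet.2 hs)),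
      fun s hs => inr_mem_pairSet.1 (h (inr_mem_pairSet.2 hs))⟩
  · rintro ⟨h1, h2⟩ (s | t) h
    · exact inl_mem_pairSet.2 (h1 (inl_mem_pairSet.1 h))
    · exact inr_mem_pairSet.2 (h2 (inr_mem_pairSet.1 h))

/-- The events of the two strategies that take part in a synchronized event. -/
inductive Rep (σ : Strat A.toGame B.toGame) (τ : Strat B.toGame C.toGame) :
    (σ.ev ⊕ C.ev) × (A.ev ⊕ τ.ev) → σ.ev ⊕ τ.ev → Prop
  | left {s q} : Rep σ τ (inl s, q) (inl s)
  | right {p t} : Rep σ τ (p, inr t) (inr t)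

theorem mir_of_disp {s : σ.ev} {t : τ.ev} {b : B.ev} (hs : σ.disp s = inr b)
    (ht : τ.disp t = inl b) : Mir (A := A.toGame) (C := C.toGame) (Set.diagonal B.ev)
      ((parStrat σ τ).disp (inl s)) ((parStrat σ τ).disp (inr t)) := by
  have h1 : (parStrat σ τ).disp (inl s) = inl (inr b) := congrArg inl hs
  have h2 : (parStrat σ τ).disp (inr t) = inr (inl b) := congrArg inr ht
  rw [h1, h2]
  exact .lr rfl

theorem disp_of_mir {s : σ.ev} {m : σ.ev ⊕ τ.ev} (h : Mir (A := A.toGame) (C := C.toGame)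
    (Set.diagonal B.ev) ((parStrat σ τ).disp (inl s)) ((parStrat σ τ).disp m)) :
    ∃ t b, m = inr t ∧ σ.disp s = inr b ∧ τ.disp t = inl b := by
  generalize h1 : (parStrat σ τ).disp (inl s) = g at h
  generalize h2 : (parStrat σ τ).disp m = g' at h
  cases h with
  | lr h =>
    rcases m with m | m
    · cases h2
    · exact ⟨m, _, rfl, Sum.inl.inj h1, (Sum.inr.inj h2).trans (congrArg inl h.symm)⟩
  | rl h => cases h1

theorem disp_of_mir' {t : τ.ev} {m : σ.ev ⊕ τ.ev} (h : Mir (A := A.toGame) (C := C.toGame)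
    (Set.diagonal B.ev) ((parStrat σ τ).disp (inr t)) ((parStrat σ τ).disp m)) :
    ∃ s b, m = inl s ∧ σ.disp s = inr b ∧ τ.disp t = inl b := by
  generalize h1 : (parStrat σ τ).disp (inr t) = g at h
  generalize h2 : (parStrat σ τ).disp m = g' at h
  cases h with
  | rl h =>
    rcases m with m | m
    · exact ⟨m, _, rfl, Sum.inl.inj h2, (Sum.inr.inj h1).trans (congrArg inl h.symm)⟩
    · cases h2
  | lr h => cases h1

variable {x : Set σ.ev} {y : Set τ.ev}

theorem Rep.mem {q} (hq : q ∈ sync σ τ x y) {a} (h : Rep σ τ q a) : a ∈ pairSet σ τ x y := by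
  cases h with
  | @left s q => rcases q with q | q <;> exact inl_mem_pairSet.2 hq.1
  | @right p t =>
    rcases p with p | p
    · exact inr_mem_pairSet.2 hq.2.1
    · exact inr_mem_pairSet.2 hq.1

theorem exists_rep (hst : State (A := A) (B := B) (C := C) (parStrat σ τ) (Set.diagonal B.ev)
    (pairSet σ τ x y)) {a} (ha : a ∈ pairSet σ τ x y) : ∃ q ∈ sync σ τ x y, Rep σ τ q a := by
  rcases a with s | t
  · rw [inl_mem_pairSet] at ha
    rcases hd : σ.disp s with a | b
    · exact ⟨(.inl s, .inl a), ⟨ha, hd⟩, .left⟩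
    · obtain ⟨m, hm, hmir⟩ := hst.mir (inl s) (inl_mem_pairSet.2 ha) (by simp [hd, Hid])
      obtain ⟨t, b', rfl, h1, h2⟩ := disp_of_mir hmir
      exact ⟨(.inl s, .inr t), ⟨ha, inr_mem_pairSet.1 hm, b', h1, h2⟩, .left⟩
  · rw [inr_mem_pairSet] at ha
    rcases hd : τ.disp t with b | c
    · obtain ⟨m, hm, hmir⟩ := hst.mir (inr t) (inr_mem_pairSet.2 ha) (by simp [hd, Hid])
      obtain ⟨s, b', rfl, h1, h2⟩ := disp_of_mir' hmir
      exact ⟨(.inl s, .inr t), ⟨inl_mem_pairSet.1 hm, ha, b', h1, h2⟩, .right⟩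
    · exact ⟨(.inr c, .inr t), ⟨ha, hd⟩, .right⟩

theorem exists_rep_of_mem {q} (hq : q ∈ sync σ τ x y) : ∃ a, Rep σ τ q a := by
  rcases q with ⟨s | c, a | t⟩
  · exact ⟨_, .left⟩
  · exact ⟨_, .left⟩
  · exact (hq : False).elim
  · exact ⟨_, .right⟩

theorem Rep.unique (hσ : IsPointedStrategy σ) (hτ : IsPointedStrategy τ) (hx : x ∈ σ.Conf)
    (hy : y ∈ τ.Conf) {q q' a} (hq : q ∈ sync σ τ x y) (hq' : q' ∈ sync σ τ x y)
    (h : Rep σ τ q a) (h' : Rep σ τ q' a) : q = q' := by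
  cases h with
  | @left s p =>
    cases h' with
    | @left _ p' =>
      rcases p with p | p <;> rcases p' with p' | p'
      · have := hq.2.symm.trans hq'.2
        rw [Sum.inl.inj this]
      · obtain ⟨b, h1, -⟩ := hq'.2.2
        exact absurd (hq.2.symm.trans h1) (by simp)
      · obtain ⟨b, h1, -⟩ := hq.2.2
        exact absurd (hq'.2.symm.trans h1) (by simp)
      · obtain ⟨b, h1, h2⟩ := hq.2.2
        obtain ⟨b', h3, h4⟩ := hq'.2.2
        rw [Sum.inr.inj (h3.symm.trans h1)] at h4
        rw [hτ.locally_injective y hy hq.2.1 hq'.2.1 (h2.trans h4.symm)]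
  | @right p t =>
    cases h' with
    | @right p' _ =>
      rcases p with p | p <;> rcases p' with p' | p'
      · obtain ⟨b, h1, h2⟩ := hq.2.2
        obtain ⟨b', h3, h4⟩ := hq'.2.2
        rw [Sum.inl.inj (h4.symm.trans h2)] at h3
        rw [hσ.locally_injective x hx hq.1 hq'.1 (h1.trans h3.symm)]
      · obtain ⟨b, h1, h2⟩ := hq.2.2
        exact absurd (hq'.2.symm.trans h2) (by simp)
      · obtain ⟨b, h1, h2⟩ := hq'.2.2
        exact absurd (hq.2.symm.trans h2) (by simp)
      · have := hq.2.symm.trans hq'.2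
        rw [Sum.inr.inj this]

theorem Rep.mir {q a a'} (hq : q ∈ sync σ τ x y) (h : Rep σ τ q a) (h' : Rep σ τ q a')
    (hne : a ≠ a') : Mir (A := A.toGame) (C := C.toGame) (Set.diagonal B.ev)
      ((parStrat σ τ).disp a) ((parStrat σ τ).disp a') := by
  cases h with
  | left =>
    cases h' with
    | left => exact (hne rfl).elim
    | right =>
      obtain ⟨b, h1, h2⟩ := hq.2.2
      exact mir_of_disp h1 h2
  | right =>
    cases h' with
    | right => exact (hne rfl).elim
    | left =>
      obtain ⟨b, h1, h2⟩ := hq.2.2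
      exact (mir_of_disp h1 h2).symm

/-- The causal constraints on synchronized events come from those of the strategies. -/
theorem syncLt_iff (hσ : IsPointedStrategy σ) (hτ : IsPointedStrategy τ) (hx : x ∈ σ.Conf)
    (hy : y ∈ τ.Conf) {p q} : syncLt σ τ x y p q ↔ p ∈ sync σ τ x y ∧ q ∈ sync σ τ x y ∧
      ∃ a b, Rep σ τ p a ∧ Rep σ τ q b ∧ (parStrat σ τ).lt a b := by
  constructor
  · rintro ⟨hp, hq, h⟩
    refine ⟨hp, hq, ?_⟩
    rcases p with ⟨p | p, p' | p'⟩ <;> rcases q with ⟨q | q, q' | q'⟩ <;>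
      first
      | exact (hp : False).elim
      | exact (hq : False).elim
      | skip
    all_goals rcases h with h | h
    all_goals dsimp only at h
    all_goals first
      | exact (ESS.par_lt_lr.1 h).elim
      | exact (ESS.par_lt_rl.1 h).elim
      | exact ⟨_, _, .left, .left, ESS.par_lt_ll.2 (ESS.par_lt_ll.1 h)⟩
      | exact ⟨_, _, .right, .right, ESS.par_lt_rr.2 (ESS.par_lt_rr.1 h)⟩
      | skip
    · have h1 := ESS.par_lt_ll.1 h
      refine ⟨_, _, .left, .left, ESS.par_lt_ll.2 (hσ.lt_of_disp_lt hx hp.1 hq.1 ?_)⟩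
      rw [hp.2, hq.2]
      exact ESS.par_lt_ll.2 h1
    · have h1 := ESS.par_lt_rr.1 h
      refine ⟨_, _, .right, .right, ESS.par_lt_rr.2 (hτ.lt_of_disp_lt hy hp.1 hq.1 ?_)⟩
      rw [hp.2, hq.2]
      exact ESS.par_lt_rr.2 h1
  · rintro ⟨hp, hq, a, b, ha, hb, h⟩
    refine ⟨hp, hq, ?_⟩
    cases ha with
    | left =>
      cases hb with
      | left => exact Or.inl (ESS.par_lt_ll.2 (ESS.par_lt_ll.1 h))
      | right => exact (ESS.par_lt_lr.1 h).elim
    | right =>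
      cases hb with
      | left => exact (ESS.par_lt_rl.1 h).elim
      | right => exact Or.inr (ESS.par_lt_rr.2 (ESS.par_lt_rr.1 h))

theorem causallyCompatible_iff (hσ : IsPointedStrategy σ) (hτ : IsPointedStrategy τ)
    (vσ : IsVisible σ) (vτ : IsVisible τ) : CausallyCompatible σ τ x y ↔
      State (A := A) (B := B) (C := C) (parStrat σ τ) (Set.diagonal B.ev) (pairSet σ τ x y) := by
  have hpre : inl ⁻¹' pairSet σ τ x y = x ∧ inr ⁻¹' pairSet σ τ x y = y := by
    constructor <;> ext <;> simp
  constructor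
  · intro h
    refine ⟨ESS.par_conf.2 ?_, ?_⟩
    · rw [hpre.1, hpre.2]; exact ⟨h.left_conf, h.right_conf⟩
    · rintro (s | t) hm hh
      · rw [inl_mem_pairSet] at hm
        rcases hd : σ.disp s with a | b
        · simp [hd, Hid] at hh
        · obtain ⟨t, ht, hdt⟩ := h.matching.le (show b ∈ _ from ⟨s, hm, hd⟩)
          exact ⟨inr t, inr_mem_pairSet.2 ht, mir_of_disp hd hdt⟩
      · rw [inr_mem_pairSet] at hm
        rcases hd : τ.disp t with b | c
        · obtain ⟨s, hs, hds⟩ := h.matching.ge (show b ∈ _ from ⟨t, hm, hd⟩)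
          exact ⟨inl s, inl_mem_pairSet.2 hs, (mir_of_disp hds hd).symm⟩
        · simp [hd, Hid] at hh
  · intro h
    have hI := isInter_parStrat hσ hτ vσ vτ
    have hc := ESS.par_conf.1 h.conf
    rw [hpre.1, hpre.2] at hc
    refine ⟨hc.1, hc.2, ?_, ?_⟩
    · ext b
      constructor
      · rintro ⟨s, hs, hd⟩
        obtain ⟨m, hm, hmir⟩ := h.mir (inl s) (inl_mem_pairSet.2 hs) (by simp [hd, Hid])
        obtain ⟨t, b', rfl, h1, h2⟩ := disp_of_mir hmir
        rw [hd, Sum.inr.injEq] at h1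
        exact ⟨t, inr_mem_pairSet.1 hm, h1 ▸ h2⟩
      · rintro ⟨t, ht, hd⟩
        obtain ⟨m, hm, hmir⟩ := h.mir (inr t) (inr_mem_pairSet.2 ht) (by simp [hd, Hid])
        obtain ⟨s, b', rfl, h1, h2⟩ := disp_of_mir' hmir
        rw [hd, Sum.inl.injEq] at h2
        exact ⟨s, inl_mem_pairSet.1 hm, h2 ▸ h1⟩
    · obtain ⟨r, hr⟩ := h.exists_rank hI.pointed hI.visible hI.side (isMirror_diag _)
      have key : ∀ p q, Relation.TransGen (syncLt σ τ x y) p q → p ∈ sync σ τ x y ∧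
          q ∈ sync σ τ x y ∧ ∀ a b, Rep σ τ p a → Rep σ τ q b → r a < r b := by
        have heq : ∀ q ∈ sync σ τ x y, ∀ a b, Rep σ τ q a → Rep σ τ q b → r a = r b := by
          intro q hq a b ha hb
          by_cases hab : a = b
          · rw [hab]
          · exact hr.mir a (ha.mem hq) b (hb.mem hq) (ha.mir hq hb hab)
        have one : ∀ p q, syncLt σ τ x y p q → p ∈ sync σ τ x y ∧
            q ∈ sync σ τ x y ∧ ∀ a b, Rep σ τ p a → Rep σ τ q b → r a < r b := by
          intro p q hpq
          obtain ⟨hp, hq, a, b, ha, hb, hl⟩ := (syncLt_iff hσ hτ hc.1 hc.2).1 hpq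
          refine ⟨hp, hq, fun a' b' ha' hb' => ?_⟩
          rw [heq p hp a' a ha' ha, heq q hq b' b hb' hb]
          exact hr.lt a (ha.mem hp) b (hb.mem hq) hl
        intro p q hpq
        induction hpq with
        | single h => exact one _ _ h
        | tail _ h ih =>
          obtain ⟨h1, h2, h3⟩ := ih
          obtain ⟨-, h5, h6⟩ := one _ _ h
          refine ⟨h1, h5, fun a b ha hb => ?_⟩
          obtain ⟨c, hc⟩ := exists_rep_of_mem h2
          exact (h3 a c ha hc).trans (h6 c b hc hb)
      intro p hp
      obtain ⟨h1, -, h2⟩ := key p p hp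
      obtain ⟨a, ha⟩ := exists_rep_of_mem h1
      exact lt_irrefl _ (h2 a a ha ha)

/-- The set of events of an event of the interaction. -/
def InterEv.set (p : InterEv σ τ) : Set (σ.ev ⊕ τ.ev) := pairSet σ τ p.left p.right

/-- A representative of the greatest element of an event of the interaction. -/
def InterEv.rep (p : InterEv σ τ) : σ.ev ⊕ τ.ev :=
  match p.top, p.top_mem with
  | (.inl s, _), _ => inl s
  | (.inr _, .inr t), _ => inr t
  | (.inr _, .inl _), h => False.elim h

theorem InterEv.rep_spec (p : InterEv σ τ) : Rep σ τ p.top p.rep := by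
  obtain ⟨x, y, ⟨s | c, a | t⟩, hc, htop, hle⟩ := p
  · exact .left
  · exact .left
  · exact (htop : False).elim
  · exact .right

theorem InterEv.rep_mem (p : InterEv σ τ) : p.rep ∈ p.set := p.rep_spec.mem p.top_mem

/-- The events that represent a synchronized event, but for those of `B` in the second strategy. -/
def interV (σ : Strat A.toGame B.toGame) (τ : Strat B.toGame C.toGame) : Set (σ.ev ⊕ τ.ev) :=
  {m | ∀ b, (parStrat σ τ).disp m ≠ inr (inl b)}

theorem mem_interV {m : σ.ev ⊕ τ.ev} :
    m ∈ interV σ τ ↔ ∀ b, (parStrat σ τ).disp m ≠ inr (inl b) := Iff.rfl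

theorem Rep.eq_of_interV {q a} (hq : q ∈ sync σ τ x y) (h : Rep σ τ q a) (ha : a ∈ interV σ τ)
    {a'} (h' : Rep σ τ q a') (ha' : a' ∈ interV σ τ) : a = a' := by
  by_contra hne
  have hm := h.mir hq h' hne
  generalize h1 : (parStrat σ τ).disp a = g at hm
  generalize h2 : (parStrat σ τ).disp a' = g' at hm
  cases hm with
  | lr h => exact ha' _ h2
  | rl h => exact ha _ h1

theorem InterEv.rep_interV (p : InterEv σ τ) : p.rep ∈ interV σ τ := by
  obtain ⟨x, y, ⟨s | c, a | t⟩, hc, htop, hle⟩ := p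
  · intro b h; cases h
  · intro b h; cases h
  · exact (htop : False).elim
  · intro b h
    have := (Sum.inr.inj h).symm.trans htop.2
    cases this

section

variable (hσ : IsPointedStrategy σ) (hτ : IsPointedStrategy τ) (vσ : IsVisible σ) (vτ : IsVisible τ)
include hσ hτ vσ vτ

theorem InterEv.set_state (p : InterEv σ τ) :
    State (A := A) (B := B) (C := C) (parStrat σ τ) (Set.diagonal B.ev) p.set :=
  (causallyCompatible_iff hσ hτ vσ vτ).1 p.compatible

omit hσ hτ vσ vτ in
theorem InterEv.set_inj : Function.Injective (InterEv.set (σ := σ) (τ := τ)) := by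
  intro p q h
  have h1 : p.left = q.left := by
    ext s; rw [← inl_mem_pairSet (τ := τ) (y := p.right), ← inl_mem_pairSet (τ := τ) (y := q.right)]
    exact Set.ext_iff.1 h _
  have h2 : p.right = q.right := by
    ext s; rw [← inr_mem_pairSet (σ := σ) (x := p.left), ← inr_mem_pairSet (σ := σ) (x := q.left)]
    exact Set.ext_iff.1 h _
  refine InterEv.ext h1 h2 ?_
  have h3 := q.top_mem
  have h4 := q.le_top
  rw [← h1, ← h2] at h3 h4
  rcases h4 _ p.top_mem with h5 | h5
  · exact h5
  rcases p.le_top _ h3 with h6 | h6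
  · exact h6.symm
  · exact (p.compatible.secured _ (h5.trans h6)).elim

theorem interEv_least (p : InterEv σ τ) (y z : Set (σ.ev ⊕ τ.ev))
    (hy : State (A := A) (B := B) (C := C) (parStrat σ τ) (Set.diagonal B.ev) y)
    (hz : State (A := A) (B := B) (C := C) (parStrat σ τ) (Set.diagonal B.ev) z)
    (hyz : y ⊆ z) (hpz : p.set ⊆ z) (hpy : p.rep ∈ y) : p.set ⊆ y := by
  have hR := hσ.par hτ
  have hc := p.compatible
  have close : ∀ q ∈ sync σ τ p.left p.right, ∀ a b, Rep σ τ q a → Rep σ τ q b → a ∈ y → b ∈ y := by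
    intro q hq a b ha hb hay
    by_cases hab : a = b
    · rwa [← hab]
    have hm := ha.mir hq hb hab
    obtain ⟨b', hb', hm'⟩ := hy.mir a hay hm.hid
    rwa [hR.mir_unique (isMirror_diag B.toGame) hz.conf (hpz (hb.mem hq)) (hyz hb') hm hm']
  have key : ∀ q q', Relation.TransGen (syncLt σ τ p.left p.right) q q' →
      (∀ b, Rep σ τ q' b → b ∈ y) → q ∈ sync σ τ p.left p.right ∧ ∀ b, Rep σ τ q b → b ∈ y := by
    have one : ∀ q q', syncLt σ τ p.left p.right q q' →
      (∀ b, Rep σ τ q' b → b ∈ y) → q ∈ sync σ τ p.left p.right ∧ ∀ b, Rep σ τ q b → b ∈ y := by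
      intro q q' h h'
      obtain ⟨hq, -, a, b, ha, hb, hl⟩ := (syncLt_iff hσ hτ hc.left_conf hc.right_conf).1 h
      exact ⟨hq, fun a' ha' => close q hq a a' ha ha' (hy.conf.2.1 b (h' b hb) a hl.1)⟩
    intro q q' h h'
    induction h using Relation.TransGen.head_induction_on with
    | single h => exact one _ _ h h'
    | head h _ ih => exact one _ _ h ih.2
  intro a ha
  obtain ⟨q, hq, hqa⟩ := exists_rep (p.set_state hσ hτ vσ vτ) ha
  have htop := fun b hb => close _ p.top_mem _ b p.rep_spec hb hpy
  rcases p.le_top q hq with rfl | h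
  · exact htop a hqa
  · exact (key _ _ h htop).2 a hqa

theorem interEv_exists (x : Set (σ.ev ⊕ τ.ev)) (m : σ.ev ⊕ τ.ev)
    (hx : State (A := A) (B := B) (C := C) (parStrat σ τ) (Set.diagonal B.ev) x) (hm : m ∈ x)
    (hV : m ∈ interV σ τ) : ∃ p : InterEv σ τ, p.rep = m ∧ p.set ⊆ x := by
  have hR := hσ.par hτ
  have hcl := State.cl (A := A) (B := B) (C := C) hR hx hm
  have hmcl : m ∈ cl (A := A) (B := B) (C := C) (parStrat σ τ) x m := fun y _ _ h => h
  have hclx : cl (A := A) (B := B) (C := C) (parStrat σ τ) x m ⊆ x :=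
    fun a ha => ha x hx subset_rfl hm
  have hmin : ∀ y, State (A := A) (B := B) (C := C) (parStrat σ τ) (Set.diagonal B.ev) y →
      y ⊆ cl (A := A) (B := B) (C := C) (parStrat σ τ) x m → m ∈ y →
      cl (A := A) (B := B) (C := C) (parStrat σ τ) x m ⊆ y :=
    fun y hy hyx hmy a ha => ha y hy (hyx.trans hclx) hmy
  rw [← pairSet_preimage (cl (A := A) (B := B) (C := C) (parStrat σ τ) x m)] at hcl hmcl hclx hmin
  generalize inl ⁻¹' cl (A := A) (B := B) (C := C) (parStrat σ τ) x m = u at *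
  generalize inr ⁻¹' cl (A := A) (B := B) (C := C) (parStrat σ τ) x m = v at *
  have hc := (causallyCompatible_iff hσ hτ vσ vτ).2 hcl
  obtain ⟨top, htop, hrep⟩ := exists_rep hcl hmcl
  have hle : pairSet σ τ u v ⊆ {a | ∃ q ∈ sync σ τ u v, Rep σ τ q a ∧
      (q = top ∨ Relation.TransGen (syncLt σ τ u v) q top)} := by
    refine hmin _ ⟨ESS.conf_of_subset hcl.conf ?_ ?_, ?_⟩ ?_ ⟨top, htop, hrep, Or.inl rfl⟩
    · rintro a ⟨q, hq, hqa, -⟩; exact hqa.mem hq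
    · rintro a ⟨q, hq, hqa, h⟩ b hba
      obtain ⟨q', hq', hqb⟩ := exists_rep hcl (hcl.conf.2.1 a (hqa.mem hq) b hba.1)
      have hl : syncLt σ τ u v q' q :=
        (syncLt_iff hσ hτ hc.left_conf hc.right_conf).2 ⟨hq', hq, b, a, hqb, hqa, hba⟩
      refine ⟨q', hq', hqb, Or.inr ?_⟩
      rcases h with rfl | h
      · exact .single hl
      · exact .head hl h
    · rintro a ⟨q, hq, hqa, h⟩ hh
      obtain ⟨b, hb, hab⟩ := hcl.mir a (hqa.mem hq) hh
      refine ⟨b, ⟨q, hq, ?_, h⟩, hab⟩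
      obtain ⟨q', hq', hqb⟩ := exists_rep hcl hb
      rcases a with a | a
      · obtain ⟨t, b', rfl, h1, h2⟩ := disp_of_mir hab
        have h3 : (inl a, inr t) ∈ sync σ τ u v :=
          ⟨inl_mem_pairSet.1 (hqa.mem hq), inr_mem_pairSet.1 hb, b', h1, h2⟩
        rw [hqa.unique hσ hτ hc.left_conf hc.right_conf hq h3 .left]
        exact .right
      · obtain ⟨t, b', rfl, h1, h2⟩ := disp_of_mir' hab
        have h3 : (inl t, inr a) ∈ sync σ τ u v :=
          ⟨inl_mem_pairSet.1 hb, inr_mem_pairSet.1 (hqa.mem hq), b', h1, h2⟩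
        rw [hqa.unique hσ hτ hc.left_conf hc.right_conf hq h3 .right]
        exact .left
    · rintro a ⟨q, hq, hqa, -⟩; exact hqa.mem hq
  refine ⟨⟨u, v, top, hc, htop, fun p hp => ?_⟩, ?_, hclx⟩
  · obtain ⟨a, ha⟩ := exists_rep_of_mem hp
    obtain ⟨q, hq, hqa, h⟩ := hle (ha.mem hp)
    rwa [ha.unique hσ hτ hc.left_conf hc.right_conf hp hq hqa]
  · exact Rep.eq_of_interV htop (InterEv.rep_spec ⟨u, v, top, hc, htop, _⟩)
      (InterEv.rep_interV _) hrep hV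

theorem isPrimes_inter : IsPrimes (A := A) (B := B) (C := C) (parStrat σ τ)
    (InterEv.set (σ := σ) (τ := τ)) InterEv.rep (interV σ τ) where
  state p := p.set_state hσ hτ vσ vτ
  tp_mem p := p.rep_mem
  tp_V p := p.rep_interV
  least p y z := interEv_least hσ hτ vσ vτ p y z
  exists_prime := interEv_exists hσ hτ vσ vτ
  inj := InterEv.set_inj
  sym_V := by
    intro Θ hΘ m n h
    have hR := hσ.par hτ
    rw [mem_interV, mem_interV]
    rcases mid_sym_cases (A := A) (B := B) (C := C) (hR.sym_preserving Θ hΘ)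
      (hR.disp_mem (A := A) (B := B) (C := C) h) with
      ⟨_, _, h1, h2⟩ | ⟨_, _, h1, h2⟩ | ⟨_, _, h1, h2⟩ | ⟨_, _, h1, h2⟩ <;>
      rw [h1, h2] <;> simp

end

theorem visDisp_eq_some {p : InterEv σ τ} {g : (A.hom C.toGame).ev} :
    visDisp p = some g ↔ (parStrat σ τ).disp p.rep = Sum.map inl inr g := by
  obtain ⟨x, y, ⟨s | c, a | t⟩, hc, htop, hle⟩ := p
  · change some (inl a) = some g ↔ inl (σ.disp s) = _
    rw [htop.2]
    rcases g with g | g <;> simp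
  · obtain ⟨b, h1, -⟩ := htop.2.2
    change none = some g ↔ inl (σ.disp s) = _
    rw [h1]
    rcases g with g | g <;> simp
  · exact (htop : False).elim
  · change some (inr c) = some g ↔ inr (τ.disp t) = _
    rw [htop.2]
    rcases g with g | g <;> simp

theorem visDisp_isSome {p : InterEv σ τ} :
    (visDisp p).isSome ↔ ¬ Hid (A := A.toGame) (C := C.toGame) ((parStrat σ τ).disp p.rep) := by
  rw [Option.isSome_iff_exists]
  refine (exists_congr fun g => visDisp_eq_some (p := p) (g := g)).trans ?_
  generalize (parStrat σ τ).disp p.rep = g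
  rcases g with (g | g) | (g | g)
  · exact ⟨fun _ h => h, fun _ => ⟨inl g, rfl⟩⟩
  · exact ⟨by rintro ⟨h | h, h'⟩ <;> simp at h', fun h => (h trivial).elim⟩
  · exact ⟨by rintro ⟨h | h, h'⟩ <;> simp at h', fun h => (h trivial).elim⟩
  · exact ⟨fun _ h => h, fun _ => ⟨inr g, rfl⟩⟩

end Interaction

/-! ## The composition as an event structure of primes -/

section Composition

variable {A B C : NegArena.{u}} {σ : Strat A.toGame B.toGame} {τ : Strat B.toGame C.toGame}

/-- The events of the interaction game that are not in the middle arena. -/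
def visV (R : PreStrat (arenaMid A B C)) : Set R.ev := {m | ¬ Hid (R.disp m)}

/-- The set of events of an event of the composition. -/
def compSet (p : CompEv σ τ) : Set (σ.ev ⊕ τ.ev) := p.1.set

/-- The event of one of the strategies displayed by an event of the composition. -/
def compRep (p : CompEv σ τ) : σ.ev ⊕ τ.ev := p.1.rep

variable (hσ : IsPointedStrategy σ) (hτ : IsPointedStrategy τ) (vσ : IsVisible σ) (vτ : IsVisible τ)
include hσ hτ vσ vτ

theorem isPrimes_comp : IsPrimes (A := A) (B := B) (C := C) (parStrat σ τ)
    (compSet (σ := σ) (τ := τ)) compRep (visV (A := A) (B := B) (C := C) (parStrat σ τ)) where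
  state p := p.1.set_state hσ hτ vσ vτ
  tp_mem p := p.1.rep_mem
  tp_V p := visDisp_isSome.1 p.2
  least p y z := interEv_least hσ hτ vσ vτ p.1 y z
  exists_prime x m hx hm hV := by
    obtain ⟨p, rfl, hp⟩ := interEv_exists hσ hτ vσ vτ x m hx hm
      (fun b hb => hV (by rw [hb]; trivial))
    exact ⟨⟨p, visDisp_isSome.2 hV⟩, rfl, hp⟩
  inj p q h := Subtype.ext (InterEv.set_inj h)
  sym_V Θ hΘ m n h := not_congr ((hσ.par hτ).hid_iff (A := A) (B := B) (C := C) hΘ h)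

theorem interES_eq : (interES σ τ).Conf =
    (primeES (A := A) (B := B) (C := C) (parStrat σ τ) InterEv.set InterEv.rep).Conf := by
  ext x
  simp only [ESS.Conf, interES]
  simp only [causallyCompatible_iff hσ hτ vσ vτ, pairSet_union, ← pairSet_subset]
  rfl

theorem compES_conf_eq : (compES σ τ).Conf =
    (primeES (A := A) (B := B) (C := C) (parStrat σ τ) compSet compRep).Conf := by
  ext x
  simp only [ESS.Conf, compES, interES]
  simp only [causallyCompatible_iff hσ hτ vσ vτ, pairSet_union, ← pairSet_subset]
  rfl

omit hσ vσ vτ in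
/-- A hidden event of the second strategy is represented by its mirror. -/
theorem InterEv.top_snd (p : InterEv σ τ) {s : σ.ev} {z : Set (σ.ev ⊕ τ.ev)} {t : τ.ev}
    (hz : State (A := A) (B := B) (C := C) (parStrat σ τ) (Set.diagonal B.ev) z)
    (hp : p.set ⊆ z) (ht : inr t ∈ z) (hs : p.top.1 = inl s) {b : B.ev}
    (hsb : σ.disp s = inr b) (htb : τ.disp t = inl b) : p.top.2 = inr t := by
  have h := p.top_mem
  have hr : ∀ t', p.top.2 = inr t' → inr t' ∈ z := by
    intro t' ht'
    refine hp (Rep.mem p.top_mem ?_)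
    rw [show p.top = (p.top.1, inr t') from by rw [← ht']]
    exact .right
  rw [show p.top = (p.top.1, p.top.2) from rfl, hs] at h
  rcases ht' : p.top.2 with a | t'
  · rw [ht'] at h
    exact absurd (h.2.symm.trans hsb) (by simp)
  · have h1 := hr t' ht'
    rw [ht'] at h
    obtain ⟨b', h2, h3⟩ := h.2.2
    rw [Sum.inr.inj (h2.symm.trans hsb)] at h3
    have hc := ESS.par_conf.1 hz.conf
    rw [hτ.locally_injective _ hc.2 h1 ht (h3.trans htb.symm)]

theorem gen_inter {x : Set (InterEv σ τ)}
    (hx : x ∈ (primeES (A := A) (B := B) (C := C) (parStrat σ τ) InterEv.set InterEv.rep).Conf) :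
    gen InterEv.set x =
      pairSet σ τ {s | ∃ p ∈ x, p.top.1 = inl s} {t | ∃ p ∈ x, p.top.2 = inr t} := by
  have hP := isPrimes_inter hσ hτ vσ vτ
  have hg := hP.gen_state hx
  have hex : ∀ m ∈ gen InterEv.set x,
      m ∈ interV σ τ → ∃ p ∈ x, p.rep = m := by
    intro m hm hV
    obtain ⟨p, hp, h⟩ := hP.exists_mem_cfg hg hm hV
    rw [hP.cfg_gen hx] at hp
    exact ⟨p, hp, h⟩
  have hl : ∀ (p : InterEv σ τ) s, p.rep = inl s → p.top.1 = inl s := by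
    intro p s h
    have := p.rep_spec
    rw [h] at this
    generalize p.top = q at this
    cases this
    rfl
  have hr : ∀ (p : InterEv σ τ) s, p.rep = inr s → p.top.2 = inr s := by
    intro p s h
    have := p.rep_spec
    rw [h] at this
    generalize p.top = q at this
    cases this
    rfl
  ext m
  constructor
  · intro hm
    rcases m with s | t
    · rw [inl_mem_pairSet]
      obtain ⟨p, hp, h⟩ := hex _ hm (fun b h => by cases h)
      exact ⟨p, hp, hl p s h⟩
    · rw [inr_mem_pairSet]
      rcases hd : τ.disp t with b | c
      · obtain ⟨n, hn, hmir⟩ := hg.mir (inr t) hm (by simp [hd, Hid])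
        obtain ⟨s, b', rfl, h1, h2⟩ := disp_of_mir' hmir
        obtain ⟨p, hp, h⟩ := hex _ hn (fun b h => by cases h)
        exact ⟨p, hp, p.top_snd hτ hg (fun _ ha => ⟨p, hp, ha⟩) hm (hl p s h) h1 h2⟩
      · obtain ⟨p, hp, h⟩ := hex _ hm (fun b h => by
          have := hd.symm.trans (Sum.inr.inj h)
          cases this)
        exact ⟨p, hp, hr p t h⟩
  · rcases m with s | t
    · rw [inl_mem_pairSet]
      rintro ⟨p, hp, h⟩
      refine IsPrimes.subset_gen (D := InterEv.set) hp (Rep.mem p.top_mem ?_)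
      rw [show p.top = (inl s, p.top.2) from by rw [← h]]
      exact .left
    · rw [inr_mem_pairSet]
      rintro ⟨p, hp, h⟩
      refine IsPrimes.subset_gen (D := InterEv.set) hp (Rep.mem p.top_mem ?_)
      rw [show p.top = (p.top.1, inr t) from by rw [← h]]
      exact .right

/-- The symmetries of the interaction come from symmetries of the two strategies. -/
theorem exists_bal_of_interSym {θ : Set (InterEv σ τ × InterEv σ τ)} (hθ : θ ∈ interSym σ τ) :
    ∃ Θ, Bal (A := A) (B := B) (C := C) (parStrat σ τ) (Set.diagonal B.ev) Θ ∧
      θ ⊆ cfgSym InterEv.set InterEv.rep Θ := by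
  obtain ⟨hb, ⟨P, hP, Q, hQ, h1⟩, ⟨P', hP', Q', hQ', h2⟩⟩ := hθ
  have hPr := isPrimes_inter hσ hτ vσ vτ
  have hc1 : gdom θ ∈ (interES σ τ).Conf := hb.2.2.1
  have hc2 : gcod θ ∈ (interES σ τ).Conf := hb.2.2.2
  rw [interES_eq hσ hτ vσ vτ] at hc1 hc2
  have m1 : ∀ p q, (p, q) ∈ θ → (p.top.1, q.top.1) ∈ parRel P Q :=
    fun p q h => h1 ▸ ⟨_, h, rfl⟩
  have m2 : ∀ p q, (p, q) ∈ θ → (p.top.2, q.top.2) ∈ parRel P' Q' :=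
    fun p q h => h2 ▸ ⟨_, h, rfl⟩
  have hdom : gdom (parRel P Q') = gen InterEv.set
      (gdom θ) := by
    rw [gen_inter hσ hτ vσ vτ hc1]
    ext (s | t)
    · rw [inl_mem_gdom_parRel, inl_mem_pairSet]
      constructor
      · intro h
        obtain ⟨s', hs'⟩ := mem_gdom.1 h
        have h3 : (inl s, inl s') ∈ parRel P Q := mem_parRel_ll.2 hs'
        rw [← h1] at h3
        obtain ⟨⟨p, q⟩, hpq, h3⟩ := h3
        exact ⟨p, mem_gdom.2 ⟨q, hpq⟩, congrArg Prod.fst h3⟩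
      · rintro ⟨p, hp, h⟩
        obtain ⟨q, hpq⟩ := mem_gdom.1 hp
        have h3 := m1 p q hpq
        rw [h] at h3
        rcases h4 : q.top.1 with s' | c <;> rw [h4] at h3
        · exact mem_gdom.2 ⟨s', mem_parRel_ll.1 h3⟩
        · exact (mem_parRel_lr.1 h3).elim
    · rw [inr_mem_gdom_parRel, inr_mem_pairSet]
      constructor
      · intro h
        obtain ⟨s', hs'⟩ := mem_gdom.1 h
        have h3 : (inr t, inr s') ∈ parRel P' Q' := mem_parRel_rr.2 hs'
        rw [← h2] at h3
        obtain ⟨⟨p, q⟩, hpq, h3⟩ := h3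
        exact ⟨p, mem_gdom.2 ⟨q, hpq⟩, congrArg Prod.fst h3⟩
      · rintro ⟨p, hp, h⟩
        obtain ⟨q, hpq⟩ := mem_gdom.1 hp
        have h3 := m2 p q hpq
        rw [h] at h3
        rcases h4 : q.top.2 with s' | c <;> rw [h4] at h3
        · exact (mem_parRel_rl.1 h3).elim
        · exact mem_gdom.2 ⟨c, mem_parRel_rr.1 h3⟩
  have hcod : gcod θ ⊆ cfg InterEv.set
      (gcod (parRel P Q')) := by
    intro q hq
    refine (IsPrimes.subset_gen (D := InterEv.set) hq).trans ?_
    rw [gen_inter hσ hτ vσ vτ hc2]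
    rintro (s | t) h
    · rw [inl_mem_pairSet] at h
      obtain ⟨q, hq, h⟩ := h
      obtain ⟨p, hpq⟩ := mem_gcod.1 hq
      have h3 := m1 p q hpq
      rw [h] at h3
      rcases h4 : p.top.1 with s' | c <;> rw [h4] at h3
      · exact mem_gcod.2 ⟨_, mem_parRel_ll.2 (mem_parRel_ll.1 h3)⟩
      · exact (mem_parRel_rl.1 h3).elim
    · rw [inr_mem_pairSet] at h
      obtain ⟨q, hq, h⟩ := h
      obtain ⟨p, hpq⟩ := mem_gcod.1 hq
      have h3 := m2 p q hpq
      rw [h] at h3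
      rcases h4 : p.top.2 with s' | c <;> rw [h4] at h3
      · exact (mem_parRel_lr.1 h3).elim
      · exact mem_gcod.2 ⟨_, mem_parRel_rr.2 (mem_parRel_rr.1 h3)⟩
  have hmem : ∀ p q, (p, q) ∈ θ → (p.rep, q.rep) ∈ parRel P Q' := by
    intro p q hpq
    have h3 := m1 p q hpq
    have h4 := m2 p q hpq
    obtain ⟨x, y, ⟨s | c, a | t⟩, hc, htop, hle⟩ := p <;>
    obtain ⟨x', y', ⟨s' | c', a' | t'⟩, hc', htop', hle'⟩ := q <;>
    first
    | exact (htop : False).elim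
    | exact (htop' : False).elim
    | exact (mem_parRel_lr.1 h3).elim
    | exact (mem_parRel_rl.1 h3).elim
    | exact mem_parRel_ll.2 (mem_parRel_ll.1 h3)
    | exact mem_parRel_rr.2 (mem_parRel_rr.1 h4)
  refine ⟨parRel P Q', ⟨⟨P, hP, Q', hQ', rfl⟩, ?_, ?_⟩, ?_⟩
  · rw [hdom]; exact hPr.gen_state hc1
  · have key : ∀ s t n n', (s, n) ∈ P → (t, n') ∈ Q' → Mir (A := A.toGame) (C := C.toGame)
      (Set.diagonal B.ev) ((parStrat σ τ).disp (inl s)) ((parStrat σ τ).disp (inr t)) →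
        Mir (A := A.toGame) (C := C.toGame)
      (Set.diagonal B.ev) ((parStrat σ τ).disp (inl n)) ((parStrat σ τ).disp (inr n')) := by
      intro s t n n' hs ht hm
      obtain ⟨_, b, h3, h4, h5⟩ := disp_of_mir hm
      cases h3
      have h6 : (inl s, inl n) ∈ parRel P Q := mem_parRel_ll.2 hs
      rw [← h1] at h6
      obtain ⟨⟨p, q⟩, hpq, h6⟩ := h6
      have h7 : p.top.1 = inl s := congrArg Prod.fst h6
      have h8 : q.top.1 = inl n := congrArg Prod.snd h6
      have h9 : p.top.2 = inr t := by
        refine p.top_snd hτ (hPr.gen_state hc1)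
          (fun _ ha => ⟨p, mem_gdom.2 ⟨q, hpq⟩, ha⟩) ?_ h7 h4 h5
        rw [← hdom, inr_mem_gdom_parRel]
        exact mem_gdom.2 ⟨_, ht⟩
      have h10 := m2 p q hpq
      rw [h9] at h10
      rcases h11 : q.top.2 with a | t' <;> rw [h11] at h10
      · exact (mem_parRel_rl.1 h10).elim
      · rw [(hτ.isoFamily.bij _ hQ').inj₁ ht (mem_parRel_rr.1 h10)]
        have h12 := q.top_mem
        rw [show q.top = (inl n, inr t') from by rw [← h8, ← h11]] at h12
        obtain ⟨b', h13, h14⟩ := h12.2.2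
        exact mir_of_disp h13 h14
    rintro (s | s) (n | n) (t | t) (n' | n') h3 h4 hm <;>
    first
    | exact (mem_parRel_lr.1 h3).elim
    | exact (mem_parRel_rl.1 h3).elim
    | exact (mem_parRel_lr.1 h4).elim
    | exact (mem_parRel_rl.1 h4).elim
    | skip
    · obtain ⟨_, _, h, -⟩ := disp_of_mir hm
      cases h
    · exact key _ _ _ _ (mem_parRel_ll.1 h3) (mem_parRel_rr.1 h4) hm
    · exact (key _ _ _ _ (mem_parRel_ll.1 h4) (mem_parRel_rr.1 h3) hm.symm).symm
    · obtain ⟨_, _, h, -⟩ := disp_of_mir' hm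
      cases h
  · rintro ⟨p, q⟩ hpq
    refine ⟨?_, hcod (mem_gcod.2 ⟨p, hpq⟩), hmem p q hpq⟩
    change p.set ⊆ _
    rw [hdom]
    exact fun _ ha => ⟨p, mem_gdom.2 ⟨q, hpq⟩, ha⟩

theorem interSym_of_bal {Θ : Set ((σ.ev ⊕ τ.ev) × (σ.ev ⊕ τ.ev))}
    (hΘ : Bal (A := A) (B := B) (C := C) (parStrat σ τ) (Set.diagonal B.ev) Θ) :
    cfgSym InterEv.set InterEv.rep Θ ∈
      interSym σ τ := by
  have hPr := isPrimes_inter hσ hτ vσ vτ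
  have hR := hσ.par hτ
  obtain ⟨P, hP, Q, hQ, rfl⟩ := hΘ.sym
  have hb := hPr.cfgSym_bij hR hΘ
  have hcod := hΘ.cod hR
  have hmid := hR.sym_preserving _ hΘ.sym
  obtain ⟨_, ⟨PA, hPA, PB, hPB, rfl⟩, _, ⟨QB, hQB, QC, hQC, rfl⟩, hφ⟩ := hmid
  rw [map_parRel] at hφ
  obtain ⟨hφ1, hφ2⟩ := parRel_inj hφ
  have hPB : ∀ s s', (s, s') ∈ P → (σ.disp s, σ.disp s') ∈ parRel PA PB := by
    intro s s' h; rw [← hφ1]; exact ⟨_, h, rfl⟩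
  have hQB : ∀ s s', (s, s') ∈ Q → (τ.disp s, τ.disp s') ∈ parRel QB QC := by
    intro s s' h; rw [← hφ2]; exact ⟨_, h, rfl⟩
  have hex : ∀ m n, (m, n) ∈ parRel P Q → m ∈ interV σ τ → ∃ p q, (p, q) ∈
      cfgSym InterEv.set InterEv.rep
        (parRel P Q) ∧ p.rep = m ∧ q.rep = n := by
    intro m n h hV
    obtain ⟨p, hp, rfl⟩ := hPr.exists_mem_cfg hΘ.dom (mem_gdom.2 ⟨n, h⟩) hV
    obtain ⟨q, hq⟩ := mem_gdom.1 ((hPr.gdom_cfgSym hR hΘ).symm ▸ hp)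
    exact ⟨p, q, hq, rfl, (hR.isoFamily.bij _ hΘ.sym).inj₁ hq.2.2 h⟩
  refine ⟨⟨hb.1, hb.2.1, ?_, ?_⟩, ⟨P, hP, QC, hQC, ?_⟩, ⟨PA, hPA, Q, hQ, ?_⟩⟩
  · rw [interES_eq hσ hτ vσ vτ]; exact hb.2.2.1
  · rw [interES_eq hσ hτ vσ vτ]; exact hb.2.2.2
  · apply subset_antisymm
    · rintro _ ⟨⟨p, q⟩, ⟨-, -, h⟩, rfl⟩
      dsimp only at h ⊢
      obtain ⟨x, y, ⟨s | c, a | t⟩, hc, htop, hle⟩ := p <;>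
      obtain ⟨x', y', ⟨s' | c', a' | t'⟩, hc', htop', hle'⟩ := q <;>
      first
      | exact (htop : False).elim
      | exact (htop' : False).elim
      | exact (mem_parRel_lr.1 h).elim
      | exact (mem_parRel_rl.1 h).elim
      | exact mem_parRel_ll.2 (mem_parRel_ll.1 h)
      | skip
      have h2 := hQB t t' (mem_parRel_rr.1 h)
      rw [htop.2, htop'.2] at h2
      exact mem_parRel_rr.2 (mem_parRel_rr.1 h2)
    · rintro ⟨s | c, s' | c'⟩ h
      · obtain ⟨p, q, hpq, h1, h2⟩ := hex (inl s) (inl s')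
          (mem_parRel_ll.2 (mem_parRel_ll.1 h)) (fun b h => by cases h)
        refine ⟨(p, q), hpq, ?_⟩
        have h3 := p.rep_spec
        have h4 := q.rep_spec
        rw [h1] at h3
        rw [h2] at h4
        dsimp only
        generalize p.top = a at h3
        generalize q.top = a' at h4
        cases h3
        cases h4
        rfl
      · exact (mem_parRel_lr.1 h).elim
      · exact (mem_parRel_rl.1 h).elim
      · have h5 : (inr c, inr c') ∈ parRel QB QC := mem_parRel_rr.2 (mem_parRel_rr.1 h)
        rw [← hφ2] at h5
        obtain ⟨⟨t, t'⟩, ht, h6⟩ := h5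
        have h7 : τ.disp t = inr c := congrArg Prod.fst h6
        have h8 : τ.disp t' = inr c' := congrArg Prod.snd h6
        obtain ⟨p, q, hpq, h1, h2⟩ := hex (inr t) (inr t')
          (mem_parRel_rr.2 ht) (fun b h => by
            have := h7.symm.trans (Sum.inr.inj h)
            cases this)
        refine ⟨(p, q), hpq, ?_⟩
        have aux : ∀ (p : InterEv σ τ) t c, p.rep = inr t → τ.disp t = inr c →
            p.top.1 = inr c := by
          intro p t c h1 h7
          obtain ⟨x, y, ⟨s | d, a | t⟩, hc, htop, hle⟩ := p
          · cases h1
          · cases h1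
          · exact (htop : False).elim
          · cases h1
            exact congrArg inr (Sum.inr.inj (htop.2.symm.trans h7))
        exact Prod.ext (aux p t c h1 h7) (aux q t' c' h2 h8)
  · apply subset_antisymm
    · rintro _ ⟨⟨p, q⟩, ⟨hp, hq, h⟩, rfl⟩
      dsimp only at h ⊢
      obtain ⟨x, y, ⟨s | c, a | t⟩, hc, htop, hle⟩ := p <;>
      obtain ⟨x', y', ⟨s' | c', a' | t'⟩, hc', htop', hle'⟩ := q <;>
      first
      | exact (htop : False).elim
      | exact (htop' : False).elim
      | exact (mem_parRel_lr.1 h).elim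
      | exact (mem_parRel_rl.1 h).elim
      | exact mem_parRel_rr.2 (mem_parRel_rr.1 h)
      | skip
      all_goals have h2 := hPB s s' (mem_parRel_ll.1 h)
      · rw [htop.2, htop'.2] at h2
        exact mem_parRel_ll.2 (mem_parRel_ll.1 h2)
      · obtain ⟨b, h3, -⟩ := htop'.2.2
        rw [htop.2, h3] at h2
        exact (mem_parRel_lr.1 h2).elim
      · obtain ⟨b, h3, -⟩ := htop.2.2
        rw [htop'.2, h3] at h2
        exact (mem_parRel_rl.1 h2).elim
      · obtain ⟨b, h3, h4⟩ := htop.2.2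
        obtain ⟨b', h3', h4'⟩ := htop'.2.2
        have h5 : inr t ∈ gdom (parRel P Q) := hp (inr_mem_pairSet.2 htop.2.1)
        obtain ⟨t'', h6⟩ := mem_gdom.1 (inr_mem_gdom_parRel.1 h5)
        have h7 := hΘ.mir _ _ _ _ h (mem_parRel_rr.2 h6) (mir_of_disp h3 h4)
        have h8 : inr t'' = (inr t' : σ.ev ⊕ τ.ev) := hR.mir_unique (isMirror_diag B.toGame)
          hcod.conf (mem_gcod.2 ⟨_, mem_parRel_rr.2 h6⟩) (hq (inr_mem_pairSet.2 htop'.2.1)) h7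
          (mir_of_disp h3' h4')
        obtain rfl : t'' = t' := Sum.inr.inj h8
        exact mem_parRel_rr.2 h6
    · rintro ⟨a | t, a' | t'⟩ h
      · have h5 : (inl a, inl a') ∈ parRel PA PB := mem_parRel_ll.2 (mem_parRel_ll.1 h)
        rw [← hφ1] at h5
        obtain ⟨⟨t, t'⟩, ht, h6⟩ := h5
        have h7 : σ.disp t = inl a := congrArg Prod.fst h6
        have h8 : σ.disp t' = inl a' := congrArg Prod.snd h6
        obtain ⟨p, q, hpq, h1, h2⟩ := hex (inl t) (inl t')
          (mem_parRel_ll.2 ht) (fun b h => by cases h)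
        refine ⟨(p, q), hpq, ?_⟩
        have aux : ∀ (p : InterEv σ τ) t c, p.rep = inl t → σ.disp t = inl c →
            p.top.2 = inl c := by
          intro p t c h1 h7
          obtain ⟨x, y, ⟨s | d, a | t⟩, hc, htop, hle⟩ := p
          · cases h1
            exact congrArg inl (Sum.inl.inj (htop.2.symm.trans h7))
          · cases h1
            obtain ⟨b, h3, -⟩ := htop.2.2
            exact absurd (h3.symm.trans h7) (by simp)
          · exact (htop : False).elim
          · cases h1
        exact Prod.ext (aux p t a h1 h7) (aux q t' a' h2 h8)
      · exact (mem_parRel_lr.1 h).elim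
      · exact (mem_parRel_rl.1 h).elim
      · have hQ1 : (t, t') ∈ Q := mem_parRel_rr.1 h
        have htd : inr t ∈ gdom (parRel P Q) := inr_mem_gdom_parRel.2 (mem_gdom.2 ⟨_, hQ1⟩)
        have htc : inr t' ∈ gcod (parRel P Q) := mem_gcod.2 ⟨_, mem_parRel_rr.2 hQ1⟩
        rcases hd : τ.disp t with b | c
        · obtain ⟨n, hn, hmir⟩ := hΘ.dom.mir (inr t) htd (by simp [hd, Hid])
          obtain ⟨s, b', rfl, h1, h2⟩ := disp_of_mir' hmir
          obtain ⟨s', hs'⟩ := mem_gdom.1 (inl_mem_gdom_parRel.1 hn)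
          obtain ⟨p, q, hpq, h3, h4⟩ := hex (inl s) (inl s')
            (mem_parRel_ll.2 hs') (fun b h => by cases h)
          refine ⟨(p, q), hpq, ?_⟩
          have hmir' := hΘ.mir _ _ _ _ (mem_parRel_ll.2 hs') (mem_parRel_rr.2 hQ1) hmir.symm
          obtain ⟨_, b'', h5, h6, h7⟩ := disp_of_mir hmir'
          cases h5
          have aux : ∀ (p : InterEv σ τ) s, p.rep = inl s → p.top.1 = inl s := by
            intro p s h
            have := p.rep_spec
            rw [h] at this
            generalize p.top = q at this
            cases this
            rfl
          exact Prod.ext (p.top_snd hτ hΘ.dom hpq.1 htd (aux p s h3) h1 h2)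
            (q.top_snd hτ hcod hpq.2.1 htc (aux q s' h4) h6 h7)
        · obtain ⟨p, q, hpq, h3, h4⟩ := hex (inr t) (inr t')
            (mem_parRel_rr.2 hQ1) (fun b h => by
              have := hd.symm.trans (Sum.inr.inj h)
              cases this)
          refine ⟨(p, q), hpq, ?_⟩
          have aux : ∀ (p : InterEv σ τ) s, p.rep = inr s → p.top.2 = inr s := by
            intro p s h
            have := p.rep_spec
            rw [h] at this
            generalize p.top = q at this
            cases this
            rfl
          exact Prod.ext (aux p t h3) (aux q t' h4)

theorem comp_sym_eq : (comp σ τ).sym =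
    (primeES (A := A) (B := B) (C := C) (parStrat σ τ) compSet compRep).sym := by
  have hPr := isPrimes_inter hσ hτ vσ vτ
  have hPc := isPrimes_comp hσ hτ vσ vτ
  have hR := hσ.par hτ
  refine Set.ext fun (θ : Set (CompEv σ τ × CompEv σ τ)) => ?_
  constructor
  · rintro ⟨hb, θ', hθ', hsub⟩
    obtain ⟨Θ, hΘ, hΘ'⟩ := exists_bal_of_interSym hσ hτ vσ vτ hθ'
    have hc : gdom θ ∈ (compES σ τ).Conf := hb.2.2.1
    rw [compES_conf_eq hσ hτ vσ vτ] at hc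
    have hsub' : ∀ p q, (p, q) ∈ θ → (p, q) ∈ cfgSym compSet compRep Θ :=
      fun p q h => hΘ' (hsub ⟨(p, q), h, rfl⟩)
    have hgen : gen compSet (gdom θ) ⊆ gdom Θ := by
      rintro a ⟨p, hp, ha⟩
      obtain ⟨q, hpq⟩ := mem_gdom.1 hp
      exact (hsub' p q hpq).1 ha
    refine ⟨_, hΘ.restrict hR (hPc.gen_state hc) hgen, ?_⟩
    have e := hPc.cfgSym_restrict hR hΘ hgen
    rw [hPc.cfg_gen hc] at e
    refine Eq.trans ?_ e.symm
    ext ⟨p, q⟩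
    refine ⟨fun h => ⟨hsub' p q h, mem_gdom.2 ⟨q, h⟩⟩, ?_⟩
    rintro ⟨h1, h2⟩
    obtain ⟨q', h3⟩ := mem_gdom.1 h2
    rwa [(hPc.cfgSym_bij hR hΘ).inj₁ h1 (hsub' p q' h3)]
  · rintro ⟨Θ, hΘ, rfl⟩
    have hb := hPc.cfgSym_bij hR hΘ
    refine ⟨⟨hb.1, hb.2.1, ?_, ?_⟩, _, interSym_of_bal hσ hτ vσ vτ hΘ, ?_⟩
    · rw [compES_conf_eq hσ hτ vσ vτ]; exact hb.2.2.1
    · rw [compES_conf_eq hσ hτ vσ vτ]; exact hb.2.2.2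
    · rintro _ ⟨⟨p, q⟩, h, rfl⟩
      exact h

theorem comp_eq : comp σ τ =
    ⟨primeES (A := A) (B := B) (C := C) (parStrat σ τ) compSet compRep, (comp σ τ).disp⟩ := by
  have h1 : (comp σ τ).le =
      (primeES (A := A) (B := B) (C := C) (parStrat σ τ) compSet compRep).le := by
    funext p q
    exact propext pairSet_subset.symm
  have h2 : (comp σ τ).conflict =
      (primeES (A := A) (B := B) (C := C) (parStrat σ τ) compSet compRep).conflict := by
    funext p q
    refine propext (not_congr ?_)
    rw [causallyCompatible_iff hσ hτ vσ vτ, pairSet_union]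
    rfl
  exact congrArg₂ (fun (f : CompEv σ τ → CompEv σ τ → Prop) (g : (CompEv σ τ → CompEv σ τ → Prop) ×
    Set (Set (CompEv σ τ × CompEv σ τ))) =>
      (⟨⟨CompEv σ τ, f, g.1, g.2⟩, (comp σ τ).disp⟩ : Strat A.toGame C.toGame))
    h1 (congrArg₂ Prod.mk h2 (comp_sym_eq hσ hτ vσ vτ))

omit hσ hτ vσ vτ in
theorem comp_disp (p : CompEv σ τ) :
    Sum.map inl inr ((comp σ τ).disp p) = (parStrat σ τ).disp (compRep p) :=
  (visDisp_eq_some.1 (Option.some_get p.2).symm).symm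

end Composition

/-! ## The strategy of primes -/

section Outer

variable {A B C : Game.{u}}

/-- The inclusion of the outer arenas in the interaction game. -/
def outer : (A.hom C).ev → (mid A B C).ev := Sum.map inl inr

theorem outer_inj : Function.Injective (outer (A := A) (B := B) (C := C)) :=
  Sum.map_injective.2 ⟨Sum.inl_injective, Sum.inr_injective⟩

theorem not_hid_outer {g : (A.hom C).ev} : ¬ Hid (outer (B := B) g) := by
  rcases g with g | g <;> exact id

theorem outer_le {g h : (A.hom C).ev} :
    (mid A B C).le (outer g) (outer h) ↔ (A.hom C).le g h := by
  rcases g with g | g <;> rcases h with h | h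
  · exact ESS.par_le_ll.trans (ESS.par_le_ll.trans ESS.par_le_ll.symm)
  · exact ESS.par_le_lr.trans ESS.par_le_lr.symm
  · exact ESS.par_le_rl.trans ESS.par_le_rl.symm
  · exact ESS.par_le_rr.trans (ESS.par_le_rr.trans ESS.par_le_rr.symm)

theorem exists_outer_of_le {g : (mid A B C).ev} {h : (A.hom C).ev}
    (hgh : (mid A B C).le g (outer h)) : ∃ g', outer g' = g ∧ (A.hom C).le g' h := by
  have : ∃ g', outer g' = g := by
    rcases h with h | h
    · rcases hgh with ⟨h | h⟩
      exact ⟨inl _, rfl⟩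
    · rcases hgh with _ | ⟨_ | h⟩
      exact ⟨inr _, rfl⟩
  obtain ⟨g', rfl⟩ := this
  exact ⟨g', rfl, outer_le.1 hgh⟩

theorem outer_conflict {g h : (A.hom C).ev} :
    (mid A B C).conflict (outer g) (outer h) ↔ (A.hom C).conflict g h := by
  rcases g with g | g <;> rcases h with h | h
  · exact Sum.liftRel_inl_inl.trans (Sum.liftRel_inl_inl.trans Sum.liftRel_inl_inl.symm)
  · exact iff_of_false Sum.not_liftRel_inl_inr Sum.not_liftRel_inl_inr
  · exact iff_of_false Sum.not_liftRel_inr_inl Sum.not_liftRel_inr_inl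
  · exact Sum.liftRel_inr_inr.trans (Sum.liftRel_inr_inr.trans Sum.liftRel_inr_inr.symm)

theorem exists_outer_of_conflict {g : (mid A B C).ev} {h : (A.hom C).ev}
    (hgh : (mid A B C).conflict g (outer h)) : ∃ g', outer g' = g := by
  rcases h with h | h
  · rcases hgh with ⟨h | h⟩
    exact ⟨inl _, rfl⟩
  · rcases hgh with _ | ⟨_ | h⟩
    exact ⟨inr _, rfl⟩

theorem outer_imm {g h : (A.hom C).ev} :
    (mid A B C).imm (outer g) (outer h) ↔ (A.hom C).imm g h := by
  rcases g with g | g <;> rcases h with h | h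
  · exact ESS.par_imm_ll.trans (ESS.par_imm_ll.trans ESS.par_imm_ll.symm)
  · exact ESS.par_imm_lr.trans ESS.par_imm_lr.symm
  · exact ESS.par_imm_rl.trans ESS.par_imm_rl.symm
  · exact ESS.par_imm_rr.trans (ESS.par_imm_rr.trans ESS.par_imm_rr.symm)

theorem outer_pol (g : (A.hom C).ev) : (mid A B C).pol (outer g) = (A.hom C).pol g := by
  rcases g with g | g <;> rfl

theorem preimage_outer_conf {x : Set (mid A B C).ev} (hx : x ∈ (mid A B C).Conf) :
    outer ⁻¹' x ∈ (A.hom C).Conf :=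
  ⟨hx.1.preimage outer_inj.injOn, fun _ he _ hl => hx.2.1 _ he _ (outer_le.2 hl),
    fun _ he _ he' hc => hx.2.2 _ he _ he' (outer_conflict.2 hc)⟩

/-- The part of a symmetry on the outer arenas. -/
theorem preimage_outer_sym {φ : Set ((mid A B C).ev × (mid A B C).ev)}
    (hφ : φ ∈ (mid A B C).sym) :
    {p : (A.hom C).ev × (A.hom C).ev | (outer p.1, outer p.2) ∈ φ} ∈ (A.hom C).sym := by
  obtain ⟨_, ⟨PA, hPA, PB, hPB, rfl⟩, _, ⟨QB, hQB, QC, hQC, rfl⟩, rfl⟩ := hφ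
  refine ⟨PA, hPA, QC, hQC, ?_⟩
  apply rel_ext <;> simp [outer]

/-- A symmetry can be extended on the outer arenas if its part there can. -/
theorem insert_outer_sym {φ : Set ((mid A B C).ev × (mid A B C).ev)} {g h : (A.hom C).ev}
    (hφ : φ ∈ (mid A B C).sym)
    (hi : insert (g, h) {p : (A.hom C).ev × (A.hom C).ev | (outer p.1, outer p.2) ∈ φ} ∈
      (A.hom C).sym) : insert (outer g, outer h) φ ∈ (mid A B C).sym := by
  obtain ⟨_, ⟨PA, hPA, PB, hPB, rfl⟩, _, ⟨QB, hQB, QC, hQC, rfl⟩, rfl⟩ := hφ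
  have : {p : (A.hom C).ev × (A.hom C).ev | (outer p.1, outer p.2) ∈
      parRel (parRel PA PB) (parRel QB QC)} = parRel PA QC := by
    apply rel_ext <;> simp [outer]
  rw [this] at hi
  rcases g with g | g <;> rcases h with h | h
  · rw [insert_inl_parRel] at hi
    have h1 := (parRel_mem_parFam.1 hi).1
    change insert (inl (inl g), inl (inl h)) _ ∈ _
    rw [insert_inl_parRel, insert_inl_parRel]
    exact ⟨_, ⟨_, h1, PB, hPB, rfl⟩, _, ⟨QB, hQB, QC, hQC, rfl⟩, rfl⟩
  · obtain ⟨P, -, Q, -, h⟩ := hi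
    exact (mem_parRel_lr.1 (h ▸ Set.mem_insert _ _)).elim
  · obtain ⟨P, -, Q, -, h⟩ := hi
    exact (mem_parRel_rl.1 (h ▸ Set.mem_insert _ _)).elim
  · rw [insert_inr_parRel] at hi
    have h1 := (parRel_mem_parFam.1 hi).2
    change insert (inr (inr g), inr (inr h)) _ ∈ _
    rw [insert_inr_parRel, insert_inr_parRel]
    exact ⟨_, ⟨PA, hPA, PB, hPB, rfl⟩, _, ⟨QB, hQB, _, h1, rfl⟩, rfl⟩

end Outer

theorem eq_of_mem_diagonal {X : Type u} {a b : X} (h : (a, b) ∈ Set.diagonal X) : a = b := h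

section Roots

variable {A B C : NegArena.{u}} {R : PreStrat (arenaMid A B C)} {x : Set R.ev}

theorem IsPointedStrategy.disp_min {G : Game.{u}} {ρ : PreStrat G} (h : IsPointedStrategy ρ)
    {m : ρ.ev} (hm : ρ.IsMinEv m) (g : G.ev) : ¬ G.lt g (ρ.disp m) := by
  intro hg
  obtain ⟨s, hs, -⟩ := h.exists_lt_of_disp hg
  exact hs.2 (hm s hs.1)

/-- An initial event is either an initial event of the right arena, or one of the middle arena that
is played by the left strategy. -/
theorem IsInter.min_cases (hR : IsInter R) {m : R.ev} (hm : R.IsMinEv m) :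
    (∃ c, R.disp m = inr (inr c)) ∨ ∃ b, R.disp m = inl (inr b) := by
  have hneg := hR.pointed.negative m hm
  have hlt := hR.pointed.disp_min hm
  generalize R.disp m = g at *
  rcases g with (a | b) | (b | c)
  · exfalso
    have ha : A.IsMinEv a := by
      by_contra ha
      obtain ⟨c, hc⟩ := A.preArena.isES.exists_imm_of_not_min ha
      exact hlt _ (ESS.par_lt_ll.2 (ESS.par_lt_ll.2 hc.1))
    have h1 : (A.pol a).flip = Pol.neg := hneg
    rw [A.negative a ha] at h1
    cases h1
  · exact Or.inr ⟨b, rfl⟩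
  · obtain ⟨b, h⟩ := hid_neg_min (A := A) (C := C) (g := inr (inl b)) trivial (fun g' h => hlt g' h.1) hneg
    cases h
  · exact Or.inl ⟨c, rfl⟩

/-- Below an event of the middle arena, there is an event displayed by the root of its display. It
is initial if it is played by the left strategy. -/
theorem IsInter.exists_root (hR : IsInter R) {n : R.ev} {b : B.ev}
    (hn : R.disp n = inl (inr b)) : ∃ n₀ b₀, R.IsMinEv n₀ ∧ R.le n₀ n ∧
      R.disp n₀ = inl (inr b₀) ∧ B.le b₀ b := by
  obtain ⟨b₀, hb₀, hle⟩ := B.preArena.isES.exists_min_le b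
  obtain ⟨n₀, hn₀, hd⟩ := (hR.pointed.rule_abiding _ (hR.pointed.isES.down_conf n)).2.1 _
    ⟨n, hR.pointed.isES.le_refl n, rfl⟩ (inl (inr b₀))
    (by rw [hn]; exact ESS.par_le_ll.2 (ESS.par_le_rr.2 hle))
  refine ⟨n₀, b₀, ?_, hn₀, hd, hle⟩
  by_contra hmin
  obtain ⟨j, hj⟩ := hR.pointed.isES.exists_imm_of_not_min hmin
  have h1 := hR.pointed.courteous j n₀ hj (Or.inr (by rw [hd]; exact B.negative b₀ hb₀))
  rw [hd] at h1
  obtain ⟨c, -, hc⟩ := mid_imm_left h1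
  exact ESS.not_min_of_imm hc hb₀

/-- The events of a state that depend on a given initial event. -/
def rootPart (R : PreStrat (arenaMid A B C)) (x : Set R.ev) (m : R.ev) :
    Set R.ev :=
  {n ∈ x | R.le m n ∨ ∃ n₀, R.le n₀ n ∧ R.IsMinEv n₀ ∧ ∃ n₁ ∈ x,
    Mir (Set.diagonal B.ev) (R.disp n₀) (R.disp n₁) ∧ R.le m n₁}

theorem IsInter.le_of_min (hR : IsInter R) {m n n' : R.ev} (hm : R.IsMinEv m)
    (hmn : R.le m n) (h : R.le n' n) : R.le m n' := by
  obtain ⟨m', h1, h2⟩ := hR.pointed.isES.exists_min_le n'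
  rwa [(hR.pointed.pointed n).unique ⟨hm, hmn⟩ ⟨h1, hR.pointed.isES.le_trans _ _ _ h2 h⟩]

theorem rootPart_state (hR : IsInter R) (hx : State R (Set.diagonal B.ev) x) {m : R.ev} {c : C.ev}
    (hm : R.IsMinEv m) (hc : R.disp m = inr (inr c)) :
    State R (Set.diagonal B.ev) (rootPart R x m) := by
  have hle := hR.pointed.isES.le_trans
  refine ⟨ESS.conf_of_subset hx.conf (fun n h => h.1) ?_, ?_⟩
  · rintro n ⟨hn, h⟩ n' hl
    refine ⟨hx.conf.2.1 n hn n' hl.1, h.imp (hR.le_of_min hm · hl.1) ?_⟩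
    rintro ⟨n₀, h1, h2, h3⟩
    exact ⟨n₀, hR.le_of_min h2 h1 hl.1, h2, h3⟩
  · rintro n ⟨hn, h⟩ hh
    obtain ⟨n', hn', hmir⟩ := hx.mir n hn hh
    refine ⟨n', ⟨hn', ?_⟩, hmir⟩
    generalize hg : R.disp n = g at hmir
    generalize hg' : R.disp n' = g' at hmir
    have key : ∀ n n' b, n ∈ x → n' ∈ x → R.disp n = inl (inr b) →
        R.disp n' = inr (inl b) → ∃ n₀, R.le n₀ n ∧ R.IsMinEv n₀ ∧ ∃ n₁ ∈ x,
        Mir (Set.diagonal B.ev) (R.disp n₀) (R.disp n₁) ∧ R.le n₁ n' := by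
      intro n n' b hn hn' h1 h2
      obtain ⟨n₀, b₀, h3, h4, h5, h6⟩ := hR.exists_root h1
      obtain ⟨n₁, h7, h8⟩ := hx.mir n₀ (hx.conf.2.1 n hn n₀ h4) (by rw [h5]; trivial)
      refine ⟨n₀, h4, h3, n₁, h7, h8, hR.pointed.le_of_disp_le hx.conf h7 hn' ?_⟩
      rw [h5] at h8
      generalize hk : R.disp n₁ = k at h8
      cases h8 with
      | lr h =>
        obtain rfl := eq_of_mem_diagonal h
        rw [h2]
        exact ESS.par_le_rr.2 (ESS.par_le_ll.2 h6)
    rcases h with h | ⟨n₀, h1, h2, n₁, h3, h4, h5⟩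
    · have hs := hR.side _ _ h
      rw [hc] at hs
      cases hmir with
      | lr hb => rw [hg] at hs; cases hs
      | rl hb =>
        obtain rfl := eq_of_mem_diagonal hb
        obtain ⟨n₀, h1, h2, n₁, h3, h4, h5⟩ := key n' n _ hn' hn hg' hg
        exact Or.inr ⟨n₀, h1, h2, n₁, h3, h4, hR.le_of_min hm h h5⟩
    · have hs := hR.side _ _ h1
      rcases hR.min_cases h2 with ⟨c', hc'⟩ | ⟨b', hb'⟩
      · rw [hc'] at h4; exact h4.hid.elim
      rw [hb'] at hs
      cases hmir with
      | lr hb =>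
        obtain rfl := eq_of_mem_diagonal hb
        obtain ⟨n₂, h6, h7, n₃, h8, h9, h10⟩ := key n n' _ hn hn' hg hg'
        obtain rfl := (hR.pointed.pointed n).unique ⟨h2, h1⟩ ⟨h7, h6⟩
        obtain rfl := hR.pointed.mir_unique (isMirror_diag _) hx.conf h3 h8 h4 h9
        exact Or.inl (hle _ _ _ h5 h10)
      | rl hb => rw [hg] at hs; cases hs

theorem exists_rootPart (hR : IsInter R) (hx : State R (Set.diagonal B.ev) x) {n : R.ev}
    (hn : n ∈ x) : ∃ m c, R.IsMinEv m ∧ R.disp m = inr (inr c) ∧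
      n ∈ rootPart R x m := by
  have key : ∀ n ∈ x, (R.disp n).isLeft = false →
      ∃ m c, R.IsMinEv m ∧ R.disp m = inr (inr c) ∧ R.le m n := by
    intro n hn hl
    obtain ⟨m, h1, h2⟩ := hR.pointed.isES.exists_min_le n
    rcases hR.min_cases h1 with ⟨c, hc⟩ | ⟨b, hb⟩
    · exact ⟨m, c, h1, hc, h2⟩
    · have hs := hR.side _ _ h2
      rw [hb, hl] at hs
      cases hs
  obtain ⟨m, h1, h2⟩ := hR.pointed.isES.exists_min_le n
  rcases hR.min_cases h1 with ⟨c, hc⟩ | ⟨b, hb⟩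
  · exact ⟨m, c, h1, hc, hn, Or.inl h2⟩
  · obtain ⟨n₁, h3, h4⟩ := hx.mir m (hx.conf.2.1 n hn m h2) (by rw [hb]; trivial)
    obtain ⟨m', c, h5, h6, h7⟩ := key n₁ h3 (by
      rw [hb] at h4
      generalize R.disp n₁ = g at h4
      cases h4
      rfl)
    exact ⟨m', c, h5, h6, hn, Or.inr ⟨m, h2, h1, n₁, h3, h4, h7⟩⟩

theorem eq_of_mem_rootPart {m m' : R.ev} (hm' : R.IsMinEv m')
    (hv : ¬ Hid (R.disp m')) (h : m' ∈ rootPart R x m) : m = m' := by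
  rcases h with ⟨-, h | ⟨n₀, h1, h2, n₁, h3, h4, h5⟩⟩
  · exact hm' _ h
  · obtain rfl := hm' _ h1
    exact (hv h4.hid).elim

end Roots

section CompP

variable {A B C : NegArena.{u}} {R : PreStrat (arenaMid A B C)}
  {P : Type u} {D : P → Set R.ev} {tp : P → R.ev} {f : P → (A.hom C.toGame).ev}

/-- The strategy of primes. -/
@[reducible] def primeStrat (R : PreStrat (arenaMid A B C)) (D : P → Set R.ev)
    (tp : P → R.ev) (f : P → (A.hom C.toGame).ev) : Strat A.toGame C.toGame where
  toESS := primeES R D tp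
  disp := f

variable {Θ Θ' : Set (R.ev × R.ev)} {x : Set P} {y : Set R.ev}

namespace IsPrimes

variable (h : IsPrimes R D tp (visV R)) (hR : IsInter R)
include h hR

theorem bal_eq (hΘ : Bal R (Set.diagonal B.ev) Θ) (hΘ' : Bal R (Set.diagonal B.ev) Θ')
    (hd : gdom Θ = gdom Θ') (hs : ∀ p q, (p, q) ∈ cfgSym D tp Θ →
      (arenaMid A B C).pol (R.disp (tp p)) = Pol.neg → ∃ q', (p, q') ∈ cfgSym D tp Θ'
        ∧ tp q = tp q') : Θ = Θ' := by
  refine hΘ.unique hR (isMirror_diag _) hΘ' hd fun m n n' hm hm' hv hpol => ?_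
  obtain ⟨p, hp, rfl⟩ := h.exists_mem_cfg hΘ.dom (mem_gdom.2 ⟨n, hm⟩) hv
  rw [← h.gdom_cfgSym hR.pointed hΘ] at hp
  obtain ⟨q, hq⟩ := mem_gdom.1 hp
  obtain ⟨q', hq', he⟩ := hs p q hq hpol
  rw [(hR.pointed.isoFamily.bij _ hΘ.sym).inj₁ hm hq.2.2, he]
  exact (hR.pointed.isoFamily.bij _ hΘ'.sym).inj₁ hq'.2.2 hm'

/-- A negative prime adds a single event to a state. -/
theorem neg_state {p : P} (hx : x ∈ (primeES R D tp).Conf)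
    (hpx : insert p x ∈ (primeES R D tp).Conf)
    (hneg : (arenaMid A B C).pol (R.disp (tp p)) = Pol.neg) :
    State R (Set.diagonal B.ev) (insert (tp p) (gen D x)) ∧ D p ⊆ insert (tp p) (gen D x) := by
  have hg := h.gen_state hx
  have hz := h.gen_state hpx
  have hpz : D p ⊆ gen D (insert p x) := fun a ha => ⟨p, Or.inl rfl, ha⟩
  have hxz : gen D x ⊆ gen D (insert p x) := fun a ⟨q, hq, ha⟩ => ⟨q, Or.inr hq, ha⟩
  have hsub : insert (tp p) (gen D x) ⊆ gen D (insert p x) :=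
    Set.insert_subset (hpz (h.tp_mem p)) hxz
  have hst : State R (Set.diagonal B.ev) (insert (tp p) (gen D x)) := by
    refine hg.insert_vis (h.tp_V p) (ESS.conf_of_subset hz.conf hsub ?_)
    rintro a (rfl | ha) b hb
    · refine Or.inr ?_
      obtain ⟨j, h1, h2, h3⟩ := hR.pointed.exists_imm_of_neg hb hneg
      have hj : j ∈ D p := (h.state p).conf.2.1 _ (h.tp_mem p) j h2.1.1
      obtain ⟨q, hq, rfl⟩ := h.exists_mem_cfg (h.state p) hj (fun hh => h.tp_V p
        ((hid_of_imm h3).1 hh))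
      rcases hpx.2.1 p (Or.inl rfl) q hq with rfl | hq'
      · exact (h2.1.2 rfl).elim
      · exact hg.conf.2.1 _ ⟨q, hq', h.tp_mem q⟩ b h1
    · exact Or.inr (hg.conf.2.1 a ha b hb.1)
  exact ⟨hst, h.least p _ _ hst hz hsub hpz (Or.inl rfl)⟩

omit hR in
theorem cfg_insert {p : P} (hx : x ∈ (primeES R D tp).Conf)
    (hst : State R (Set.diagonal B.ev) (insert (tp p) (gen D x)))
    (hp : D p ⊆ insert (tp p) (gen D x)) : cfg D (insert (tp p) (gen D x)) = insert p x := by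
  ext q
  constructor
  · intro hq
    rcases hq (h.tp_mem q) with h1 | ⟨q', hq', h1⟩
    · exact Or.inl (h.tp_inj hst hq hp h1)
    · refine Or.inr (hx.2.1 q' hq' q (h.le_of_mem hst hq ?_ h1))
      exact (subset_gen hq').trans (Set.subset_insert _ _)
  · rintro (rfl | hq)
    · exact hp
    · exact (subset_gen hq).trans (Set.subset_insert _ _)

omit hR in
theorem lt_tp {p q : P} (hpq : (primeES R D tp).lt p q) : tp p ≠ tp q := by
  intro he
  exact hpq.2 (h.tp_inj (h.state q) hpq.1 subset_rfl he)

/-- Initial primes consist of a single initial event. -/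
theorem min_prime {p : P} (hp : (primeES R D tp).IsMinEv p) :
    R.IsMinEv (tp p) ∧ D p = {tp p} := by
  obtain ⟨m, c, h1, h2, h3⟩ := exists_rootPart hR (h.state p) (h.tp_mem p)
  have h4 := rootPart_state hR (h.state p) h1 h2
  have h5 := h.least p _ _ h4 (h.state p) (fun _ h => h.1) subset_rfl h3
  have hmD : m ∈ D p := by
    rcases h3 with ⟨-, h3 | ⟨n₀, h6, h7, n₁, h8, h9, h10⟩⟩
    · exact (h.state p).conf.2.1 _ (h.tp_mem p) m h3
    · exact (h.state p).conf.2.1 _ h8 m h10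
  have hmV : m ∈ visV R := by
    change ¬ Hid (R.disp m)
    rw [h2]; exact id
  obtain ⟨q, hq, rfl⟩ := h.exists_mem_cfg (h.state p) hmD hmV
  obtain rfl := hp q hq
  refine ⟨h1, ?_⟩
  refine subset_antisymm (h.least q {tp q} _ ⟨?_, ?_⟩ (h.state q) ?_ subset_rfl rfl) ?_
  · refine ESS.conf_of_subset (h.state q).conf (by simpa using h.tp_mem q) ?_
    rintro a rfl b hb
    exact (hb.2 (h1 b hb.1)).elim
  · rintro a rfl hh
    exact (h.tp_V q hh).elim
  · simpa using h.tp_mem q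
  · simpa using h.tp_mem q

variable (hf : ∀ p, outer (f p) = R.disp (tp p))
include hf

omit h hR in
theorem pol_eq (p : P) : (A.hom C.toGame).pol (f p) =
    (arenaMid A B C).pol (R.disp (tp p)) := by
  rw [← hf, outer_pol]

omit hR in
theorem image_cfg (hy : State R (Set.diagonal B.ev) y) :
    f '' cfg D y = outer ⁻¹' (R.disp '' y) := by
  ext g
  constructor
  · rintro ⟨p, hp, rfl⟩
    exact ⟨tp p, hp (h.tp_mem p), (hf p).symm⟩
  · rintro ⟨m, hm, hg⟩
    obtain ⟨p, hp, rfl⟩ := h.exists_mem_cfg hy hm (fun hh => not_hid_outer (by rwa [← hg]))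
    exact ⟨p, hp, outer_inj ((hf p).trans hg)⟩

theorem image_cfgSym (hΘ : Bal R (Set.diagonal B.ev) Θ) :
    Prod.map f f '' cfgSym D tp Θ =
      {p | (outer p.1, outer p.2) ∈ Prod.map R.disp R.disp '' Θ} := by
  ext ⟨g, g'⟩
  constructor
  · rintro ⟨⟨p, q⟩, hpq, he⟩
    obtain ⟨rfl, rfl⟩ := Prod.mk.inj he
    exact ⟨_, hpq.2.2, Prod.ext (hf p).symm (hf q).symm⟩
  · rintro ⟨⟨m, n⟩, hm, he⟩
    obtain ⟨h1, h2⟩ := Prod.mk.inj he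
    obtain ⟨p, hp, rfl⟩ := h.exists_mem_cfg hΘ.dom (mem_gdom.2 ⟨_, hm⟩)
      (fun hh => not_hid_outer (by rwa [← h1]))
    rw [← h.gdom_cfgSym hR.pointed hΘ] at hp
    obtain ⟨q, hq⟩ := mem_gdom.1 hp
    obtain rfl := (hR.pointed.isoFamily.bij _ hΘ.sym).inj₁ hm hq.2.2
    exact ⟨(p, q), hq, Prod.ext (outer_inj ((hf p).trans h1)) (outer_inj ((hf q).trans h2))⟩

omit hR in
theorem prime_rule_abiding (hx : x ∈ (primeES R D tp).Conf) (hR : IsPointedStrategy R) :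
    f '' x ∈ (A.hom C.toGame).Conf := by
  rw [← h.cfg_gen hx, h.image_cfg hf (h.gen_state hx)]
  exact preimage_outer_conf (hR.rule_abiding _ (h.gen_state hx).conf)

omit hR in
theorem prime_inj (hR : IsPointedStrategy R) (hx : x ∈ (primeES R D tp).Conf) :
    Set.InjOn f x := by
  intro p hp q hq he
  refine h.tp_inj (h.gen_state hx) (subset_gen hp) (subset_gen hq)
    (hR.locally_injective _ (h.gen_state hx).conf ⟨p, hp, h.tp_mem p⟩ ⟨q, hq, h.tp_mem q⟩ ?_)
  rw [← hf, ← hf, he]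

omit f hf in
/-- An extension of a symmetry of primes. -/
theorem exists_insert {p : P} (hΘ : Bal R (Set.diagonal B.ev) Θ)
    (hΘ' : Bal R (Set.diagonal B.ev) Θ') (hsub : Θ ⊆ Θ')
    (hd : cfg D (gdom Θ') = insert p (cfg D (gdom Θ))) :
    ∃ q, (p, q) ∈ cfgSym D tp Θ' ∧ cfgSym D tp Θ' = insert (p, q) (cfgSym D tp Θ) := by
  have h1 : p ∈ gdom (cfgSym D tp Θ') := by
    rw [h.gdom_cfgSym hR.pointed hΘ', hd]; exact Or.inl rfl
  obtain ⟨q, hq⟩ := mem_gdom.1 h1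
  have hs : cfgSym D tp Θ ⊆ cfgSym D tp Θ' := fun r hr =>
    ⟨hr.1.trans (gdom_mono hsub), hr.2.1.trans (gcod_mono hsub), hsub hr.2.2⟩
  refine ⟨q, hq, subset_antisymm ?_ (Set.insert_subset hq hs)⟩
  rintro ⟨a, b⟩ hab
  have ha : a ∈ gdom (cfgSym D tp Θ') := mem_gdom.2 ⟨b, hab⟩
  have hb := h.cfgSym_bij hR.pointed hΘ'
  rw [h.gdom_cfgSym hR.pointed hΘ', hd] at ha
  rcases ha with rfl | ha
  · rw [hb.inj₁ hab hq]; exact Or.inl rfl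
  · rw [← h.gdom_cfgSym hR.pointed hΘ] at ha
    obtain ⟨b', hb'⟩ := mem_gdom.1 ha
    rw [hb.inj₁ hab (hs hb')]
    exact Or.inr hb'

omit f hf in
/-- A symmetry of primes comes from a symmetry on the generated state. -/
theorem exists_gen {θ : Set (P × P)} (hθ : θ ∈ (primeES R D tp).sym) :
    ∃ Θ, Bal R (Set.diagonal B.ev) Θ ∧ θ = cfgSym D tp Θ ∧ gdom Θ = gen D (gdom θ) ∧
      cfg D (gdom Θ) = gdom θ := by
  obtain ⟨Θ₀, hΘ₀, rfl⟩ := hθ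
  obtain ⟨Θ, -, h1, h2, h3⟩ := h.cfgSym_gen hR.pointed hΘ₀
  refine ⟨Θ, h1, h2.symm, ?_, ?_⟩
  · rw [h3, h.gdom_cfgSym hR.pointed hΘ₀]
  · rw [← h.gdom_cfgSym hR.pointed h1, h2]

theorem prime_thin (θ : Set (P × P)) (hθ : θ ∈ (primeES R D tp).sym) (p : P)
    (hp : (primeES R D tp).Enables (gdom θ) p)
    (hpos : (A.hom C.toGame).pol (f p) = Pol.pos) :
    ∃! q, (primeES R D tp).Enables (gcod θ) q ∧ SymEnables (primeES R D tp).sym θ (p, q) := by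
  have hiso := h.isoFamily hR
  obtain ⟨Θ, hΘ, rfl, h1, h1'⟩ := h.exists_gen hR hθ
  have hst := h.gen_state hp.2.2
  obtain ⟨Θ₁, h2, h3, h4⟩ := hΘ.extend_diag hR hst
    (by rw [h1]; exact fun a ⟨q, hq, ha⟩ => ⟨q, Or.inr hq, ha⟩)
  obtain ⟨q, hq, h5⟩ := h.exists_insert hR hΘ h3 h2 (by rw [h4, h.cfg_gen hp.2.2, h1'])
  have hnot : ∀ q, (p, q) ∉ cfgSym D tp Θ := fun q hq => hp.2.1 (mem_gdom.2 ⟨q, hq⟩)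
  refine ⟨q, ⟨hiso.enables_cod hθ (h5 ▸ ⟨_, h3, rfl⟩) hp.2.1, hnot q, h5 ▸ ⟨_, h3, rfl⟩⟩, ?_⟩
  rintro q' ⟨-, -, h6⟩
  obtain ⟨Θ₂, h7, h8, h9, h10⟩ := h.exists_gen hR h6
  rw [gdom_insert] at h9
  have : Θ₁ = Θ₂ := by
    refine h.bal_eq hR h3 h7 (h4.trans h9.symm) fun a b hab hneg => ⟨b, ?_, rfl⟩
    rw [h5] at hab
    rw [← h8]
    rcases hab with hab | hab
    · obtain ⟨rfl, rfl⟩ := Prod.mk.inj hab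
      rw [← pol_eq hf, hpos] at hneg
      cases hneg
    · exact Or.inr hab
  subst this
  rw [← h8] at hq
  rcases hq with hq | hq
  · exact (Prod.mk.inj hq).2.symm
  · exact (hnot _ hq).elim

theorem prime_sim_receptive (θ : Set (P × P)) (hθ : θ ∈ (primeES R D tp).sym) (p : P)
    (a : (A.hom C.toGame).ev) (hp : (primeES R D tp).Enables (gdom θ) p)
    (hneg : (A.hom C.toGame).pol (f p) = Pol.neg)
    (hneg' : (A.hom C.toGame).pol a = Pol.neg)
    (ha : SymEnables (A.hom C.toGame).sym (Prod.map f f '' θ) (f p, a)) :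
    ∃! q, SymEnables (primeES R D tp).sym θ (p, q) ∧ f q = a := by
  obtain ⟨Θ, hΘ, rfl, h1, h1'⟩ := h.exists_gen hR hθ
  have hnot : ∀ q, (p, q) ∉ cfgSym D tp Θ := fun q hq => hp.2.1 (mem_gdom.2 ⟨q, hq⟩)
  have hneg₁ : (arenaMid A B C).pol (R.disp (tp p)) = Pol.neg := by
    rw [← pol_eq hf, hneg]
  obtain ⟨hst, hD⟩ := h.neg_state hR hp.1 hp.2.2 hneg₁
  have hcfg := h.cfg_insert hp.1 hst hD
  rw [← h1] at hst hD hcfg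
  have hpΘ : tp p ∉ gdom Θ := by
    intro hm
    refine hp.2.1 ?_
    rw [← h1', ← Set.insert_eq_of_mem hm, hcfg]
    exact Or.inl rfl
  have hen : R.Enables (gdom Θ) (tp p) := ⟨hΘ.dom.conf, hpΘ, hst.conf⟩
  rw [h.image_cfgSym hR hf hΘ] at ha
  have hmid := insert_outer_sym (hR.pointed.sym_preserving _ hΘ.sym) ha.2
  rw [hf] at hmid
  have huniq := hR.pointed.sim_receptive _ hΘ.sym (tp p) (outer a) hen hneg₁
    (by rw [outer_pol, hneg']) ⟨hR.pointed.not_mem_disp hen _, hmid⟩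
  obtain ⟨n, ⟨hn', hn⟩, hna⟩ := huniq.exists
  have hvis : ∀ m m', Mir (Set.diagonal B.ev) (R.disp m) (R.disp m') → m ≠ tp p ∧ m' ≠ tp p := by
    intro m m' hm
    exact ⟨by rintro rfl; exact h.tp_V p hm.hid, by rintro rfl; exact h.tp_V p hm.hid'⟩
  have hB₁ : Bal R (Set.diagonal B.ev) (insert (tp p, n) Θ) := by
    refine ⟨hn, by rw [gdom_insert]; exact hst, ?_⟩
    rintro m k m' k' (h2 | h2) (h3 | h3) hm
    · exact ((hvis _ _ hm).1 (Prod.mk.inj h2).1).elim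
    · exact ((hvis _ _ hm).1 (Prod.mk.inj h2).1).elim
    · exact ((hvis _ _ hm).2 (Prod.mk.inj h3).1).elim
    · exact hΘ.mir _ _ _ _ h2 h3 hm
  obtain ⟨q, hq, h2⟩ := h.exists_insert hR hΘ hB₁ (Set.subset_insert _ _)
    (by rw [gdom_insert, hcfg, h1'])
  have hqn : tp q = n := (hR.pointed.isoFamily.bij _ hn).inj₁ hq.2.2 (Or.inl rfl)
  refine ⟨q, ⟨⟨hnot q, h2 ▸ ⟨_, hB₁, rfl⟩⟩, outer_inj ((hf q).trans (hqn ▸ hna))⟩, ?_⟩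
  rintro q' ⟨⟨-, h3⟩, hqa⟩
  obtain ⟨Θ₂, h4, h5, h6, h7⟩ := h.exists_gen hR h3
  have hpq' : (p, q') ∈ cfgSym D tp Θ₂ := h5 ▸ Or.inl rfl
  have hdom₂ : gdom Θ₂ = insert (tp p) (gdom Θ) := by
    rw [h6, gdom_insert]
    apply subset_antisymm
    · rintro e ⟨r, rfl | hr, he⟩
      · exact hD he
      · rw [h1]; exact Or.inr ⟨r, hr, he⟩
    · rintro e (rfl | he)
      · exact ⟨p, Or.inl rfl, h.tp_mem p⟩
      · rw [h1] at he
        obtain ⟨r, hr, he⟩ := he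
        exact ⟨r, Or.inr hr, he⟩
  have hsub : gdom Θ ⊆ gdom Θ₂ := by rw [hdom₂]; exact Set.subset_insert _ _
  have h8 : Θ = {r ∈ Θ₂ | r.1 ∈ gdom Θ} := by
    refine h.bal_eq hR hΘ (h4.restrict hR.pointed hΘ.dom hsub) (gdom_restrict hsub).symm
      fun r r' hr _ => ⟨r', ?_, rfl⟩
    rw [h.cfgSym_restrict hR.pointed h4 hsub, ← h5]
    exact ⟨Or.inr hr, hr.1⟩
  have h9 : Θ₂ = insert (tp p, tp q') Θ := by
    rw [h8, ← (hR.pointed.isoFamily.bij _ h4.sym).restrict_insert hpq'.2.2, ← hdom₂]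
    ext ⟨r, r'⟩
    exact ⟨fun hr => ⟨hr, mem_gdom.2 ⟨_, hr⟩⟩, fun hr => hr.1⟩
  have h10 : tp q' = n := huniq.unique ⟨⟨fun hm => hpΘ (mem_gdom.2 ⟨_, hm⟩), h9 ▸ h4.sym⟩,
    by rw [← hf, hqa]⟩ ⟨⟨hn', hn⟩, hna⟩
  rw [h9, h10] at hpq'
  exact (h.cfgSym_bij hR.pointed hB₁).inj₁ hpq' hq

theorem isPointed : IsPointedStrategy (primeStrat R D tp f) where
  isES := h.isES hR.pointed
  isoFamily := h.isoFamily hR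
  rule_abiding x hx := h.prime_rule_abiding hf hx hR.pointed
  locally_injective x hx := h.prime_inj hf hR.pointed hx
  sym_preserving := by
    rintro _ ⟨Θ, hΘ, rfl⟩
    rw [h.image_cfgSym hR hf hΘ]
    exact preimage_outer_sym (hR.pointed.sym_preserving _ hΘ.sym)
  sim_receptive := h.prime_sim_receptive hR hf
  thin := h.prime_thin hR hf
  negative p hp := by
    change (A.hom C.toGame).pol (f p) = _
    rw [pol_eq hf]
    exact hR.pointed.negative _ (h.min_prime hR hp).1
  courteous := by
    intro p₁ p₂ hi hpol
    change (A.hom C.toGame).imm (f p₁) (f p₂)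
    rw [← outer_imm (B := B.toGame), hf, hf]
    by_cases hpol₁ : (A.hom C.toGame).pol (f p₁) = Pol.pos
    · rw [pol_eq hf] at hpol₁
      by_cases hex : ∃ n ∈ D p₂, R.lt (tp p₁) n
      · obtain ⟨n, hn, hl⟩ := hex
        obtain ⟨n, hn, hl, hmin⟩ := hR.pointed.isES.exists_minimal
          (fun n => R.lt (tp p₁) n) ⟨n, hn, hl⟩
        have himm : R.imm (tp p₁) n := ⟨hl, fun d hd =>
          hmin d ((h.state p₂).conf.2.1 n hn d hd.2.1) hd.2 hd.1⟩
        have hg := hR.pointed.courteous _ _ himm (Or.inl hpol₁)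
        obtain ⟨q, hq, rfl⟩ := h.exists_mem_cfg (h.state p₂) hn (fun hh => h.tp_V p₁
          ((hid_of_imm hg).2 hh))
        have h1 : D p₁ ⊆ D q := h.le_of_mem (h.state p₂) hi.1.1 hq
          ((h.state q).conf.2.1 _ (h.tp_mem q) _ hl.1)
        by_cases hqp : q = p₂
        · rwa [← hqp]
        · exact (hi.2 q ⟨⟨h1, by rintro rfl; exact hl.2 rfl⟩, hq, hqp⟩).elim
      · exfalso
        have hne := h.lt_tp hi.1
        have h1 : State R (Set.diagonal B.ev) (D p₂ \ {tp p₁}) := by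
          refine ⟨ESS.conf_of_subset (h.state p₂).conf Set.sdiff_subset ?_, ?_⟩
          · rintro e ⟨he, -⟩ e' hl
            refine ⟨(h.state p₂).conf.2.1 e he e' hl.1, ?_⟩
            rintro rfl
            exact hex ⟨e, he, hl⟩
          · rintro e ⟨he, -⟩ hh
            obtain ⟨e', he', hm⟩ := (h.state p₂).mir e he hh
            refine ⟨e', ⟨he', ?_⟩, hm⟩
            rintro rfl
            exact h.tp_V p₁ hm.hid'
        have h2 := h.least p₂ _ _ h1 (h.state p₂) Set.sdiff_subset subset_rfl
          ⟨h.tp_mem p₂, fun he => hne he.symm⟩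
        exact (h2 (hi.1.1 (h.tp_mem p₁))).2 rfl
    · have hneg : (arenaMid A B C).pol (R.disp (tp p₂)) = Pol.neg := by
        rw [← pol_eq hf]; exact hpol.resolve_left hpol₁
      have hne := h.lt_tp hi.1
      have key : ∀ y, State R (Set.diagonal B.ev) y → y ⊆ D p₂ →
          (∀ j, R.lt j (tp p₂) → j ∈ y) → D p₂ ⊆ insert (tp p₂) y := by
        intro y hy hyD hj
        have hsub := Set.insert_subset (h.tp_mem p₂) hyD
        refine h.least p₂ _ _ (hy.insert_vis (h.tp_V p₂) (ESS.conf_of_subset (h.state p₂).conf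
          hsub ?_)) (h.state p₂) hsub subset_rfl (Or.inl rfl)
        rintro e (rfl | he) e' hl
        · exact Or.inr (hj e' hl)
        · exact Or.inr (hy.conf.2.1 e he e' hl.1)
      by_cases hmin : R.IsMinEv (tp p₂)
      · exfalso
        have := key ∅ State.empty (Set.empty_subset _) (fun j hj => (hj.2 (hmin j hj.1)).elim)
          (hi.1.1 (h.tp_mem p₁))
        rcases this with h1 | h1
        · exact hne h1
        · exact h1
      · obtain ⟨j, hj⟩ := hR.pointed.isES.exists_imm_of_not_min hmin
        have hg := hR.pointed.courteous _ _ hj (Or.inr hneg)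
        obtain ⟨q, hq, rfl⟩ := h.exists_mem_cfg (h.state p₂)
          ((h.state p₂).conf.2.1 _ (h.tp_mem p₂) j hj.1.1) (fun hh => h.tp_V p₂
          ((hid_of_imm hg).1 hh))
        have h1 := key (D q) (h.state q) hq fun k hk => by
          obtain ⟨k', h2, h3, h4⟩ := hR.pointed.exists_imm_of_neg hk hneg
          have h5 : k' = tp q := hR.pointed.locally_injective _ (hR.pointed.isES.down_conf (tp p₂))
            h3.1.1 hj.1.1 ((mid_preArena A B C).imm_unique h4 hg)
          rw [h5] at h2
          exact (h.state q).conf.2.1 _ (h.tp_mem q) k h2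
        have h2 : D p₁ ⊆ D q := by
          rcases h1 (hi.1.1 (h.tp_mem p₁)) with h2 | h2
          · exact (hne h2).elim
          · exact h.le_of_mem (h.state p₂) hi.1.1 hq h2
        by_cases hqp : p₁ = q
        · rwa [hqp]
        · refine (hi.2 q ⟨⟨h2, hqp⟩, hq, ?_⟩).elim
          rintro rfl
          exact hj.1.2 rfl
  receptive := by
    intro x hx a ha hneg
    change (primeES R D tp).Conf x at hx
    have hg := h.gen_state hx
    have hfx : f '' x = outer ⁻¹' (R.disp '' gen D x) := by
      rw [← h.image_cfg hf hg, h.cfg_gen hx]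
    have ha' : (A.hom C.toGame).Enables (f '' x) a := ha
    rw [hfx] at ha'
    have hen : (arenaMid A B C).Enables (R.disp '' gen D x) (outer a) := by
      have hc := hR.pointed.rule_abiding _ hg.conf
      refine ⟨hc, ha'.2.1, hc.1.insert _, ?_, ?_⟩
      · rintro e (rfl | he) e' hl
        · obtain ⟨g, rfl, hg⟩ := exists_outer_of_le hl
          rcases ha'.2.2.2.1 a (Or.inl rfl) g hg with rfl | hg
          · exact Or.inl rfl
          · exact Or.inr hg
        · exact Or.inr (hc.2.1 e he e' hl)
      · have hconf : ∀ e ∈ R.disp '' gen D x,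
            ¬ (arenaMid A B C).conflict e (outer a) := by
          intro e he hcf
          obtain ⟨g, rfl⟩ := exists_outer_of_conflict hcf
          exact ha'.2.2.2.2 g (Or.inr he) a (Or.inl rfl) (outer_conflict.1 hcf)
        have hES := (mid_preArena A B C).isES
        rintro e (rfl | he) e' (rfl | he')
        · exact hES.conflict_irrefl _
        · exact fun hcf => hconf e' he' (hES.conflict_symm _ _ hcf)
        · exact hconf e he
        · exact hc.2.2 e he e' he'
    have hu := hR.pointed.receptive _ hg.conf _ hen (by rw [outer_pol]; exact hneg)
    obtain ⟨n, hn, hna⟩ := hu.exists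
    have hst := hg.insert_vis (fun hh => not_hid_outer (by rwa [← hna])) hn.2.2
    obtain ⟨p, hp, rfl⟩ := h.exists_mem_cfg hst (Or.inl rfl)
      (fun hh => not_hid_outer (by rwa [← hna]))
    have hcfg := h.cfg_insert hx hst hp
    refine ⟨p, ⟨⟨hx, fun hpx => hn.2.1 ⟨p, hpx, h.tp_mem p⟩, ?_⟩, outer_inj ((hf p).trans hna)⟩, ?_⟩
    · rw [← hcfg]; exact h.cfg_conf hst
    · rintro q ⟨hq, hqa⟩
      have hqd : R.disp (tp q) = outer a := by rw [← hf]; exact congrArg outer hqa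
      obtain ⟨h1, h2⟩ := h.neg_state hR hx hq.2.2 (by rw [hqd, outer_pol]; exact hneg)
      have h3 : tp q ∉ gen D x := fun hm => hn.2.1 (by
        rwa [hR.pointed.locally_injective _ hst.conf (Or.inl rfl) (Or.inr hm) (hna.trans hqd.symm)])
      have h4 := hu.unique ⟨⟨hg.conf, h3, h1.conf⟩, hqd⟩ ⟨hn, hna⟩
      exact h.tp_inj hst (h4 ▸ h2) hp h4
  pointed := by
    intro p
    refine existsUnique_of_exists_of_unique ?_ ?_
    · exact (h.isES hR.pointed).exists_min_le p
    · have key : ∀ q, (primeES R D tp).IsMinEv q → D q ⊆ D p → ∀ m c, R.IsMinEv m →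
          R.disp m = inr (inr c) → tp p ∈ rootPart R (D p) m → m = tp q := by
        intro q hq hqp m c h1 h2 h3
        have h4 := h.least p _ _ (rootPart_state hR (h.state p) h1 h2) (h.state p) (fun _ h => h.1)
          subset_rfl h3
        exact eq_of_mem_rootPart (h.min_prime hR hq).1 (h.tp_V q) (h4 (hqp (h.tp_mem q)))
      rintro q q' ⟨h1, h2⟩ ⟨h3, h4⟩
      obtain ⟨m, c, h5, h6, h7⟩ := exists_rootPart hR (h.state p) (h.tp_mem p)
      exact h.tp_inj (h.state p) h2 h4
        ((key q h1 h2 m c h5 h6 h7).symm.trans (key q' h3 h4 m c h5 h6 h7))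

end IsPrimes

end CompP

/-! ## Visibility of the composition -/

section Thread

variable {A B C : NegArena.{u}} {R : PreStrat (arenaMid A B C)}

/-- Causal chains of the interaction, that move from one strategy to the other in the direction of
the flow of information. -/
inductive Thread (R : PreStrat (arenaMid A B C)) : Set R.ev → R.ev → Prop
  | base {m : R.ev} : R.IsMinEv m → ¬ Hid (R.disp m) → Thread R {m} m
  | step {K : Set R.ev} {w n : R.ev} : Thread R K w → R.imm w n →
      ((arenaMid A B C).pol (R.disp n) = Pol.pos ∨ ¬ Hid (R.disp n)) →
      Thread R (insert n K) n
  | mir {K : Set R.ev} {w n : R.ev} : Thread R K w →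
      (arenaMid A B C).pol (R.disp w) = Pol.pos →
      Mir (Set.diagonal B.ev) (R.disp w) (R.disp n) → Thread R (insert n K) n

theorem Thread.last_mem {K : Set R.ev} {n : R.ev} (h : Thread R K n) : n ∈ K := by
  cases h <;> simp

/-- Every event of a thread is the last event of a causal chain made of events of the thread. -/
theorem Thread.exists_thr (hR : IsInter R) {K x : Set R.ev} {n : R.ev} (h : Thread R K n)
    (hx : State R (Set.diagonal B.ev) x) (hK : K ⊆ x) :
    (∀ v ∈ K, ∃ K' ⊆ K, R.Thr K' v) ∧ ∀ v ∈ K, Hid (R.disp v) →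
      (arenaMid A B C).pol (R.disp v) = Pol.neg →
      ∃ w ∈ K, Mir (Set.diagonal B.ev) (R.disp v) (R.disp w) := by
  have extend : ∀ {K : Set R.ev} {n}, (∀ v ∈ K, ∃ K' ⊆ K, R.Thr K' v) →
      (∃ K' ⊆ insert n K, R.Thr K' n) → ∀ v ∈ insert n K, ∃ K' ⊆ insert n K,
        R.Thr K' v := by
    rintro K n h h' v (rfl | hv)
    · exact h'
    · obtain ⟨K', h1, h2⟩ := h v hv
      exact ⟨K', h1.trans (Set.subset_insert _ _), h2⟩
  induction h with
  | base hm hv =>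
    refine ⟨?_, ?_⟩
    · rintro v rfl; exact ⟨_, subset_rfl, .base hm⟩
    · rintro v rfl hh; exact (hv hh).elim
  | @step K w n hw hi hn ih =>
    obtain ⟨h1, h2⟩ := ih ((Set.subset_insert _ _).trans hK)
    refine ⟨extend h1 ?_, ?_⟩
    · obtain ⟨K', h3, h4⟩ := h1 w hw.last_mem
      exact ⟨_, Set.insert_subset_insert h3, h4.step hi⟩
    · rintro v (rfl | hv) hh hneg
      · rcases hn with hn | hn
        · rw [hneg] at hn; cases hn
        · exact (hn hh).elim
      · obtain ⟨w, h3, h4⟩ := h2 v hv hh hneg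
        exact ⟨w, Or.inr h3, h4⟩
  | @mir K w n hw hpos hm ih =>
    obtain ⟨h1, h2⟩ := ih ((Set.subset_insert _ _).trans hK)
    refine ⟨extend h1 ?_, ?_⟩
    · by_cases hmin : R.IsMinEv n
      · exact ⟨{n}, by simp, .base hmin⟩
      · obtain ⟨j, hj⟩ := hR.pointed.isES.exists_imm_of_not_min hmin
        have hneg : (arenaMid A B C).pol (R.disp n) = Pol.neg := by
          rw [hm.symm.pol_eq (isMirror_diag _), hpos]; rfl
        have hg := hR.pointed.courteous _ _ hj (Or.inr hneg)
        obtain ⟨g, hg1, hg2⟩ := hm.symm.exists_imm (isMirror_diag _) hg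
        obtain ⟨K', h3, h4⟩ := h1 w hw.last_mem
        obtain ⟨jw, hjw, rfl⟩ := (hR.visible.thr h4).2.1 _ ⟨w, h4.last_mem, rfl⟩ g hg2.1.1
        have h5 : (arenaMid A B C).pol (R.disp jw) = Pol.neg := by
          have := (mid_preArena A B C).alternating _ _ hg2
          rw [hpos] at this
          exact Pol.eq_neg.2 this
        obtain ⟨j', h6, h7⟩ := h2 jw (h3 hjw) hg1.hid' h5
        obtain rfl := hR.pointed.mir_unique (isMirror_diag _) hx.conf (hK (Or.inr h6))
          (hx.conf.2.1 n (hK (Or.inl rfl)) j hj.1.1) h7 hg1.symm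
        obtain ⟨K'', h8, h9⟩ := h1 j' h6
        exact ⟨_, Set.insert_subset_insert h8, h9.step hj⟩
    · rintro v (rfl | hv) hh hneg
      · exact ⟨w, Or.inr hw.last_mem, hm.symm⟩
      · obtain ⟨w, h3, h4⟩ := h2 v hv hh hneg
        exact ⟨w, Or.inr h3, h4⟩

/-- Events that can be reached through hidden events in a set of events. -/
inductive Reach (R : PreStrat (arenaMid A B C)) (x : Set R.ev) (m : R.ev) :
    R.ev → Prop
  | base : Reach R x m m
  | step {w n : R.ev} : Reach R x m w → (w = m ∨ Hid (R.disp w)) → n ∈ x → R.imm w n →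
      ((arenaMid A B C).pol (R.disp n) = Pol.pos ∨ ¬ Hid (R.disp n)) →
      Reach R x m n
  | mir {w n : R.ev} : Reach R x m w → n ∈ x →
      (arenaMid A B C).pol (R.disp w) = Pol.pos →
      Mir (Set.diagonal B.ev) (R.disp w) (R.disp n) → Reach R x m n

variable {x y : Set R.ev} {m n : R.ev}

theorem Reach.mem (h : Reach R x m n) (hm : m ∈ x) : n ∈ x := by
  cases h <;> assumption

theorem Reach.mem_of_state (hR : IsInter R) (h : Reach R x m n) (hx : x ∈ R.Conf)
    (hm : m ∈ x) (hy : State R (Set.diagonal B.ev) y) (hyx : y ⊆ x) (hn : n ∈ y) : m ∈ y := by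
  induction h with
  | base => exact hn
  | step _ _ _ hi _ ih => exact ih (hy.conf.2.1 _ hn _ hi.1.1)
  | @mir w n hw hnx _ hmir ih =>
    obtain ⟨w', h1, h2⟩ := hy.mir _ hn hmir.hid'
    refine ih ?_
    rwa [hR.pointed.mir_unique (isMirror_diag _) hx (hw.mem hm) (hyx h1) hmir.symm h2]

theorem Reach.thread {K : Set R.ev} (h : Reach R x m n) (hm : m ∈ x) (hK : Thread R K m)
    (hKx : K ⊆ x) : ∃ K', Thread R K' n ∧ K ⊆ K' ∧ K' ⊆ x ∧
      ∀ v ∈ K', v ∈ K ∨ v = n ∨ Hid (R.disp v) := by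
  induction h with
  | base => exact ⟨K, hK, subset_rfl, hKx, fun v hv => Or.inl hv⟩
  | @step w n hw hwh hn hi hnp ih =>
    obtain ⟨K', h1, h2, h3, h4⟩ := ih
    refine ⟨_, h1.step hi hnp, h2.trans (Set.subset_insert _ _), Set.insert_subset hn h3, ?_⟩
    rintro v (rfl | hv)
    · exact Or.inr (Or.inl rfl)
    · rcases h4 v hv with h5 | rfl | h5
      · exact Or.inl h5
      · rcases hwh with rfl | hwh
        · exact Or.inl hK.last_mem
        · exact Or.inr (Or.inr hwh)
      · exact Or.inr (Or.inr h5)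
  | @mir w n hw hn hpos hmir ih =>
    obtain ⟨K', h1, h2, h3, h4⟩ := ih
    refine ⟨_, h1.mir hpos hmir, h2.trans (Set.subset_insert _ _), Set.insert_subset hn h3, ?_⟩
    rintro v (rfl | hv)
    · exact Or.inr (Or.inl rfl)
    · rcases h4 v hv with h5 | rfl | h5
      · exact Or.inl h5
      · exact Or.inr (Or.inr hmir.hid)
      · exact Or.inr (Or.inr h5)

/-- The events that are not reachable from a visible event form a state, if the reachable ones are
hidden. -/
theorem State.sdiff_reach (hR : IsInter R) (hx : State R (Set.diagonal B.ev) x) (hm : m ∈ x)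
    (hv : ¬ Hid (R.disp m)) (hh : ∀ n, Reach R x m n → n = m ∨ Hid (R.disp n)) :
    State R (Set.diagonal B.ev) (x \ {n | Reach R x m n}) := by
  obtain ⟨r, hr⟩ := hx.exists_rank hR.pointed hR.visible hR.side (isMirror_diag _)
  have up : ∀ k b, r b = k → b ∈ x → (∃ w, Reach R x m w ∧ R.lt w b) → Reach R x m b := by
    intro k
    induction k using Nat.strong_induction_on with
    | _ k ih =>
      have pred : ∀ b, r b = k → b ∈ x → (∃ w, Reach R x m w ∧ R.lt w b) →
          ∃ c, Reach R x m c ∧ R.imm c b := by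
        rintro b rfl hb ⟨w, hw, hl⟩
        obtain ⟨c, h1, h2⟩ := hR.pointed.isES.exists_imm hl
        have hc : c ∈ x := hx.conf.2.1 b hb c h2.1.1
        refine ⟨c, ?_, h2⟩
        by_cases hwc : w = c
        · exact hwc ▸ hw
        · exact ih (r c) (hr.lt c hc b hb h2.1) c rfl hc ⟨w, hw, h1, hwc⟩
      intro b hbk hb hw
      obtain ⟨c, hc, hi⟩ := pred b hbk hb hw
      by_cases hnp : (arenaMid A B C).pol (R.disp b) = Pol.pos ∨ ¬ Hid (R.disp b)
      · exact hc.step (hh c hc) hb hi hnp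
      · push Not at hnp
        have hneg := Pol.eq_neg.2 hnp.1
        have hg := hR.pointed.courteous _ _ hi (Or.inr hneg)
        obtain ⟨b', hb', hmb⟩ := hx.mir b hb hnp.2
        obtain ⟨g, hg1, hg2⟩ := hmb.exists_imm (isMirror_diag _) hg
        obtain ⟨c', hc', rfl⟩ := hR.pointed.exists_lt_of_disp hg2.1
        have hcpos : (arenaMid A B C).pol (R.disp c) = Pol.pos := by
          have := (mid_preArena A B C).alternating _ _ hg
          rw [hneg] at this
          exact Pol.eq_pos.2 this
        have hc'r : Reach R x m c' := hc.mir (hx.conf.2.1 b' hb' c' hc'.1) hcpos hg1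
        have hbpos : (arenaMid A B C).pol (R.disp b') = Pol.pos := by
          rw [hmb.symm.pol_eq (isMirror_diag _), hneg]; rfl
        obtain ⟨d, hd, hdi⟩ := pred b' ((hr.mir b hb b' hb' hmb).symm.trans hbk) hb'
          ⟨c', hc'r, hc'⟩
        exact (hd.step (hh d hd) hb' hdi (Or.inl hbpos)).mir hb hbpos hmb.symm
  refine ⟨ESS.conf_of_subset hx.conf Set.sdiff_subset ?_, ?_⟩
  · rintro e ⟨he, hne⟩ e' hl
    exact ⟨hx.conf.2.1 e he e' hl.1, fun hr => hne (up _ e rfl he ⟨e', hr, hl⟩)⟩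
  · rintro e ⟨he, hne⟩ heh
    obtain ⟨e', he', hm'⟩ := hx.mir e he heh
    refine ⟨e', ⟨he', fun (hre : Reach R x m e') => hne ?_⟩, hm'⟩
    by_cases hpos : (arenaMid A B C).pol (R.disp e') = Pol.pos
    · exact hre.mir he hpos hm'.symm
    · cases hre with
      | base => exact (hv hm'.hid').elim
      | step _ _ _ _ h =>
        rcases h with h | h
        · exact (hpos h).elim
        · exact (h hm'.hid').elim
      | mir hw _ _ hmw =>
        rwa [hR.pointed.mir_unique (isMirror_diag _) hx.conf he (hw.mem hm) hm'.symm hmw.symm]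

end Thread

namespace IsPrimes

variable {A B C : NegArena.{u}} {R : PreStrat (arenaMid A B C)}
  {P : Type u} {D : P → Set R.ev} {tp : P → R.ev} {f : P → (A.hom C.toGame).ev}

theorem reach_of_imm (h : IsPrimes R D tp (visV R)) (hR : IsInter R) {p q : P}
    (hpq : (primeES R D tp).imm p q) : Reach R (D q) (tp p) (tp q) := by
  by_contra hc
  have hp : tp p ∈ D q := hpq.1.1 (h.tp_mem p)
  have h1 := (h.state q).sdiff_reach hR hp (h.tp_V p) fun n hn => by
    by_contra hnh
    push Not at hnh
    obtain ⟨r, hr, rfl⟩ := h.exists_mem_cfg (h.state q) (hn.mem hp) hnh.2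
    have h2 := hn.mem_of_state hR (h.state q).conf hp (h.state r) hr (h.tp_mem r)
    by_cases hrq : r = q
    · exact hc (hrq ▸ hn)
    · refine hpq.2 r ⟨⟨h.le_of_mem (h.state q) hpq.1.1 hr h2, ?_⟩, hr, hrq⟩
      rintro rfl
      exact hnh.1 rfl
  exact (h.least q _ _ h1 (h.state q) Set.sdiff_subset subset_rfl ⟨h.tp_mem q, hc⟩ hp).2 .base

theorem exists_thread (h : IsPrimes R D tp (visV R)) (hR : IsInter R)
    {K : Set (primeES R D tp).ev} {p : (primeES R D tp).ev} (hK : (primeES R D tp).Thr K p) : ∃ L, Thread R L (tp p) ∧ L ⊆ D p ∧ tp '' K ⊆ L ∧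
      (∀ v ∈ L, v ∈ tp '' K ∨ Hid (R.disp v)) ∧ K ⊆ cfg D (D p) := by
  induction hK with
  | @base m hm =>
    obtain ⟨h1, h2⟩ := h.min_prime hR hm
    refine ⟨{tp m}, .base h1 (h.tp_V m), by rw [h2], by simp, ?_, ?_⟩
    · rintro v rfl
      exact Or.inl ⟨m, rfl, rfl⟩
    · rintro v rfl
      exact Set.Subset.refl (D v)
  | @step K p q hK hi ih =>
    obtain ⟨L, h1, h2, h3, h4, h5⟩ := ih
    obtain ⟨L', h6, h7, h8, h9⟩ := (h.reach_of_imm hR hi).thread (hi.1.1 (h.tp_mem p)) h1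
      (h2.trans hi.1.1)
    refine ⟨L', h6, h8, ?_, ?_, ?_⟩
    · rw [Set.image_insert_eq]
      exact Set.insert_subset h6.last_mem (h3.trans h7)
    · intro v hv
      rw [Set.image_insert_eq]
      rcases h9 v hv with h10 | rfl | h10
      · exact (h4 v h10).imp Or.inr id
      · exact Or.inl (Or.inl rfl)
      · exact Or.inr h10
    · rintro r (rfl | hr)
      · exact Set.Subset.refl (D r)
      · exact (h5 hr).trans hi.1.1

theorem isVisible (h : IsPrimes R D tp (visV R)) (hR : IsInter R)
    (hf : ∀ p, outer (f p) = R.disp (tp p)) : IsVisible (primeStrat R D tp f) := by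
  refine isVisible_of_thr fun K p hK => ?_
  obtain ⟨L, h1, h2, h3, h4, h5⟩ := h.exists_thread hR hK
  have hc := h.prime_rule_abiding hf (h.cfg_conf (h.state p)) hR.pointed
  have hsub : f '' K ⊆ f '' cfg D (D p) := Set.image_mono h5
  refine ⟨hc.1.subset hsub, ?_, fun e he e' he' => hc.2.2 e (hsub he) e' (hsub he')⟩
  rintro _ ⟨q, hq, rfl⟩ g hg
  obtain ⟨K', h6, h7⟩ := (h1.exists_thr hR (h.state p) h2).1 _ (h3 ⟨q, hq, rfl⟩)
  obtain ⟨n, hn, hng⟩ := (hR.visible.thr h7).2.1 _ ⟨_, h7.last_mem, rfl⟩ (outer g)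
    (by rw [← hf]; exact outer_le.2 hg)
  rcases h4 n (h6 hn) with ⟨r, hr, rfl⟩ | hh
  · exact ⟨r, hr, outer_inj ((hf r).trans hng)⟩
  · rw [hng] at hh
    exact (not_hid_outer hh).elim

end IsPrimes

/-! ## Well-bracketing in terms of the events of a strategy -/

section Brackets

/-- The conditions of well-bracketing on a move `m` played in a position `S`, with respect to a
justification relation. -/
structure WbStep {X : Type u} (Q Ans : X → Prop) (J : X → X → Prop) (S : Set X) (m : X) :
    Prop where
  fork : ∀ q ∈ S, Q q → J q m → ¬ ∃ a ∈ S, Ans a ∧ J q a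
  wait : Ans m → ∀ q ∈ S, Q q → J q m → ∀ q' ∈ S, Q q' → J q q' → ∃ a ∈ insert m S, Ans a ∧ J q' a

variable {X X' : Type u} {Q Ans : X → Prop} {J : X → X → Prop} {Q' Ans' : X' → Prop}
  {J' : X' → X' → Prop} {S : Set X} {S' : Set X'} {m : X} {m' : X'}

/-- The transfer of well-bracketing between two systems that share some moves. -/
theorem WbStep.transfer (h : WbStep Q Ans J S m) (E : X → X' → Prop)
    (hQ : ∀ q q', E q q' → (Q q ↔ Q' q')) (hAns : ∀ a a', E a a' → (Ans a ↔ Ans' a'))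
    (hm : E m m')
    (h1 : ∀ q' ∈ S', Q' q' → J' q' m' → (∃ q ∈ S, E q q' ∧ J q m) ∨
      ¬ Ans' m' ∧ ¬ ∃ a ∈ S', Ans' a ∧ J' q' a)
    (h2 : ∀ q q', E q q' → q ∈ S → Q q → J q m → ∀ r' ∈ S', J' q' r' → (∃ r ∈ S, E r r' ∧ J q r) ∨
      ¬ Ans' r' ∧ (Ans m → ∃ a ∈ S', Ans' a ∧ J' r' a))
    (h3 : ∀ r r', E r r' → ∀ u ∈ insert m S, Ans u → J r u → ∃ u' ∈ insert m' S', E u u' ∧ J' r' u') :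
    WbStep Q' Ans' J' S' m' := by
  constructor
  · rintro q' hq' hQq' hJ ⟨a', ha', hAa', hJa'⟩
    rcases h1 q' hq' hQq' hJ with ⟨q, hq, hqq', hqm⟩ | ⟨-, h4⟩
    · rcases h2 q q' hqq' hq ((hQ _ _ hqq').2 hQq') hqm a' ha' hJa' with ⟨a, ha, haa', hJa⟩ | ⟨h5, -⟩
      · exact h.fork q hq ((hQ _ _ hqq').2 hQq') hqm ⟨a, ha, (hAns _ _ haa').2 hAa', hJa⟩
      · exact h5 hAa'
    · exact h4 ⟨a', ha', hAa', hJa'⟩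
  · intro hAm q' hq' hQq' hJ r' hr' hQr' hJr'
    rcases h1 q' hq' hQq' hJ with ⟨q, hq, hqq', hqm⟩ | ⟨h4, -⟩
    · rcases h2 q q' hqq' hq ((hQ _ _ hqq').2 hQq') hqm r' hr' hJr' with ⟨r, hr, hrr', hJr⟩ | ⟨-, h5⟩
      · obtain ⟨u, hu, hAu, hJu⟩ := h.wait ((hAns _ _ hm).2 hAm) q hq ((hQ _ _ hqq').2 hQq') hqm r hr
          ((hQ _ _ hrr').2 hQr') hJr
        obtain ⟨u', hu', huu', hJu'⟩ := h3 r r' hrr' u hu hAu hJu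
        exact ⟨u', hu', (hAns _ _ huu').1 hAu, hJu'⟩
      · obtain ⟨a, ha, h6⟩ := h5 ((hAns _ _ hm).2 hAm)
        exact ⟨a, Or.inr ha, h6⟩
    · exact (h4 hAm).elim

end Brackets

theorem QA.ne_answer {q : QA} : q = .question → q ≠ .answer := by rintro rfl; simp

section Just

variable {A B : NegArena.{u}} (σ : Strat A.toGame B.toGame)

/-- Immediate causality between the displays of events of a strategy in the arrow arena. -/
inductive Just : σ.ev → σ.ev → Prop
  | left {s s' a a'} : σ.disp s = inl a → σ.disp s' = inl a' → A.imm a a' → Just s s'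
  | right {s s' b b'} : σ.disp s = inr b → σ.disp s' = inr b' → B.imm b b' → Just s s'
  | jump {s s' b a} : σ.disp s = inr b → σ.disp s' = inl a → A.IsMinEv a →
      σ.IsMinEv s → σ.le s s' → Just s s'

/-- Events displayed by questions. -/
def IsQ (s : σ.ev) : Prop := (A.hom B.toGame).lam (σ.disp s) = QA.question

/-- Events displayed by answers. -/
def IsAns (s : σ.ev) : Prop := (A.hom B.toGame).lam (σ.disp s) = QA.answer

/-- Well-bracketing for the moves of a strategy. -/
abbrev Step (S : Set σ.ev) (s : σ.ev) : Prop := WbStep (IsQ σ) (IsAns σ) (Just σ) S s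

/-- The configurations reached by well-bracketed plays. -/
inductive WbRun : Set σ.ev → Prop
  | empty : WbRun ∅
  | insert {S : Set σ.ev} {s : σ.ev} : WbRun S → σ.Enables S s → Step σ S s →
      WbRun (insert s S)

variable {σ} {S x : Set σ.ev} {s s' : σ.ev}

theorem IsAns.not_isQ (h : IsAns σ s) : ¬ IsQ σ s := fun h' => QA.ne_answer h' h

theorem WbRun.conf (h : WbRun σ S) : S ∈ σ.Conf := by
  cases h with
  | empty => exact ESS.empty_conf
  | insert _ h _ => exact h.2.2

variable (hσ : IsPointedStrategy σ)
include hσ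

/-- An initial event is displayed by an initial event of the right arena. -/
theorem IsPointedStrategy.exists_min_disp (hs : σ.IsMinEv s) :
    ∃ b, σ.disp s = inr b ∧ B.IsMinEv b := by
  have hneg := hσ.negative s hs
  have hlt := hσ.disp_min hs
  generalize σ.disp s = g at *
  rcases g with a | b
  · exfalso
    have ha : A.IsMinEv a := by
      by_contra ha
      obtain ⟨c, hc⟩ := A.preArena.isES.exists_imm_of_not_min ha
      exact hlt _ (ESS.par_lt_ll.2 hc.1)
    have h1 : (A.pol a).flip = Pol.neg := hneg
    rw [A.negative a ha] at h1
    cases h1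
  · refine ⟨b, rfl, ?_⟩
    by_contra hb
    obtain ⟨c, hc⟩ := B.preArena.isES.exists_imm_of_not_min hb
    exact hlt _ (ESS.par_lt_rr.2 hc.1)

theorem Just.lt (hx : x ∈ σ.Conf) (hs : s ∈ x) (hs' : s' ∈ x) (h : Just σ s s') :
    σ.lt s s' := by
  cases h with
  | left h1 h2 h3 =>
    refine hσ.lt_of_disp_lt hx hs hs' ?_
    rw [h1, h2]
    exact ESS.par_lt_ll.2 h3.1
  | right h1 h2 h3 =>
    refine hσ.lt_of_disp_lt hx hs hs' ?_
    rw [h1, h2]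
    exact ESS.par_lt_rr.2 h3.1
  | jump h1 h2 h3 h4 h5 =>
    refine ⟨h5, ?_⟩
    rintro rfl
    exact absurd (h1.symm.trans h2) (by simp)

/-- In a well-bracketed play, questions above an answered question are answered. -/
theorem WbRun.answered (h : WbRun σ S) : ∀ q ∈ S, ∀ a ∈ S, ∀ q' ∈ S, IsQ σ q → IsAns σ a →
    IsQ σ q' → Just σ q a → Just σ q q' → ∃ a' ∈ S, IsAns σ a' ∧ Just σ q' a' := by
  induction h with
  | empty => rintro q ⟨⟩
  | @insert S s h hen hst ih =>
    intro q hq a ha q' hq' hQ hA hQ' hJ hJ'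
    have hqs : q ∈ S := by
      rcases hq with rfl | hq
      · rcases ha with rfl | ha
        · exact (hA.not_isQ hQ).elim
        · exact hen.1.2.1 a ha q (hJ.lt hσ hen.2.2 (Or.inl rfl) (Or.inr ha)).1
      · exact hq
    rcases ha with rfl | ha
    · rcases hq' with rfl | hq'
      · exact (hA.not_isQ hQ').elim
      · exact hst.wait hA q hqs hQ hJ q' hq' hQ' hJ'
    · rcases hq' with rfl | hq'
      · exact (hst.fork q hqs hQ hJ' ⟨a, ha, hA, hJ⟩).elim
      · obtain ⟨a', h1, h2⟩ := ih q hqs a ha q' hq' hQ hA hQ' hJ hJ'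
        exact ⟨a', Or.inr h1, h2⟩

theorem exists_arrowDisp (s : σ.ev) : ∃ e, ArrowDisp σ s e := by
  rcases h : σ.disp s with a | b
  · obtain ⟨m, h1, h2⟩ := hσ.isES.exists_min_le s
    obtain ⟨b, h3, h4⟩ := hσ.exists_min_disp h1
    exact ⟨inl (⟨b, h4⟩, a), h, m, h1, h2, h3⟩
  · exact ⟨inr b, h⟩

omit hσ in
theorem ArrowDisp.chi {e} (h : ArrowDisp σ s e) : Game.chi A.toGame B.toGame e = σ.disp s := by
  rcases e with ⟨b, a⟩ | b
  · exact h.1.symm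
  · exact h.symm

omit hσ in
theorem arrow_imm_rr {b b' : B.ev} :
    (A.arrow B.toGame).imm (inr b) (inr b') ↔ B.imm b b' := by
  constructor
  · rintro ⟨⟨h1, h2⟩, h3⟩
    exact ⟨⟨h1, fun h => h2 (congrArg inr h)⟩, fun d hd => h3 (inr d)
      ⟨⟨hd.1.1, fun h => hd.1.2 (Sum.inr.inj h)⟩, ⟨hd.2.1, fun h => hd.2.2 (Sum.inr.inj h)⟩⟩⟩
  · rintro ⟨⟨h1, h2⟩, h3⟩
    refine ⟨⟨h1, fun h => h2 (Sum.inr.inj h)⟩, ?_⟩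
    rintro (d | d) ⟨h4, h5⟩
    · exact (h5.1 : False).elim
    · exact h3 d ⟨⟨h4.1, fun h => h4.2 (congrArg inr h)⟩,
        ⟨h5.1, fun h => h5.2 (congrArg inr h)⟩⟩

omit hσ in
theorem arrow_imm_ll {b b' : {b : B.ev // B.IsMinEv b}} {a a' : A.ev} :
    (A.arrow B.toGame).imm (inl (b, a)) (inl (b', a')) ↔
      b = b' ∧ A.imm a a' := by
  constructor
  · rintro ⟨⟨⟨rfl, h1⟩, h2⟩, h3⟩
    refine ⟨rfl, ⟨h1, fun h => h2 (by rw [h])⟩, fun d hd => h3 (inl (b, d))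
      ⟨⟨⟨rfl, hd.1.1⟩, fun h => hd.1.2 ?_⟩, ⟨⟨rfl, hd.2.1⟩, fun h => hd.2.2 ?_⟩⟩⟩
    · exact (Prod.mk.inj (Sum.inl.inj h)).2
    · exact (Prod.mk.inj (Sum.inl.inj h)).2
  · rintro ⟨rfl, ⟨h1, h2⟩, h3⟩
    refine ⟨⟨⟨rfl, h1⟩, fun h => h2 (Prod.mk.inj (Sum.inl.inj h)).2⟩, ?_⟩
    rintro (⟨b', d⟩ | d) ⟨h4, h5⟩
    · obtain ⟨⟨rfl, h4⟩, h6⟩ := h4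
      exact h3 d ⟨⟨h4, fun h => h6 (by rw [h])⟩, ⟨h5.1.2, fun h => h5.2 (by rw [h])⟩⟩
    · exact (h4.1 : False).elim

omit hσ in
theorem arrow_imm_rl {b : B.ev} {b' : {b : B.ev // B.IsMinEv b}} {a : A.ev} :
    (A.arrow B.toGame).imm (inr b) (inl (b', a)) ↔
      b = b' ∧ A.IsMinEv a := by
  constructor
  · rintro ⟨⟨h1, -⟩, h2⟩
    refine ⟨h1, fun d hd => ?_⟩
    by_contra hne
    exact h2 (inl (b', d)) ⟨⟨h1, fun h => Sum.inr_ne_inl h⟩, ⟨rfl, hd⟩, fun h =>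
      hne (Prod.mk.inj (Sum.inl.inj h)).2⟩
  · rintro ⟨h1, h2⟩
    refine ⟨⟨h1, fun h => Sum.inr_ne_inl h⟩, ?_⟩
    rintro (⟨b'', d⟩ | d) ⟨h3, h4⟩
    · obtain ⟨⟨rfl, h5⟩, h6⟩ := h4
      exact h6 (by rw [h2 d h5])
    · obtain ⟨h5, -⟩ := h4
      exact h3.2 (by rw [h1, show d = b' from h5])

theorem arrow_imm_iff (hx : x ∈ σ.Conf) (hs : s ∈ x) (hs' : s' ∈ x) {e e'}
    (he : ArrowDisp σ s e) (he' : ArrowDisp σ s' e') :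
    (A.arrow B.toGame).imm e e' ↔ Just σ s s' := by
  rcases e with ⟨b, a⟩ | b <;> rcases e' with ⟨b', a'⟩ | b'
  · rw [arrow_imm_ll]
    constructor
    · rintro ⟨-, h⟩; exact .left he.1 he'.1 h
    · intro h
      have hlt := h.lt hσ hx hs hs'
      have h1 : A.imm a a' := by
        cases h with
        | left h1 h2 h3 =>
          rw [he.1, Sum.inl.injEq] at h1
          rw [he'.1, Sum.inl.injEq] at h2
          rwa [h1, h2]
        | right h1 => exact absurd (h1.symm.trans he.1) (by simp)
        | jump h1 => exact absurd (h1.symm.trans he.1) (by simp)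
      refine ⟨?_, h1⟩
      obtain ⟨m, h2, h3, h4⟩ := he.2
      obtain ⟨m', h2', h3', h4'⟩ := he'.2
      rw [(hσ.pointed s').unique ⟨h2, hσ.isES.le_trans _ _ _ h3 hlt.1⟩ ⟨h2', h3'⟩, h4'] at h4
      exact Subtype.ext (Sum.inr.inj h4).symm
  · refine iff_of_false (fun h => (h.1.1 : False).elim) fun h => ?_
    cases h with
    | left h1 h2 => exact absurd (h2.symm.trans he') (by simp)
    | right h1 => exact absurd (h1.symm.trans he.1) (by simp)
    | jump h1 => exact absurd (h1.symm.trans he.1) (by simp)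
  · rw [arrow_imm_rl]
    constructor
    · rintro ⟨h1, h2⟩
      obtain ⟨m, h3, h4, h5⟩ := he'.2
      have : m = s := hσ.locally_injective x hx (hx.2.1 s' hs' m h4) hs
        (h5.trans ((congrArg inr h1.symm).trans he.symm))
      subst this
      exact .jump he he'.1 h2 h3 h4
    · intro h
      cases h with
      | left h1 => exact absurd (h1.symm.trans he) (by simp)
      | right h1 h2 => exact absurd (h2.symm.trans he'.1) (by simp)
      | jump h1 h2 h3 h4 h5 =>
        obtain ⟨m, h6, h7, h8⟩ := he'.2
        rw [(hσ.pointed s').unique ⟨h4, h5⟩ ⟨h6, h7⟩] at he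
        rw [he'.1, Sum.inl.injEq] at h2
        exact ⟨Sum.inr.inj (he.symm.trans h8), h2 ▸ h3⟩
  · rw [arrow_imm_rr]
    constructor
    · intro h; exact .right he he' h
    · intro h
      cases h with
      | left h1 => exact absurd (h1.symm.trans he) (by simp)
      | right h1 h2 h3 =>
        rw [he, Sum.inr.injEq] at h1
        rw [he', Sum.inr.injEq] at h2
        rwa [h1, h2]
      | jump h1 h2 => exact absurd (h2.symm.trans he') (by simp)

end Just

theorem isWbPlay_append {A : Game.{u}} {w : List A.ev} {m : A.ev} :
    IsWbPlay A (w ++ [m]) ↔ IsWbPlay A w ∧ WbStep (fun q => A.lam q = .question)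
      (fun q => A.lam q = .answer) A.imm {e | e ∈ w} m := by
  have hset : ∀ (v : List A.ev) a e, e ∈ v ++ [a] ↔ e ∈ insert a {e | e ∈ v} := by
    intro v a e; simp [or_comm]
  constructor
  · intro h
    refine ⟨⟨fun v n hv => h.fork v n (hv.trans (List.prefix_append _ _)),
      fun v n hv => h.wait v n (hv.trans (List.prefix_append _ _))⟩,
      h.fork w m (List.prefix_refl _), fun ha q hq hQ hJ q' hq' hQ' hJ' => ?_⟩
    obtain ⟨a, h1, h2⟩ := h.wait w m (List.prefix_refl _) ha q hq hQ hJ q' hq' hQ' hJ'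
    exact ⟨a, (hset _ _ _).1 h1, h2⟩
  · rintro ⟨h1, h2⟩
    have hcase : ∀ v n, v ++ [n] <+: w ++ [m] → v ++ [n] <+: w ∨ (v = w ∧ n = m) := by
      intro v n h
      rcases List.prefix_concat_iff.1 h with h | h
      · exact Or.inr (by simpa using List.append_inj' h rfl)
      · exact Or.inl h
    constructor
    · intro v n h
      rcases hcase v n h with h | ⟨rfl, rfl⟩
      · exact h1.fork v n h
      · exact h2.fork
    · intro v n h
      rcases hcase v n h with h | ⟨rfl, rfl⟩
      · exact h1.wait v n h
      · intro ha q hq hQ hJ q' hq' hQ' hJ'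
        obtain ⟨a, h3, h4⟩ := h2.wait ha q hq hQ hJ q' hq' hQ' hJ'
        exact ⟨a, (hset _ _ _).2 h3, h4⟩

section Plays

variable {A B : NegArena.{u}} {σ : Strat A.toGame B.toGame} (hσ : IsPointedStrategy σ)
include hσ

theorem isPlay_append {t : List σ.ev} {s : σ.ev} :
    IsPlay σ.toESS (fun s => (A.hom B.toGame).pol (σ.disp s)) (t ++ [s]) ↔
      IsPlay σ.toESS (fun s => (A.hom B.toGame).pol (σ.disp s)) t ∧
        σ.Enables {e | e ∈ t} s := by
  have hset : {e | e ∈ t ++ [s]} = insert s {e | e ∈ t} := by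
    ext e; simp [or_comm]
  constructor
  · intro h
    have h1 := List.nodup_append.1 h.nonrepetitive
    refine ⟨⟨fun v hv => h.valid v (hv.trans (List.prefix_append _ _)), h1.1, fun e he =>
      h.negative e ?_⟩, h.valid t (List.prefix_append _ _), fun hs => ?_, ?_⟩
    · cases t with
      | nil => cases he
      | cons a t => exact he
    · exact h1.2.2 s hs s (by simp) rfl
    · rw [← hset]; exact h.valid _ (List.prefix_refl _)
  · rintro ⟨h1, h2⟩
    refine ⟨fun v hv => ?_, ?_, ?_⟩
    · rcases List.prefix_concat_iff.1 hv with rfl | hv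
      · rw [hset]; exact h2.2.2
      · exact h1.valid v hv
    · refine List.nodup_append.2 ⟨h1.nonrepetitive, by simp, ?_⟩
      rintro a ha b hb rfl
      rw [List.mem_singleton] at hb
      exact h2.2.1 (hb ▸ ha)
    · intro e he
      cases t with
      | nil =>
        simp only [List.nil_append, List.head?_cons, Option.mem_def, Option.some.injEq] at he
        subst he
        refine hσ.negative s fun d hd => ?_
        by_contra hne
        exact absurd (h2.pre ⟨hd, hne⟩) (by simp)
      | cons a t => exact h1.negative e he

theorem step_iff {t : List σ.ev} {s : σ.ev} {w m} (ht : σ.Enables {e | e ∈ t} s)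
    (h : List.Forall₂ (ArrowDisp σ) t w) (hm : ArrowDisp σ s m) :
    WbStep (fun q => (A.arrow B.toGame).lam q = .question)
      (fun q => (A.arrow B.toGame).lam q = .answer) (A.arrow B.toGame).imm {e | e ∈ w} m ↔
    Step σ {e | e ∈ t} s := by
  have hw : ∀ e ∈ insert m {e | e ∈ w}, ∃ s' ∈ insert s {e | e ∈ t}, ArrowDisp σ s' e ∧
      (e ∈ w → s' ∈ t) := by
    rintro e (rfl | he)
    · by_cases hew : e ∈ w
      · obtain ⟨i, hi, rfl⟩ := List.getElem_of_mem hew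
        have h1 := h.length_eq
        exact ⟨t[i]'(h1 ▸ hi), Or.inr (List.getElem_mem _), h.get _ _, fun _ => List.getElem_mem _⟩
      · exact ⟨s, Or.inl rfl, hm, fun h => (hew h).elim⟩
    · obtain ⟨i, hi, rfl⟩ := List.getElem_of_mem he
      have h1 := h.length_eq
      exact ⟨t[i]'(h1 ▸ hi), Or.inr (List.getElem_mem _), h.get _ _, fun _ => List.getElem_mem _⟩
  have ht' : ∀ s' ∈ insert s {e | e ∈ t}, ∃ e ∈ insert m {e | e ∈ w}, ArrowDisp σ s' e ∧
      (s' ∈ t → e ∈ w) := by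
    have key : ∀ s' ∈ t, ∃ e ∈ w, ArrowDisp σ s' e := by
      intro s' he
      obtain ⟨i, hi, rfl⟩ := List.getElem_of_mem he
      have h1 := h.length_eq
      exact ⟨w[i]'(h1 ▸ hi), List.getElem_mem _, h.get _ _⟩
    rintro s' (rfl | hs')
    · exact ⟨m, Or.inl rfl, hm, fun h => (ht.2.1 h).elim⟩
    · obtain ⟨e, h1, h2⟩ := key s' hs'
      exact ⟨e, Or.inr h1, h2, fun _ => h1⟩
  have hlam : ∀ s e, ArrowDisp σ s e →
      (A.arrow B.toGame).lam e = (A.hom B.toGame).lam (σ.disp s) := by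
    intro s e he
    rw [← he.chi]; rfl
  have hJ : ∀ s₁ ∈ insert s {e | e ∈ t}, ∀ s₂ ∈ insert s {e | e ∈ t}, ∀ e₁ e₂, ArrowDisp σ s₁ e₁ →
      ArrowDisp σ s₂ e₂ → ((A.arrow B.toGame).imm e₁ e₂ ↔ Just σ s₁ s₂) :=
    fun s₁ h1 s₂ h2 e₁ e₂ => arrow_imm_iff hσ ht.2.2 h1 h2
  constructor
  · intro H
    constructor
    · rintro q hq hQ hqs ⟨a, ha, hAa, hqa⟩
      obtain ⟨q', -, h2, h3⟩ := ht' q (Or.inr hq)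
      obtain ⟨a', -, h4, h5⟩ := ht' a (Or.inr ha)
      refine H.fork q' (h3 hq) ((hlam _ _ h2).trans hQ)
        ((hJ q (Or.inr hq) s (Or.inl rfl) q' m h2 hm).2 hqs)
        ⟨a', h5 ha, (hlam _ _ h4).trans hAa, (hJ q (Or.inr hq) a (Or.inr ha) q' a' h2 h4).2 hqa⟩
    · intro hA q hq hQ hqs r hr hR hqr
      obtain ⟨q', -, h2, h3⟩ := ht' q (Or.inr hq)
      obtain ⟨r', -, h4, h5⟩ := ht' r (Or.inr hr)
      obtain ⟨a', h6, h7, h8⟩ := H.wait ((hlam _ _ hm).trans hA) q' (h3 hq) ((hlam _ _ h2).trans hQ)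
        ((hJ q (Or.inr hq) s (Or.inl rfl) q' m h2 hm).2 hqs) r' (h5 hr) ((hlam _ _ h4).trans hR)
        ((hJ q (Or.inr hq) r (Or.inr hr) q' r' h2 h4).2 hqr)
      obtain ⟨a, h9, h10, -⟩ := hw a' h6
      exact ⟨a, h9, (hlam _ _ h10).symm.trans h7, (hJ r (Or.inr hr) a h9 r' a' h4 h10).1 h8⟩
  · intro H
    constructor
    · rintro q' hq' hQ hqs ⟨a', ha', hAa, hqa⟩
      obtain ⟨q, -, h2, h3⟩ := hw q' (Or.inr hq')
      obtain ⟨a, -, h4, h5⟩ := hw a' (Or.inr ha')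
      have hq := h3 hq'
      have ha := h5 ha'
      exact H.fork q hq ((hlam _ _ h2).symm.trans hQ)
        ((hJ q (Or.inr hq) s (Or.inl rfl) q' m h2 hm).1 hqs)
        ⟨a, ha, (hlam _ _ h4).symm.trans hAa, (hJ q (Or.inr hq) a (Or.inr ha) q' a' h2 h4).1 hqa⟩
    · intro hA q' hq' hQ hqs r' hr' hR hqr
      obtain ⟨q, -, h2, h3⟩ := hw q' (Or.inr hq')
      obtain ⟨r, -, h4, h5⟩ := hw r' (Or.inr hr')
      have hq := h3 hq'
      have hr := h5 hr'
      obtain ⟨a, h6, h7, h8⟩ := H.wait ((hlam _ _ hm).symm.trans hA) q hq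
        ((hlam _ _ h2).symm.trans hQ) ((hJ q (Or.inr hq) s (Or.inl rfl) q' m h2 hm).1 hqs) r hr
        ((hlam _ _ h4).symm.trans hR) ((hJ q (Or.inr hq) r (Or.inr hr) q' r' h2 h4).1 hqr)
      obtain ⟨a', h9, h10, -⟩ := ht' a h6
      exact ⟨a', h9, (hlam _ _ h10).trans h7, (hJ r (Or.inr hr) a h6 r' a' h4 h10).2 h8⟩

theorem WbRun.exists_play {S : Set σ.ev} (h : WbRun σ S) : ∃ t w, {e | e ∈ t} = S ∧
    IsPlay σ.toESS (fun s => (A.hom B.toGame).pol (σ.disp s)) t ∧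
    List.Forall₂ (ArrowDisp σ) t w ∧ IsWbPlay (A.arrow B.toGame) w := by
  induction h with
  | empty =>
    refine ⟨[], [], by simp, ⟨?_, by simp, by simp⟩, .nil, ⟨?_, ?_⟩⟩
    · intro v hv
      rw [List.prefix_nil.1 hv]
      convert ESS.empty_conf
      simp
    · intro v m hv; simp at hv
    · intro v m hv; simp at hv
  | @insert S s h hen hst ih =>
    obtain ⟨t, w, rfl, h2, h3, h4⟩ := ih
    obtain ⟨m, hm⟩ := exists_arrowDisp hσ s
    refine ⟨t ++ [s], w ++ [m], by ext; simp [or_comm], (isPlay_append hσ).2 ⟨h2, hen⟩,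
      List.rel_append h3 (.cons hm .nil), isWbPlay_append.2 ⟨h4, (step_iff hσ hen h3 hm).2 hst⟩⟩

theorem wbRun_of_play {t : List σ.ev} {w}
    (ht : IsPlay σ.toESS (fun s => (A.hom B.toGame).pol (σ.disp s)) t)
    (h : List.Forall₂ (ArrowDisp σ) t w) (hw : IsWbPlay (A.arrow B.toGame) w) :
    WbRun σ {e | e ∈ t} := by
  induction t using List.reverseRecOn generalizing w with
  | nil =>
    convert WbRun.empty (σ := σ)
    simp
  | append_singleton t s ih =>
    obtain ⟨h1, h2⟩ := (isPlay_append hσ).1 ht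
    obtain ⟨w, m, rfl⟩ : ∃ v m, w = v ++ [m] := by
      rcases List.eq_nil_or_concat w with rfl | h'
      · have := h.length_eq
        simp at this
      · simpa using h'
    have h3 : List.Forall₂ (ArrowDisp σ) t w ∧ ArrowDisp σ s m := by
      have hl : t.length = w.length := by simpa using h.length_eq
      constructor
      · have := List.forall₂_take t.length h
        rwa [List.take_left, hl, List.take_left] at this
      · have := List.forall₂_drop t.length h
        rw [List.drop_left, hl, List.drop_left] at this
        cases this
        assumption
    obtain ⟨h4, h5⟩ := isWbPlay_append.1 hw
    have : {e | e ∈ t ++ [s]} = insert s {e | e ∈ t} := by ext; simp [or_comm]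
    rw [this]
    exact (ih h1 h3.1 h4).insert h2 ((step_iff hσ h2 h3.1 h3.2).1 h5)

/-- Well-bracketed strategies in terms of their events. -/
theorem isWellBracketed_iff : IsWellBracketed σ ↔ ∀ S s, WbRun σ S → σ.Enables S s →
    (A.hom B.toGame).pol (σ.disp s) = Pol.pos → Step σ S s := by
  have hpol : ∀ s e, ArrowDisp σ s e →
      (A.arrow B.toGame).pol e = (A.hom B.toGame).pol (σ.disp s) := by
    intro s e he
    rw [← he.chi]; rfl
  constructor
  · intro h S s hS hen hpos
    obtain ⟨t, w, rfl, h2, h3, h4⟩ := hS.exists_play hσ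
    obtain ⟨m, hm⟩ := exists_arrowDisp hσ s
    have h5 := h w m ⟨_, (isPlay_append hσ).2 ⟨h2, hen⟩, List.rel_append h3 (.cons hm .nil)⟩
      ((hpol _ _ hm).trans hpos) h4
    exact (step_iff hσ hen h3 hm).1 (isWbPlay_append.1 h5).2
  · rintro H w m ⟨t', ht', hf⟩ hpos hw
    obtain ⟨t, s, rfl⟩ : ∃ t s, t' = t ++ [s] := by
      rcases List.eq_nil_or_concat t' with rfl | h'
      · have := hf.length_eq
        simp at this
      · simpa using h'
    obtain ⟨h1, h2⟩ := (isPlay_append hσ).1 ht'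
    have h3 : List.Forall₂ (ArrowDisp σ) t w ∧ ArrowDisp σ s m := by
      have hl : t.length = w.length := by simpa using hf.length_eq
      constructor
      · have := List.forall₂_take t.length hf
        rwa [List.take_left, hl, List.take_left] at this
      · have := List.forall₂_drop t.length hf
        rw [List.drop_left, hl, List.drop_left] at this
        cases this
        assumption
    exact isWbPlay_append.2 ⟨hw, (step_iff hσ h2 h3.1 h3.2).2 (H _ s
      (wbRun_of_play hσ h1 h3.1 hw) h2 ((hpol _ _ h3.2).symm.trans hpos))⟩

end Plays

/-! ## Well-bracketing of the composition -/

section JustInversion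

variable {A B : NegArena.{u}} {σ : Strat A.toGame B.toGame} {s s' : σ.ev}

theorem Just.of_left (h : Just σ s s') {a} (hs : σ.disp s = inl a) :
    ∃ a', σ.disp s' = inl a' ∧ A.imm a a' := by
  cases h with
  | left h1 h2 h3 =>
    obtain rfl := Sum.inl.inj (h1.symm.trans hs)
    exact ⟨_, h2, h3⟩
  | right h1 => exact (Sum.inl_ne_inr (hs.symm.trans h1)).elim
  | jump h1 => exact (Sum.inl_ne_inr (hs.symm.trans h1)).elim

theorem Just.to_right (h : Just σ s s') {b'} (hs : σ.disp s' = inr b') :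
    ∃ b, σ.disp s = inr b ∧ B.imm b b' := by
  cases h with
  | left h1 h2 => exact (Sum.inl_ne_inr (h2.symm.trans hs)).elim
  | right h1 h2 h3 =>
    obtain rfl := Sum.inr.inj (h2.symm.trans hs)
    exact ⟨_, h1, h3⟩
  | jump h1 h2 => exact (Sum.inl_ne_inr (h2.symm.trans hs)).elim

theorem Just.of_right (h : Just σ s s') {b} (hs : σ.disp s = inr b) :
    (∃ b', σ.disp s' = inr b' ∧ B.imm b b') ∨
      ∃ a, σ.disp s' = inl a ∧ A.IsMinEv a ∧ σ.IsMinEv s ∧ σ.le s s' := by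
  cases h with
  | left h1 => exact (Sum.inl_ne_inr (h1.symm.trans hs)).elim
  | right h1 h2 h3 =>
    obtain rfl := Sum.inr.inj (h1.symm.trans hs)
    exact Or.inl ⟨_, h2, h3⟩
  | jump h1 h2 h3 h4 h5 => exact Or.inr ⟨_, h2, h3, h4, h5⟩

theorem Just.to_left (h : Just σ s s') {a'} (hs : σ.disp s' = inl a') :
    (∃ a, σ.disp s = inl a ∧ A.imm a a') ∨
      ∃ b, σ.disp s = inr b ∧ A.IsMinEv a' ∧ σ.IsMinEv s ∧ σ.le s s' := by
  cases h with
  | left h1 h2 h3 =>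
    obtain rfl := Sum.inl.inj (h2.symm.trans hs)
    exact Or.inl ⟨_, h1, h3⟩
  | right h1 h2 => exact (Sum.inl_ne_inr (hs.symm.trans h2)).elim
  | jump h1 h2 h3 h4 h5 =>
    obtain rfl := Sum.inl.inj (h2.symm.trans hs)
    exact Or.inr ⟨_, h1, h3, h4, h5⟩

theorem isQ_of_min_left {a} (h : σ.disp s = inl a) (ha : A.IsMinEv a) : IsQ σ s := by
  rw [IsQ, h]
  exact A.isArena.question_opening a ha

theorem isQ_of_min_right {b} (h : σ.disp s = inr b) (hb : B.IsMinEv b) : IsQ σ s := by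
  rw [IsQ, h]
  exact B.isArena.question_opening b hb

theorem IsAns.not_min_left (hs : IsAns σ s) {a} (h : σ.disp s = inl a) : ¬ A.IsMinEv a :=
  fun ha => hs.not_isQ (isQ_of_min_left h ha)

theorem pol_of_min_left {a} (h : σ.disp s = inl a) (ha : A.IsMinEv a) :
    (A.hom B.toGame).pol (σ.disp s) = Pol.pos := by
  rw [h]
  exact Pol.flip_eq_pos.2 (A.negative a ha)

theorem pol_of_min_right {b} (h : σ.disp s = inr b) (hb : B.IsMinEv b) :
    (A.hom B.toGame).pol (σ.disp s) = Pol.neg := by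
  rw [h]
  exact B.negative b hb

theorem pol_of_imm_min {b b'} (h : σ.disp s = inr b') (hb : B.IsMinEv b)
    (hi : B.imm b b') : (A.hom B.toGame).pol (σ.disp s) = Pol.pos := by
  rw [h]
  have := B.isArena.alternating b b' hi
  rw [B.negative b hb] at this
  exact Pol.eq_pos.2 this.symm

end JustInversion

section Comp

variable {A B C : NegArena.{u}} {σ : Strat A.toGame B.toGame} {τ : Strat B.toGame C.toGame}

/-- The states of the interaction of `σ` and `τ`. -/
abbrev PairState (σ : Strat A.toGame B.toGame) (τ : Strat B.toGame C.toGame)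
    (z : Set (σ.ev ⊕ τ.ev)) : Prop :=
  State (A := A) (B := B) (C := C) (parStrat σ τ) (Set.diagonal B.ev) z

variable {y z : Set (σ.ev ⊕ τ.ev)}

theorem PairState.mirror_left (hz : PairState σ τ z) {s b} (hs : inl s ∈ z)
    (h : σ.disp s = inr b) : ∃ t, inr t ∈ z ∧ τ.disp t = inl b := by
  obtain ⟨m, hm, hmir⟩ := hz.mir (inl s) hs (by simp [h, Hid])
  obtain ⟨t, b', rfl, h1, h2⟩ := disp_of_mir hmir
  obtain rfl := Sum.inr.inj (h.symm.trans h1)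
  exact ⟨t, hm, h2⟩

theorem PairState.mirror_right (hz : PairState σ τ z) {t b} (ht : inr t ∈ z)
    (h : τ.disp t = inl b) : ∃ s, inl s ∈ z ∧ σ.disp s = inr b := by
  obtain ⟨m, hm, hmir⟩ := hz.mir (inr t) ht (by simp [h, Hid])
  obtain ⟨s, b', rfl, h1, h2⟩ := disp_of_mir' hmir
  obtain rfl := Sum.inl.inj (h.symm.trans h2)
  exact ⟨s, hm, h1⟩

theorem PairState.left_conf (hz : PairState σ τ z) : inl ⁻¹' z ∈ σ.Conf :=
  (ESS.par_conf.1 hz.conf).1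

theorem PairState.right_conf (hz : PairState σ τ z) : inr ⁻¹' z ∈ τ.Conf :=
  (ESS.par_conf.1 hz.conf).2

theorem PairState.enables_left (hy : PairState σ τ y) (hz : PairState σ τ z) (hyz : y ⊆ z) {s}
    (hs : inl s ∈ z) (hsy : inl s ∉ y) (hpre : ∀ s', σ.lt s' s → inl s' ∈ y) :
    σ.Enables (inl ⁻¹' y) s := by
  refine ⟨hy.left_conf, hsy, ESS.conf_of_subset hz.left_conf
    (Set.insert_subset hs (Set.preimage_mono hyz)) ?_⟩
  rintro e (rfl | he) e' hl
  · exact Or.inr (hpre _ hl)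
  · exact Or.inr (hy.left_conf.2.1 e he e' hl.1)

theorem PairState.enables_right (hy : PairState σ τ y) (hz : PairState σ τ z) (hyz : y ⊆ z) {t}
    (ht : inr t ∈ z) (hty : inr t ∉ y) (hpre : ∀ t', τ.lt t' t → inr t' ∈ y) :
    τ.Enables (inr ⁻¹' y) t := by
  refine ⟨hy.right_conf, hty, ESS.conf_of_subset hz.right_conf
    (Set.insert_subset ht (Set.preimage_mono hyz)) ?_⟩
  rintro e (rfl | he) e' hl
  · exact Or.inr (hpre _ hl)
  · exact Or.inr (hy.right_conf.2.1 e he e' hl.1)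

theorem isQ_mirror {s t b} (hs : σ.disp s = inr b) (ht : τ.disp t = inl b) :
    IsQ σ s ↔ IsQ τ t := by
  rw [IsQ, IsQ, hs, ht]; exact Iff.rfl

theorem isAns_mirror {s t b} (hs : σ.disp s = inr b) (ht : τ.disp t = inl b) :
    IsAns σ s ↔ IsAns τ t := by
  rw [IsAns, IsAns, hs, ht]; exact Iff.rfl

theorem Step.left_to_right (hy : PairState σ τ y) {s t b} (hs : σ.disp s = inr b)
    (ht : τ.disp t = inl b) (hpos : (A.hom B.toGame).pol (σ.disp s) = Pol.pos)
    (h : Step σ (inl ⁻¹' y) s) : Step τ (inr ⁻¹' y) t := by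
  refine WbStep.transfer h (fun s t => ∃ b, σ.disp s = inr b ∧ τ.disp t = inl b)
    (fun _ _ ⟨_, h1, h2⟩ => isQ_mirror h1 h2) (fun _ _ ⟨_, h1, h2⟩ => isAns_mirror h1 h2)
    ⟨b, hs, ht⟩ ?_ ?_ ?_
  · intro q' hq' hQ hJ
    rcases hJ.to_left ht with ⟨b₀, h1, h2⟩ | ⟨c, -, hb, -⟩
    · obtain ⟨q, hq, h3⟩ := hy.mirror_right hq' h1
      exact Or.inl ⟨q, hq, ⟨b₀, h3, h1⟩, .right h3 hs h2⟩
    · rw [pol_of_min_right hs hb] at hpos; cases hpos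
  · rintro q q' ⟨b₀, h1, h2⟩ hq hQ hJ r' hr' hJ'
    obtain ⟨b₁, h3, h4⟩ := hJ'.of_left h2
    obtain ⟨r, hr, h5⟩ := hy.mirror_right hr' h3
    exact Or.inl ⟨r, hr, ⟨b₁, h5, h3⟩, .right h1 h5 h4⟩
  · rintro r r' ⟨b₀, h1, h2⟩ v hv hA hJ
    rcases hJ.of_right h1 with ⟨b₁, h3, h4⟩ | ⟨a, h3, ha, -⟩
    · rcases hv with rfl | hv
      · obtain rfl := Sum.inr.inj (hs.symm.trans h3)
        exact ⟨t, Or.inl rfl, ⟨_, hs, ht⟩, .left h2 ht h4⟩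
      · obtain ⟨w, hw, h5⟩ := hy.mirror_left hv h3
        exact ⟨w, Or.inr hw, ⟨b₁, h3, h5⟩, .left h2 h5 h4⟩
    · exact (hA.not_min_left h3 ha).elim

theorem Step.right_to_left (hσ : IsPointedStrategy σ) (hy : PairState σ τ y) {s t b}
    (hs : σ.disp s = inr b)
    (ht : τ.disp t = inl b) (hneg : (A.hom B.toGame).pol (σ.disp s) = Pol.neg)
    (h : Step τ (inr ⁻¹' y) t) : Step σ (inl ⁻¹' y) s := by
  refine WbStep.transfer h (fun t s => ∃ b, σ.disp s = inr b ∧ τ.disp t = inl b)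
    (fun _ _ ⟨_, h1, h2⟩ => (isQ_mirror h1 h2).symm)
    (fun _ _ ⟨_, h1, h2⟩ => (isAns_mirror h1 h2).symm)
    ⟨b, hs, ht⟩ ?_ ?_ ?_
  · intro q' hq' hQ hJ
    obtain ⟨b₀, h1, h2⟩ := hJ.to_right hs
    obtain ⟨q, hq, h3⟩ := hy.mirror_left hq' h1
    exact Or.inl ⟨q, hq, ⟨b₀, h1, h3⟩, .left h3 ht h2⟩
  · rintro q q' ⟨b₀, h1, h2⟩ hq hQ hJ r' hr' hJ'
    rcases hJ'.of_right h1 with ⟨b₁, h3, h4⟩ | ⟨a, h3, ha, hmin, -⟩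
    · obtain ⟨r, hr, h5⟩ := hy.mirror_left hr' h3
      exact Or.inl ⟨r, hr, ⟨b₁, h3, h5⟩, .left h2 h5 h4⟩
    · exfalso
      obtain ⟨b₂, h5, h6⟩ := hσ.exists_min_disp hmin
      obtain rfl := Sum.inr.inj (h5.symm.trans h1)
      obtain ⟨b₃, h7, h8⟩ := hJ.of_left h2
      obtain rfl := Sum.inl.inj (ht.symm.trans h7)
      rw [pol_of_imm_min hs h6 h8] at hneg
      cases hneg
  · rintro r r' ⟨b₀, h1, h2⟩ v hv hA hJ
    obtain ⟨b₁, h3, h4⟩ := hJ.of_left h2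
    rcases hv with rfl | hv
    · obtain rfl := Sum.inl.inj (ht.symm.trans h3)
      exact ⟨s, Or.inl rfl, ⟨_, hs, ht⟩, .right h1 hs h4⟩
    · obtain ⟨w, hw, h5⟩ := hy.mirror_right hv h3
      exact ⟨w, Or.inr hw, ⟨b₁, h5, h3⟩, .right h1 h5 h4⟩

/-- States whose two components are reached by well-bracketed plays. -/
def PairRun (σ : Strat A.toGame B.toGame) (τ : Strat B.toGame C.toGame)
    (y : Set (σ.ev ⊕ τ.ev)) : Prop :=
  WbRun σ (inl ⁻¹' y) ∧ WbRun τ (inr ⁻¹' y)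

/-- Well-bracketing in terms of the moves of a strategy. -/
def IsWbStrat (σ : Strat A.toGame B.toGame) : Prop :=
  ∀ S s, WbRun σ S → σ.Enables S s → (A.hom B.toGame).pol (σ.disp s) = Pol.pos →
    Step σ S s

theorem PairState.insert_pair (hy : PairState σ τ y) (hz : PairState σ τ z) (hyz : y ⊆ z) {s t b}
    (hs : inl s ∈ z) (ht : inr t ∈ z) (hsd : σ.disp s = inr b)
    (htd : τ.disp t = inl b) (hs' : ∀ s', σ.lt s' s → inl s' ∈ y)
    (ht' : ∀ t', τ.lt t' t → inr t' ∈ y) :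
    PairState σ τ (insert (inl s) (insert (inr t) y)) := by
  refine ⟨ESS.conf_of_subset hz.conf (Set.insert_subset hs (Set.insert_subset ht hyz)) ?_, ?_⟩
  · rintro e (rfl | rfl | he) e' hl
    · rcases e' with e' | e'
      · exact Or.inr (Or.inr (hs' e' (ESS.par_lt_ll.1 hl)))
      · exact (ESS.par_lt_rl.1 hl).elim
    · rcases e' with e' | e'
      · exact (ESS.par_lt_lr.1 hl).elim
      · exact Or.inr (Or.inr (ht' e' (ESS.par_lt_rr.1 hl)))
    · exact Or.inr (Or.inr (hy.conf.2.1 e he e' hl.1))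
  · rintro e (rfl | rfl | he) hh
    · exact ⟨_, Or.inr (Or.inl rfl), mir_of_disp hsd htd⟩
    · exact ⟨_, Or.inl rfl, (mir_of_disp hsd htd).symm⟩
    · obtain ⟨m, hm, h⟩ := hy.mir e he hh
      exact ⟨m, Or.inr (Or.inr hm), h⟩

/-- Well-bracketed strategies remain well-bracketed during their hidden interaction. -/
theorem PairRun.fill (hσ : IsPointedStrategy σ) (hτ : IsPointedStrategy τ) (vσ : IsVisible σ)
    (vτ : IsVisible τ) (wσ : IsWbStrat σ) (wτ : IsWbStrat τ) (hz : PairState σ τ z) :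
    ∀ (n : ℕ) (y : Set (σ.ev ⊕ τ.ev)), (z \ y).ncard = n → PairState σ τ y → y ⊆ z →
      (∀ m ∈ z, m ∉ y → Hid ((parStrat σ τ).disp m)) → PairRun σ τ y → PairRun σ τ z := by
  have hR := isInter_parStrat hσ hτ vσ vτ
  obtain ⟨r, hr⟩ := State.exists_rank hR.pointed hR.visible hR.side (isMirror_diag _) hz
  intro n
  induction n using Nat.strong_induction_on with
  | _ n ih =>
    intro y hn hy hyz hh hrun
    by_cases hne : (z \ y).Nonempty
    swap
    · rw [Set.not_nonempty_iff_eq_empty, Set.sdiff_eq_empty] at hne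
      rwa [subset_antisymm hne hyz]
    obtain ⟨m, ⟨hmz, hmy⟩, hmin⟩ := Set.exists_min_image (z \ y) r (hz.conf.1.subset
      Set.sdiff_subset) hne
    have main : ∀ s t b, inl s ∈ z → inr t ∈ z → inl s ∉ y → inr t ∉ y →
        σ.disp s = inr b → τ.disp t = inl b → (∀ s', σ.lt s' s → inl s' ∈ y) →
        (∀ t', τ.lt t' t → inr t' ∈ y) → PairRun σ τ z := by
      intro s t b hs ht hsy hty hsd htd hs' ht'
      have hst := hy.insert_pair hz hyz hs ht hsd htd hs' ht'
      have hes := hy.enables_left hz hyz hs hsy hs'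
      have het := hy.enables_right hz hyz ht hty ht'
      refine ih _ ?_ _ rfl hst (Set.insert_subset hs (Set.insert_subset ht hyz))
        (fun m hm hmy => hh m hm fun h => hmy (Or.inr (Or.inr h))) ?_
      · rw [← hn]
        refine Set.ncard_lt_ncard ⟨fun e he => ⟨he.1, fun h => he.2 (Or.inr (Or.inr h))⟩, fun h =>
          (h ⟨hs, hsy⟩).2 (Or.inl rfl)⟩ (hz.conf.1.subset Set.sdiff_subset)
      · have key : Step σ (inl ⁻¹' y) s ∧ Step τ (inr ⁻¹' y) t := by
          by_cases hpol : (A.hom B.toGame).pol (σ.disp s) = Pol.pos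
          · have h1 := wσ _ _ hrun.1 hes hpol
            exact ⟨h1, h1.left_to_right hy hsd htd hpol⟩
          · have h2 := Pol.eq_neg.2 hpol
            have h1 := wτ _ _ hrun.2 het (by
              rw [hsd] at h2; rw [htd]; exact Pol.flip_eq_pos.2 h2)
            exact ⟨h1.right_to_left hσ hy hsd htd h2, h1⟩
        constructor
        · have := hrun.1.insert hes key.1
          rwa [ESS.preimage_inl_insert_inl, ESS.preimage_inl_insert_inr]
        · have := hrun.2.insert het key.2
          rwa [ESS.preimage_inr_insert_inl, ESS.preimage_inr_insert_inr]
    have pre : ∀ m' ∈ z, r m' = r m → ∀ e, (parStrat σ τ).lt e m' → e ∈ y := by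
      intro m' hm' he e hl
      have hez := hz.conf.2.1 m' hm' e hl.1
      by_contra hey
      have := hr.lt e hez m' hm' hl
      have := hmin e ⟨hez, hey⟩
      omega
    obtain ⟨m', hm'z, hmir⟩ := hz.mir m hmz (hh m hmz hmy)
    have hm'y : m' ∉ y := by
      intro hm'
      obtain ⟨m₁, h1, h2⟩ := hy.mir m' hm' hmir.hid'
      rw [← hR.pointed.mir_unique (isMirror_diag _) hz.conf hmz (hyz h1) hmir.symm h2] at h1
      exact hmy h1
    have hpre := pre m hmz rfl
    have hpre' := pre m' hm'z (hr.mir m hmz m' hm'z hmir).symm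
    rcases m with s | t
    · obtain ⟨t, b, rfl, h1, h2⟩ := disp_of_mir hmir
      exact main s t b hmz hm'z hmy hm'y h1 h2 (fun e h => hpre _ (ESS.par_lt_ll.2 h))
        (fun e h => hpre' _ (ESS.par_lt_rr.2 h))
    · obtain ⟨s, b, rfl, h1, h2⟩ := disp_of_mir' hmir
      exact main s t b hm'z hmz hm'y hmy h1 h2 (fun e h => hpre' _ (ESS.par_lt_ll.2 h))
        (fun e h => hpre _ (ESS.par_lt_rr.2 h))

end Comp

section PrimeBrackets

variable {A B C : NegArena.{u}} {σ : Strat A.toGame B.toGame} {τ : Strat B.toGame C.toGame}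
  {P : Type u} {D : P → Set (σ.ev ⊕ τ.ev)} {tp : P → σ.ev ⊕ τ.ev}
  {f : P → (A.hom C.toGame).ev} {y z : Set (σ.ev ⊕ τ.ev)} {p : P}

/-- The strategy of primes of the interaction of `σ` and `τ`. -/
abbrev pairStrat (σ : Strat A.toGame B.toGame) (τ : Strat B.toGame C.toGame)
    (D : P → Set (σ.ev ⊕ τ.ev)) (tp : P → σ.ev ⊕ τ.ev) (f : P → (A.hom C.toGame).ev) :
    Strat A.toGame C.toGame :=
  primeStrat (A := A) (B := B) (C := C) (parStrat σ τ) D tp f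

/-- Primes of the interaction of two strategies. -/
structure IsPairPrimes (σ : Strat A.toGame B.toGame) (τ : Strat B.toGame C.toGame)
    (D : P → Set (σ.ev ⊕ τ.ev)) (tp : P → σ.ev ⊕ τ.ev) (f : P → (A.hom C.toGame).ev) :
    Prop where
  left : IsWbVis σ
  right : IsWbVis τ
  primes : IsPrimes (A := A) (B := B) (C := C) (parStrat σ τ) D tp (visV (parStrat σ τ))
  disp : ∀ p, outer (f p) = (parStrat σ τ).disp (tp p)

namespace IsPairPrimes

variable (h : IsPairPrimes σ τ D tp f)
include h

theorem inter : IsInter (A := A) (B := B) (C := C) (parStrat σ τ) :=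
  isInter_parStrat h.left.strategy h.right.strategy h.left.visible h.right.visible

theorem pointed : IsPointedStrategy (pairStrat σ τ D tp f) := h.primes.isPointed h.inter h.disp

theorem tp_left {a} (hp : f p = inl a) : ∃ s, tp p = inl s ∧ σ.disp s = inl a := by
  have h1 : inl (inl a) = Sum.map σ.disp τ.disp (tp p) :=
    (congrArg outer hp).symm.trans (h.disp p)
  generalize tp p = e at *
  rcases e with s | t
  · exact ⟨s, rfl, (Sum.inl.inj h1).symm⟩
  · cases h1

theorem tp_right {c} (hp : f p = inr c) : ∃ t, tp p = inr t ∧ τ.disp t = inr c := by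
  have h1 : inr (inr c) = Sum.map σ.disp τ.disp (tp p) :=
    (congrArg outer hp).symm.trans (h.disp p)
  generalize tp p = e at *
  rcases e with s | t
  · cases h1
  · exact ⟨t, rfl, (Sum.inr.inj h1).symm⟩

theorem f_left {s} (hp : tp p = inl s) : ∃ a, f p = inl a ∧ σ.disp s = inl a := by
  rcases hf : f p with a | c
  · obtain ⟨s', h1, h2⟩ := h.tp_left hf
    obtain rfl := Sum.inl.inj (hp.symm.trans h1)
    exact ⟨a, rfl, h2⟩
  · obtain ⟨s', h1, h2⟩ := h.tp_right hf
    cases hp.symm.trans h1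

theorem f_right {t} (hp : tp p = inr t) : ∃ c, f p = inr c ∧ τ.disp t = inr c := by
  rcases hf : f p with a | c
  · obtain ⟨s', h1, h2⟩ := h.tp_left hf
    cases hp.symm.trans h1
  · obtain ⟨s', h1, h2⟩ := h.tp_right hf
    obtain rfl := Sum.inr.inj (hp.symm.trans h1)
    exact ⟨c, rfl, h2⟩

theorem exists_left (hz : PairState σ τ z) {s a} (hs : inl s ∈ z) (hd : σ.disp s = inl a) :
    ∃ p ∈ cfg D z, tp p = inl s ∧ f p = inl a := by
  obtain ⟨p, hp, h1⟩ := h.primes.exists_mem_cfg hz hs (by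
    simp only [visV, Set.mem_ofPred_eq, Sum.map_inl, hd, Hid]; exact id)
  obtain ⟨a', h2, h3⟩ := h.f_left h1
  obtain rfl := Sum.inl.inj (hd.symm.trans h3)
  exact ⟨p, hp, h1, h2⟩

theorem exists_right (hz : PairState σ τ z) {t c} (ht : inr t ∈ z)
    (hd : τ.disp t = inr c) : ∃ p ∈ cfg D z, tp p = inr t ∧ f p = inr c := by
  obtain ⟨p, hp, h1⟩ := h.primes.exists_mem_cfg hz ht (by
    simp only [visV, Set.mem_ofPred_eq, Sum.map_inr, hd, Hid]; exact id)
  obtain ⟨a', h2, h3⟩ := h.f_right h1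
  obtain rfl := Sum.inr.inj (hd.symm.trans h3)
  exact ⟨p, hp, h1, h2⟩

omit h in
theorem isQ_left {s a} (hp : f p = inl a) (hs : σ.disp s = inl a) :
    IsQ σ s ↔ IsQ (pairStrat σ τ D tp f) p := by
  rw [IsQ, IsQ, hs, show (pairStrat σ τ D tp f).disp p = _ from hp]; exact Iff.rfl

omit h in
theorem isAns_left {s a} (hp : f p = inl a) (hs : σ.disp s = inl a) :
    IsAns σ s ↔ IsAns (pairStrat σ τ D tp f) p := by
  rw [IsAns, IsAns, hs, show (pairStrat σ τ D tp f).disp p = _ from hp]; exact Iff.rfl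

omit h in
theorem isQ_right {t c} (hp : f p = inr c) (ht : τ.disp t = inr c) :
    IsQ τ t ↔ IsQ (pairStrat σ τ D tp f) p := by
  rw [IsQ, IsQ, ht, show (pairStrat σ τ D tp f).disp p = _ from hp]; exact Iff.rfl

omit h in
theorem isAns_right {t c} (hp : f p = inr c) (ht : τ.disp t = inr c) :
    IsAns τ t ↔ IsAns (pairStrat σ τ D tp f) p := by
  rw [IsAns, IsAns, ht, show (pairStrat σ τ D tp f).disp p = _ from hp]; exact Iff.rfl

/-- An event of the left arena is linked to the initial event on which it depends by an initial
event of the middle arena. -/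
theorem exists_link {q : P} (hq : (pairStrat σ τ D tp f).IsMinEv q) (hqp : D q ⊆ D p) {s t}
    (hp : tp p = inl s) (ht : tp q = inr t) :
    ∃ m₀ t₀ b, σ.IsMinEv m₀ ∧ σ.le m₀ s ∧ inr t₀ ∈ D p ∧ σ.disp m₀ = inr b ∧
      τ.disp t₀ = inl b ∧ τ.IsMinEv t ∧ τ.le t t₀ ∧ B.IsMinEv b := by
  have hR := h.inter
  obtain ⟨m, c, h1, h2, h3⟩ := exists_rootPart hR (h.primes.state p) (h.primes.tp_mem p)
  have h4 := h.primes.least p _ _ (rootPart_state hR (h.primes.state p) h1 h2) (h.primes.state p)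
    (fun _ h => h.1) subset_rfl h3
  have h5 := h.primes.min_prime hR hq
  have h6 := eq_of_mem_rootPart h5.1 (h.primes.tp_V q) (h4 (hqp (h.primes.tp_mem q)))
  rw [ht] at h6 h5
  subst h6
  rw [hp] at h3
  rcases h3 with ⟨-, h3 | ⟨n₀, h7, h8, n₁, h9, h10, h11⟩⟩
  · exact (ESS.par_le_rl.1 h3).elim
  · rcases n₀ with m₀ | n₀
    · obtain ⟨t₀, b, rfl, h12, h13⟩ := disp_of_mir h10
      have h14 := ESS.par_min_l.1 h8
      obtain ⟨b', h15, h16⟩ := h.left.strategy.exists_min_disp h14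
      obtain rfl := Sum.inr.inj (h12.symm.trans h15)
      exact ⟨m₀, t₀, b, h14, ESS.par_le_ll.1 h7, h9, h12, h13, ESS.par_min_r.1 h5.1,
        ESS.par_le_rr.1 h11, h16⟩
    · exact (ESS.par_le_rl.1 h7).elim

theorem step_of_left (hy : PairState σ τ y) (hrun : WbRun τ (inr ⁻¹' y))
    (hz : D p ⊆ insert (tp p) y) {s}
    (hp : tp p = inl s) (hst : Step σ (inl ⁻¹' y) s) :
    Step (pairStrat σ τ D tp f) (cfg D y) p := by
  obtain ⟨a, ha, hs⟩ := h.f_left hp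
  refine WbStep.transfer hst (fun s p => tp p = inl s) (fun s p hp => ?_) (fun s p hp => ?_)
    hp ?_ ?_ ?_
  · obtain ⟨a, h1, h2⟩ := h.f_left hp
    exact isQ_left h1 h2
  · obtain ⟨a, h1, h2⟩ := h.f_left hp
    exact isAns_left h1 h2
  · intro q' hq' hQ hJ
    rcases hJ.to_left ha with ⟨a', h1, h2⟩ | ⟨c, h1, h2, h3, h4⟩
    · obtain ⟨s', h3, h4⟩ := h.tp_left h1
      have h5 : inl s' ∈ y := h3 ▸ hq' (h.primes.tp_mem q')
      exact Or.inl ⟨s', h5, h3, .left h4 hs h2⟩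
    · refine Or.inr ⟨fun hA => hA.not_min_left ha h2, ?_⟩
      rintro ⟨a', ha', hA', hJ'⟩
      rcases hJ'.of_right h1 with ⟨c', h5, h6⟩ | ⟨a'', h5, h6, -⟩
      swap
      · exact hA'.not_min_left h5 h6
      obtain ⟨t, h7, h8⟩ := h.tp_right h1
      obtain ⟨t', h9, h10⟩ := h.tp_right h5
      obtain ⟨m₀, t₀, b, h11, h12, h13, h14, h15, h16, h17, h18⟩ := h.exists_link h3 h4 hp h7
      have h19 : inr t₀ ∈ y := by
        rcases hz h13 with h' | h'
        · rw [hp] at h'; cases h'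
        · exact h'
      obtain ⟨t'', h20, h21, h22⟩ := hrun.answered h.right.strategy t
        (show inr t ∈ y from h7 ▸ hq' (h.primes.tp_mem q')) t'
        (show inr t' ∈ y from h9 ▸ ha' (h.primes.tp_mem a')) t₀ h19
        ((isQ_right h1 h8).2 hQ) ((isAns_right h5 h10).2 hA') (isQ_of_min_left h15 h18)
        (.right h8 h10 h6) (.jump h8 h15 h18 h16 h17)
      obtain ⟨b'', h23, h24⟩ := h22.of_left h15
      obtain ⟨s'', h25, h26⟩ := hy.mirror_right h20 h23
      obtain ⟨s₀, h27, h28⟩ := hy.mirror_right h19 h15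
      have h29 : s₀ = m₀ := by
        have hs₀ : m₀ ∈ inl ⁻¹' D p := (h.primes.state p).conf.2.1 _ (h.primes.tp_mem p) _
          (hp ▸ ESS.par_le_ll.2 h12)
        rcases hz hs₀ with h' | h'
        · rw [hp] at h'
          obtain rfl := Sum.inl.inj h'
          rw [h14] at hs; cases hs
        · exact h.left.strategy.locally_injective _ hy.left_conf h27 h' (h28.trans h14.symm)
      subst h29
      exact hst.fork s₀ h27 (isQ_of_min_right h14 h18) (.jump h14 hs h2 h11 h12)
        ⟨s'', h25, (isAns_mirror h26 h23).2 h21, .right h14 h26 h24⟩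
  · intro q q' hqq' hq hQ hJ r' hr' hJ'
    obtain ⟨a', h1, h2⟩ := h.f_left hqq'
    obtain ⟨a'', h3, h4⟩ := hJ'.of_left h1
    obtain ⟨s', h5, h6⟩ := h.tp_left h3
    have h7 : inl s' ∈ y := h5 ▸ hr' (h.primes.tp_mem r')
    exact Or.inl ⟨s', h7, h5, .left h2 h6 h4⟩
  · intro r r' hrr' v hv hA hJ
    obtain ⟨a', h1, h2⟩ := h.f_left hrr'
    obtain ⟨a'', h3, h4⟩ := hJ.of_left h2
    rcases hv with rfl | hv
    · obtain rfl := Sum.inl.inj (hs.symm.trans h3)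
      exact ⟨p, Or.inl rfl, hp, .left h1 ha h4⟩
    · obtain ⟨w, hw, h5, h6⟩ := h.exists_left hy hv h3
      exact ⟨w, Or.inr hw, h5, .left h1 h6 h4⟩

theorem step_to_left (hy : PairState σ τ y) {s}
    (hp : tp p = inl s) (hneg : (A.hom B.toGame).pol (σ.disp s) = Pol.neg)
    (hst : Step (pairStrat σ τ D tp f) (cfg D y) p) : Step σ (inl ⁻¹' y) s := by
  obtain ⟨a, ha, hs⟩ := h.f_left hp
  refine WbStep.transfer hst (fun p s => tp p = inl s) (fun p s hp => ?_) (fun p s hp => ?_)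
    hp ?_ ?_ ?_
  · obtain ⟨a, h1, h2⟩ := h.f_left hp
    exact (isQ_left h1 h2).symm
  · obtain ⟨a, h1, h2⟩ := h.f_left hp
    exact (isAns_left h1 h2).symm
  · intro q' hq' hQ hJ
    rcases hJ.to_left hs with ⟨a', h1, h2⟩ | ⟨c, h1, h2, h3, h4⟩
    · obtain ⟨q, h3, h4, h5⟩ := h.exists_left hy hq' h1
      exact Or.inl ⟨q, h3, h4, .left h5 ha h2⟩
    · rw [pol_of_min_left hs h2] at hneg; cases hneg
  · intro q q' hqq' hq hQ hJ r' hr' hJ'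
    obtain ⟨a', h1, h2⟩ := h.f_left hqq'
    obtain ⟨a'', h3, h4⟩ := hJ'.of_left h2
    obtain ⟨r, h5, h6, h7⟩ := h.exists_left hy hr' h3
    exact Or.inl ⟨r, h5, h6, .left h1 h7 h4⟩
  · intro r r' hrr' v hv hA hJ
    obtain ⟨a', h1, h2⟩ := h.f_left hrr'
    obtain ⟨a'', h3, h4⟩ := hJ.of_left h1
    rcases hv with rfl | hv
    · obtain rfl := Sum.inl.inj (ha.symm.trans h3)
      exact ⟨s, Or.inl rfl, hp, .left h2 hs h4⟩
    · obtain ⟨w, h5, h6⟩ := h.tp_left h3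
      exact ⟨w, Or.inr (h5 ▸ hv (h.primes.tp_mem v) : inl w ∈ y), h5, .left h2 h6 h4⟩

theorem step_of_right (hy : PairState σ τ y) (hrun : WbRun σ (inl ⁻¹' y)) {t}
    (hp : tp p = inr t) (hst : Step τ (inr ⁻¹' y) t) :
    Step (pairStrat σ τ D tp f) (cfg D y) p := by
  obtain ⟨c, hc, ht⟩ := h.f_right hp
  refine WbStep.transfer hst (fun t p => tp p = inr t) (fun t p hp => ?_) (fun t p hp => ?_)
    hp ?_ ?_ ?_
  · obtain ⟨a, h1, h2⟩ := h.f_right hp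
    exact isQ_right h1 h2
  · obtain ⟨a, h1, h2⟩ := h.f_right hp
    exact isAns_right h1 h2
  · intro q' hq' hQ hJ
    obtain ⟨c', h1, h2⟩ := hJ.to_right hc
    obtain ⟨t', h3, h4⟩ := h.tp_right h1
    exact Or.inl ⟨t', (h3 ▸ hq' (h.primes.tp_mem q') : inr t' ∈ y), h3, .right h4 ht h2⟩
  · intro q q' hqq' hq hQ hJ r' hr' hJ'
    obtain ⟨c', h1, h2⟩ := h.f_right hqq'
    rcases hJ'.of_right h1 with ⟨c'', h3, h4⟩ | ⟨a, h3, h4, h5, h6⟩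
    · obtain ⟨t', h5, h6⟩ := h.tp_right h3
      exact Or.inl ⟨t', (h5 ▸ hr' (h.primes.tp_mem r') : inr t' ∈ y), h5, .right h2 h6 h4⟩
    · refine Or.inr ⟨fun hA => hA.not_min_left h3 h4, fun hA => ?_⟩
      obtain ⟨s', h7, h8⟩ := h.tp_left h3
      obtain ⟨m₀, t₀, b, h11, h12, h13, h14, h15, h16, h17, h18⟩ := h.exists_link h5 h6 h7 hqq'
      obtain ⟨t'', h20, h21, h22⟩ := hst.wait hA q hq hQ hJ t₀ (hr' h13) (isQ_of_min_left h15 h18)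
        (.jump h2 h15 h18 h16 h17)
      obtain ⟨b'', h23, h24⟩ := h22.of_left h15
      rcases h20 with rfl | h20
      · rw [ht] at h23; cases h23
      obtain ⟨s'', h25, h26⟩ := hy.mirror_right h20 h23
      have hs' : s' ∈ inl ⁻¹' y := (h7 ▸ hr' (h.primes.tp_mem r') : inl s' ∈ y)
      have hm₀ : m₀ ∈ inl ⁻¹' y := hy.left_conf.2.1 s' hs' m₀ h12
      obtain ⟨v, h27, h28, h29⟩ := hrun.answered h.left.strategy m₀ hm₀ s'' h25 s' hs'
        (isQ_of_min_right h14 h18) ((isAns_mirror h26 h23).2 h21) (isQ_of_min_left h8 h4)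
        (.right h14 h26 h24) (.jump h14 h8 h4 h11 h12)
      obtain ⟨a', h30, h31⟩ := h29.of_left h8
      obtain ⟨w, h32, h33, h34⟩ := h.exists_left hy h27 h30
      exact ⟨w, h32, (isAns_left h34 h30).1 h28, .left h3 h34 h31⟩
  · intro r r' hrr' v hv hA hJ
    obtain ⟨c', h1, h2⟩ := h.f_right hrr'
    rcases hJ.of_right h2 with ⟨c'', h3, h4⟩ | ⟨a, h3, h4, -⟩
    · rcases hv with rfl | hv
      · obtain rfl := Sum.inr.inj (ht.symm.trans h3)
        exact ⟨p, Or.inl rfl, hp, .right h1 hc h4⟩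
      · obtain ⟨w, hw, h5, h6⟩ := h.exists_right hy hv h3
        exact ⟨w, Or.inr hw, h5, .right h1 h6 h4⟩
    · exact (hA.not_min_left h3 h4).elim

theorem step_to_right (hy : PairState σ τ y) {t}
    (hp : tp p = inr t) (hneg : (B.hom C.toGame).pol (τ.disp t) = Pol.neg)
    (hst : Step (pairStrat σ τ D tp f) (cfg D y) p) : Step τ (inr ⁻¹' y) t := by
  obtain ⟨c, hc, ht⟩ := h.f_right hp
  refine WbStep.transfer hst (fun p t => tp p = inr t) (fun p t hp => ?_) (fun p t hp => ?_)
    hp ?_ ?_ ?_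
  · obtain ⟨a, h1, h2⟩ := h.f_right hp
    exact (isQ_right h1 h2).symm
  · obtain ⟨a, h1, h2⟩ := h.f_right hp
    exact (isAns_right h1 h2).symm
  · intro q' hq' hQ hJ
    obtain ⟨c', h1, h2⟩ := hJ.to_right ht
    obtain ⟨q, h3, h4, h5⟩ := h.exists_right hy hq' h1
    exact Or.inl ⟨q, h3, h4, .right h5 hc h2⟩
  · intro q q' hqq' hq hQ hJ r' hr' hJ'
    obtain ⟨c', h1, h2⟩ := h.f_right hqq'
    rcases hJ'.of_right h2 with ⟨c'', h3, h4⟩ | ⟨b, h3, h4, h5, -⟩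
    · obtain ⟨r, h5, h6, h7⟩ := h.exists_right hy hr' h3
      exact Or.inl ⟨r, h5, h6, .right h1 h7 h4⟩
    · exfalso
      obtain ⟨c₁, h6, h7⟩ := h.right.strategy.exists_min_disp h5
      obtain rfl := Sum.inr.inj (h6.symm.trans h2)
      obtain ⟨c₂, h8, h9⟩ := hJ.to_right hc
      obtain rfl := Sum.inr.inj (h8.symm.trans h1)
      rw [pol_of_imm_min ht h7 h9] at hneg
      cases hneg
  · intro r r' hrr' v hv hA hJ
    obtain ⟨c', h1, h2⟩ := h.f_right hrr'
    rcases hJ.of_right h1 with ⟨c'', h3, h4⟩ | ⟨a, h3, h4, -⟩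
    · rcases hv with rfl | hv
      · obtain rfl := Sum.inr.inj (hc.symm.trans h3)
        exact ⟨t, Or.inl rfl, hp, .right h2 ht h4⟩
      · obtain ⟨w, h5, h6⟩ := h.tp_right h3
        exact ⟨w, Or.inr (h5 ▸ hv (h.primes.tp_mem v) : inr w ∈ y), h5, .right h2 h6 h4⟩
    · exact (hA.not_min_left h3 h4).elim

/-- A positive prime is maximal in the state that it generates together with earlier primes. -/
theorem pos_state {S : Set P} (hen : (pairStrat σ τ D tp f).Enables S p)
    (hpos : (A.hom C.toGame).pol (f p) = Pol.pos) :
    PairState σ τ (gen D (insert p S) \ {tp p}) ∧ cfg D (gen D (insert p S) \ {tp p}) = S ∧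
      gen D S ⊆ gen D (insert p S) \ {tp p} := by
  have hR := h.inter
  have hpol : (arenaMid A B C).pol ((parStrat σ τ).disp (tp p)) = Pol.pos := by
    rw [← h.disp, outer_pol]; exact hpos
  have hz := h.primes.gen_state hen.2.2
  have hcz := h.primes.cfg_gen hen.2.2
  have hgS := h.primes.gen_state hen.1
  have hsub : gen D S ⊆ gen D (insert p S) := fun a ⟨q, hq, ha⟩ => ⟨q, Or.inr hq, ha⟩
  have htp : tp p ∉ gen D S := by
    rintro ⟨q, hq, ha⟩
    refine hen.2.1 (hen.1.2.1 q hq p ?_)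
    exact h.primes.le_of_mem hz (IsPrimes.subset_gen (Or.inl rfl)) (IsPrimes.subset_gen (Or.inr hq)) ha
  have hmax : ∀ e ∈ gen D (insert p S), ¬ (parStrat σ τ).lt (tp p) e := by
    intro e he hl
    obtain ⟨n, hn, hl, hmin⟩ := hR.pointed.isES.exists_minimal
      (fun n => (parStrat σ τ).lt (tp p) n) (x := gen D (insert p S)) ⟨e, he, hl⟩
    have himm : (parStrat σ τ).imm (tp p) n := ⟨hl, fun d hd =>
      hmin d (hz.conf.2.1 n hn d hd.2.1) hd.2 hd.1⟩
    have hg := hR.pointed.courteous _ _ himm (Or.inl hpol)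
    obtain ⟨q, hq, rfl⟩ := h.primes.exists_mem_cfg hz hn (fun hh => h.primes.tp_V p
      ((hid_of_imm hg).2 hh))
    rw [hcz] at hq
    rcases hq with rfl | hq
    · exact hl.2 rfl
    · exact htp (hgS.conf.2.1 (tp q) ⟨q, hq, h.primes.tp_mem q⟩ _ hl.1)
  have hst : PairState σ τ (gen D (insert p S) \ {tp p}) := by
    refine ⟨ESS.conf_of_subset hz.conf Set.sdiff_subset ?_, ?_⟩
    · rintro e ⟨he, -⟩ e' hl
      refine ⟨hz.conf.2.1 e he e' hl.1, ?_⟩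
      rintro rfl
      exact hmax e he hl
    · rintro e ⟨he, -⟩ hh
      obtain ⟨e', he', hm⟩ := hz.mir e he hh
      refine ⟨e', ⟨he', ?_⟩, hm⟩
      rintro rfl
      exact h.primes.tp_V p hm.hid'
  have hsub' : gen D S ⊆ gen D (insert p S) \ {tp p} := fun a ha => ⟨hsub ha, fun he =>
    htp (he ▸ ha)⟩
  refine ⟨hst, subset_antisymm ?_ fun q hq => (IsPrimes.subset_gen (D := D) hq).trans hsub', hsub'⟩
  intro q hq
  have : q ∈ cfg D (gen D (insert p S)) := hq.trans Set.sdiff_subset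
  rw [hcz] at this
  rcases this with rfl | hq'
  · exact ((hq (h.primes.tp_mem q)).2 rfl).elim
  · exact hq'

theorem step_of_pos (wσ : IsWbStrat σ) (wτ : IsWbStrat τ) {S : Set P} (hrun : PairRun σ τ (gen D S))
    (hen : (pairStrat σ τ D tp f).Enables S p)
    (hpos : (A.hom C.toGame).pol (f p) = Pol.pos) :
    PairRun σ τ (gen D (insert p S)) ∧ Step (pairStrat σ τ D tp f) S p := by
  have hR := h.inter
  obtain ⟨h1, h2, h3⟩ := h.pos_state hen hpos
  have hrun' : PairRun σ τ (gen D (insert p S) \ {tp p}) := by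
    refine PairRun.fill h.left.strategy h.right.strategy h.left.visible h.right.visible wσ wτ h1 _ _
      rfl (h.primes.gen_state hen.1) h3 (fun m hm hmS => ?_) hrun
    by_contra hh
    obtain ⟨q, hq, rfl⟩ := h.primes.exists_mem_cfg h1 hm hh
    rw [h2] at hq
    exact hmS ⟨q, hq, h.primes.tp_mem q⟩
  have hz := h.primes.gen_state hen.2.2
  have htz : tp p ∈ gen D (insert p S) := ⟨p, Or.inl rfl, h.primes.tp_mem p⟩
  have hins : gen D (insert p S) = insert (tp p) (gen D (insert p S) \ {tp p}) := by
    rw [Set.insert_sdiff_singleton, Set.insert_eq_of_mem htz]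
  have hDp : D p ⊆ insert (tp p) (gen D (insert p S) \ {tp p}) := by
    rw [← hins]; exact IsPrimes.subset_gen (Set.mem_insert _ _)
  have hpre : ∀ e, (parStrat σ τ).lt e (tp p) → e ∈ gen D (insert p S) \ {tp p} :=
    fun e hl => ⟨hz.conf.2.1 _ htz e hl.1, hl.2⟩
  have hpol : (arenaMid A B C).pol ((parStrat σ τ).disp (tp p)) = Pol.pos := by
    rw [← h.disp, outer_pol]; exact hpos
  generalize hy : gen D (insert p S) \ {tp p} = y at *
  rw [hins] at hz htz ⊢
  rcases ht : tp p with s | t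
  · rw [ht] at hz htz hpre hy hpol
    have hen' := h1.enables_left hz (Set.subset_insert _ _) htz (fun h => (hy.symm ▸ h).2 rfl)
      (fun s' hl => hpre _ (ESS.par_lt_ll.2 hl))
    have hst := wσ _ _ hrun'.1 hen' hpol
    refine ⟨⟨?_, ?_⟩, h2 ▸ h.step_of_left h1 hrun'.2 hDp ht hst⟩
    · rw [ESS.preimage_inl_insert_inl]; exact hrun'.1.insert hen' hst
    · rw [ESS.preimage_inr_insert_inl]; exact hrun'.2
  · rw [ht] at hz htz hpre hy hpol
    have hen' := h1.enables_right hz (Set.subset_insert _ _) htz (fun h => (hy.symm ▸ h).2 rfl)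
      (fun s' hl => hpre _ (ESS.par_lt_rr.2 hl))
    have hst := wτ _ _ hrun'.2 hen' hpol
    refine ⟨⟨?_, ?_⟩, h2 ▸ h.step_of_right h1 hrun'.1 ht hst⟩
    · rw [ESS.preimage_inl_insert_inr]; exact hrun'.1
    · rw [ESS.preimage_inr_insert_inr]; exact hrun'.2.insert hen' hst

/-- Well-bracketed plays of the composition come from well-bracketed plays of its components. -/
theorem pairRun (wσ : IsWbStrat σ) (wτ : IsWbStrat τ) {S : Set (pairStrat σ τ D tp f).ev}
    (hS : WbRun (pairStrat σ τ D tp f) S) : PairRun σ τ (gen D S) := by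
  induction hS with
  | empty =>
    have : gen D ∅ = ∅ := by ext; simp [gen]
    rw [this]
    exact ⟨.empty, .empty⟩
  | @insert S p hS hen hst ih =>
    by_cases hpos : (A.hom C.toGame).pol (f p) = Pol.pos
    · exact (h.step_of_pos wσ wτ ih hen hpos).1
    have hneg : (arenaMid A B C).pol ((parStrat σ τ).disp (tp p)) = Pol.neg := by
      rw [← h.disp, outer_pol]; exact Pol.eq_neg.2 hpos
    obtain ⟨h1, h2⟩ := h.primes.neg_state h.inter hen.1 hen.2.2 hneg
    have hy : PairState σ τ (gen D S) := h.primes.gen_state hen.1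
    have hins : gen D (insert p S) = insert (tp p) (gen D S) := by
      refine subset_antisymm ?_ (Set.insert_subset ⟨p, Or.inl rfl, h.primes.tp_mem p⟩
        fun a ⟨q, hq, ha⟩ => ⟨q, Or.inr hq, ha⟩)
      rintro a ⟨q, rfl | hq, ha⟩
      · exact h2 ha
      · exact Or.inr ⟨q, hq, ha⟩
    have htp : tp p ∉ gen D S := by
      rintro ⟨q, hq, ha⟩
      refine hen.2.1 (hen.1.2.1 q hq p ?_)
      exact h.primes.le_of_mem h1 h2 ((IsPrimes.subset_gen hq).trans (Set.subset_insert _ _)) ha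
    have hpre : ∀ e, (parStrat σ τ).lt e (tp p) → e ∈ gen D S := by
      intro e hl
      rcases h1.conf.2.1 _ (Or.inl rfl) e hl.1 with rfl | h3
      · exact (hl.2 rfl).elim
      · exact h3
    rw [hins]
    rw [← h.primes.cfg_gen hen.1] at hst
    rcases ht : tp p with s | t
    · rw [ht] at h1 htp hpre hneg
      have hst' := h.step_to_left hy ht hneg hst
      have hen' := hy.enables_left h1 (Set.subset_insert _ _) (Or.inl rfl) htp
        (fun s' hl => hpre _ (ESS.par_lt_ll.2 hl))
      refine ⟨?_, ?_⟩
      · rw [ESS.preimage_inl_insert_inl]; exact ih.1.insert hen' hst'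
      · rw [ESS.preimage_inr_insert_inl]; exact ih.2
    · rw [ht] at h1 htp hpre hneg
      have hst' := h.step_to_right hy ht hneg hst
      have hen' := hy.enables_right h1 (Set.subset_insert _ _) (Or.inl rfl) htp
        (fun s' hl => hpre _ (ESS.par_lt_rr.2 hl))
      refine ⟨?_, ?_⟩
      · rw [ESS.preimage_inl_insert_inr]; exact ih.1
      · rw [ESS.preimage_inr_insert_inr]; exact ih.2.insert hen' hst'

theorem isWbStrat (wσ : IsWbStrat σ) (wτ : IsWbStrat τ) : IsWbStrat (pairStrat σ τ D tp f) :=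
  fun _ _ hS hen hpos => (h.step_of_pos wσ wτ (h.pairRun wσ wτ hS) hen hpos).2

end IsPairPrimes

end PrimeBrackets

/-! ## Well-bracketed linearisation of complete configurations -/

section Linearisation

variable {A B : NegArena.{u}} {σ : Strat A.toGame B.toGame} {x S : Set σ.ev} {s s' q q' a : σ.ev}

theorem Just.imm_of_not_isQ (h : Just σ s s') (hs : ¬ IsQ σ s') :
    (A.hom B.toGame).imm (σ.disp s) (σ.disp s') := by
  cases h with
  | left h1 h2 h3 => rw [h1, h2]; exact ESS.par_imm_ll.2 h3
  | right h1 h2 h3 => rw [h1, h2]; exact ESS.par_imm_rr.2 h3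
  | jump h1 h2 h3 => exact (hs (isQ_of_min_left h2 h3)).elim

theorem just_of_imm (h : (A.hom B.toGame).imm (σ.disp s) (σ.disp s')) : Just σ s s' := by
  rcases h1 : σ.disp s with g | g <;> rcases h2 : σ.disp s' with g' | g' <;> rw [h1, h2] at h
  · exact .left h1 h2 (ESS.par_imm_ll.1 h)
  · exact (ESS.par_imm_lr.1 h).elim
  · exact (ESS.par_imm_rl.1 h).elim
  · exact .right h1 h2 (ESS.par_imm_rr.1 h)

theorem isQ_or_isAns (s : σ.ev) : IsQ σ s ∨ IsAns σ s := by
  rw [IsQ, IsAns]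
  cases (A.hom B.toGame).lam (σ.disp s)
  · exact Or.inl rfl
  · exact Or.inr rfl

variable (hσ : IsPointedStrategy σ)
include hσ

theorem Just.pol_ne (h : Just σ s s') :
    (A.hom B.toGame).pol (σ.disp s) ≠ (A.hom B.toGame).pol (σ.disp s') := by
  by_cases hs : IsQ σ s'
  · cases h with
    | left h1 h2 h3 =>
      rw [h1, h2]; exact (A.hom_preArena B).alternating _ _ (ESS.par_imm_ll.2 h3)
    | right h1 h2 h3 =>
      rw [h1, h2]; exact (A.hom_preArena B).alternating _ _ (ESS.par_imm_rr.2 h3)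
    | jump h1 h2 h3 h4 h5 => rw [hσ.negative _ h4, pol_of_min_left h2 h3]; simp
  · exact (A.hom_preArena B).alternating _ _ (h.imm_of_not_isQ hs)

/-- Answers are opened by a question. -/
theorem IsAns.exists_just (hx : x ∈ σ.Conf) (ha : a ∈ x) (h : IsAns σ a) :
    ∃ q ∈ x, IsQ σ q ∧ Just σ q a := by
  have hmin : ¬ (A.hom B.toGame).IsMinEv (σ.disp a) := by
    intro hm
    refine h.not_isQ ?_
    rcases hd : σ.disp a with g | g <;> rw [hd] at hm
    · exact isQ_of_min_left hd (ESS.par_min_l.1 hm)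
    · exact isQ_of_min_right hd (ESS.par_min_r.1 hm)
  obtain ⟨g, hg⟩ := (A.hom_preArena B).isES.exists_imm_of_not_min hmin
  obtain ⟨q, hq, rfl⟩ := hσ.exists_lt_of_disp hg.1
  have hJ := just_of_imm hg
  refine ⟨q, hx.2.1 a ha q hq.1, (isQ_or_isAns q).resolve_right fun hq => ?_, hJ⟩
  cases hJ with
  | left h1 h2 h3 =>
    rw [IsAns, h1] at hq
    exact h3.1.2 (A.isArena.answer_closing _ hq _ h3.1.1).symm
  | right h1 h2 h3 =>
    rw [IsAns, h1] at hq
    exact h3.1.2 (B.isArena.answer_closing _ hq _ h3.1.1).symm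
  | jump h1 h2 h3 => exact h.not_min_left h2 h3

theorem IsAns.eq (hx : x ∈ σ.Conf) (ha : s ∈ x) (ha' : s' ∈ x) (h : IsAns σ s)
    (h' : IsAns σ s') (hJ : Just σ q s) (hJ' : Just σ q s') : s = s' := by
  have h1 := hJ.imm_of_not_isQ h.not_isQ
  have h2 := hJ'.imm_of_not_isQ h'.not_isQ
  have hc := (hσ.rule_abiding x hx).2.2 _ ⟨s, ha, rfl⟩ _ ⟨s', ha', rfl⟩
  refine hσ.locally_injective x hx ha ha' ?_
  rw [IsAns] at h h'
  generalize σ.disp q = g, σ.disp s = g₁, σ.disp s' = g₂ at *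
  rcases ESS.par_imm_cases h1 with ⟨a, b, rfl, rfl, hi⟩ | ⟨a, b, rfl, rfl, hi⟩ <;>
  rcases ESS.par_imm_cases h2 with ⟨a', b', h3, rfl, hi'⟩ | ⟨a', b', h3, rfl, hi'⟩ <;> cases h3
  · rcases A.isArena.answer_linear _ _ _ h h' hi hi' with h | h
    · rw [h]
    · exact (hc (Sum.LiftRel.inl h)).elim
  · rcases B.isArena.answer_linear _ _ _ h h' hi hi' with h | h
    · rw [h]
    · exact (hc (Sum.LiftRel.inr h)).elim

/-- Complete configurations of well-bracketed visible strategies are reached by well-bracketed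
plays. -/
theorem wbRun_of_complete (vσ : IsVisible σ) (wσ : IsWbStrat σ) (hx : x ∈ σ.Conf)
    (hc : IsComplete (A.hom B.toGame) (σ.disp '' x)) : WbRun σ x := by
  have hans : ∀ q ∈ x, IsQ σ q → ∃ a ∈ x, IsAns σ a ∧ Just σ q a := by
    intro q hq hQ
    obtain ⟨_, ⟨a, ha, rfl⟩, h1, h2⟩ := hc _ ⟨q, hq, rfl⟩ hQ
    exact ⟨a, ha, h1, just_of_imm h2⟩
  let Good : Set σ.ev → Prop := fun S => S ⊆ x ∧ WbRun σ S ∧ ∀ a ∈ S, IsAns σ a →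
    (A.hom B.toGame).pol (σ.disp a) = Pol.neg → ∀ q, Just σ q a → ∀ e ∈ x, Just σ q e → e ∈ S
  obtain ⟨S, ⟨hSx, hrun, hS⟩, hmax⟩ := Set.exists_max_image {S | Good S} Set.ncard
    (hx.1.finite_subsets.subset fun y hy => hy.1)
    ⟨∅, Set.empty_subset _, .empty, fun _ h => h.elim⟩
  by_cases hne : ∃ e ∈ x, e ∉ S
  swap
  · push Not at hne
    rwa [show x = S from subset_antisymm hne hSx]
  exfalso
  let M : σ.ev → Prop := fun e => e ∈ x ∧ e ∉ S ∧ ∀ d, σ.lt d e → d ∈ S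
  have hbelow : ∀ e ∈ x, e ∉ S → ∃ m, M m ∧ σ.le m e := by
    intro e he heS
    obtain ⟨m, hm, hmS, hmin⟩ := hσ.isES.exists_minimal (x := σ.down e) (fun d => d ∉ S)
      ⟨e, hσ.isES.le_refl e, heS⟩
    refine ⟨m, ⟨hx.2.1 e he m hm, hmS, fun d hd => ?_⟩, hm⟩
    by_contra hdS
    exact hmin d (hσ.isES.le_trans _ _ _ hd.1 hm) hd hdS
  have hstuck : ∀ e, M e → Step σ S e → ¬ (IsAns σ e → (A.hom B.toGame).pol (σ.disp e) =
      Pol.neg → ∀ q, Just σ q e → ∀ e' ∈ x, Just σ q e' → e' ∈ insert e S) := by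
    intro e he hst hp
    have hen := ESS.enables_of hrun.conf hx hSx he.1 he.2.1 he.2.2
    have hle : (insert e S).ncard ≤ S.ncard :=
      hmax (insert e S) ⟨Set.insert_subset he.1 hSx, hrun.insert hen hst, by
        rintro a (rfl | ha) h1 h2 q h3 e' h4 h5
        · exact hp h1 h2 q h3 e' h4 h5
        · exact Or.inr (hS a ha h1 h2 q h3 e' h4 h5)⟩
    rw [Set.ncard_insert_of_notMem he.2.1 hrun.conf.1] at hle
    omega
  have hneg : ∀ e, M e → (A.hom B.toGame).pol (σ.disp e) = Pol.neg ∧ IsAns σ e := by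
    intro e he
    have h1 : (A.hom B.toGame).pol (σ.disp e) = Pol.neg := by
      by_contra hpos
      exact hstuck e he (wσ S e hrun (ESS.enables_of hrun.conf hx hSx he.1 he.2.1 he.2.2)
        (Pol.eq_pos.2 hpos)) fun _ h => (hpos h).elim
    refine ⟨h1, ?_⟩
    by_contra hA
    refine hstuck e he ⟨?_, fun h => (hA h).elim⟩ fun h => (hA h).elim
    rintro q hq hQ hJ ⟨a, ha, hAa, hJa⟩
    have h2 := hJ.pol_ne hσ
    rw [h1] at h2
    have h3 := hJa.pol_ne hσ
    rw [Pol.eq_pos.2 h2] at h3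
    exact he.2.1 (hS a ha hAa (Pol.eq_neg.2 h3.symm) q hJa e he.1 hJ)
  have hblock : ∀ e, M e → ∃ q ∈ x, ∃ q', IsAns σ e ∧ Just σ q e ∧ q' ∈ S ∧ IsQ σ q' ∧ Just σ q q' ∧
      ∀ a ∈ S, IsAns σ a → ¬ Just σ q' a := by
    intro e he
    obtain ⟨hn, hA⟩ := hneg e he
    obtain ⟨q, hq, hQ, hJ⟩ := hA.exists_just hσ hx he.1
    have huniq : ∀ q₁ ∈ x, Just σ q₁ e → q₁ = q := by
      intro q₁ hq₁ hJ₁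
      exact hσ.locally_injective x hx hq₁ hq ((A.hom_preArena B).imm_unique
        (hJ₁.imm_of_not_isQ hA.not_isQ) (hJ.imm_of_not_isQ hA.not_isQ))
    have hqS : q ∈ S := he.2.2 q (hJ.lt hσ hx hq he.1)
    have hqpos : (A.hom B.toGame).pol (σ.disp q) = Pol.pos := by
      have := hJ.pol_ne hσ
      rw [hn] at this
      exact Pol.eq_pos.2 this
    by_contra hcon
    push Not at hcon
    refine hstuck e he ⟨?_, ?_⟩ ?_
    · rintro q₁ hq₁ - hJ₁ ⟨a, ha, hAa, hJa⟩
      exact he.2.1 (hAa.eq hσ hx (hSx ha) he.1 hA hJa hJ₁ ▸ ha)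
    · intro _ q₁ hq₁ _ hJ₁ q' hq' hQ' hJ'
      obtain rfl := huniq q₁ (hSx hq₁) hJ₁
      obtain ⟨a, ha, hAa, hJa⟩ := hcon q₁ (hSx hq₁) q' hA hJ hq' hQ' hJ'
      exact ⟨a, Or.inr ha, hAa, hJa⟩
    · intro _ _ q₁ hJ₁ e' he' hJ'
      by_contra hne'
      have hd : σ.disp q₁ = σ.disp q := (A.hom_preArena B).imm_unique
        (hJ₁.imm_of_not_isQ hA.not_isQ) (hJ.imm_of_not_isQ hA.not_isQ)
      have hn' : (A.hom B.toGame).pol (σ.disp e') = Pol.neg := by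
        have := hJ'.pol_ne hσ
        rw [hd, hqpos] at this
        exact Pol.eq_neg.2 this.symm
      have hi : (A.hom B.toGame).imm (σ.disp q) (σ.disp e') := by
        rw [← hd]
        cases hJ' with
        | left h1 h2 h3 => rw [h1, h2]; exact ESS.par_imm_ll.2 h3
        | right h1 h2 h3 => rw [h1, h2]; exact ESS.par_imm_rr.2 h3
        | jump h1 h2 h3 => rw [pol_of_min_left h2 h3] at hn'; cases hn'
      have hM : M e' := by
        refine ⟨he', fun h => hne' (Or.inr h), fun d hd => ?_⟩
        obtain ⟨j, h1, h2, h3⟩ := hσ.exists_imm_of_neg hd hn'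
        rw [hσ.locally_injective x hx (hx.2.1 e' he' j h2.1.1) hq
          ((A.hom_preArena B).imm_unique h3 hi)] at h1
        exact hrun.conf.2.1 q hqS d h1
      exact hne' (Or.inl ((hneg e' hM).2.eq hσ hx he' he.1 hA (just_of_imm hi) hJ))
  let T : Set σ.ev := {q' | q' ∈ S ∧ ∃ e q, M e ∧ IsAns σ e ∧ Just σ q e ∧ IsQ σ q' ∧ Just σ q q' ∧
    ∀ a ∈ S, IsAns σ a → ¬ Just σ q' a}
  have hT : T.Nonempty := by
    obtain ⟨e, he, heS⟩ := hne
    obtain ⟨m, hm, -⟩ := hbelow e he heS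
    obtain ⟨q, -, q', h1, h2, h3, h4⟩ := hblock m hm
    exact ⟨q', h3, m, q, hm, h1, h2, h4⟩
  obtain ⟨q', ⟨hq', e, q, he, hA, hJ, hQ', hJ', hun⟩, hqmax⟩ := Set.exists_max_image T
    (fun q => (σ.down q).ncard) (hx.1.subset fun q hq => hSx hq.1) hT
  obtain ⟨a, ha, hAa, hJa⟩ := hans q' (hSx hq') hQ'
  have haS : a ∉ S := fun h => hun a h hAa hJa
  obtain ⟨m, hm, hma⟩ := hbelow a ha haS
  obtain ⟨q₁, hq₁, q₁', hA₁, hJ₁, hq₁', hQ₁', hJ₁', hun₁⟩ := hblock m hm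
  have hlt : σ.lt q' m := by
    rcases hσ.comparable vσ hma (hJa.lt hσ hx (hSx hq') ha).1 (hJa.imm_of_not_isQ hAa.not_isQ).1.1
      with h | h
    · exact (hm.2.1 (hrun.conf.2.1 q' hq' m h)).elim
    · exact ⟨h, by rintro rfl; exact hm.2.1 hq'⟩
  obtain ⟨j, h1, h2, h3⟩ := hσ.exists_imm_of_neg hlt (hneg m hm).1
  rw [hσ.locally_injective x hx (hx.2.1 m hm.1 j h2.1.1) hq₁ ((A.hom_preArena B).imm_unique h3
    (hJ₁.imm_of_not_isQ hA₁.not_isQ))] at h1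
  have hlt' := hσ.isES.lt_of_le_of_lt h1 (hJ₁'.lt hσ hx hq₁ (hSx hq₁'))
  refine absurd (hqmax q₁' ⟨hq₁', m, q₁, hm, hA₁, hJ₁, hQ₁', hJ₁', hun₁⟩) (not_le.2 ?_)
  exact Set.ncard_lt_ncard ⟨fun d hd => hσ.isES.le_trans _ _ _ hd hlt'.1, fun h =>
    hlt'.2 (hσ.isES.le_antisymm _ _ hlt'.1 (h (hσ.isES.le_refl q₁')))⟩ (hσ.isES.finite_causes q₁')

end Linearisation

/-! ## Positions -/

section Positions

variable {G : Game.{u}}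

theorem IsComplete.of_sym (hG : IsPreArena G) {θ : Set (G.ev × G.ev)} (hθ : θ ∈ G.sym)
    (h : IsComplete G (gdom θ)) : IsComplete G (gcod θ) := by
  intro q hq hQ
  obtain ⟨p, hp⟩ := mem_gcod.1 hq
  obtain ⟨a, ha, h1, h2⟩ := h p (mem_gdom.2 ⟨q, hp⟩) ((hG.sym_lam θ hθ _ hp).trans hQ)
  obtain ⟨b, hb⟩ := mem_gdom.1 ha
  exact ⟨b, mem_gcod.2 ⟨a, hb⟩, (hG.sym_lam θ hθ _ hb).symm.trans h1,
    hG.isoFamily.imm_of_imm hG.isES hθ hp hb h2⟩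

theorem Positions.mk_eq (hG : IsPreArena G) {x y : CompleteConf G} :
    Positions.mk x = Positions.mk y ↔ Symmetric G x y := by
  have hS := hG.isoFamily
  have : Equivalence (Symmetric G) := by
    refine ⟨fun x => ⟨gid x.1, hS.id_mem _ x.2.1, gdom_gid _, gcod_gid _⟩, ?_, ?_⟩
    · rintro x y ⟨θ, h, h1, h2⟩
      exact ⟨_, hS.inv_mem θ h, (gdom_swap θ).trans h2, (gcod_swap θ).trans h1⟩
    · rintro x y z ⟨θ, h, h1, h2⟩ ⟨θ', h', h1', h2'⟩
      have he : gcod θ = gdom θ' := h2.trans h1'.symm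
      exact ⟨_, hS.comp_mem' h h' he, (gdom_gcomp he.le).trans h1, (gcod_gcomp he.ge).trans h2'⟩
  exact Quot.eq.trans (by rw [this.eqvGen_iff])

/-- Complete configurations reached by `σ` are reached by `τ`, up to symmetry. -/
def Covers (σ τ : PreStrat G) : Prop :=
  ∀ x ∈ σ.Conf, σ.disp '' x ∈ G.Conf → IsComplete G (σ.disp '' x) →
    ∃ y ∈ τ.Conf, τ.disp '' y ∈ G.Conf ∧ IsComplete G (τ.disp '' y) ∧
      ∃ θ ∈ G.sym, gdom θ = σ.disp '' x ∧ gcod θ = τ.disp '' y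

variable {σ τ : PreStrat G}

theorem Covers.collapse_subset (h : Covers σ τ) : collapse σ ⊆ collapse τ := by
  rintro _ ⟨x, hx, ⟨_, h1, h2⟩, rfl, rfl⟩
  obtain ⟨y, hy, h3, h4, θ, hθ, h5, h6⟩ := h x hx h1 h2
  exact ⟨y, hy, ⟨_, h3, h4⟩, rfl, Quot.sound ⟨θ, hθ, h5, h6⟩⟩

theorem covers_of_subset (hG : IsPreArena G) (h : collapse σ ⊆ collapse τ) : Covers σ τ := by
  intro x hx h1 h2
  obtain ⟨y, hy, ⟨_, h3, h4⟩, rfl, h5⟩ := h ⟨x, hx, ⟨_, h1, h2⟩, rfl, rfl⟩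
  exact ⟨y, hy, h3, h4, (Positions.mk_eq hG).1 h5⟩

theorem posEquiv_iff_covers (hG : IsPreArena G) : PosEquiv σ τ ↔ Covers σ τ ∧ Covers τ σ :=
  ⟨fun h => ⟨covers_of_subset hG h.subset, covers_of_subset hG h.symm.subset⟩,
    fun h => subset_antisymm h.1.collapse_subset h.2.collapse_subset⟩

end Positions

section CollapseRel

variable {A B : NegArena.{u}} {σ τ : Strat A.toGame B.toGame}

theorem isComplete_hom {A B : Game.{u}} {z : Set (A.hom B).ev} : IsComplete (A.hom B) z ↔
    IsComplete A (inl ⁻¹' z) ∧ IsComplete B (inr ⁻¹' z) := by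
  constructor
  · refine fun h => ⟨fun q hq hQ => ?_, fun q hq hQ => ?_⟩
    · obtain ⟨a | a, h1, h2, h3⟩ := h _ hq hQ
      · exact ⟨a, h1, h2, ESS.par_imm_ll.1 h3⟩
      · exact (ESS.par_imm_lr.1 h3).elim
    · obtain ⟨a | a, h1, h2, h3⟩ := h _ hq hQ
      · exact (ESS.par_imm_rl.1 h3).elim
      · exact ⟨a, h1, h2, ESS.par_imm_rr.1 h3⟩
  · rintro ⟨h, h'⟩ (q | q) hq hQ
    · obtain ⟨a, h1, h2, h3⟩ := h q hq hQ
      exact ⟨inl a, h1, h2, ESS.par_imm_ll.2 h3⟩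
    · obtain ⟨a, h1, h2, h3⟩ := h' q hq hQ
      exact ⟨inr a, h1, h2, ESS.par_imm_rr.2 h3⟩

theorem eq_union_iff {X Y : Type u} {z : Set (X ⊕ Y)} {x : Set X} {y : Set Y} :
    z = inl '' x ∪ inr '' y ↔ x = inl ⁻¹' z ∧ y = inr ⁻¹' z := by
  constructor
  · rintro rfl
    constructor <;> ext <;> simp
  · rintro ⟨rfl, rfl⟩
    exact (Set.image_preimage_inl_union_image_preimage_inr z).symm

/-- The parts in the two arenas of a complete configuration. -/
theorem CompleteConf.exists_parts {A B : Game.{u}} (z : CompleteConf (A.hom B)) :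
    ∃ (xA : CompleteConf A) (xB : CompleteConf B), z.1 = inl '' xA.1 ∪ inr '' xB.1 :=
  ⟨⟨_, (ESS.par_conf.1 z.2.1).1, (isComplete_hom.1 z.2.2).1⟩,
    ⟨_, (ESS.par_conf.1 z.2.1).2, (isComplete_hom.1 z.2.2).2⟩, eq_union_iff.2 ⟨rfl, rfl⟩⟩

theorem mk_eq_of_parts {z z' : CompleteConf (A.hom B.toGame)} {xA yA : CompleteConf A.toGame}
    {xB yB : CompleteConf B.toGame} (hz : z.1 = inl '' xA.1 ∪ inr '' xB.1)
    (hz' : z'.1 = inl '' yA.1 ∪ inr '' yB.1) :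
    Positions.mk z = Positions.mk z' ↔
      Positions.mk xA = Positions.mk yA ∧ Positions.mk xB = Positions.mk yB := by
  rw [Positions.mk_eq (A.hom_preArena B), Positions.mk_eq A.preArena, Positions.mk_eq B.preArena]
  obtain ⟨h1, h2⟩ := eq_union_iff.1 hz
  obtain ⟨h3, h4⟩ := eq_union_iff.1 hz'
  constructor
  · rintro ⟨_, ⟨θ, hθ, θ', hθ', rfl⟩, h5, h6⟩
    rw [Symmetric, Symmetric, h1, h2, h3, h4, ← h5, ← h6]
    exact ⟨⟨θ, hθ, preimage_inl_gdom.symm, preimage_inl_gcod.symm⟩,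
      ⟨θ', hθ', preimage_inr_gdom.symm, preimage_inr_gcod.symm⟩⟩
  · rintro ⟨⟨θ, hθ, h5, h6⟩, ⟨θ', hθ', h7, h8⟩⟩
    refine ⟨parRel θ θ', ⟨θ, hθ, θ', hθ', rfl⟩, ?_, ?_⟩
    · rw [hz, eq_union_iff, preimage_inl_gdom, preimage_inr_gdom, h5, h7]
      exact ⟨rfl, rfl⟩
    · rw [hz', eq_union_iff, preimage_inl_gcod, preimage_inr_gcod, h6, h8]
      exact ⟨rfl, rfl⟩

theorem posEquiv_iff : PosEquiv σ τ ↔ collapseRel σ = collapseRel τ := by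
  have key : ∀ σ τ : Strat A.toGame B.toGame, collapseRel σ = collapseRel τ →
      collapse σ ⊆ collapse τ := by
    rintro σ τ h _ ⟨x, hx, z, hz, rfl⟩
    obtain ⟨xA, xB, hp⟩ := z.exists_parts
    have : (Positions.mk xA, Positions.mk xB) ∈ collapseRel τ := by
      rw [← h]
      exact ⟨xA, xB, z, hp, rfl, x, hx, z, hz, rfl⟩
    obtain ⟨yA, yB, z', h1, h2, h3⟩ := this
    obtain ⟨h4, h5⟩ := Prod.mk.inj h2
    rwa [(mk_eq_of_parts hp h1).2 ⟨h4, h5⟩]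
  exact ⟨fun h => by unfold collapseRel; rw [show collapse σ = collapse τ from h],
    fun h => subset_antisymm (key _ _ h) (key _ _ h.symm)⟩

/-- The collapse of a strategy as a relation, in terms of its configurations. -/
theorem mem_collapseRel {p} : p ∈ collapseRel σ ↔ ∃ x ∈ σ.Conf, ∃ (xA : CompleteConf A.toGame)
    (xB : CompleteConf B.toGame), σ.disp '' x = inl '' xA.1 ∪ inr '' xB.1 ∧
      p = (Positions.mk xA, Positions.mk xB) := by
  constructor
  · rintro ⟨xA, xB, z, h1, rfl, x, hx, z', h2, h3⟩
    obtain ⟨yA, yB, hp⟩ := z'.exists_parts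
    obtain ⟨h4, h5⟩ := (mk_eq_of_parts h1 hp).1 h3
    exact ⟨x, hx, yA, yB, h2.symm.trans hp, by rw [h4, h5]⟩
  · rintro ⟨x, hx, xA, xB, h1, rfl⟩
    obtain ⟨h2, h3⟩ := eq_union_iff.1 h1
    have hz : σ.disp '' x ∈ (A.hom B.toGame).Conf ∧
        IsComplete (A.hom B.toGame) (σ.disp '' x) := by
      refine ⟨ESS.par_conf.2 ⟨?_, ?_⟩, isComplete_hom.2 ⟨?_, ?_⟩⟩
      · rw [← h2]; exact xA.2.1
      · rw [← h3]; exact xB.2.1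
      · rw [← h2]; exact xA.2.2
      · rw [← h3]; exact xB.2.2
    exact ⟨xA, xB, ⟨_, hz⟩, h1, rfl, x, hx, ⟨_, hz⟩, rfl, rfl⟩

theorem PosIso.posEquiv (h : PosIso σ τ) : PosEquiv σ τ := by
  obtain ⟨φ, h1, h2, -, h3⟩ := h
  have hG := A.hom_preArena B
  have hsym : ∀ x ∈ σ.Conf, ∃ θ ∈ (A.hom B.toGame).sym, gdom θ = σ.disp '' x ∧
      gcod θ = τ.disp '' (φ '' x) := by
    intro x hx
    obtain ⟨θ, hθ, θ', hθ', he⟩ := h3 x hx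
    refine ⟨_, ⟨θ, A.isArena.nsym_sub hθ, θ', B.isArena.psym_sub hθ', he⟩, ?_, ?_⟩
    · rw [gdom, ← Set.image_comp]; rfl
    · rw [gcod, ← Set.image_comp, ← Set.image_comp]; rfl
  have hconf : ∀ x, x ∈ σ.Conf ↔ φ '' x ∈ τ.Conf := by
    intro x
    refine and_congr (Set.finite_image_iff φ.injective.injOn).symm (and_congr ?_ ?_)
    · refine Iff.trans ?_ Set.forall_mem_image.symm
      refine forall₂_congr fun e he => ⟨fun h e' hl => ?_, fun h e' hl => ?_⟩
      · obtain ⟨e', rfl⟩ := φ.surjective e'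
        exact ⟨e', h e' ((h1 _ _).2 hl), rfl⟩
      · obtain ⟨d, hd, he⟩ := h (φ e') ((h1 _ _).1 hl)
        rwa [← φ.injective he]
    · refine Iff.trans ?_ Set.forall_mem_image.symm
      refine forall₂_congr fun e he => Iff.trans ?_ Set.forall_mem_image.symm
      exact forall₂_congr fun e' he' => not_congr (h2 e e')
  rw [posEquiv_iff_covers hG]
  constructor
  · intro x hx _ hc
    obtain ⟨θ, hθ, h4, h5⟩ := hsym x hx
    refine ⟨φ '' x, (hconf x).1 hx, h5 ▸ hG.isoFamily.cod_conf hθ, ?_, θ, hθ, h4, h5⟩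
    rw [← h5]; exact .of_sym hG hθ (h4 ▸ hc)
  · intro y hy _ hc
    obtain ⟨x, rfl⟩ : ∃ x, y = φ '' x := ⟨φ ⁻¹' y, (Set.image_preimage_eq y φ.surjective).symm⟩
    have hx := (hconf x).2 hy
    obtain ⟨θ, hθ, h4, h5⟩ := hsym x hx
    have hs := hG.isoFamily.inv_mem θ hθ
    refine ⟨x, hx, h4 ▸ hG.isoFamily.dom_conf hθ, ?_, _, hs, (gdom_swap θ).trans h5,
      (gcod_swap θ).trans h4⟩
    rw [← h4, ← gcod_swap]; exact .of_sym hG hs (by rwa [gdom_swap, h5])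

end CollapseRel

/-! ## The collapse of a composition -/

theorem gdom_map {X Y : Type u} (g : X → Y) (θ : Set (X × X)) :
    gdom (Prod.map g g '' θ) = g '' gdom θ := by
  rw [gdom, gdom, ← Set.image_comp, ← Set.image_comp]; rfl

theorem gcod_map {X Y : Type u} (g : X → Y) (θ : Set (X × X)) :
    gcod (Prod.map g g '' θ) = g '' gcod θ := by
  rw [gcod, gcod, ← Set.image_comp, ← Set.image_comp]; rfl

theorem isWbStrat_of {A B : NegArena.{u}} {σ : Strat A.toGame B.toGame} (hσ : IsWbVis σ) :
    IsWbStrat σ :=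
  (isWellBracketed_iff hσ.strategy).1 hσ.wellBracketed

namespace IsPairPrimes

variable {A B C : NegArena.{u}} {σ : Strat A.toGame B.toGame} {τ : Strat B.toGame C.toGame}
  {P : Type u} {D : P → Set (σ.ev ⊕ τ.ev)} {tp : P → σ.ev ⊕ τ.ev}
  {f : P → (A.hom C.toGame).ev} {z : Set (σ.ev ⊕ τ.ev)}

theorem isWbVis (h : IsPairPrimes σ τ D tp f) : IsWbVis (pairStrat σ τ D tp f) :=
  ⟨h.pointed, (isWellBracketed_iff h.pointed).2
    (h.isWbStrat (isWbStrat_of h.left) (isWbStrat_of h.right)), h.primes.isVisible h.inter h.disp⟩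

/-- The parts of a state in the three arenas. -/
theorem image_parts (h : IsPairPrimes σ τ D tp f) (hz : PairState σ τ z) :
    inl ⁻¹' (f '' cfg D z) = inl ⁻¹' (σ.disp '' (inl ⁻¹' z)) ∧
      inr ⁻¹' (f '' cfg D z) = inr ⁻¹' (τ.disp '' (inr ⁻¹' z)) := by
  rw [h.primes.image_cfg h.disp hz]
  refine ⟨Set.ext fun a => ⟨?_, ?_⟩, Set.ext fun c => ⟨?_, ?_⟩⟩
  · rintro ⟨s | t, hs, he⟩
    · exact ⟨s, hs, Sum.inl.inj he⟩
    · cases he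
  · rintro ⟨s, hs, he⟩
    exact ⟨inl s, hs, congrArg inl he⟩
  · rintro ⟨s | t, hs, he⟩
    · cases he
    · exact ⟨t, hs, Sum.inr.inj he⟩
  · rintro ⟨t, ht, he⟩
    exact ⟨inr t, ht, congrArg inr he⟩

theorem middle_eq (hz : PairState σ τ z) :
    inr ⁻¹' (σ.disp '' (inl ⁻¹' z)) = inl ⁻¹' (τ.disp '' (inr ⁻¹' z)) := by
  ext b
  constructor
  · rintro ⟨s, hs, he⟩
    obtain ⟨t, ht, he'⟩ := hz.mirror_left hs he
    exact ⟨t, ht, he'⟩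
  · rintro ⟨t, ht, he⟩
    obtain ⟨s, hs, he'⟩ := hz.mirror_right ht he
    exact ⟨s, hs, he'⟩

/-- In a well-bracketed interaction that is complete from outside, the middle part is complete. -/
theorem middle_complete (hτ : IsPointedStrategy τ) (hrun : WbRun τ (inr ⁻¹' z))
    (hz : PairState σ τ z)
    (hc : IsComplete C.toGame (inr ⁻¹' (τ.disp '' (inr ⁻¹' z)))) :
    IsComplete B.toGame (inl ⁻¹' (τ.disp '' (inr ⁻¹' z))) := by
  by_contra hn
  rw [IsComplete] at hn
  push Not at hn
  have hcz : (inl ⁻¹' (τ.disp '' (inr ⁻¹' z)) : Set B.ev) ∈ B.Conf :=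
    (ESS.par_conf.1 (hτ.rule_abiding _ hz.right_conf)).1
  obtain ⟨b, ⟨t, ht, hd⟩, ⟨hQ, hno⟩, hmin⟩ := B.preArena.isES.exists_minimal
    (fun b => B.lam b = .question ∧ ∀ a ∈ (inl ⁻¹' (τ.disp '' (inr ⁻¹' z)) : Set B.ev),
      B.lam a = .answer → ¬ B.imm b a) hn
  have hQt : IsQ τ t := by rw [IsQ, hd]; exact hQ
  have key : ∃ q ∈ inr ⁻¹' z, ∃ a ∈ inr ⁻¹' z, IsQ τ q ∧ IsAns τ a ∧ Just τ q a ∧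
      Just τ q t := by
    by_cases hb : B.IsMinEv b
    · obtain ⟨m, h1, h2⟩ := hτ.isES.exists_min_le t
      obtain ⟨c, h3, h4⟩ := hτ.exists_min_disp h1
      have hm : m ∈ inr ⁻¹' z := hz.right_conf.2.1 t ht m h2
      obtain ⟨c', ⟨t', h5, h6⟩, h7, h8⟩ := hc c ⟨m, hm, h3⟩ (C.isArena.question_opening c h4)
      exact ⟨m, hm, t', h5, isQ_of_min_right h3 h4, by rw [IsAns, h6]; exact h7, .right h3 h6 h8,
        .jump h3 hd hb h1 h2⟩
    · obtain ⟨b₀, h1⟩ := B.preArena.isES.exists_imm_of_not_min hb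
      obtain ⟨t₀, h2, h3⟩ := hcz.2.1 b ⟨t, ht, hd⟩ b₀ h1.1.1
      have h4 : B.lam b₀ = .question := by
        cases h : B.lam b₀
        · rfl
        · exact (h1.1.2 (B.isArena.answer_closing b₀ h b h1.1.1).symm).elim
      have h5 := hmin b₀ ⟨t₀, h2, h3⟩ h1.1
      push Not at h5
      obtain ⟨a, ⟨t₁, h6, h7⟩, h8, h9⟩ := h5 h4
      exact ⟨t₀, h2, t₁, h6, by rw [IsQ, h3]; exact h4, by rw [IsAns, h7]; exact h8,
        .left h3 h7 h9, .left h3 hd h1⟩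
  obtain ⟨q, hq, a, ha, h1, h2, h3, h4⟩ := key
  obtain ⟨a', h5, h6, h7⟩ := hrun.answered hτ q hq a ha t ht h1 h2 hQt h3 h4
  obtain ⟨b', h8, h9⟩ := h7.of_left hd
  exact hno b' ⟨a', h5, h8⟩ (by rw [IsAns, h8] at h6; exact h6) h9

theorem collapseRel_eq (h : IsPairPrimes σ τ D tp f) :
    collapseRel (pairStrat σ τ D tp f) = (collapseRel σ).comp (collapseRel τ) := by
  have hσ := h.left.strategy
  have hτ := h.right.strategy
  ext ⟨pA, pC⟩
  rw [SetRel.mem_comp, mem_collapseRel]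
  constructor
  · rintro ⟨S, hS, xA, xC, h1, h2⟩
    obtain ⟨rfl, rfl⟩ := Prod.mk.inj h2
    obtain ⟨h3, h4⟩ := eq_union_iff.1 h1
    have hcomp := isComplete_hom.2 ⟨h3 ▸ xA.2.2, h4 ▸ xC.2.2⟩
    have hrun := h.pairRun (isWbStrat_of h.left) (isWbStrat_of h.right) (wbRun_of_complete h.pointed
      h.isWbVis.visible (isWbStrat_of h.isWbVis) hS hcomp)
    have hz : PairState σ τ (gen D S) := h.primes.gen_state hS
    obtain ⟨h5, h6⟩ := h.image_parts hz
    rw [h.primes.cfg_gen hS] at h5 h6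
    have h7 := middle_complete hτ hrun.2 hz (h6 ▸ h4 ▸ xC.2.2)
    let xB : CompleteConf B.toGame := ⟨_, (ESS.par_conf.1 (hτ.rule_abiding _ hz.right_conf)).1, h7⟩
    exact ⟨Positions.mk xB, mem_collapseRel.2 ⟨_, hz.left_conf, xA, xB, eq_union_iff.2
      ⟨h3.trans h5, (middle_eq hz).symm⟩, rfl⟩, mem_collapseRel.2 ⟨_, hz.right_conf, xB, xC,
      eq_union_iff.2 ⟨rfl, h4.trans h6⟩, rfl⟩⟩
  · rintro ⟨pB, h1, h2⟩
    obtain ⟨x, hx, xA, xB, h3, h4⟩ := mem_collapseRel.1 h1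
    obtain ⟨y, hy, yB, yC, h5, h6⟩ := mem_collapseRel.1 h2
    obtain ⟨rfl, rfl⟩ := Prod.mk.inj h4
    obtain ⟨h7, rfl⟩ := Prod.mk.inj h6
    obtain ⟨θ, hθ, h8, h9⟩ := (Positions.mk_eq B.preArena).1 h7
    obtain ⟨h10, h11⟩ := eq_union_iff.1 h3
    obtain ⟨h12, h13⟩ := eq_union_iff.1 h5
    have hR := h.inter
    have hpre : inl ⁻¹' pairSet σ τ x y = x ∧ inr ⁻¹' pairSet σ τ x y = y := by
      constructor <;> ext <;> simp
    have hst : State (A := A) (B := B) (C := C) (parStrat σ τ) θ (pairSet σ τ x y) := by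
      refine ⟨ESS.par_conf.2 (by rw [hpre.1, hpre.2]; exact ⟨hx, hy⟩), ?_⟩
      rintro (s | t) hm hh
      · rw [inl_mem_pairSet] at hm
        rcases hd : σ.disp s with a | b
        · simp [hd, Hid] at hh
        · obtain ⟨b', hb⟩ := mem_gdom.1 (h8.ge (h11.ge ⟨s, hm, hd⟩))
          obtain ⟨t, ht, hdt⟩ := h12.le (h9.le (mem_gcod.2 ⟨b, hb⟩))
          refine ⟨inr t, inr_mem_pairSet.2 ht, ?_⟩
          rw [show (parStrat σ τ).disp (inl s) = _ from congrArg inl hd,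
            show (parStrat σ τ).disp (inr t) = _ from congrArg inr hdt]
          exact .lr hb
      · rw [inr_mem_pairSet] at hm
        rcases hd : τ.disp t with b | c
        · obtain ⟨b', hb⟩ := mem_gcod.1 (h9.ge (h12.ge ⟨t, hm, hd⟩))
          obtain ⟨s, hs, hds⟩ := h11.le (h8.le (mem_gdom.2 ⟨b, hb⟩))
          refine ⟨inl s, inl_mem_pairSet.2 hs, ?_⟩
          rw [show (parStrat σ τ).disp (inl s) = _ from congrArg inl hds,
            show (parStrat σ τ).disp (inr t) = _ from congrArg inr hd]
          exact .rl hb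
        · simp [hd, Hid] at hh
    have hbal : Bal (A := A) (B := B) (C := C) (parStrat σ τ) θ ∅ := by
      refine ⟨?_, ?_, fun _ _ _ _ h => h.elim⟩
      · have := hR.pointed.isoFamily.id_mem ∅ ESS.empty_conf
        rwa [show gid (∅ : Set (σ.ev ⊕ τ.ev)) = ∅ by ext; simp [gid]] at this
      · rw [gdom, Set.image_empty]
        exact ⟨ESS.empty_conf, fun _ h => h.elim⟩
    obtain ⟨Θ, -, hΘ, hd⟩ := hbal.extend hR hθ hst (by simp [gdom])
    have hz : PairState σ τ (gcod Θ) := hΘ.cod hR.pointed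
    obtain ⟨U, hU, V, hV, rfl⟩ := hΘ.sym
    obtain ⟨UA, hUA, UB, -, hUe⟩ := hσ.sym_preserving U hU
    obtain ⟨VB, -, VC, hVC, hVe⟩ := hτ.sym_preserving V hV
    rw [← hd, preimage_inl_gdom, preimage_inr_gdom] at hpre
    have h14 := h.image_parts hz
    rw [preimage_inl_gcod, preimage_inr_gcod, ← gcod_map, ← gcod_map, hUe, hVe, preimage_inl_gcod,
      preimage_inr_gcod] at h14
    have h15 : gdom UA = xA.1 := by
      rw [h10, ← hpre.1, ← gdom_map, hUe, preimage_inl_gdom]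
    have h16 : gdom VC = yC.1 := by
      rw [h13, ← hpre.2, ← gdom_map, hVe, preimage_inr_gdom]
    let zA : CompleteConf A.toGame := ⟨_, A.preArena.isoFamily.cod_conf hUA,
      .of_sym A.preArena hUA (h15 ▸ xA.2.2)⟩
    let zC : CompleteConf C.toGame := ⟨_, C.preArena.isoFamily.cod_conf hVC,
      .of_sym C.preArena hVC (h16 ▸ yC.2.2)⟩
    exact ⟨_, h.primes.cfg_conf hz, zA, zC, eq_union_iff.2 ⟨h14.1.symm, h14.2.symm⟩,
      Prod.ext (Quot.sound ⟨UA, hUA, h15, rfl⟩) (Quot.sound ⟨VC, hVC, h16, rfl⟩)⟩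

end IsPairPrimes

theorem isPairPrimes_comp {A B C : NegArena.{u}} {σ : Strat A.toGame B.toGame}
    {τ : Strat B.toGame C.toGame} (hσ : IsWbVis σ) (hτ : IsWbVis τ) :
    IsPairPrimes σ τ compSet compRep (comp σ τ).disp :=
  ⟨hσ, hτ, isPrimes_comp hσ.strategy hτ.strategy hσ.visible hτ.visible, comp_disp⟩

theorem isWbVis_comp {A B C : NegArena.{u}} {σ : Strat A.toGame B.toGame}
    {τ : Strat B.toGame C.toGame} (hσ : IsWbVis σ) (hτ : IsWbVis τ) : IsWbVis (comp σ τ) := by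
  rw [comp_eq hσ.strategy hτ.strategy hσ.visible hτ.visible]
  exact (isPairPrimes_comp hσ hτ).isWbVis

theorem collapseRel_comp {A B C : NegArena.{u}} {σ : Strat A.toGame B.toGame}
    {τ : Strat B.toGame C.toGame} (hσ : IsWbVis σ) (hτ : IsWbVis τ) :
    collapseRel (comp σ τ) = (collapseRel σ).comp (collapseRel τ) := by
  rw [comp_eq hσ.strategy hτ.strategy hσ.visible hτ.visible]
  exact (isPairPrimes_comp hσ hτ).collapseRel_eq

/-! ## Copycat -/

theorem ESS.IsES.exists_minConflict {E : ESS.{u}} (h : E.IsES) {a b : E.ev}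
    (hab : E.conflict a b) : ∃ d d', E.le d a ∧ E.le d' b ∧ E.MinConflict d d' := by
  obtain ⟨d, hd, hdb, hmin⟩ := h.exists_minimal (x := E.down a) (E.conflict · b)
    ⟨a, h.le_refl a, hab⟩
  obtain ⟨d', hd', hdd', hmin'⟩ := h.exists_minimal (x := E.down b) (E.conflict d ·)
    ⟨b, h.le_refl b, hdb⟩
  exact ⟨d, d', hd, hd', hdd', fun c hc hcd => hmin c (h.le_trans _ _ _ hc.1 hd) hc
    (h.conflict_inherit _ _ _ hcd hd'), fun c hc => hmin' c (h.le_trans _ _ _ hc.1 hd') hc⟩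

/-- Two extensions of a symmetry of opposite polarities can be amalgamated. -/
theorem IsIsoFamily.amalgam {E : ESS.{u}} {S N Q : Set (Set (E.ev × E.ev))}
    (hS : IsIsoFamily E S) (hN : IsIsoFamily E N) (hQ : IsIsoFamily E Q) (hNS : N ⊆ S)
    {pol : E.ev → Pol} (hpol : ∀ θ ∈ S, ∀ p ∈ θ, pol p.1 = pol p.2)
    (hNQ : ∀ θ ∈ N, θ ∈ Q → ∀ p ∈ θ, p.1 = p.2) {k l : Pol}
    (hNe : ∀ θ ∈ N, ∀ θ' ∈ S, θ ⊆ θ' →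
      (∀ p ∈ θ', p ∉ θ → pol p.1 = k ∧ pol p.2 = k) → θ' ∈ N)
    (hQe : ∀ θ ∈ Q, ∀ θ' ∈ S, θ ⊆ θ' →
      (∀ p ∈ θ', p ∉ θ → pol p.1 = l ∧ pol p.2 = l) → θ' ∈ Q)
    {θ φ : Set (E.ev × E.ev)} (hφ : φ ∈ S) (hθφ : θ ⊆ φ)
    (hl : ∀ p ∈ φ, p ∉ θ → pol p.1 = l) {a b : E.ev} (hab : insert (a, b) θ ∈ S)
    (hθ : θ ∈ S) (ha : pol a = k) (hen : E.Enables (gdom φ) a) : insert (a, b) φ ∈ S := by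
  obtain ⟨c, hc⟩ := hS.extend_one hφ hen
  have hcb := hS.bij _ hc
  have hc' : insert (a, c) θ ∈ S := by
    have := hS.restrict _ hc _ (hS.dom_conf hab)
      (by rw [gdom_insert, gdom_insert]; exact Set.insert_subset_insert (gdom_mono hθφ))
    rw [gdom_insert] at this
    convert this using 1
    ext ⟨x, y⟩
    constructor
    · rintro (h | h)
      · exact ⟨Or.inl h, Or.inl (Prod.mk.inj h).1⟩
      · exact ⟨Or.inr (hθφ h), Or.inr (mem_gdom.2 ⟨y, h⟩)⟩
    · rintro ⟨h | h, h' | h'⟩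
      · exact Or.inl h
      · exact Or.inl h
      · exact (hen.2.1 (mem_gdom.2 ⟨y, by rw [← (show x = a from h')]; exact h⟩)).elim
      · obtain ⟨y', hy'⟩ := mem_gdom.1 h'
        rw [(hS.bij _ hφ).inj₁ h (hθφ hy')]
        exact Or.inr hy'
  have hcN : insert (c, b) (gid (gcod θ)) ∈ N := by
    refine hNe _ (hN.id_mem _ (hS.cod_conf hθ)) _ ?_ (Set.subset_insert _ _) ?_
    · have := hS.comp_mem' (hS.inv_mem _ hc') hab (by rw [gcod_swap, gdom_insert, gdom_insert])
      convert this using 1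
      ext ⟨x, y⟩
      rw [mem_gcomp]
      constructor
      · rintro (h | ⟨h, h'⟩)
        · obtain ⟨rfl, rfl⟩ := Prod.mk.inj h
          exact ⟨a, mem_swap.2 (Or.inl rfl), Or.inl rfl⟩
        · obtain rfl : y = x := h'
          obtain ⟨e, he⟩ := mem_gcod.1 h
          exact ⟨e, mem_swap.2 (Or.inr he), Or.inr he⟩
      · rintro ⟨e, h, h'⟩
        rw [mem_swap] at h
        by_cases hea : e = a
        · subst hea
          rw [(hS.bij _ hc').inj₁ h (Or.inl rfl), (hS.bij _ hab).inj₁ h' (Or.inl rfl)]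
          exact Or.inl rfl
        · have h1 : (e, x) ∈ θ := h.resolve_left fun hh => hea (Prod.mk.inj hh).1
          have h2 : (e, y) ∈ θ := h'.resolve_left fun hh => hea (Prod.mk.inj hh).1
          exact Or.inr ⟨mem_gcod.2 ⟨e, h1⟩, (hS.bij _ hθ).inj₁ h2 h1⟩
    · rintro p (rfl | hp) hp'
      · exact ⟨(hpol _ hc _ (Or.inl rfl)).symm.trans ha, (hpol _ hab _ (Or.inl rfl)).symm.trans ha⟩
      · exact (hp' hp).elim
  obtain ⟨ω, hω, hsub, hdom⟩ := hN.extend _ hcN _ (hS.cod_conf hc)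
    (by rw [gdom_insert, gdom_gid, gcod_insert]; exact Set.insert_subset_insert (gcod_mono hθφ))
  have hφω : gcod φ ⊆ gdom ω := by rw [hdom, gcod_insert]; exact Set.subset_insert _ _
  have hω0 := hN.restrict _ hω _ (hS.cod_conf hφ) hφω
  have hid := hNQ _ hω0 (hQe _ (hQ.id_mem _ (hS.cod_conf hθ)) _ (hNS hω0)
    (fun p hp => ⟨hsub (Or.inr hp), gcod_mono hθφ hp.1⟩) (by
      intro p hp hp'
      obtain ⟨d, hd⟩ := mem_gcod.1 hp.2
      have h1 : pol p.1 = l := by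
        rw [← hpol _ hφ _ hd]
        refine hl _ hd fun hdθ => hp' ?_
        have h2 : (p.1, p.1) ∈ ω := hsub (Or.inr ⟨mem_gcod.2 ⟨d, hdθ⟩, rfl⟩)
        exact ⟨mem_gcod.2 ⟨d, hdθ⟩, (hN.bij _ hω).inj₁ hp.1 h2⟩
      exact ⟨h1, (hpol _ (hNS hω) _ hp.1).symm.trans h1⟩))
  have := hS.comp_mem' hc (hNS hω) hdom.symm
  convert this using 1
  ext ⟨x, y⟩
  rw [mem_gcomp]
  have hcbω : (c, b) ∈ ω := hsub (Or.inl rfl)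
  constructor
  · rintro (h | h)
    · obtain ⟨rfl, rfl⟩ := Prod.mk.inj h
      exact ⟨c, Or.inl rfl, hcbω⟩
    · obtain ⟨z, hz⟩ := mem_gdom.1 (hφω (mem_gcod.2 ⟨x, h⟩))
      obtain rfl : y = z := hid (y, z) ⟨hz, mem_gcod.2 ⟨x, h⟩⟩
      exact ⟨y, Or.inr h, hz⟩
  · rintro ⟨e, h | h, h'⟩
    · obtain ⟨rfl, rfl⟩ := Prod.mk.inj h
      rw [(hN.bij _ hω).inj₁ h' hcbω]
      exact Or.inl rfl
    · obtain rfl : e = y := hid (e, y) ⟨h', mem_gcod.2 ⟨x, h⟩⟩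
      exact Or.inr h

theorem inter_eq_restrict {X : Type u} {θ₁ θ₂ : Set (X × X)}
    (h : ∀ a b b', (a, b) ∈ θ₁ → (a, b') ∈ θ₂ → b = b') :
    θ₁ ∩ θ₂ = {p ∈ θ₁ | p.1 ∈ gdom θ₁ ∩ gdom θ₂} := by
  ext ⟨x, y⟩
  refine ⟨fun h => ⟨h.1, mem_gdom.2 ⟨y, h.1⟩, mem_gdom.2 ⟨y, h.2⟩⟩, fun h' => ⟨h'.1, ?_⟩⟩
  obtain ⟨y', hy'⟩ := mem_gdom.1 h'.2.2
  rw [h _ _ _ h'.1 hy']; exact hy'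

/-- A symmetry `θ₁` extends by an event of `θ₂` that has the polarity opposite to the events of `θ₁`
not in `θ₂`. -/
theorem IsArena.sym_insert {A : Game.{u}} (hA : IsArena A) {θ₁ θ₂ : Set (A.ev × A.ev)}
    (h₁ : θ₁ ∈ A.sym) (h₂ : θ₂ ∈ A.sym)
    (hcoh : ∀ a b b', (a, b) ∈ θ₁ → (a, b') ∈ θ₂ → b = b') {a b : A.ev} (hab : (a, b) ∈ θ₂)
    (hen : A.Enables (gdom θ₁) a)
    (hp : ∀ d ∈ gdom θ₁, d ∉ gdom θ₂ → A.pol d ≠ A.pol a) : insert (a, b) θ₁ ∈ A.sym := by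
  have hS := hA.isoFamily
  have hi := inter_eq_restrict hcoh
  have hθ : θ₁ ∩ θ₂ ∈ A.sym := by
    rw [hi]
    exact hS.restrict _ h₁ _ (ESS.conf_inter (hS.dom_conf h₁) (hS.dom_conf h₂))
      Set.inter_subset_left
  have hθ' : insert (a, b) (θ₁ ∩ θ₂) ∈ A.sym := by
    have := hS.restrict _ h₂ _ (ESS.conf_inter hen.2.2 (hS.dom_conf h₂)) Set.inter_subset_right
    convert this using 1
    ext ⟨x, y⟩
    constructor
    · rintro (h | h)
      · obtain ⟨rfl, rfl⟩ := Prod.mk.inj h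
        exact ⟨hab, Or.inl rfl, mem_gdom.2 ⟨_, hab⟩⟩
      · exact ⟨h.2, Or.inr (mem_gdom.2 ⟨_, h.1⟩), mem_gdom.2 ⟨_, h.2⟩⟩
    · rintro ⟨h, h' | h', -⟩
      · obtain rfl : x = a := h'
        rw [(hS.bij _ h₂).inj₁ h hab]; exact Or.inl rfl
      · obtain ⟨y', hy'⟩ := mem_gdom.1 h'
        refine Or.inr ⟨?_, h⟩
        rw [← hcoh _ _ _ hy' h]; exact hy'
  have hl : ∀ p ∈ θ₁, p ∉ θ₁ ∩ θ₂ → A.pol p.1 = (A.pol a).flip := by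
    intro p hp' hpn
    have := hp p.1 (mem_gdom.2 ⟨_, hp'⟩) fun hd => hpn (by
      rw [hi]; exact ⟨hp', mem_gdom.2 ⟨_, hp'⟩, hd⟩)
    revert this
    cases A.pol p.1 <;> cases A.pol a <;> simp [Pol.flip]
  cases hk : A.pol a with
  | neg =>
    rw [hk] at hl
    exact hS.amalgam hA.nsym_isoFamily hA.psym_isoFamily hA.nsym_sub hA.sym_pol
      hA.nsym_inter_psym hA.nsym_ext hA.psym_ext h₁ Set.inter_subset_left hl hθ' hθ hk hen
  | pos =>
    rw [hk] at hl
    exact hS.amalgam hA.psym_isoFamily hA.nsym_isoFamily hA.psym_sub hA.sym_pol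
      (fun θ h h' => hA.nsym_inter_psym θ h' h) hA.psym_ext hA.nsym_ext h₁
      Set.inter_subset_left hl hθ' hθ hk hen

abbrev merge {X : Type u} : X ⊕ X → X := Sum.elim id id

theorem merge_swap {X : Type u} (e : X ⊕ X) : merge e.swap = merge e := by cases e <;> rfl

theorem eq_or_eq_swap {X : Type u} {e e' : X ⊕ X} (h : merge e = merge e') :
    e' = e ∨ e' = e.swap := by
  rcases e with e | e <;> rcases e' with e' | e' <;> obtain rfl : e = e' := h <;> simp

theorem hom_imm_swap {A : Game.{u}} {e d : A.ev ⊕ A.ev} (h : (A.hom A).imm e d) :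
    (A.hom A).imm e.swap d.swap := by
  rcases e with e | e <;> rcases d with d | d
  · exact ESS.par_imm_rr.2 (ESS.par_imm_ll.1 h)
  · exact (ESS.par_imm_lr.1 h).elim
  · exact (ESS.par_imm_rl.1 h).elim
  · exact ESS.par_imm_ll.2 (ESS.par_imm_rr.1 h)

theorem merge_lt {A : Game.{u}} {e d : A.ev ⊕ A.ev} (h : (A.hom A).lt e d) :
    A.lt (merge e) (merge d) := by
  rcases e with e | e <;> rcases d with d | d
  · exact ESS.par_lt_ll.1 h
  · exact (ESS.par_lt_lr.1 h).elim
  · exact (ESS.par_lt_rl.1 h).elim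
  · exact ESS.par_lt_rr.1 h

theorem merge_conflict {A : Game.{u}} {e d : A.ev ⊕ A.ev} (h : (A.hom A).conflict e d) :
    A.conflict (merge e) (merge d) := by
  rcases e with e | e <;> rcases d with d | d <;> cases h <;> assumption

theorem hom_conflict {A : Game.{u}} {e d : A.ev ⊕ A.ev} (h : A.conflict (merge e) (merge d))
    (hs : e.isLeft = d.isLeft) : (A.hom A).conflict e d := by
  rcases e with e | e <;> rcases d with d | d
  · exact Sum.LiftRel.inl h
  · cases hs
  · cases hs
  · exact Sum.LiftRel.inr h

/-- The event of `A` on the side of `e`. -/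
def onSide {X : Type u} (e : X ⊕ X) (a : X) : X ⊕ X := Sum.map (fun _ => a) (fun _ => a) e

theorem merge_onSide {X : Type u} (e : X ⊕ X) (a : X) : merge (onSide e a) = a := by
  cases e <;> rfl

theorem isLeft_onSide {X : Type u} (e : X ⊕ X) (a : X) : (onSide e a).isLeft = e.isLeft := by
  cases e <;> rfl

theorem onSide_lt {A : Game.{u}} {e : A.ev ⊕ A.ev} {a : A.ev} (h : A.lt a (merge e)) :
    (A.hom A).lt (onSide e a) e := by
  rcases e with e | e
  · exact ESS.par_lt_ll.2 h
  · exact ESS.par_lt_rr.2 h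

theorem onSide_imm {A : Game.{u}} {e : A.ev ⊕ A.ev} {a : A.ev} (h : A.imm a (merge e)) :
    (A.hom A).imm (onSide e a) e := by
  rcases e with e | e
  · exact ESS.par_imm_ll.2 h
  · exact ESS.par_imm_rr.2 h

theorem eq_of_side {X : Type u} {e d : X ⊕ X} (h : merge e = merge d) (hs : e.isLeft = d.isLeft) :
    e = d := by
  rcases eq_or_eq_swap h with rfl | rfl
  · rfl
  · cases e <;> cases hs

section Order

variable {A : NegArena.{u}} {e d f : A.ev ⊕ A.ev} {x : Set (A.ev ⊕ A.ev)}

abbrev copyES (A : NegArena.{u}) : ESS.{u} := (copycat A.toGame).toESS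

abbrev hpol (A : NegArena.{u}) : A.ev ⊕ A.ev → Pol := (A.hom A.toGame).pol

theorem pol_swap (e : A.ev ⊕ A.ev) : hpol A e.swap = (hpol A e).flip := by
  rcases e with e | e
  · exact (by cases A.pol e <;> rfl : A.pol e = ((A.pol e).flip).flip)
  · rfl

theorem copy_lt_iff : (copyES A).lt e d ↔ A.lt (merge e) (merge d) ∨
    merge e = merge d ∧ hpol A e = .neg ∧ hpol A d = .pos := by
  constructor
  · rintro ⟨h | h | h, hne⟩
    · exact (hne h).elim
    · exact Or.inl h
    · exact Or.inr h
  · rintro (h | h)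
    · exact ⟨Or.inr (Or.inl h), fun he => h.2 (he ▸ rfl)⟩
    · refine ⟨Or.inr (Or.inr h), ?_⟩
      rintro rfl
      cases h.2.1.symm.trans h.2.2

theorem copy_swap_lt (h : hpol A e = .pos) : (copyES A).lt e.swap e :=
  copy_lt_iff.2 (Or.inr ⟨merge_swap e, (pol_swap e).trans (by rw [h]; rfl), h⟩)

theorem copy_merge_le (h : (copyES A).le e d) : A.le (merge e) (merge d) := by
  rcases h with rfl | h | h
  · exact A.isArena.isES.le_refl _
  · exact h.1
  · rw [show merge e = merge d from h.1]; exact A.isArena.isES.le_refl _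

theorem copy_isES (A : NegArena.{u}) : (copyES A).IsES where
  countable := by
    have := A.isArena.isES.countable
    exact inferInstanceAs (Countable (A.ev ⊕ A.ev))
  le_refl _ := Or.inl rfl
  le_trans := by
    have hE := A.isArena.isES
    rintro a b c (rfl | h | h) (rfl | h' | h')
    · exact Or.inl rfl
    · exact Or.inr (Or.inl h')
    · exact Or.inr (Or.inr h')
    · exact Or.inr (Or.inl h)
    · exact Or.inr (Or.inl (hE.lt_trans h h'))
    · exact Or.inr (Or.inl (h'.1 ▸ h))
    · exact Or.inr (Or.inr h)
    · exact Or.inr (Or.inl (h.1 ▸ h'))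
    · cases h.2.2.symm.trans h'.2.1
  le_antisymm := by
    have hE := A.isArena.isES
    intro a b h h'
    have hm := hE.le_antisymm _ _ (copy_merge_le h) (copy_merge_le h')
    rcases h with h | h | h
    · exact h
    · exact (h.2 hm).elim
    · rcases h' with h' | h' | h'
      · exact h'.symm
      · exact (h'.2 hm.symm).elim
      · cases h.2.2.symm.trans h'.2.1
  finite_causes e := by
    have hf := A.isArena.isES.finite_causes (merge e)
    refine ((hf.image inl).union (hf.image inr)).subset fun d hd => ?_
    have := copy_merge_le hd
    rcases d with d | d
    · exact Or.inl ⟨d, this, rfl⟩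
    · exact Or.inr ⟨d, this, rfl⟩
  conflict_irrefl _ := A.isArena.isES.conflict_irrefl _
  conflict_symm _ _ := A.isArena.isES.conflict_symm _ _
  conflict_inherit _ _ _ h h' := A.isArena.isES.conflict_inherit _ _ _ h (copy_merge_le h')

theorem mem_of_copy_lt (hx : x ∈ (copyES A).Conf) (he : e ∈ x) (h : (copyES A).lt d e) : d ∈ x :=
  hx.2.1 _ he _ h.1

theorem mem_of_merge_lt (hx : x ∈ (copyES A).Conf) (he : e ∈ x)
    (h : A.lt (merge d) (merge e)) : d ∈ x := mem_of_copy_lt hx he (copy_lt_iff.2 (Or.inl h))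

theorem swap_mem (hx : x ∈ (copyES A).Conf) (he : e ∈ x) (h : hpol A e = .pos) : e.swap ∈ x :=
  mem_of_copy_lt hx he (copy_swap_lt h)

theorem copy_conf_hom (hx : x ∈ (copyES A).Conf) : x ∈ (A.hom A.toGame).Conf := by
  refine ⟨hx.1, fun e he d hd => ?_, fun e he d hd h => hx.2.2 e he d hd (merge_conflict h)⟩
  by_cases h : d = e
  · exact h ▸ he
  · exact mem_of_merge_lt hx he (merge_lt ⟨hd, h⟩)

theorem copy_conf_insert_pos (hx : x ∈ (copyES A).Conf) (he : hpol A e = .pos) (hs : e.swap ∈ x) :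
    insert e x ∈ (copyES A).Conf := by
  have hc : ∀ d ∈ insert e x, ∃ d' ∈ x, merge d' = merge d := by
    rintro d (rfl | hd)
    · exact ⟨_, hs, merge_swap d⟩
    · exact ⟨d, hd, rfl⟩
  refine ⟨hx.1.insert e, ?_, fun d hd f hf h => ?_⟩
  · rintro d (rfl | hd) f hf
    · rcases hf with rfl | hf | hf
      · exact Or.inl rfl
      · exact Or.inr (mem_of_merge_lt hx hs ((congrArg (A.lt _) (merge_swap _)).mpr hf))
      · rcases eq_or_eq_swap (hf.1.symm : merge d = merge f) with rfl | rfl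
        · exact Or.inl rfl
        · exact Or.inr hs
    · exact Or.inr (hx.2.1 _ hd _ hf)
  · obtain ⟨d', hd', h1⟩ := hc d hd
    obtain ⟨f', hf', h2⟩ := hc f hf
    refine hx.2.2 d' hd' f' hf' ?_
    change A.conflict (merge d') (merge f')
    rw [h1, h2]; exact h

theorem copy_conf_insert_neg (hx : x ∈ (copyES A).Conf) (he : hpol A e = .neg)
    (h : insert e x ∈ (A.hom A.toGame).Conf) : insert e x ∈ (copyES A).Conf := by
  have hP := A.hom_preArena A
  have hE := A.isArena.isES
  have hconf : ∀ y ∈ x, ¬ A.conflict (merge e) (merge y) := by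
    intro y hy hc
    obtain ⟨d, d', hd, hd', hm⟩ := hE.exists_minConflict hc
    have hmem : ∀ z ∈ insert e x, ∀ a, A.le a (merge z) → onSide z a ∈ insert e x := by
      intro z hz a ha
      by_cases haz : a = merge z
      · rw [eq_of_side ((merge_onSide z a).trans haz) (isLeft_onSide z a)]; exact hz
      · exact h.2.1 _ hz _ (onSide_lt ⟨ha, haz⟩).1
    have h1 := hmem e (Or.inl rfl) d hd
    have h2 := hmem y (Or.inr hy) d' hd'
    have hmc : A.conflict (merge (onSide e d)) (merge (onSide y d')) := by
      rw [merge_onSide, merge_onSide]; exact hm.1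
    by_cases hs : e.isLeft = y.isLeft
    · exact h.2.2 _ h1 _ h2 (hom_conflict hmc (by rw [isLeft_onSide, isLeft_onSide, hs]))
    · have hp : hpol A (onSide e d) = (hpol A (onSide y d')).flip := by
        have := A.isArena.race_free _ _ hm
        rcases e with e | e <;> rcases y with y | y
        · exact (hs rfl).elim
        · exact congrArg Pol.flip this
        · exact (by rw [this]; cases A.pol d' <;> rfl : A.pol d = ((A.pol d').flip).flip)
        · exact (hs rfl).elim
      have h2' : onSide y d' ∈ x := h2.resolve_left fun hh => hs (by
        rw [← isLeft_onSide y d', hh])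
      cases hq : hpol A (onSide y d') with
      | pos =>
        refine h.2.2 _ h1 _ (Or.inr (swap_mem hx h2' hq)) (hom_conflict ?_ ?_)
        · rw [merge_swap]; exact hmc
        · rw [isLeft_onSide]
          rcases e with e | e <;> rcases y with y | y
          · exact (hs rfl).elim
          · rfl
          · rfl
          · exact (hs rfl).elim
      | neg =>
        rw [hq] at hp
        refine hx.2.2 _ (h1.resolve_left fun hh => ?_) _ h2' hmc
        rw [hh, show hpol A e = _ from he] at hp
        cases hp
  refine ⟨hx.1.insert e, ?_, ?_⟩
  · rintro z (rfl | hz) d hd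
    · rcases hd with rfl | hd | hd
      · exact Or.inl rfl
      · obtain ⟨c, hc, hci⟩ := hE.exists_imm hd
        have hi := onSide_imm hci
        have hcx : onSide z c ∈ x := (h.2.1 _ (Or.inl rfl) _ hi.1.1).resolve_left hi.1.2
        have hne : hpol A _ ≠ hpol A _ := hP.alternating _ _ hi
        rw [he] at hne
        have hsw := swap_mem hx hcx (Pol.eq_pos.2 hne)
        right
        by_cases hdc : merge d = c
        · rcases eq_or_eq_swap ((merge_onSide z c).trans hdc.symm) with h' | h'
          · exact h' ▸ hcx
          · exact h' ▸ hsw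
        · exact mem_of_merge_lt hx hcx ((congrArg (A.lt _) (merge_onSide z c)).mpr
            ⟨hc, hdc⟩)
      · cases he.symm.trans hd.2.2
    · exact Or.inr (hx.2.1 _ hz _ hd)
  · rintro d (rfl | hd) f (rfl | hf)
    · exact hE.conflict_irrefl _
    · exact hconf f hf
    · exact fun hh => hconf d hd (hE.conflict_symm _ _ hh)
    · exact hx.2.2 d hd f hf

theorem copy_comparable (h : (copyES A).le e f) (h' : (copyES A).le d f) :
    (copyES A).le e d ∨ (copyES A).le d e := by
  by_cases hm : merge e = merge d
  · rcases eq_or_eq_swap hm with rfl | rfl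
    · exact Or.inl (Or.inl rfl)
    · have := pol_swap (A := A) e
      cases hp : hpol A e with
      | neg => exact Or.inl (Or.inr (Or.inr ⟨hm, hp, this.trans (by rw [hp]; rfl)⟩))
      | pos => exact Or.inr (Or.inr (Or.inr ⟨hm.symm, this.trans (by rw [hp]; rfl), hp⟩))
  · rcases A.isArena.forestial _ _ _ (copy_merge_le h) (copy_merge_le h') with hl | hl
    · exact Or.inl (Or.inr (Or.inl ⟨hl, hm⟩))
    · exact Or.inr (Or.inr (Or.inl ⟨hl, Ne.symm hm⟩))

theorem eq_of_pol (h : merge e = merge d) (hp : hpol A e = hpol A d) : e = d := by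
  rcases eq_or_eq_swap h with rfl | rfl
  · rfl
  · exact (Pol.flip_ne _ ((pol_swap e).symm.trans hp.symm)).elim

theorem copy_min (h : (copyES A).IsMinEv e) : hpol A e = .neg ∧ A.IsMinEv (merge e) := by
  refine ⟨Pol.eq_neg.2 fun hp => (copy_swap_lt hp).2 (h _ (copy_swap_lt hp).1), fun a ha => ?_⟩
  by_contra hne
  have hl : (copyES A).lt (inl a) e := copy_lt_iff.2 (Or.inl ⟨ha, hne⟩)
  exact hl.2 (h _ hl.1)

theorem copy_imm (h : (copyES A).imm e d) : (A.hom A.toGame).imm e d ∨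
    d = e.swap ∧ hpol A e = .neg ∧ hpol A d = .pos := by
  rcases copy_lt_iff.1 h.1 with hl | ⟨hm, h1, h2⟩
  · left
    have hi : A.imm (merge e) (merge d) := ⟨hl, fun c hc =>
      h.2 (inl c) ⟨copy_lt_iff.2 (Or.inl hc.1), copy_lt_iff.2 (Or.inl hc.2)⟩⟩
    have hi' := onSide_imm hi
    rcases eq_or_eq_swap (merge_onSide d (merge e)) with he | he
    · rw [he]; exact hi'
    · exfalso
      have hne : hpol A _ ≠ hpol A _ := (A.hom_preArena A).alternating _ _ hi'
      rw [show onSide d (merge e) = e.swap from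
        ((congrArg Sum.swap he).trans (Sum.swap_swap _)).symm, pol_swap] at hne
      cases hp : hpol A d with
      | pos => exact h.2 d.swap ⟨copy_lt_iff.2 (Or.inl (by rw [merge_swap]; exact hl)),
          copy_swap_lt hp⟩
      | neg =>
        rw [hp, Ne, Pol.flip_eq_neg, ← Ne, ← Pol.eq_neg] at hne
        exact h.2 e.swap ⟨copy_lt_iff.2 (Or.inr ⟨(merge_swap e).symm, hne, by
          rw [pol_swap, hne]; rfl⟩), copy_lt_iff.2 (Or.inl (by rw [merge_swap]; exact hl))⟩
  · rcases eq_or_eq_swap hm with rfl | rfl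
    · exact (h.1.2 rfl).elim
    · exact Or.inr ⟨rfl, h1, h2⟩

theorem copy_thr {K : Set (copyES A).ev} (h : (copyES A).Thr K e) :
    K = (copyES A).down e := by
  induction h with
  | base hm => exact Set.ext fun d => ⟨fun h => Or.inl h, fun h => hm _ h⟩
  | @step K e f hK hi ih =>
    rw [ih]
    ext d
    constructor
    · rintro (rfl | hd)
      · exact Or.inl rfl
      · exact (copy_isES A).le_trans _ _ _ hd hi.1.1
    · intro hd
      by_cases hdf : d = f
      · exact Or.inl hdf
      right
      rcases copy_comparable hd hi.1.1 with hl | hl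
      · exact hl
      · by_cases hde : e = d
        · exact Or.inl hde.symm
        · exact (hi.2 d ⟨⟨hl, hde⟩, hd, hdf⟩).elim

end Order

section Symmetry

variable {A : NegArena.{u}} {e f g : A.ev ⊕ A.ev}
  {φ ψ : Set ((A.ev ⊕ A.ev) × (A.ev ⊕ A.ev))}

/-- Symmetries of copycat: symmetries that act in the same way on the two copies of an event. -/
structure IsCopySym (A : NegArena.{u}) (φ : Set ((A.ev ⊕ A.ev) × (A.ev ⊕ A.ev))) : Prop where
  bij : IsConfBij (copyES A) φ
  sym : φ ∈ (A.hom A.toGame).sym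
  coh : ∀ e f, (e, f) ∈ φ → ∀ e' f', (e', f') ∈ φ → (merge e = merge e' ↔ merge f = merge f')

theorem mem_copy_sym : φ ∈ (copyES A).sym ↔ IsCopySym A φ := by
  have hS := A.isArena.isoFamily
  constructor
  · rintro ⟨hb, θ₁, h₁, θ₂, h₂, h₃, hd, hc, rfl⟩
    have key : ∀ a b b', (a, b) ∈ θ₁ → (a, b') ∈ θ₂ → b = b' := by
      intro a b b' h h'
      have ha : a ∈ gdom (θ₁ ∩ θ₂) := by rw [hd]; exact ⟨mem_gdom.2 ⟨_, h⟩, mem_gdom.2 ⟨_, h'⟩⟩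
      obtain ⟨c, hc⟩ := mem_gdom.1 ha
      exact ((hS.bij _ h₁).inj₁ h hc.1).trans ((hS.bij _ h₂).inj₁ h' hc.2).symm
    have key' : ∀ a a' b, (a, b) ∈ θ₁ → (a', b) ∈ θ₂ → a = a' := by
      intro a a' b h h'
      have ha : b ∈ gcod (θ₁ ∩ θ₂) := by rw [hc]; exact ⟨mem_gcod.2 ⟨_, h⟩, mem_gcod.2 ⟨_, h'⟩⟩
      obtain ⟨c, hc⟩ := mem_gcod.1 ha
      exact ((hS.bij _ h₁).inj₂ h hc.1).trans ((hS.bij _ h₂).inj₂ h' hc.2).symm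
    refine ⟨hb, parRel_mem_parFam.2 ⟨h₁, h₂⟩, ?_⟩
    rintro (e | e) (f | f) h (e' | e') (f' | f') h' <;> simp at h h' <;>
      simp only [Sum.elim_inl, Sum.elim_inr, id]
    · exact ⟨fun hh => (hS.bij _ h₁).inj₁ h (hh ▸ h'), fun hh => (hS.bij _ h₁).inj₂ h (hh ▸ h')⟩
    · exact ⟨fun hh => key _ _ _ h (hh ▸ h'), fun hh => key' _ _ _ h (hh ▸ h')⟩
    · exact ⟨fun hh => (key _ _ _ h' (hh ▸ h)).symm, fun hh => (key' _ _ _ h' (hh ▸ h)).symm⟩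
    · exact ⟨fun hh => (hS.bij _ h₂).inj₁ h (hh ▸ h'), fun hh => (hS.bij _ h₂).inj₂ h (hh ▸ h')⟩
  · rintro ⟨hb, ⟨θ₁, h₁, θ₂, h₂, rfl⟩, hcoh⟩
    have key : ∀ a b b', (a, b) ∈ θ₁ → (a, b') ∈ θ₂ → b = b' := fun a b b' h h' =>
      (hcoh (.inl a) (.inl b) (mem_parRel_ll.2 h) (.inr a) (.inr b') (mem_parRel_rr.2 h')).1 rfl
    have hi := inter_eq_restrict key
    refine ⟨hb, θ₁, h₁, θ₂, h₂, ?_, ?_, ?_, rfl⟩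
    · rw [hi]
      exact hS.restrict _ h₁ _ (ESS.conf_inter (hS.dom_conf h₁) (hS.dom_conf h₂))
        Set.inter_subset_left
    · rw [hi, gdom_restrict Set.inter_subset_left]
    · refine subset_antisymm (fun b h => ?_) fun b h => ?_
      · obtain ⟨a, ha⟩ := mem_gcod.1 h
        exact ⟨mem_gcod.2 ⟨a, ha.1⟩, mem_gcod.2 ⟨a, ha.2⟩⟩
      · obtain ⟨a, ha⟩ := mem_gcod.1 h.1
        obtain ⟨a', ha'⟩ := mem_gcod.1 h.2
        obtain rfl : a = a' := (hcoh (.inl a) (.inl b) (mem_parRel_ll.2 ha) (.inr a') (.inr b)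
          (mem_parRel_rr.2 ha')).2 rfl
        exact mem_gcod.2 ⟨a, ha, ha'⟩

namespace IsCopySym

theorem pol_eq (h : IsCopySym A φ) (he : (e, f) ∈ φ) : hpol A e = hpol A f :=
  (A.hom_preArena A).sym_pol φ h.sym _ he

theorem swap (h : IsCopySym A φ) : IsCopySym A (Prod.swap '' φ) :=
  ⟨h.bij.swap, (A.hom_preArena A).isoFamily.inv_mem _ h.sym, fun e f hef e' f' hef' =>
    (h.coh f e (mem_swap.1 hef) f' e' (mem_swap.1 hef')).symm⟩

theorem lt_of_lt (h : IsCopySym A φ) {e' f' : A.ev ⊕ A.ev} (he : (e, f) ∈ φ) (he' : (e', f') ∈ φ)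
    (hl : (copyES A).lt e e') : (copyES A).lt f f' := by
  have hP := A.hom_preArena A
  rcases copy_lt_iff.1 hl with hl' | ⟨h1, h2, h3⟩
  · have ho := onSide_lt hl'
    obtain ⟨g, hg⟩ := mem_gdom.1 (mem_of_merge_lt h.bij.2.2.1 (mem_gdom.2 ⟨_, he'⟩)
      (d := onSide e' (merge e)) (by rw [merge_onSide]; exact hl'))
    have := (hP.isoFamily.lt_iff hP.isES h.sym hg he').1 ho
    rw [copy_lt_iff, ← (h.coh _ _ hg _ _ he).1 (merge_onSide _ _)]
    exact Or.inl (merge_lt this)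
  · exact copy_lt_iff.2 (Or.inr ⟨(h.coh _ _ he _ _ he').1 h1, (h.pol_eq he).symm.trans h2,
      (h.pol_eq he').symm.trans h3⟩)

theorem insert_neg (h : IsCopySym A φ) (he : e ∉ gdom φ) (hp : hpol A e = .neg)
    (hs : insert (e, f) φ ∈ (A.hom A.toGame).sym) : IsCopySym A (insert (e, f) φ) := by
  have hP := A.hom_preArena A
  have hb := hP.isoFamily.bij _ hs
  have hd := hb.2.2.1
  have hc := hb.2.2.2
  rw [gdom_insert] at hd
  rw [gcod_insert] at hc
  have hp' : hpol A f = .neg := (hP.sym_pol _ hs _ (Or.inl rfl)).symm.trans hp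
  have hf : f ∉ gcod φ := fun hf => by
    obtain ⟨e', he'⟩ := mem_gcod.1 hf
    exact he (mem_gdom.2 ⟨f, hb.inj₂ (Or.inl rfl) (Or.inr he') ▸ he'⟩)
  have key : ∀ x ∈ (copyES A).Conf, ∀ d, hpol A d = .neg → d ∉ x → ∀ d' ∈ x,
      merge d ≠ merge d' := by
    intro x hx d hd hdx d' hd' hm
    rcases eq_or_eq_swap hm with rfl | rfl
    · exact hdx hd'
    · refine hdx ?_
      have := CausalGames.swap_mem hx hd' ((pol_swap d).trans (by rw [hd]; rfl))
      rwa [Sum.swap_swap] at this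
  refine ⟨⟨hb.1, hb.2.1, ?_, ?_⟩, hs, ?_⟩
  · rw [gdom_insert]; exact copy_conf_insert_neg h.bij.2.2.1 hp hd
  · rw [gcod_insert]; exact copy_conf_insert_neg h.bij.2.2.2 hp' hc
  have k1 := key _ h.bij.2.2.1 e hp he
  have k2 := key _ h.bij.2.2.2 f hp' hf
  rintro a b (hab | hab) a' b' (hab' | hab')
  · obtain ⟨rfl, rfl⟩ := Prod.mk.inj hab
    obtain ⟨rfl, rfl⟩ := Prod.mk.inj hab'
    exact iff_of_true rfl rfl
  · obtain ⟨rfl, rfl⟩ := Prod.mk.inj hab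
    exact iff_of_false (k1 _ (mem_gdom.2 ⟨_, hab'⟩)) (k2 _ (mem_gcod.2 ⟨_, hab'⟩))
  · obtain ⟨rfl, rfl⟩ := Prod.mk.inj hab'
    exact iff_of_false (k1 _ (mem_gdom.2 ⟨_, hab⟩)).symm (k2 _ (mem_gcod.2 ⟨_, hab⟩)).symm
  · exact h.coh _ _ hab _ _ hab'

theorem insert_pos (h : IsCopySym A φ) (hen : (copyES A).Enables (gdom φ) e)
    (hp : hpol A e = .pos) (hs : (e.swap, f.swap) ∈ φ) : IsCopySym A (insert (e, f) φ) := by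
  have hP := A.hom_preArena A
  have hpf : hpol A f = .pos := by
    have := h.pol_eq hs
    rwa [pol_swap, pol_swap, Pol.flip_inj, hp, eq_comm] at this
  have hG : insert (e, f) φ ∈ (A.hom A.toGame).sym := by
    obtain ⟨-, ⟨θ₁, h₁, θ₂, h₂, rfl⟩, hcoh⟩ := id h
    have hpol : ∀ d ∈ gdom (parRel θ₁ θ₂), d.swap ∉ gdom (parRel θ₁ θ₂) → hpol A d = .neg :=
      fun d hd hd' => Pol.eq_neg.2 fun hh => hd' (CausalGames.swap_mem h.bij.2.2.1 hd hh)
    have hen' : (A.hom A.toGame).Enables (gdom (parRel θ₁ θ₂)) e :=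
      ⟨hP.isoFamily.dom_conf h.sym, hen.2.1, copy_conf_hom hen.2.2⟩
    rcases e with e | e <;> rcases f with f | f
    · have h2 := (ESS.par_enables_l.1 hen').1
      rw [preimage_inl_gdom] at h2
      rw [insert_inl_parRel]
      refine parRel_mem_parFam.2 ⟨A.isArena.sym_insert h₁ h₂ (fun a b b' h h' => (hcoh (.inl a)
        (.inl b) (mem_parRel_ll.2 h) (.inr a) (.inr b') (mem_parRel_rr.2 h')).1 rfl)
        (mem_parRel_rr.1 hs) h2 fun d hd hd' hh => ?_, h₂⟩
      have := hpol (.inl d) (inl_mem_gdom_parRel.2 hd) fun hh => hd' (inr_mem_gdom_parRel.1 hh)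
      rw [show CausalGames.hpol A (.inl d) = (A.pol d).flip from rfl, hh] at this
      cases this.symm.trans hp
    · exact (mem_parRel_rl.1 hs).elim
    · exact (mem_parRel_lr.1 hs).elim
    · have h2 := (ESS.par_enables_r.1 hen').1
      rw [preimage_inr_gdom] at h2
      rw [insert_inr_parRel]
      refine parRel_mem_parFam.2 ⟨h₁, A.isArena.sym_insert h₂ h₁ (fun a b b' h h' => (hcoh (.inr a)
        (.inr b) (mem_parRel_rr.2 h) (.inl a) (.inl b') (mem_parRel_ll.2 h')).1 rfl)
        (mem_parRel_ll.1 hs) h2 fun d hd hd' hh => ?_⟩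
      have := hpol (.inr d) (inr_mem_gdom_parRel.2 hd) fun hh => hd' (inl_mem_gdom_parRel.1 hh)
      rw [show CausalGames.hpol A (.inr d) = A.pol d from rfl, hh] at this
      cases this.symm.trans hp
  have hb := hP.isoFamily.bij _ hG
  refine ⟨⟨hb.1, hb.2.1, ?_, ?_⟩, hG, ?_⟩
  · rw [gdom_insert]; exact hen.2.2
  · rw [gcod_insert]; exact copy_conf_insert_pos h.bij.2.2.2 hpf (mem_gcod.2 ⟨_, hs⟩)
  have key : ∀ a b, (a, b) ∈ insert (e, f) φ → ∃ a' b', (a', b') ∈ φ ∧ merge a' = merge a ∧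
      merge b' = merge b := by
    rintro a b (hab | hab)
    · obtain ⟨rfl, rfl⟩ := Prod.mk.inj hab
      exact ⟨_, _, hs, merge_swap _, merge_swap _⟩
    · exact ⟨_, _, hab, rfl, rfl⟩
  intro a b hab a' b' hab'
  obtain ⟨c, d, hcd, h1, h2⟩ := key _ _ hab
  obtain ⟨c', d', hcd', h1', h2'⟩ := key _ _ hab'
  rw [← h1, ← h2, ← h1', ← h2']
  exact h.coh _ _ hcd _ _ hcd'

theorem exists_insert_pos (h : IsCopySym A φ) (hen : (copyES A).Enables (gdom φ) e)
    (hp : hpol A e = .pos) : ∃ f, (e.swap, f.swap) ∈ φ ∧ IsCopySym A (insert (e, f) φ) := by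
  obtain ⟨g, hg⟩ := mem_gdom.1 (hen.pre (copy_swap_lt hp))
  rw [← Sum.swap_swap g] at hg
  exact ⟨g.swap, hg, h.insert_pos hen hp hg⟩

end IsCopySym

theorem copy_isoFamily (A : NegArena.{u}) : IsIsoFamily (copyES A) (copyES A).sym := by
  have hP := A.hom_preArena A
  have hS := hP.isoFamily
  constructor
  · exact fun θ hθ => hθ.1
  · intro x hx
    have hG := hS.id_mem x (copy_conf_hom hx)
    have hb := hS.bij _ hG
    refine mem_copy_sym.2 ⟨⟨hb.1, hb.2.1, by rw [gdom_gid]; exact hx, by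
      rw [gcod_gid]; exact hx⟩, hG, ?_⟩
    rintro e f ⟨-, h⟩ e' f' ⟨-, h'⟩
    rw [show f = e from h, show f' = e' from h']
  · exact fun θ hθ => mem_copy_sym.2 (mem_copy_sym.1 hθ).swap
  · intro θ hθ θ' hθ' he
    replace hθ := mem_copy_sym.1 hθ
    replace hθ' := mem_copy_sym.1 hθ'
    have hG := hS.comp_mem' hθ.sym hθ'.sym he
    have hb := hS.bij _ hG
    change gcomp θ θ' ∈ _
    refine mem_copy_sym.2 ⟨⟨hb.1, hb.2.1, ?_, ?_⟩, hG, ?_⟩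
    · rw [gdom_gcomp he.le]; exact hθ.bij.2.2.1
    · rw [gcod_gcomp he.ge]; exact hθ'.bij.2.2.2
    · rintro e f ⟨g, h1, h2⟩ e' f' ⟨g', h1', h2'⟩
      exact (hθ.coh _ _ h1 _ _ h1').trans (hθ'.coh _ _ h2 _ _ h2')
  · intro θ hθ x hx hsub
    replace hθ := mem_copy_sym.1 hθ
    have hG := hS.restrict _ hθ.sym x (copy_conf_hom hx) hsub
    have hb := hS.bij _ hG
    refine mem_copy_sym.2 ⟨⟨hb.1, hb.2.1, by rw [gdom_restrict hsub]; exact hx, ?_⟩, hG,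
      fun e f h e' f' h' => hθ.coh _ _ h.1 _ _ h'.1⟩
    refine ESS.conf_of_subset hθ.bij.2.2.2 (gcod_mono fun p hp => hp.1) fun f hf f' hl => ?_
    obtain ⟨e, he⟩ := mem_gcod.1 hf
    obtain ⟨e', he'⟩ := mem_gcod.1 (mem_of_copy_lt hθ.bij.2.2.2 (mem_gcod.2 ⟨_, he.1⟩) hl)
    exact mem_gcod.2 ⟨e', he', mem_of_copy_lt hx he.2
      (hθ.swap.lt_of_lt (mem_swap.2 he') (mem_swap.2 he.1) hl)⟩
  · refine extend_of_step (copy_isES A) (fun θ hθ => hθ.1) fun θ hθ e hen => ?_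
    replace hθ := mem_copy_sym.1 hθ
    cases hp : hpol A e with
    | pos =>
      obtain ⟨f, -, hf⟩ := hθ.exists_insert_pos hen hp
      exact ⟨f, mem_copy_sym.2 hf⟩
    | neg =>
      obtain ⟨f, hf⟩ := hS.extend_one hθ.sym ⟨hS.dom_conf hθ.sym, hen.2.1, copy_conf_hom hen.2.2⟩
      exact ⟨f, mem_copy_sym.2 (hθ.insert_neg hen.2.1 hp hf)⟩

theorem copy_isPointedStrategy (A : NegArena.{u}) : IsPointedStrategy (copycat A.toGame) := by
  have hP := A.hom_preArena A
  have hmap : ∀ θ : Set ((A.ev ⊕ A.ev) × (A.ev ⊕ A.ev)),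
      Prod.map (copycat A.toGame).disp (copycat A.toGame).disp '' θ = θ := fun θ => Set.image_id θ
  have himg : ∀ x : Set (A.ev ⊕ A.ev), (copycat A.toGame).disp '' x = x := fun x => Set.image_id x
  constructor
  · exact copy_isES A
  · exact copy_isoFamily A
  · intro x hx
    rw [himg]; exact copy_conf_hom hx
  · exact fun x _ => Function.injective_id.injOn
  · intro θ hθ
    rw [hmap]; exact (mem_copy_sym.1 hθ).sym
  · intro θ hθ e f hen hp _ hs
    rw [hmap] at hs
    exact ⟨f, ⟨⟨hs.1, mem_copy_sym.2 ((mem_copy_sym.1 hθ).insert_neg hen.2.1 hp hs.2)⟩, rfl⟩,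
      fun g hg => hg.2⟩
  · intro θ hθ e hen hp
    replace hθ := mem_copy_sym.1 hθ
    obtain ⟨f, hf, hs⟩ := hθ.exists_insert_pos hen hp
    have hc := hs.bij.2.2.2
    rw [gcod_insert] at hc
    refine ⟨f, ⟨⟨hθ.bij.2.2.2, ?_, hc⟩, fun h => hen.2.1 (mem_gdom.2 ⟨_, h⟩),
      mem_copy_sym.2 hs⟩, ?_⟩
    · intro h
      obtain ⟨e', he'⟩ := mem_gcod.1 h
      exact hen.2.1 (mem_gdom.2 ⟨f, hs.bij.inj₂ (Or.inr he') (Or.inl rfl) ▸ he'⟩)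
    · rintro g ⟨-, -, hg⟩
      replace hg := mem_copy_sym.1 hg
      have h1 := (hg.coh _ _ (Or.inr hf) _ _ (Or.inl rfl)).1 (merge_swap e)
      exact eq_of_pol (h1.symm.trans (merge_swap f))
        ((hg.pol_eq (Or.inl rfl)).symm.trans (hs.pol_eq (Or.inl rfl)))
  · exact fun e he => (copy_min he).1
  · rintro e d hi hp
    rcases copy_imm hi with h | ⟨-, h1, h2⟩
    · exact h
    · rcases hp with hp | hp
      · cases h1.symm.trans hp
      · cases h2.symm.trans hp
  · intro x hx e hen hp
    rw [himg] at hen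
    exact ⟨e, ⟨⟨hx, hen.2.1, copy_conf_insert_neg hx hp hen.2.2⟩, rfl⟩, fun g hg => hg.2⟩
  · intro e
    obtain ⟨m, hm, hme⟩ := (copy_isES A).exists_min_le e
    refine ⟨m, ⟨hm, hme⟩, fun m' hm' => ?_⟩
    rcases copy_comparable hm'.2 hme with h | h
    · exact hm _ h
    · exact (hm'.1 _ h).symm

theorem copy_isVisible (A : NegArena.{u}) : IsVisible (copycat A.toGame) :=
  isVisible_of_thr fun K e h => by
    rw [copy_thr h, show (copycat A.toGame).disp '' _ = _ from Set.image_id _]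
    exact copy_conf_hom ((copy_isES A).down_conf e)

end Symmetry

section Copycat

variable {A : NegArena.{u}} {e f : A.ev ⊕ A.ev} {x S : Set (A.ev ⊕ A.ev)}

theorem lam_swap (e : A.ev ⊕ A.ev) :
    (A.hom A.toGame).lam e.swap = (A.hom A.toGame).lam e := by
  cases e <;> rfl

theorem mem_of_hom_imm (hx : x ∈ (copyES A).Conf) (hf : f ∈ x)
    (h : (A.hom A.toGame).imm e f) : e ∈ x :=
  (copy_conf_hom hx).2.1 _ hf _ h.1.1

theorem pol_of_imm (h : (A.hom A.toGame).imm e f) {p : Pol}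
    (he : hpol A e = p) : hpol A f = p.flip := by
  have : hpol A e ≠ hpol A f := (A.hom_preArena A).alternating _ _ h
  rw [he] at this
  revert this
  cases hpol A f <;> cases p <;> simp [Pol.flip]

/-- A positive event answering the copy of `e`. -/
theorem swap_mem_of_imm_swap (hx : x ∈ (copyES A).Conf) (he : hpol A e = .pos) {a : A.ev ⊕ A.ev}
    (ha : a ∈ x) (h : (A.hom A.toGame).imm e.swap a) :
    a.swap ∈ x ∧ (A.hom A.toGame).imm e a.swap := by
  have h1 := pol_of_imm h ((pol_swap e).trans (congrArg _ he))
  refine ⟨swap_mem hx ha h1, ?_⟩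
  have := hom_imm_swap h
  rwa [Sum.swap_swap] at this

theorem copy_answer_eq (hx : x ∈ (copyES A).Conf) (he : e ∈ x) (hf : f ∈ x)
    (h : IsAns (copycat A.toGame) e) (h' : IsAns (copycat A.toGame) f) {q : A.ev ⊕ A.ev}
    (hq : (A.hom A.toGame).imm q e) (hq' : (A.hom A.toGame).imm q f) :
    e = f :=
  IsAns.eq (copy_isPointedStrategy A) hx he hf h h' (just_of_imm (σ := copycat A.toGame) hq)
    (just_of_imm (σ := copycat A.toGame) hq')

theorem copy_isWellBracketed (A : NegArena.{u}) : IsWellBracketed (copycat A.toGame) := by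
  have hσ := copy_isPointedStrategy A
  refine (isWellBracketed_iff hσ).2 fun S s hrun hen hp => ?_
  have hS := hrun.conf
  have hs : Sum.swap s ∈ S := hen.pre (copy_swap_lt hp)
  have hns : ∀ {q : A.ev ⊕ A.ev}, (A.hom A.toGame).imm q s → hpol A q = .neg :=
    fun {q} h => Pol.eq_neg.2 fun hh => by cases (pol_of_imm h hh).symm.trans hp
  have hmir : ∀ {q}, (A.hom A.toGame).imm q s → Sum.swap q ∈ S :=
    fun h => mem_of_hom_imm hS hs (hom_imm_swap h)
  have hjimm : ∀ {q t : A.ev ⊕ A.ev}, Just (copycat A.toGame) q t →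
      (A.hom A.toGame).imm q t ∨
        ∃ m, q = inr m ∧ t = inl m ∧ A.IsMinEv m := by
    rintro q t (⟨h1, h2, h3⟩ | ⟨h1, h2, h3⟩ | ⟨h1, h2, h3, h4, h5⟩)
    · rw [show q = _ from h1, show t = _ from h2]; exact Or.inl (ESS.par_imm_ll.2 h3)
    · rw [show q = _ from h1, show t = _ from h2]; exact Or.inl (ESS.par_imm_rr.2 h3)
    · rw [show q = _ from h1, show t = _ from h2] at h5
      have := h3 _ (copy_merge_le h5)
      exact Or.inr ⟨_, h1, (show t = _ from h2).trans (congrArg inl this.symm),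
        (congrArg A.IsMinEv this).mpr h3⟩
  constructor
  · rintro q hq hQ hJ ⟨a, ha, hA, hJa⟩
    have hia : (A.hom A.toGame).imm q a := Just.imm_of_not_isQ hJa hA.not_isQ
    rcases hjimm hJ with hi | ⟨m, rfl, rfl, hm⟩
    · have hsa : Sum.swap a ∈ S := swap_mem hS ha (pol_of_imm hia (hns hi))
      have hA' : IsAns (copycat A.toGame) (Sum.swap a) := (lam_swap a).trans hA
      have hsi := hom_imm_swap hi
      have hsia := hom_imm_swap hia
      rcases isQ_or_isAns (σ := copycat A.toGame) s with hQs | hAs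
      · obtain ⟨a', ha', hA'', hJ'⟩ := hrun.answered hσ (Sum.swap q) (hmir hi) (Sum.swap a) hsa
          (Sum.swap s) hs ((lam_swap q).trans hQ) hA' ((lam_swap s).trans hQs)
          (just_of_imm (σ := copycat A.toGame) hsia) (just_of_imm (σ := copycat A.toGame) hsi)
        obtain ⟨h1, h2⟩ := swap_mem_of_imm_swap hS hp ha' (Just.imm_of_not_isQ hJ' hA''.not_isQ)
        exact hen.2.1 (mem_of_hom_imm hS h1 h2)
      · have := copy_answer_eq hS hs hsa ((lam_swap s).trans hAs) hA' hsi hsia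
        rw [← Sum.swap_swap s, this, Sum.swap_swap] at hen
        exact hen.2.1 ha
    · have h1 := pol_of_imm hia (A.negative m hm)
      have h2 := hom_imm_swap hia
      exact hen.2.1 (mem_of_hom_imm hS (swap_mem hS ha h1) h2)
  · intro hA q hq hQ hJ q' hq' hQ' hJ'
    have hi : (A.hom A.toGame).imm q s := Just.imm_of_not_isQ hJ hA.not_isQ
    have hA' : IsAns (copycat A.toGame) (Sum.swap s) := (lam_swap s).trans hA
    have hsi := hom_imm_swap hi
    rcases hjimm hJ' with hi' | ⟨m, rfl, rfl, hm⟩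
    · have hp' := pol_of_imm hi' (hns hi)
      obtain ⟨a', ha', hA'', hJ''⟩ := hrun.answered hσ (Sum.swap q) (hmir hi) (Sum.swap s) hs
        (Sum.swap q') (swap_mem hS hq' hp') ((lam_swap q).trans hQ) hA' ((lam_swap q').trans hQ')
        (just_of_imm (σ := copycat A.toGame) hsi)
        (just_of_imm (σ := copycat A.toGame) (hom_imm_swap hi'))
      obtain ⟨h1, h2⟩ := swap_mem_of_imm_swap hS hp' ha' (Just.imm_of_not_isQ hJ'' hA''.not_isQ)
      exact ⟨Sum.swap a', Or.inr h1, (lam_swap a').trans hA'',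
        just_of_imm (σ := copycat A.toGame) h2⟩
    · exact ⟨Sum.swap s, Or.inr hs, hA', just_of_imm (σ := copycat A.toGame) hsi⟩

theorem isWbVis_copycat (A : NegArena.{u}) : IsWbVis (copycat A.toGame) :=
  ⟨copy_isPointedStrategy A, copy_isWellBracketed A, copy_isVisible A⟩

theorem swap_mem_of_complete (hx : x ∈ (copyES A).Conf)
    (hc : IsComplete (A.hom A.toGame) x) (he : e ∈ x) : e.swap ∈ x := by
  have hσ := copy_isPointedStrategy A
  cases hp : hpol A e with
  | pos => exact swap_mem hx he hp
  | neg =>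
    rcases isQ_or_isAns (σ := copycat A.toGame) e with hQ | hA
    · obtain ⟨a, ha, -, hi⟩ := hc e he hQ
      exact mem_of_hom_imm hx (swap_mem hx ha (pol_of_imm hi hp)) (hom_imm_swap hi)
    · obtain ⟨q, hq, hQ, hJ⟩ := hA.exists_just hσ hx he
      have hi : (A.hom A.toGame).imm q e := hJ.imm_of_not_isQ hA.not_isQ
      have hpq : hpol A q = .pos := Pol.eq_pos.2 fun hh => by cases (pol_of_imm hi hh).symm.trans hp
      obtain ⟨a, ha, hA', hia⟩ := hc _ (swap_mem hx hq hpq) ((lam_swap q).trans hQ)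
      obtain ⟨h1, h2⟩ := swap_mem_of_imm_swap hx hpq ha hia
      rw [copy_answer_eq hx he h1 hA ((lam_swap a).trans hA') hi h2, Sum.swap_swap]
      exact ha

theorem copy_conf_merge {z : Set A.ev} (hz : z ∈ A.Conf) :
    (merge ⁻¹' z : Set (A.ev ⊕ A.ev)) ∈ (copyES A).Conf := by
  refine ⟨?_, fun e he d hd => hz.2.1 _ he _ (copy_merge_le hd), fun e he d hd =>
    hz.2.2 _ he _ hd⟩
  refine ((hz.1.image inl).union (hz.1.image inr)).subset fun d hd => ?_
  rcases d with d | d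
  · exact Or.inl ⟨d, hd, rfl⟩
  · exact Or.inr ⟨d, hd, rfl⟩

theorem collapseRel_copycat (A : NegArena.{u}) : collapseRel (copycat A.toGame) = SetRel.id := by
  ext ⟨p, q⟩
  rw [mem_collapseRel, SetRel.mem_id]
  constructor
  · rintro ⟨x, hx, xA, xB, hxy, hp⟩
    rw [show (copycat A.toGame).disp '' x = x from Set.image_id x] at hxy
    obtain ⟨h1, h2⟩ := eq_union_iff.1 hxy
    have hc : IsComplete (A.hom A.toGame) x :=
      isComplete_hom.2 ⟨h1 ▸ xA.2.2, h2 ▸ xB.2.2⟩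
    obtain ⟨rfl, rfl⟩ := Prod.mk.inj hp
    refine congrArg _ (Subtype.ext ?_)
    rw [h1, h2]
    exact Set.ext fun a => ⟨fun h => swap_mem_of_complete hx hc h,
      fun h => swap_mem_of_complete hx hc h⟩
  · rintro rfl
    obtain ⟨z, rfl⟩ := Quot.exists_rep p
    refine ⟨_, copy_conf_merge z.2.1, z, z, ?_, rfl⟩
    rw [show (copycat A.toGame).disp '' _ = _ from Set.image_id _]
    exact eq_union_iff.2 ⟨rfl, rfl⟩

end Copycat

/-! ## Congruences -/

section Family

variable {I : Type} {R : Set I → Prop}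

/-- `E` is a sum of the event structures `F i`. The configurations of `E` are unions of
configurations of the `F i`, with a support that satisfies `R`. -/
structure ESS.IsFamily (E : ESS.{u}) (F : I → ESS.{u}) (k : ∀ i, (F i).ev → E.ev)
    (R : Set I → Prop) : Prop where
  inj : ∀ i, Function.Injective (k i)
  fin : ∀ S, R S → S.Finite
  mono : ∀ S T, S ⊆ T → R T → R S
  disj : ∀ S, R S → ∀ i ∈ S, ∀ j ∈ S, ∀ a b, k i a = k j b → i = j
  le : ∀ e i b, E.le e (k i b) ↔ ∃ a, e = k i a ∧ (F i).le a b
  conflict : ∀ i a b, E.conflict (k i a) (k i b) ↔ (F i).conflict a b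
  conflict_eq : ∀ S, R S → ∀ i ∈ S, ∀ j ∈ S, ∀ a b, E.conflict (k i a) (k j b) → i = j

namespace ESS.IsFamily

variable {E : ESS.{u}} {F : I → ESS.{u}} {k : ∀ i, (F i).ev → E.ev} (h : E.IsFamily F k R)
include h

theorem le_iff {i : I} {a b : (F i).ev} : E.le (k i a) (k i b) ↔ (F i).le a b := by
  rw [h.le]
  exact ⟨fun ⟨c, hc, hl⟩ => h.inj i hc ▸ hl, fun hl => ⟨a, rfl, hl⟩⟩

theorem lt_iff {i : I} {a b : (F i).ev} : E.lt (k i a) (k i b) ↔ (F i).lt a b :=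
  and_congr h.le_iff (h.inj i).ne_iff

theorem imm_iff {i : I} {a b : (F i).ev} : E.imm (k i a) (k i b) ↔ (F i).imm a b := by
  refine and_congr h.lt_iff ⟨fun hi d hd => hi (k i d) ⟨h.lt_iff.2 hd.1, h.lt_iff.2 hd.2⟩, ?_⟩
  rintro hi d ⟨h1, h2⟩
  obtain ⟨c, rfl, -⟩ := (h.le _ _ _).1 h2.1
  exact hi c ⟨h.lt_iff.1 h1, h.lt_iff.1 h2⟩

variable {z : ∀ i, Set (F i).ev} (hR : R {i | (z i).Nonempty})
include hR

theorem mem_iff {i : I} {a : (F i).ev} (hi : (z i).Nonempty) :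
    k i a ∈ ⋃ i, k i '' z i ↔ a ∈ z i := by
  refine ⟨fun ha => ?_, fun ha => Set.mem_iUnion.2 ⟨i, a, ha, rfl⟩⟩
  obtain ⟨j, b, hb, hab⟩ := Set.mem_iUnion.1 ha
  obtain rfl := h.disj _ hR j ⟨b, hb⟩ i hi _ _ hab
  exact h.inj j hab ▸ hb

theorem conf_iff : (⋃ i, k i '' z i) ∈ E.Conf ↔ ∀ i, z i ∈ (F i).Conf := by
  constructor
  · intro hc i
    refine ⟨?_, fun a ha b hb => ?_, fun a ha b hb hab => ?_⟩
    · exact ((hc.1.subset (Set.subset_iUnion (fun i => k i '' z i) i)).of_finite_image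
        (h.inj i).injOn)
    · exact (h.mem_iff hR ⟨a, ha⟩).1
        (hc.2.1 _ ((h.mem_iff hR ⟨a, ha⟩).2 ha) _ (h.le_iff.2 hb))
    · exact hc.2.2 _ ((h.mem_iff hR ⟨a, ha⟩).2 ha) _ ((h.mem_iff hR ⟨a, ha⟩).2 hb)
        ((h.conflict _ _ _).2 hab)
  · refine fun hc => ⟨?_, ?_, ?_⟩
    · refine ((h.fin _ hR).biUnion fun i _ => (hc i).1.image (k i)).subset fun e he => ?_
      obtain ⟨i, a, ha, rfl⟩ := Set.mem_iUnion.1 he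
      exact Set.mem_biUnion (x := i) ⟨a, ha⟩ ⟨a, ha, rfl⟩
    · intro e he d hd
      obtain ⟨i, a, ha, rfl⟩ := Set.mem_iUnion.1 he
      obtain ⟨b, rfl, hb⟩ := (h.le _ _ _).1 hd
      exact Set.mem_iUnion.2 ⟨i, b, (hc i).2.1 _ ha _ hb, rfl⟩
    · intro e he d hd hed
      obtain ⟨i, a, ha, rfl⟩ := Set.mem_iUnion.1 he
      obtain ⟨j, b, hb, rfl⟩ := Set.mem_iUnion.1 hd
      obtain rfl := h.conflict_eq _ hR i ⟨a, ha⟩ j ⟨b, hb⟩ _ _ hed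
      exact (hc i).2.2 _ ha _ hb ((h.conflict _ _ _).1 hed)

end ESS.IsFamily

/-- The arena `H` is a sum of the arenas `G i`. -/
structure Game.IsFamily (H : Game.{u}) (G : I → Game.{u}) (k : ∀ i, (G i).ev → H.ev)
    (R : Set I → Prop) : Prop where
  es : H.toESS.IsFamily (fun i => (G i).toESS) k R
  lam : ∀ i a, H.lam (k i a) = (G i).lam a
  sym : ∀ θ : ∀ i, Set ((G i).ev × (G i).ev), R {i | (θ i).Nonempty} → (∀ i, θ i ∈ (G i).sym) →
    (⋃ i, Prod.map (k i) (k i) '' θ i) ∈ H.sym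

theorem Game.IsFamily.complete_iff {H : Game.{u}} {G : I → Game.{u}} {k : ∀ i, (G i).ev → H.ev}
    (h : H.IsFamily G k R) {z : ∀ i, Set (G i).ev} (hR : R {i | (z i).Nonempty}) :
    IsComplete H (⋃ i, k i '' z i) ↔ ∀ i, IsComplete (G i) (z i) := by
  constructor
  · intro hc i q hq hQ
    obtain ⟨a, ha, hA, hi⟩ := hc _ ((h.es.mem_iff hR ⟨q, hq⟩).2 hq) ((h.lam i q).trans hQ)
    obtain ⟨j, b, hb, rfl⟩ := Set.mem_iUnion.1 ha
    obtain ⟨c, hc', -⟩ := (h.es.le _ _ _).1 hi.1.1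
    obtain rfl := h.es.disj _ hR i ⟨q, hq⟩ j ⟨b, hb⟩ _ _ hc'
    exact ⟨b, hb, (h.lam _ b).symm.trans hA, h.es.imm_iff.1 hi⟩
  · intro hc q hq hQ
    obtain ⟨i, q, hq', rfl⟩ := Set.mem_iUnion.1 hq
    obtain ⟨a, ha, hA, hi⟩ := hc i q hq' ((h.lam i q).symm.trans hQ)
    exact ⟨k i a, Set.mem_iUnion.2 ⟨i, a, ha, rfl⟩, (h.lam i a).trans hA, h.es.imm_iff.2 hi⟩

/-- The strategy `σ` is a sum of the strategies `s i`. -/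
structure PreStrat.IsFamily {H : Game.{u}} {G : I → Game.{u}} (k : ∀ i, (G i).ev → H.ev)
    (R : Set I → Prop) (σ : PreStrat H) (s : ∀ i, PreStrat (G i))
    (l : ∀ i, (s i).ev → σ.ev) : Prop where
  es : σ.toESS.IsFamily (fun i => (s i).toESS) l R
  surj : ∀ e, ∃ i a, e = l i a
  supp : ∀ x ∈ σ.Conf, R {i | (l i ⁻¹' x).Nonempty}
  disp : ∀ i a, σ.disp (l i a) = k i ((s i).disp a)

theorem PreStrat.IsFamily.image {H : Game.{u}} {G : I → Game.{u}} {k : ∀ i, (G i).ev → H.ev}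
    {σ : PreStrat H} {s : ∀ i, PreStrat (G i)} {l} (h : PreStrat.IsFamily k R σ s l)
    (z : ∀ i, Set (s i).ev) :
    σ.disp '' (⋃ i, l i '' z i) = ⋃ i, k i '' ((s i).disp '' z i) := by
  rw [Set.image_iUnion]
  refine Set.iUnion_congr fun i => ?_
  rw [Set.image_image, Set.image_image]
  exact Set.image_congr fun a _ => h.disp i a

theorem Covers.family {H : Game.{u}} {G : I → Game.{u}} {k : ∀ i, (G i).ev → H.ev}
    (hG : H.IsFamily G k R) {σ τ : PreStrat H} {s t : ∀ i, PreStrat (G i)} {l l'}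
    (hσ : PreStrat.IsFamily k R σ s l) (hτ : PreStrat.IsFamily k R τ t l')
    (h : ∀ i, Covers (s i) (t i)) : Covers σ τ := by
  intro x hx hd hcx
  have hRx := hσ.supp x hx
  have hxe : x = ⋃ i, l i '' (l i ⁻¹' x) := by
    refine subset_antisymm (fun e he => ?_) (Set.iUnion_subset fun i => Set.image_preimage_subset _ _)
    obtain ⟨i, a, rfl⟩ := hσ.surj e
    exact Set.mem_iUnion.2 ⟨i, a, he, rfl⟩
  generalize hz : (fun i => l i ⁻¹' x) = z at *
  replace hxe : x = ⋃ i, l i '' z i := by rw [← hz]; exact hxe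
  replace hRx : R {i | (z i).Nonempty} := by rw [← hz]; exact hRx
  subst hxe
  rw [hσ.image] at hd hcx
  have hRd : R {i | ((s i).disp '' z i).Nonempty} :=
    hG.es.mono _ _ (fun i hi => Set.image_nonempty.1 hi) hRx
  have hzc := (hσ.es.conf_iff hRx).1 hx
  choose y hy hyc hyq θ hθ hθd hθc using fun i => h i (z i) (hzc i)
    ((hG.es.conf_iff hRd).1 hd i) ((hG.complete_iff hRd).1 hcx i)
  have hRθ : R {i | (θ i).Nonempty} :=
    hG.es.mono _ _ (fun i hi => by rw [Set.mem_ofPred_eq, ← hθd]; exact hi.image _) hRd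
  have hRy : R {i | ((t i).disp '' y i).Nonempty} :=
    hG.es.mono _ _ (fun i hi => by
      rw [Set.mem_ofPred_eq, ← hθc] at hi; exact Set.image_nonempty.1 hi) hRθ
  refine ⟨⋃ i, l' i '' y i, (hτ.es.conf_iff (hG.es.mono _ _ (fun i hi => hi.image _) hRy)).2 hy,
    ?_, ?_, _, hG.sym θ hRθ hθ, ?_, ?_⟩
  · rw [hτ.image]; exact (hG.es.conf_iff hRy).2 hyc
  · rw [hτ.image]; exact (hG.complete_iff hRy).2 hyq
  · rw [hσ.image, gdom, Set.image_iUnion]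
    exact Set.iUnion_congr fun i => (gdom_map (k i) (θ i)).trans (congrArg _ (hθd i))
  · rw [hτ.image, gcod, Set.image_iUnion]
    exact Set.iUnion_congr fun i => (gcod_map (k i) (θ i)).trans (congrArg _ (hθc i))

theorem ESS.IsFamily.par {E E' : ESS.{u}} {F F' : I → ESS.{u}} {k : ∀ i, (F i).ev → E.ev}
    {k' : ∀ i, (F' i).ev → E'.ev} (h : E.IsFamily F k R) (h' : E'.IsFamily F' k' R) :
    (E.par E').IsFamily (fun i => (F i).par (F' i)) (fun i => Sum.map (k i) (k' i)) R where
  inj i := (h.inj i).sumMap (h'.inj i)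
  fin := h.fin
  mono := h.mono
  disj S hS i hi j hj := by
    rintro (a | a) (b | b) hab
    · exact h.disj S hS i hi j hj a b (Sum.inl.inj hab)
    · cases hab
    · cases hab
    · exact h'.disj S hS i hi j hj a b (Sum.inr.inj hab)
  le := by
    rintro (e | e) i (b | b)
    · refine ESS.par_le_ll.trans ((h.le e i b).trans ⟨?_, ?_⟩)
      · rintro ⟨a, rfl, ha⟩; exact ⟨inl a, rfl, Sum.LiftRel.inl ha⟩
      · rintro ⟨a | a, ha, hl⟩
        · exact ⟨a, Sum.inl.inj ha, ESS.par_le_ll.1 hl⟩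
        · cases ha
    · exact iff_of_false (fun hh => by cases hh) (by rintro ⟨a | a, ha, hl⟩ <;> cases hl; cases ha)
    · exact iff_of_false (fun hh => by cases hh) (by rintro ⟨a | a, ha, hl⟩ <;> cases hl; cases ha)
    · refine ESS.par_le_rr.trans ((h'.le e i b).trans ⟨?_, ?_⟩)
      · rintro ⟨a, rfl, ha⟩; exact ⟨inr a, rfl, Sum.LiftRel.inr ha⟩
      · rintro ⟨a | a, ha, hl⟩
        · cases ha
        · exact ⟨a, Sum.inr.inj ha, ESS.par_le_rr.1 hl⟩
  conflict := by
    rintro i (a | a) (b | b)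
    · exact Sum.liftRel_inl_inl.trans ((h.conflict i a b).trans Sum.liftRel_inl_inl.symm)
    · exact iff_of_false (fun hh => by cases hh) (fun hh => by cases hh)
    · exact iff_of_false (fun hh => by cases hh) (fun hh => by cases hh)
    · exact Sum.liftRel_inr_inr.trans ((h'.conflict i a b).trans Sum.liftRel_inr_inr.symm)
  conflict_eq S hS i hi j hj := by
    rintro (a | a) (b | b) hab
    · exact h.conflict_eq S hS i hi j hj a b (Sum.liftRel_inl_inl.1 hab)
    · cases hab
    · cases hab
    · exact h'.conflict_eq S hS i hi j hj a b (Sum.liftRel_inr_inr.1 hab)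

theorem Game.IsFamily.hom {A B : Game.{u}} {F F' : I → Game.{u}} {k : ∀ i, (F i).ev → A.ev}
    {k' : ∀ i, (F' i).ev → B.ev} (h : A.IsFamily F k R) (h' : B.IsFamily F' k' R) :
    (A.hom B).IsFamily (fun i => (F i).hom (F' i)) (fun i => Sum.map (k i) (k' i)) R where
  es := h.es.par h'.es
  lam i := by
    rintro (a | a)
    · exact h.lam i a
    · exact h'.lam i a
  sym θ hR hθ := by
    choose α hα β hβ hθ using hθ
    refine ⟨_, h.sym α (h.es.mono _ _ (fun i hi => ?_) hR) hα,
      _, h'.sym β (h.es.mono _ _ (fun i hi => ?_) hR) hβ, ?_⟩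
    · rw [Set.mem_ofPred_eq, hθ]; exact (hi.image _).inl
    · rw [Set.mem_ofPred_eq, hθ]; exact (hi.image _).inr
    · rw [parRel, Set.image_iUnion, Set.image_iUnion, ← Set.iUnion_union_distrib]
      refine Set.iUnion_congr fun i => ?_
      rw [hθ]
      exact map_parRel (k i) (k' i)

end Family

section Binary

variable (F : Bool → ESS.{u}) (G : Bool → Game.{u})

abbrev bi {α : Bool → Sort*} (a : α true) (b : α false) : ∀ i, α i
  | true => a
  | false => b

abbrev inj (X : Bool → Type u) : ∀ i, X i → X true ⊕ X false
  | true => inl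
  | false => inr

theorem bi_iUnion {X : Type u} (f : Bool → Set X) : ⋃ i, f i = f true ∪ f false := by
  ext a
  simp [or_comm]

theorem ESS.isFamily_par :
    ((F true).par (F false)).IsFamily F (inj fun i => (F i).ev) fun _ => True where
  inj := by rintro (_ | _); exacts [Sum.inr_injective, Sum.inl_injective]
  fin _ _ := Set.toFinite _
  mono _ _ _ _ := trivial
  disj _ _ := by rintro (_ | _) _ (_ | _) _ a b h <;> first | rfl | cases h
  le := by
    rintro (e | e) (_ | _) b
    · exact iff_of_false (fun hh => by cases hh) (by rintro ⟨a, ha, -⟩; cases ha)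
    · exact ESS.par_le_ll.trans ⟨fun h => ⟨e, rfl, h⟩, fun ⟨a, ha, h⟩ => Sum.inl.inj ha ▸ h⟩
    · exact ESS.par_le_rr.trans ⟨fun h => ⟨e, rfl, h⟩, fun ⟨a, ha, h⟩ => Sum.inr.inj ha ▸ h⟩
    · exact iff_of_false (fun hh => by cases hh) (by rintro ⟨a, ha, -⟩; cases ha)
  conflict := by rintro (_ | _) a b; exacts [Sum.liftRel_inr_inr, Sum.liftRel_inl_inl]
  conflict_eq _ _ := by rintro (_ | _) _ (_ | _) _ a b h <;> first | rfl | cases h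

theorem ESS.isFamily_prod :
    ((F true).prod (F false)).IsFamily F (inj fun i => (F i).ev) Set.Subsingleton where
  inj := (ESS.isFamily_par F).inj
  fin _ _ := Set.toFinite _
  mono _ _ h h' := h'.anti h
  disj _ h i hi j hj _ _ _ := h hi hj
  le := (ESS.isFamily_par F).le
  conflict i a b := by
    refine Iff.trans ?_ ((ESS.isFamily_par F).conflict i a b)
    refine ⟨fun h => h.resolve_right fun hh => ?_, Or.inl⟩
    cases i <;> exact hh rfl
  conflict_eq _ h i hi j hj _ _ _ := h hi hj

theorem Game.isFamily_tensor :
    ((G true).tensor (G false)).IsFamily G (inj fun i => (G i).ev) fun _ => True where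
  es := ESS.isFamily_par fun i => (G i).toESS
  lam := by rintro (_ | _) a <;> rfl
  sym θ _ hθ := ⟨θ true, hθ true, θ false, hθ false, bi_iUnion _⟩

theorem Game.isFamily_prod :
    ((G true).prod (G false)).IsFamily G (inj fun i => (G i).ev) Set.Subsingleton where
  es := ESS.isFamily_prod fun i => (G i).toESS
  lam := by rintro (_ | _) a <;> rfl
  sym θ hR hθ := by
    refine ⟨⟨θ true, hθ true, θ false, hθ false, bi_iUnion _⟩, fun p hp q hq => ?_⟩
    obtain ⟨i, p, hi, rfl⟩ := Set.mem_iUnion.1 hp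
    obtain ⟨j, q, hj, rfl⟩ := Set.mem_iUnion.1 hq
    obtain rfl := hR ⟨p, hi⟩ ⟨q, hj⟩
    cases i <;> rfl

theorem Game.isFamily_const (A : Game.{u}) (hA : ∅ ∈ A.sym) :
    A.IsFamily (fun _ : Bool => A) (fun _ => id) Set.Subsingleton where
  es :=
    { inj := fun _ => Function.injective_id
      fin := fun _ _ => Set.toFinite _
      mono := fun _ _ h h' => h'.anti h
      disj := fun _ h i hi j hj _ _ _ => h hi hj
      le := fun e _ b => ⟨fun h => ⟨e, rfl, h⟩, fun ⟨_, h, h'⟩ => h ▸ h'⟩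
      conflict := fun _ _ _ => Iff.rfl
      conflict_eq := fun _ h i hi j hj _ _ _ => h hi hj }
  lam _ _ := rfl
  sym θ hR hθ := by
    by_cases h : ∃ i, (θ i).Nonempty
    · obtain ⟨i, hi⟩ := h
      convert hθ i using 1
      refine subset_antisymm (fun p hp => ?_) fun p hp => Set.mem_iUnion.2 ⟨i, p, hp, rfl⟩
      obtain ⟨j, p, hj, rfl⟩ := Set.mem_iUnion.1 hp
      obtain rfl := hR hi ⟨p, hj⟩
      exact hj
    · convert hA using 1
      refine Set.eq_empty_of_forall_notMem fun p hp => h ?_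
      obtain ⟨j, p, hj, rfl⟩ := Set.mem_iUnion.1 hp
      exact ⟨j, p, hj⟩

variable {A B : Bool → Game.{u}} {C : Game.{u}}

theorem tensorStrat_isFamily (s : ∀ i, Strat (A i) (B i)) :
    PreStrat.IsFamily (fun i => Sum.map (inj (fun i => (A i).ev) i) (inj (fun i => (B i).ev) i))
      (fun _ => True) (tensorStrat (s true) (s false)) s (inj fun i => (s i).ev) where
  es := ESS.isFamily_par fun i => (s i).toESS
  surj := by rintro (e | e); exacts [⟨true, e, rfl⟩, ⟨false, e, rfl⟩]
  supp _ _ := trivial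
  disp := by rintro (_ | _) a <;> rfl

theorem pairing_isFamily (s : ∀ i, Strat C (B i)) :
    PreStrat.IsFamily (fun i => Sum.map id (inj (fun i => (B i).ev) i)) Set.Subsingleton
      (pairing (s true) (s false)) s (inj fun i => (s i).ev) where
  es := ESS.isFamily_prod fun i => (s i).toESS
  surj := by rintro (e | e); exacts [⟨true, e, rfl⟩, ⟨false, e, rfl⟩]
  supp x hx := by
    rintro (_ | _) ⟨a, ha⟩ (_ | _) ⟨b, hb⟩
    · rfl
    · exact (hx.2.2 _ ha _ hb (Or.inr (by simp))).elim
    · exact (hx.2.2 _ ha _ hb (Or.inr (by simp))).elim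
    · rfl
  disp := by rintro (_ | _) a <;> rfl

end Binary

section Bang

theorem ESS.isFamily_bang (E : ESS.{u}) :
    E.bang.IsFamily (fun _ : ℕ => E) (fun n e => (n, e)) Set.Finite where
  inj _ _ _ h := (Prod.mk.inj h).2
  fin _ h := h
  mono _ _ h h' := h'.subset h
  disj _ _ _ _ _ _ _ _ h := (Prod.mk.inj h).1
  le e _ _ := ⟨fun h => ⟨e.2, Prod.ext h.1 rfl, h.2⟩, fun ⟨_, h, h'⟩ => h ▸ ⟨rfl, h'⟩⟩
  conflict _ _ _ := ⟨fun h => h.2, fun h => ⟨rfl, h⟩⟩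
  conflict_eq _ _ _ _ _ _ _ _ h := h.1

theorem Game.isFamily_bang {A : Game.{u}} (hA : IsPreArena A) :
    A.bang.IsFamily (fun _ : ℕ => A) (fun n e => (n, e)) Set.Finite where
  es := ESS.isFamily_bang A.toESS
  lam _ _ := rfl
  sym θ hR hθ := by
    refine ⟨(hR.biUnion fun n _ => (Set.Finite.of_finite_image (hA.isoFamily.dom_conf (hθ n)).1
      (hA.isoFamily.bij _ (hθ n)).1).image (Prod.map (Prod.mk n) (Prod.mk n))).subset
        fun p hp => ?_, 1, θ, hθ, ?_⟩
    · obtain ⟨n, p, hn, rfl⟩ := Set.mem_iUnion.1 hp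
      exact Set.mem_biUnion (x := n) ⟨p, hn⟩ ⟨p, hn, rfl⟩
    · ext ⟨⟨n, a⟩, ⟨m, b⟩⟩
      constructor
      · intro h
        obtain ⟨i, ⟨a', b'⟩, hi, he⟩ := Set.mem_iUnion.1 h
        obtain ⟨h1, h2⟩ := Prod.mk.inj he
        obtain ⟨rfl, rfl⟩ := Prod.mk.inj h1
        obtain ⟨rfl, rfl⟩ := Prod.mk.inj h2
        exact ⟨rfl, hi⟩
      · rintro ⟨h1, h2⟩
        obtain rfl : m = n := h1
        exact Set.mem_iUnion.2 ⟨m, (a, b), h2, rfl⟩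

theorem bangStrat_isFamily {A B : Game.{u}} (σ : Strat A B) :
    PreStrat.IsFamily (fun n : ℕ => Sum.map (Prod.mk n) (Prod.mk n)) Set.Finite
      (bangStrat σ) (fun _ => σ) (fun n e => (n, e)) where
  es := ESS.isFamily_bang σ.toESS
  surj e := ⟨e.1, e.2, rfl⟩
  supp _ hx := (hx.1.image Prod.fst).subset fun _ ⟨_, ha⟩ => ⟨_, ha, rfl⟩
  disp _ _ := rfl

end Bang

theorem PosEquiv.tensor {A B : Bool → NegArena.{u}} {s t : ∀ i, Strat (A i).toGame (B i).toGame}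
    (h : ∀ i, PosEquiv (s i) (t i)) :
    PosEquiv (tensorStrat (s true) (s false)) (tensorStrat (t true) (t false)) := by
  have key : ∀ s t : ∀ i, Strat (A i).toGame (B i).toGame, (∀ i, PosEquiv (s i) (t i)) →
      Covers (tensorStrat (s true) (s false)) (tensorStrat (t true) (t false)) := fun s t h =>
    Covers.family ((Game.isFamily_tensor _).hom (Game.isFamily_tensor _))
      (tensorStrat_isFamily s) (tensorStrat_isFamily t)
      fun i => ((posEquiv_iff_covers ((A i).hom_preArena (B i))).1 (h i)).1
  exact subset_antisymm (key s t h).collapse_subset (key t s fun i => (h i).symm).collapse_subset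

theorem PosEquiv.pairing {A : NegArena.{u}} {B : Bool → NegArena.{u}}
    {s t : ∀ i, Strat A.toGame (B i).toGame} (h : ∀ i, PosEquiv (s i) (t i)) :
    PosEquiv (pairing (s true) (s false)) (pairing (t true) (t false)) := by
  have hA : ∅ ∈ A.sym := by
    have := A.isArena.isoFamily.id_mem _ ESS.empty_conf
    rwa [Set.eq_empty_of_forall_notMem (s := gid ∅) fun p hp => hp.1] at this
  have key : ∀ s t : ∀ i, Strat A.toGame (B i).toGame, (∀ i, PosEquiv (s i) (t i)) →
      Covers (CausalGames.pairing (s true) (s false)) (CausalGames.pairing (t true) (t false)) :=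
    fun s t h => Covers.family ((Game.isFamily_const _ hA).hom (Game.isFamily_prod _))
      (pairing_isFamily s) (pairing_isFamily t)
      fun i => ((posEquiv_iff_covers (A.hom_preArena (B i))).1 (h i)).1
  exact subset_antisymm (key s t h).collapse_subset (key t s fun i => (h i).symm).collapse_subset

theorem PosEquiv.bang {A B : NegArena.{u}} {σ τ : Strat A.toGame B.toGame} (h : PosEquiv σ τ) :
    PosEquiv (bangStrat σ) (bangStrat τ) := by
  have key : ∀ σ τ : Strat A.toGame B.toGame, PosEquiv σ τ →
      Covers (bangStrat σ) (bangStrat τ) := fun σ τ h =>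
    Covers.family ((Game.isFamily_bang A.preArena).hom (Game.isFamily_bang B.preArena))
      (bangStrat_isFamily σ) (bangStrat_isFamily τ)
      fun _ => ((posEquiv_iff_covers (A.hom_preArena B)).1 h).1
  exact subset_antisymm (key σ τ h).collapse_subset (key τ σ h.symm).collapse_subset

section Curry

variable {Γ A C : NegArena.{u}}

abbrev uncurried (Γ A C : NegArena.{u}) : Game.{u} := (Γ.toGame.tensor A.toGame).hom C.toGame

abbrev curried (Γ A C : NegArena.{u}) : Game.{u} := Γ.toGame.hom (A.toGame.arrow C.toGame)

theorem uncurried_preArena (Γ A C : NegArena.{u}) : IsPreArena (uncurried Γ A C) :=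
  (Γ.preArena.par A.preArena).hom C.preArena

/-- Attach the events of `A` to the minimal event `m` of `C`. -/
def attach (m : {c : C.ev // C.IsMinEv c}) : (uncurried Γ A C).ev → (curried Γ A C).ev
  | .inl (.inl g) => .inl g
  | .inl (.inr a) => .inr (.inl (m, a))
  | .inr c => .inr (.inr c)

variable {m m' : {c : C.ev // C.IsMinEv c}} {z : Set (uncurried Γ A C).ev}

theorem attach_conf (hz : z ∈ (uncurried Γ A C).Conf) (hm : inr m.1 ∈ z) :
    attach m '' z ∈ (curried Γ A C).Conf := by
  have hA := A.isArena.isES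
  have hC := C.isArena.isES
  refine ⟨hz.1.image _, ?_, ?_⟩
  · rintro _ ⟨(g | a) | c, he, rfl⟩ (g' | ⟨m', a'⟩ | c') hd
    · exact ⟨_, hz.2.1 _ he (.inl (.inl g')) (.inl (.inl (Sum.liftRel_inl_inl.1 hd))), rfl⟩
    · cases hd
    · cases hd
    · cases hd
    · have hd' := ESS.par_le_rr.1 hd
      obtain ⟨h1, h2⟩ : m' = m ∧ A.le a' a := hd'
      subst h1
      exact ⟨_, hz.2.1 _ he (.inl (.inr a')) (.inl (.inr h2)), rfl⟩
    · have hd' := ESS.par_le_rr.1 hd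
      obtain rfl : c' = m.1 := hd'
      exact ⟨_, hm, rfl⟩
    · cases hd
    · exact (ESS.par_le_rr.1 hd : False).elim
    · have hd' := ESS.par_le_rr.1 hd
      exact ⟨_, hz.2.1 _ he (.inr c') (.inr hd'), rfl⟩
  · rintro _ ⟨(g | a) | c, he, rfl⟩ _ ⟨(g' | a') | c', hd, rfl⟩ h
    · exact hz.2.2 _ he _ hd (.inl (.inl (Sum.liftRel_inl_inl.1 h)))
    · cases h
    · cases h
    · cases h
    · have h' := Sum.liftRel_inr_inr.1 h
      rcases h' with h | h | h
      · exact hC.conflict_irrefl _ h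
      · exact hz.2.2 _ he _ hd (.inl (.inr h))
      · exact h.1 rfl
    · have h' := Sum.liftRel_inr_inr.1 h
      exact hz.2.2 _ hm _ hd (.inr h')
    · cases h
    · have h' := Sum.liftRel_inr_inr.1 h
      exact hz.2.2 _ he _ hm (.inr h')
    · have h' := Sum.liftRel_inr_inr.1 h
      exact hz.2.2 _ he _ hd (.inr h')

theorem lam_attach (e : (uncurried Γ A C).ev) :
    (curried Γ A C).lam (attach m e) = (uncurried Γ A C).lam e := by
  rcases e with (g | a) | c <;> rfl

theorem attach_imm_iff {q a : (uncurried Γ A C).ev} (ha : (uncurried Γ A C).lam a = .answer) :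
    (curried Γ A C).imm (attach m q) (attach m a) ↔ (uncurried Γ A C).imm q a := by
  rcases q with (q | q) | q <;> rcases a with (a | a) | a
  · exact ESS.par_imm_ll.trans (ESS.par_imm_ll.trans ESS.par_imm_ll).symm
  · exact ESS.par_imm_lr.trans (ESS.par_imm_ll.trans ESS.par_imm_lr).symm
  · exact ESS.par_imm_lr.trans ESS.par_imm_lr.symm
  · exact ESS.par_imm_rl.trans (ESS.par_imm_ll.trans ESS.par_imm_rl).symm
  · exact ESS.par_imm_rr.trans ((arrow_imm_ll.trans (and_iff_right rfl)).trans
      (ESS.par_imm_ll.trans ESS.par_imm_rr).symm)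
  · exact iff_of_false (fun h => (ESS.par_imm_rr.1 h).1.1) ESS.par_imm_lr.1
  · exact ESS.par_imm_rl.trans ESS.par_imm_rl.symm
  · refine iff_of_false (fun h => ?_) ESS.par_imm_rl.1
    cases ha.symm.trans (A.isArena.question_opening _ (arrow_imm_rl.1 (ESS.par_imm_rr.1 h)).2)
  · exact ESS.par_imm_rr.trans (arrow_imm_rr.trans ESS.par_imm_rr.symm)

theorem attach_complete_iff :
    IsComplete (curried Γ A C) (attach m '' z) ↔ IsComplete (uncurried Γ A C) z := by
  constructor
  · intro h q hq hQ
    obtain ⟨_, ⟨a, ha, rfl⟩, hA, hi⟩ := h _ ⟨q, hq, rfl⟩ ((lam_attach q).trans hQ)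
    rw [lam_attach] at hA
    exact ⟨a, ha, hA, (attach_imm_iff hA).1 hi⟩
  · rintro h _ ⟨q, hq, rfl⟩ hQ
    obtain ⟨a, ha, hA, hi⟩ := h _ hq ((lam_attach q).symm.trans hQ)
    exact ⟨_, ⟨a, ha, rfl⟩, (lam_attach a).trans hA, (attach_imm_iff hA).2 hi⟩

theorem attach_sym {θ : Set ((uncurried Γ A C).ev × (uncurried Γ A C).ev)}
    (hθ : θ ∈ (uncurried Γ A C).sym) (hm : (inr m.1, inr m'.1) ∈ θ) :
    (Prod.map (attach m) (attach m') '' θ : Set (_ × _)) ∈ (curried Γ A C).sym := by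
  have hdom := attach_conf ((uncurried_preArena Γ A C).isoFamily.dom_conf hθ)
    (mem_gdom.2 ⟨_, hm⟩)
  have hcod := attach_conf ((uncurried_preArena Γ A C).isoFamily.cod_conf hθ)
    (mem_gcod.2 ⟨_, hm⟩)
  obtain ⟨_, ⟨α, hα, β, hβ, rfl⟩, γ, hγ, rfl⟩ := hθ
  have hbA := A.isArena.isoFamily.bij _ hβ
  have hbC := C.isArena.isoFamily.bij _ hγ
  have he : Prod.map (attach m) (attach m') '' parRel (parRel α β) γ =
      parRel α (parRel (Prod.map (Prod.mk m) (Prod.mk m') '' β) γ) := by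
    simp only [parRel, Set.image_union, Set.image_image, Set.union_assoc]
    rfl
  have hd : gdom (parRel α (parRel (Prod.map (Prod.mk m) (Prod.mk m') '' β) γ)) =
      attach m '' gdom (parRel (parRel α β) γ) := by
    rw [← he]
    exact (Set.image_image Prod.fst _ _).trans (Set.image_image (attach m) Prod.fst _).symm
  have hc : gcod (parRel α (parRel (Prod.map (Prod.mk m) (Prod.mk m') '' β) γ)) =
      attach m' '' gcod (parRel (parRel α β) γ) := by
    rw [← he]
    exact (Set.image_image Prod.snd _ _).trans (Set.image_image (attach m') Prod.snd _).symm
  rw [← hd] at hdom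
  rw [← hc] at hcod
  have hdom' := (congrArg (· ∈ (Game.arrowES A.toGame C.toGame).Conf) preimage_inr_gdom).mp
    (ESS.par_conf.1 hdom).2
  have hcod' := (congrArg (· ∈ (Game.arrowES A.toGame C.toGame).Conf) preimage_inr_gcod).mp
    (ESS.par_conf.1 hcod).2
  rw [he]
  have hm' := mem_parRel_rr.1 hm
  refine ⟨α, hα, _, ⟨⟨?_, ?_, hdom', hcod'⟩, ?_, ?_⟩, rfl⟩
  · rintro _ (⟨_, ⟨⟨a, b⟩, ha, rfl⟩, rfl⟩ | ⟨⟨c, d⟩, hc, rfl⟩) _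
      (⟨_, ⟨⟨a', b'⟩, ha', rfl⟩, rfl⟩ | ⟨⟨c', d'⟩, hc', rfl⟩) h
    · obtain rfl : a = a' := (Prod.mk.inj (Sum.inl.inj h)).2
      rw [hbA.inj₁ ha ha']
    · cases h
    · cases h
    · obtain rfl : c = c' := Sum.inr.inj h
      rw [hbC.inj₁ hc hc']
  · rintro _ (⟨_, ⟨⟨a, b⟩, ha, rfl⟩, rfl⟩ | ⟨⟨c, d⟩, hc, rfl⟩) _
      (⟨_, ⟨⟨a', b'⟩, ha', rfl⟩, rfl⟩ | ⟨⟨c', d'⟩, hc', rfl⟩) h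
    · obtain rfl : b = b' := (Prod.mk.inj (Sum.inl.inj h)).2
      rw [hbA.inj₂ ha ha']
    · cases h
    · cases h
    · obtain rfl : d = d' := Sum.inr.inj h
      rw [hbC.inj₂ hc hc']
  · rintro _ (⟨_, ⟨⟨a, b⟩, ha, rfl⟩, rfl⟩ | ⟨⟨c, d⟩, hc, rfl⟩) _
      (⟨_, ⟨⟨a', b'⟩, ha', rfl⟩, rfl⟩ | ⟨⟨c', d'⟩, hc', rfl⟩)
    · exact and_congr (iff_of_true rfl rfl)
        (A.isArena.isoFamily.le_iff A.isArena.isES hβ ha ha')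
    · exact Iff.rfl
    · exact ⟨fun h => hbC.inj₁ hc ((show c = m.1 from h) ▸ hm'),
        fun h => hbC.inj₂ hc ((show d = m'.1 from h) ▸ hm')⟩
    · exact C.isArena.isoFamily.le_iff C.isArena.isES hγ hc hc'
  · have : Prod.map (Game.chi A.toGame C.toGame) (Game.chi A.toGame C.toGame) ''
        parRel (Prod.map (Prod.mk m) (Prod.mk m') '' β) γ = parRel β γ := by
      rw [parRel, Set.image_union, Set.image_image, Set.image_image, Set.image_image, parRel]
      rfl
    rw [this]
    exact parRel_mem_parFam.2 ⟨hβ, hγ⟩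

theorem exists_inr_of_min {σ : Strat (Γ.toGame.tensor A.toGame) C.toGame}
    (hσ : IsPointedStrategy σ) {s : σ.ev} (hs : σ.IsMinEv s) :
    ∃ c, σ.disp s = inr c ∧ C.IsMinEv c := by
  have hmin : (uncurried Γ A C).IsMinEv (σ.disp s) := by
    intro e he
    by_contra hne
    obtain ⟨t, ht, -⟩ := hσ.exists_lt_of_disp ⟨he, hne⟩
    exact ht.2 (hs _ ht.1)
  have hneg := hσ.negative s hs
  rcases h : σ.disp s with (g | a) | c
  · rw [h] at hmin hneg
    have := Γ.negative g (ESS.par_min_l.1 (ESS.par_min_l.1 hmin))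
    cases (congrArg Pol.flip this).symm.trans hneg
  · rw [h] at hmin hneg
    have := A.negative a (ESS.par_min_r.1 (ESS.par_min_l.1 hmin))
    cases (congrArg Pol.flip this).symm.trans hneg
  · rw [h] at hmin
    exact ⟨c, rfl, ESS.par_min_r.1 hmin⟩

/-- Configurations of a strategy on a strict arena have a single initial move. -/
theorem exists_attach (hC : IsStrict C.toGame) {σ : Strat (Γ.toGame.tensor A.toGame) C.toGame}
    (hσ : IsPointedStrategy σ) {x : Set σ.ev} (hx : x ∈ σ.Conf) (hne : x.Nonempty) :
    ∃ m : {c : C.ev // C.IsMinEv c}, inr m.1 ∈ σ.disp '' x ∧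
      (curry σ hσ).disp '' x = attach m '' (σ.disp '' x) := by
  obtain ⟨s, hs⟩ := hne
  obtain ⟨m, ⟨hm, hms⟩, -⟩ := hσ.pointed s
  obtain ⟨c, hc, hcm⟩ := exists_inr_of_min hσ hm
  have hmx : m ∈ x := hx.2.1 _ hs _ hms
  refine ⟨⟨c, hcm⟩, ⟨m, hmx, hc⟩, ?_⟩
  rw [Set.image_image]
  refine Set.image_congr fun t ht => ?_
  have hd : CurryDisp σ t ((curry σ hσ).disp t) := (exists_curryDisp hσ t).choose_spec
  generalize (curry σ hσ).disp t = e at hd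
  rcases e with g | ⟨m', a⟩ | c'
  · rw [show σ.disp t = _ from hd]; rfl
  · obtain ⟨h1, n, hn, hnt, hn'⟩ := hd
    rw [h1]
    have hz := hσ.rule_abiding x hx
    have : m' = ⟨c, hcm⟩ := by
      by_contra hne
      refine hz.2.2 _ ⟨n, hx.2.1 _ ht _ hnt, hn'⟩ _ ⟨m, hmx, hc⟩
        (.inr (hC _ _ m'.2 hcm fun h => hne (Subtype.ext h)))
    rw [this]; rfl
  · rw [show σ.disp t = _ from hd]; rfl

theorem empty_mem_curried_sym : ∅ ∈ (curried Γ A C).sym := by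
  have hid : ∀ {E : ESS.{u}} {S : Set (Set (E.ev × E.ev))}, IsIsoFamily E S → ∅ ∈ S := by
    intro E S hS
    have := hS.id_mem _ ESS.empty_conf
    rwa [Set.eq_empty_of_forall_notMem (s := gid ∅) fun p hp => hp.1] at this
  refine ⟨∅, hid Γ.isArena.isoFamily, ∅, ⟨⟨Set.injOn_empty _, Set.injOn_empty _, ?_, ?_⟩, ?_, ?_⟩,
    by simp [parRel]⟩
  · convert ESS.empty_conf using 1; exact Set.image_empty _
  · convert ESS.empty_conf using 1; exact Set.image_empty _
  · exact fun p hp => hp.elim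
  · convert hid (A.hom_preArena C).isoFamily using 1; exact Set.image_empty _

theorem Covers.curry (hC : IsStrict C.toGame)
    {σ τ : Strat (Γ.toGame.tensor A.toGame) C.toGame} (hσ : IsPointedStrategy σ)
    (hτ : IsPointedStrategy τ) (h : Covers σ τ) : Covers (curry σ hσ) (curry τ hτ) := by
  intro x hx _ hcx
  rcases x.eq_empty_or_nonempty with rfl | hne
  · refine ⟨∅, ESS.empty_conf, ?_, ?_, ∅, empty_mem_curried_sym, ?_, ?_⟩
    · rw [Set.image_empty]; exact ESS.empty_conf
    · rw [Set.image_empty]; exact fun q hq => hq.elim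
    · rw [Set.image_empty]; exact Set.image_empty _
    · rw [Set.image_empty]; exact Set.image_empty _
  obtain ⟨m, hm, he⟩ := exists_attach hC hσ hx hne
  rw [he] at hcx ⊢
  obtain ⟨y, hy, hyc, hyq, θ, hθ, hd, hc⟩ := h x hx (hσ.rule_abiding x hx)
    (attach_complete_iff.1 hcx)
  rw [← hd] at hm
  obtain ⟨n, hn⟩ := mem_gdom.1 hm
  have hyne : y.Nonempty := by
    rw [← Set.image_nonempty (f := τ.disp), ← hc]
    exact ⟨n, mem_gcod.2 ⟨_, hn⟩⟩
  obtain ⟨m', hm', he'⟩ := exists_attach hC hτ hy hyne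
  have hmm : (inr m.1, inr m'.1) ∈ θ := by
    have hP := uncurried_preArena Γ A C
    rw [← hc] at hm' hyc
    have hnmin : (uncurried Γ A C).IsMinEv n := by
      intro e hen
      obtain ⟨d, hde⟩ := mem_gcod.1 (hyc.2.1 _ (mem_gcod.2 ⟨_, hn⟩) _ hen)
      have := ESS.par_min_r.2 m.2 _ ((hP.isoFamily.le_iff hP.isES hθ hde hn).2 hen)
      rw [this] at hde
      exact (hP.isoFamily.bij _ hθ).inj₁ hde hn
    have hnn := hn
    obtain ⟨_, _, γ, _, rfl⟩ := hθ
    rcases n with n | n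
    · exact (mem_parRel_rl.1 hn).elim
    · by_cases hne : n = m'.1
      · exact hne ▸ hnn
      · exact (hyc.2.2 _ (mem_gcod.2 ⟨_, hn⟩) _ hm'
          (.inr (hC _ _ (ESS.par_min_r.1 hnmin) m'.2 hne))).elim
  refine ⟨y, hy, ?_, ?_, _, attach_sym hθ hmm, ?_, ?_⟩
  · rw [he']; exact attach_conf hyc hm'
  · rw [he']; exact attach_complete_iff.2 hyq
  · rw [← hd]
    exact (Set.image_image Prod.fst _ _).trans (Set.image_image (attach m) Prod.fst _).symm
  · rw [he', ← hc]
    exact (Set.image_image Prod.snd _ _).trans (Set.image_image (attach m') Prod.snd _).symm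

theorem PosEquiv.curry (hC : IsStrict C.toGame)
    {σ τ : Strat (Γ.toGame.tensor A.toGame) C.toGame} (hσ : IsPointedStrategy σ)
    (hτ : IsPointedStrategy τ) (h : PosEquiv σ τ) :
    PosEquiv (curry σ hσ) (curry τ hτ) := by
  obtain ⟨h1, h2⟩ := (posEquiv_iff_covers (uncurried_preArena Γ A C)).1 h
  exact subset_antisymm (h1.curry hC hσ hτ).collapse_subset (h2.curry hC hτ hσ).collapse_subset

end Curry

/-! ## The category of strategies up to positional equivalence -/

open CategoryTheory

abbrev WbVis (A B : NegArena.{u}) := {σ : Strat A.toGame B.toGame // IsWbVis σ}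

variable {A B C : NegArena.{u}}

theorem PosEquiv.comp {σ σ' : Strat A.toGame B.toGame} {τ τ' : Strat B.toGame C.toGame}
    (hσ : IsWbVis σ) (hσ' : IsWbVis σ') (hτ : IsWbVis τ) (hτ' : IsWbVis τ')
    (h : PosEquiv σ σ') (h' : PosEquiv τ τ') : PosEquiv (comp σ τ) (comp σ' τ') := by
  rw [posEquiv_iff] at h h' ⊢
  rw [collapseRel_comp hσ hτ, collapseRel_comp hσ' hτ', h, h']

def posSetoid (A B : NegArena.{u}) : Setoid (WbVis A B) where
  r σ τ := PosEquiv σ.1 τ.1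
  iseqv := ⟨fun _ => rfl, fun h => h.symm, fun h h' => h.trans h'⟩

def StratClass (A B : NegArena.{u}) := Quotient (posSetoid A B)

def StratClass.mk (σ : WbVis A B) : StratClass A B := Quotient.mk (posSetoid A B) σ

theorem StratClass.mk_eq {σ τ : WbVis A B} : mk σ = mk τ ↔ PosEquiv σ.1 τ.1 :=
  ⟨fun h => Quotient.exact h, fun h => Quotient.sound (s := posSetoid A B) h⟩

def WbVis.comp (σ : WbVis A B) (τ : WbVis B C) : WbVis A C :=
  ⟨CausalGames.comp σ.1 τ.1, isWbVis_comp σ.2 τ.2⟩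

def StratClass.comp : StratClass A B → StratClass B C → StratClass A C :=
  Quotient.map₂ WbVis.comp fun σ σ' h τ τ' h' => PosEquiv.comp σ.2 σ'.2 τ.2 τ'.2 h h'

def StratClass.collapse : StratClass A B → SetRel (Positions A.toGame) (Positions B.toGame) :=
  Quotient.lift (fun σ => collapseRel σ.1) fun _ _ h => posEquiv_iff.1 h

theorem StratClass.collapse_injective :
    Function.Injective (StratClass.collapse : StratClass A B → _) := by
  rintro ⟨σ⟩ ⟨τ⟩ h
  exact mk_eq.2 (posEquiv_iff.2 h)

theorem StratClass.collapse_comp (s : StratClass A B) (t : StratClass B C) :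
    (s.comp t).collapse = s.collapse.comp t.collapse := by
  obtain ⟨σ⟩ := s
  obtain ⟨τ⟩ := t
  exact collapseRel_comp σ.2 τ.2

def StratClass.id (A : NegArena.{u}) : StratClass A A := mk ⟨copycat A.toGame, isWbVis_copycat A⟩

theorem StratClass.collapse_id (A : NegArena.{u}) : (StratClass.id A).collapse = SetRel.id :=
  collapseRel_copycat A

/-- Strategies up to positional equivalence. -/
abbrev stratCategory : Category.{u + 1} NegArena.{u} where
  Hom := StratClass
  id := StratClass.id
  comp := StratClass.comp
  id_comp s := StratClass.collapse_injective (by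
    rw [StratClass.collapse_comp, StratClass.collapse_id, SetRel.id_comp])
  comp_id s := StratClass.collapse_injective (by
    rw [StratClass.collapse_comp, StratClass.collapse_id, SetRel.comp_id])
  assoc r s t := StratClass.collapse_injective (by
    simp only [StratClass.collapse_comp, SetRel.comp_assoc])

/-- The positional collapse. -/
def collapseFunctor : @Functor NegArena.{u} stratCategory RelCat.{u} inferInstance :=
  letI := stratCategory.{u}
  { obj := fun A => Positions A.toGame
    map := fun s => RelCat.Hom.ofRel (StratClass.collapse s)
    map_id := fun A => congrArg RelCat.Hom.ofRel (StratClass.collapse_id A)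
    map_comp := fun s t => congrArg RelCat.Hom.ofRel (StratClass.collapse_comp s t) }

end CausalGames

theorem mainTheorem8 :
    -- The collapse preserves composition, and well-bracketed visible strategies compose.
    (∀ {A B C : NegArena.{u}} (σ : Strat A.toGame B.toGame) (τ : Strat B.toGame C.toGame),
      IsWbVis σ → IsWbVis τ →
        IsWbVis (comp σ τ) ∧ collapseRel (comp σ τ) = (collapseRel σ).comp (collapseRel τ)) ∧
    -- The collapse preserves identities.
    (∀ A : NegArena.{u}, IsWbVis (copycat A.toGame) ∧
      collapseRel (copycat A.toGame) = SetRel.id) ∧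
    -- The collapse is faithful to positional equivalence and invariant under positive isomorphism.
    (∀ {A B : NegArena.{u}} (σ σ' : Strat A.toGame B.toGame), IsWbVis σ → IsWbVis σ' →
      (PosEquiv σ σ' ↔ collapseRel σ = collapseRel σ') ∧ (PosIso σ σ' → PosEquiv σ σ')) ∧
    -- Positional equivalence is a congruence for composition,
    (∀ {A B C : NegArena.{u}} (σ σ' : Strat A.toGame B.toGame) (τ τ' : Strat B.toGame C.toGame),
      IsWbVis σ → IsWbVis σ' → IsWbVis τ → IsWbVis τ' → PosEquiv σ σ' → PosEquiv τ τ' →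
        PosEquiv (comp σ τ) (comp σ' τ')) ∧
    -- for the tensor product,
    (∀ {A₁ B₁ A₂ B₂ : NegArena.{u}} (σ₁ σ₁' : Strat A₁.toGame B₁.toGame)
      (σ₂ σ₂' : Strat A₂.toGame B₂.toGame),
      IsWbVis σ₁ → IsWbVis σ₁' → IsWbVis σ₂ → IsWbVis σ₂' → PosEquiv σ₁ σ₁' → PosEquiv σ₂ σ₂' →
        PosEquiv (tensorStrat σ₁ σ₂) (tensorStrat σ₁' σ₂')) ∧
    -- for pairing,
    (∀ {A B₁ B₂ : NegArena.{u}} (σ₁ σ₁' : Strat A.toGame B₁.toGame)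
      (σ₂ σ₂' : Strat A.toGame B₂.toGame),
      IsWbVis σ₁ → IsWbVis σ₁' → IsWbVis σ₂ → IsWbVis σ₂' → PosEquiv σ₁ σ₁' → PosEquiv σ₂ σ₂' →
        PosEquiv (pairing σ₁ σ₂) (pairing σ₁' σ₂')) ∧
    -- for the exponential,
    (∀ {A B : NegArena.{u}} (σ σ' : Strat A.toGame B.toGame), IsWbVis σ → IsWbVis σ' →
      PosEquiv σ σ' → PosEquiv (bangStrat σ) (bangStrat σ')) ∧
    -- and for currying into a strict arena.
    (∀ {Γ A C : NegArena.{u}} (σ σ' : Strat (Γ.toGame.tensor A.toGame) C.toGame)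
      (hσ : IsWbVis σ) (hσ' : IsWbVis σ'), IsStrict C.toGame → PosEquiv σ σ' →
        PosEquiv (curry σ hσ.strategy) (curry σ' hσ'.strategy)) ∧
    -- Negative arenas and classes of strategies form a category, with a functor to `Rel`.
    (∃ (cat : CategoryTheory.Category.{u + 1} NegArena.{u})
      (cls : ∀ {A B : NegArena.{u}}, {σ : Strat A.toGame B.toGame // IsWbVis σ} →
        cat.toQuiver.Hom A B),
      (∀ A B : NegArena.{u}, Function.Surjective (cls (A := A) (B := B))) ∧
      (∀ {A B : NegArena.{u}} (σ σ' : {σ : Strat A.toGame B.toGame // IsWbVis σ}),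
        cls σ = cls σ' ↔ PosEquiv σ.1 σ'.1) ∧
      (∀ A : NegArena.{u}, ∃ h, cls ⟨copycat A.toGame, h⟩ = cat.id A) ∧
      (∀ {A B C : NegArena.{u}} (σ : {σ : Strat A.toGame B.toGame // IsWbVis σ})
        (τ : {τ : Strat B.toGame C.toGame // IsWbVis τ}),
        ∃ h, cls ⟨comp σ.1 τ.1, h⟩ = cat.comp (cls σ) (cls τ)) ∧
      ∃ F : CategoryTheory.Functor NegArena.{u} CategoryTheory.RelCat.{u},
        ∃ hF : ∀ A : NegArena.{u}, F.obj A = Positions A.toGame,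
          ∀ {A B : NegArena.{u}} (σ : {σ : Strat A.toGame B.toGame // IsWbVis σ}),
            F.map (cls σ) = CategoryTheory.CategoryStruct.comp (CategoryTheory.eqToHom (hF A))
              (CategoryTheory.CategoryStruct.comp
                (CategoryTheory.RelCat.Hom.ofRel (collapseRel σ.1))
                (CategoryTheory.eqToHom (hF B).symm))) := by
  refine ⟨fun σ τ hσ hτ => ⟨isWbVis_comp hσ hτ, collapseRel_comp hσ hτ⟩,
    fun A => ⟨isWbVis_copycat A, collapseRel_copycat A⟩,
    fun σ σ' _ _ => ⟨posEquiv_iff, PosIso.posEquiv⟩,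
    fun σ σ' τ τ' hσ hσ' hτ hτ' h h' => h.comp hσ hσ' hτ hτ' h',
    ?_, ?_, fun σ σ' _ _ h => h.bang,
    fun σ σ' hσ hσ' hC h => h.curry hC hσ.strategy hσ'.strategy,
    stratCategory, StratClass.mk, fun A B => Quotient.mk_surjective,
    fun σ σ' => StratClass.mk_eq, fun A => ⟨isWbVis_copycat A, rfl⟩,
    fun σ τ => ⟨isWbVis_comp σ.2 τ.2, rfl⟩, collapseFunctor, fun A => rfl, ?_⟩
  · intro A₁ B₁ A₂ B₂ σ₁ σ₁' σ₂ σ₂' _ _ _ _ h₁ h₂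
    exact PosEquiv.tensor (A := bi A₁ A₂) (B := bi B₁ B₂) (s := bi σ₁ σ₂) (t := bi σ₁' σ₂')
      (by rintro (_ | _); exacts [h₂, h₁])
  · intro A B₁ B₂ σ₁ σ₁' σ₂ σ₂' _ _ _ _ h₁ h₂
    exact PosEquiv.pairing (B := bi B₁ B₂) (s := bi σ₁ σ₂) (t := bi σ₁' σ₂')
      (by rintro (_ | _); exacts [h₂, h₁])
  · intro A B σ
    exact ((CategoryTheory.Category.id_comp _).trans (@CategoryTheory.Category.comp_id
      CategoryTheory.RelCat _ (Positions A.toGame) (Positions B.toGame)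
      (CategoryTheory.RelCat.Hom.ofRel (collapseRel σ.1)))).symm
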